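/- Let $M$ be a smooth $6$-manifold and $D\subset TM$ a smooth $3$-plane field with $D+[D,D]=TM$, i.e. locally $D$ is spanned by vector fields $X_1,X_2,X_3$ such that $X_1,X_2,X_3,[X_2,X_3],[X_3,X_1],[X_1,X_2]$ are linearly independent. The summation convention is used, and $\epsilon_{ijk}$ is totally skew with $\epsilon_{123}=1$. *Definitions.* A local coframing $(\theta_1,\theta_2,\theta_3,\omega^1,\omega^2,\omega^3)$ is *$1$-adapted* if the $\theta_i$ annihilate $D$ and $d\theta_i\equiv\epsilon_{ijk}\,\omega^j\wedge\omega^k$ modulo $\theta_1,\theta_2,\theta_3$. It is *$2$-adapted* if moreover there are $1$-forms $\alpha^i_j,\beta^{ij}$ with $$d\theta_i=-\alpha^k_k\wedge\theta_i+\alpha^j_i\wedge\theta_j+\epsilon_{ijk}\,\omega^j\wedge\omega^k,\qquad d\omega^i=-\beta^{ij}\wedge\theta_j-\alpha^i_j\wedge\omega^j .$$ A metric on an open set (a smooth nondegenerate symmetric bilinear form) *represents the conformal structure of $D$* if it is pointwise a multiple of $\theta_i\circ\omega^i$ for every $2$-adapted coframing. A local section of the third-order bundle $B_3\to M$ is a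 $2$-adapted coframing with $1$-forms $\alpha^i_j,\beta_i$ such that these equations hold with $\beta^{ij}=\epsilon^{ikj}\beta_k$. Along such a section, the normalized $1$-forms $\tau^i$ and the curvature functions $S=(S^{ik}_{jl},S^i_{jk},S_{ij})$ satisfy $$d\alpha^i_j=-\alpha^i_k\wedge\alpha^k_j-2\,\omega^i\wedge\beta_j+\delta^i_j\,\tau^k\wedge\theta_k-\tau^i\wedge\theta_j+\mathcal A^i_j,\qquad \mathcal A^i_j=S^i_{jk}\epsilon^{klm}\theta_l\wedge\theta_m+S^{ik}_{jl}\,\theta_k\wedge\omega^l,$$ $$d\beta_i=\alpha^j_i\wedge\beta_j+\epsilon_{ijk}\,\tau^j\wedge\omega^k+\mathcal B_i,\qquad \mathcal B_i=-2S^j_{ik}\,\theta_j\wedge\omega^k+\epsilon^{jkl}S_{ij}\,\theta_k\wedge\theta_l,$$ with $S^{ik}_{jl}=S^{ki}_{jl}=S^{ik}_{lj}$, $S^{ik}_{il}=0$, $S^i_{jk}=S^i_{kj}$, $S^i_{ik}=0$, $S_{ij}=S_{ji}$. The *extended curvature tensor* $\mathcal S^+$ is the $\operatorname{End}(TM)$-valued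 $2$-form whose matrix with respect to the coframing $(\theta,\omega)$ is $$\begin{pmatrix}-{}^t\mathcal A&0\\(\epsilon^{ikj}\mathcal B_k)&\mathcal A\end{pmatrix}.$$ Put $\phi=\tfrac12\alpha^i_i$ and let $\hat\gamma$ be the $\mathfrak{so}(4,4)$-valued $1$-form $$\hat\gamma=\begin{pmatrix} -\phi&\beta_j&\tau^j&0\\ \omega^i&\alpha^i_j-\delta^i_j\phi&\epsilon^{ikj}\beta_k&\tau^i\\ \theta_i&\epsilon_{ijk}\omega^k&\delta^j_i\phi-\alpha^j_i&\beta_i\\ 0&\theta_j&\omega^j&\phi\end{pmatrix},$$ where $\mathfrak{so}(4,4)$ is taken with respect to the quadratic form $-2x_0x_7+2(x_1x_4+x_2x_5+x_3x_6)$. *Proposition.* 1. Every point of $M$ has a neighborhood with a $2$-adapted coframing. Every $2$-adapted coframing extends to a section of $B_3$ over the same open set, and along every section of $B_3$ there exist $\tau^i$ and $S$ as above. For every $2$-adapted coframing the metric $\theta_i\circ\omega^i$ represents the conformal structure of $D$. 2. The algebraic tensors $\mathcal S^+$ form a space of dimension $48$ that is invariant under the structure group $$G_2=\left\{\begin{pmatrix}\det(A)\,{}^tA^{-1}&0\\AB&A\end{pmatrix}:A\in\mathrm{GL}(3,\mathbb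 R),\ {}^tB=-B\right\}$$ of $2$-adapted coframings. Thus $\mathcal S^+$ takes values in a bundle of rank $48$. 3. $B_3$ embeds in the normal conformal Cartan bundle so that the connection form $\Gamma$ pulls back to $\hat\gamma$. In terms of local gauges: along every section of $B_3$ over an open set $U$, $\hat\gamma$ is a gauge of the normal conformal Cartan connection, i.e. its components $(\omega^i,\theta_i)$ modulo the stabilizer of the null line of the first basis vector $e_0$ are a soldering form inducing the conformal structure of $D$, its curvature $d\hat\gamma+\hat\gamma\wedge\hat\gamma$ is torsion-free, and the Ricci contraction of this curvature vanishes. Moreover, for every such normal gauge $\Gamma$ over $U$ there is a unique smooth map $k$ from $U$ to the group of matrices that preserve the quadratic form up to sign and fix the null ray $\mathbb R_{>0}e_0$, such that $\hat\gamma=k^{-1}\Gamma k+k^{-1}dk$. 4. For every metric $g$ representing the conformal structure of $D$ on an open set, the Weyl tensor of $g$, as an $\operatorname{End}(TM)$-valued $2$-form, equals $\mathcal S^+$. 5. The conformal structure of $D$ is conformally flat (near every point it is represented by a flat metric) if and only if $D$ is locally equivalent to the flat example, i.e. the $\mathrm{SO}(4,3)$-invariant $3$-plane field on the space $\mathrm{SO}(4,3)/H$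 of null $3$-planes in $\mathbb R^{4,3}$; equivalently, if and only if near every point there are local coordinates $(x^j,y_i)$ in which $D$ is annihilated by the forms $dy_i+\epsilon_{ijk}\,x^j\,dx^k$. -/

import Mathlib

open Set Bundle
open scoped Manifold ContDiff Matrix

noncomputable section

namespace ThreePlane

/-! ### Differential forms on a smooth `6`-manifold -/

/-- The model space of `6`-manifolds. -/
abbrev E6 : Type := EuclideanSpace ℝ (Fin 6)

section Forms

variable {M : Type*} [TopologicalSpace M] [ChartedSpace E6 M]

variable (M) in
/-- Fields of covectors (not necessarily smooth). -/
abbrev OneForm : Type _ := (x : M) → (TangentSpace (𝓡 6) x →L[ℝ] ℝ)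

variable (M) in
/-- Fields of bilinear forms on the tangent spaces (not necessarily smooth). -/
abbrev BilinField : Type _ :=
  (x : M) → (TangentSpace (𝓡 6) x →L[ℝ] TangentSpace (𝓡 6) x →L[ℝ] ℝ)

/-- Smoothness on `U` of a `1`-form, as a section of the cotangent bundle. -/
def SmoothOneFormOn [IsManifold (𝓡 6) ∞ M] (U : Set M) (α : OneForm M) : Prop :=
  ContMDiffOn (𝓡 6) ((𝓡 6).prod 𝓘(ℝ, E6 →L[ℝ] ℝ)) ∞
    (fun x => TotalSpace.mk' (E6 →L[ℝ] ℝ)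
      (E := fun x : M => TangentSpace (𝓡 6) x →L[ℝ] Trivial M ℝ x) x (α x)) U

/-- Smoothness on `U` of a field of bilinear forms. -/
def SmoothBilinOn [IsManifold (𝓡 6) ∞ M] (U : Set M) (g : BilinField M) : Prop :=
  ContMDiffOn (𝓡 6) ((𝓡 6).prod 𝓘(ℝ, E6 →L[ℝ] E6 →L[ℝ] ℝ)) ∞
    (fun x => TotalSpace.mk' (E6 →L[ℝ] E6 →L[ℝ] ℝ)
      (E := fun x : M => TangentSpace (𝓡 6) x →L[ℝ] TangentSpace (𝓡 6) x →L[ℝ] Trivial M ℝ x)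
      x (g x)) U

/-- Smoothness on `U` of a vector field. -/
def SmoothVectorFieldOn [IsManifold (𝓡 6) ∞ M] (U : Set M)
    (X : (x : M) → TangentSpace (𝓡 6) x) : Prop :=
  ContMDiffOn (𝓡 6) (𝓡 6).tangent ∞ (fun x => (⟨x, X x⟩ : TangentBundle (𝓡 6) M)) U

/-- Smoothness on `U` of a map to a normed space. -/
def SmoothFunOn {V : Type*} [NormedAddCommGroup V] [NormedSpace ℝ V] (U : Set M) (f : M → V) :
    Prop :=
  ContMDiffOn (𝓡 6) 𝓘(ℝ, V) ∞ f U

/-- The differential at `x` of a map to a normed space. -/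
def diff {V : Type*} [NormedAddCommGroup V] [NormedSpace ℝ V] (f : M → V) (x : M) :
    TangentSpace (𝓡 6) x →L[ℝ] V :=
  mfderiv (𝓡 6) 𝓘(ℝ, V) f x

/-- The derivative at `p` of the inverse of the preferred chart at `x`. -/
def chartSymmDeriv (x : M) (p : E6) :
    E6 →L[ℝ] TangentSpace (𝓡 6) ((extChartAt (𝓡 6) x).symm p) :=
  mfderiv 𝓘(ℝ, E6) (𝓡 6) (extChartAt (𝓡 6) x).symm p

/-- The derivative at `x` of the preferred chart at `x`. -/
def chartDeriv (x : M) : TangentSpace (𝓡 6) x →L[ℝ] E6 :=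
  mfderiv (𝓡 6) 𝓘(ℝ, E6) (extChartAt (𝓡 6) x) x

/-- The expression of a `1`-form in the preferred chart at `x`. -/
def OneForm.inChart (α : OneForm M) (x : M) (p : E6) : E6 →L[ℝ] ℝ :=
  (α ((extChartAt (𝓡 6) x).symm p)).comp (chartSymmDeriv x p)

/-- The exterior derivative of a `1`-form, with the convention
`dα(X, Y) = X(α(Y)) - Y(α(X)) - α([X, Y])`; it is computed at `x` in the preferred chart at `x`. -/
def extD (α : OneForm M) (x : M) (v w : TangentSpace (𝓡 6) x) : ℝ :=
  fderiv ℝ (α.inChart x) (extChartAt (𝓡 6) x x) (chartDeriv x v) (chartDeriv x w) -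
    fderiv ℝ (α.inChart x) (extChartAt (𝓡 6) x x) (chartDeriv x w) (chartDeriv x v)

/-- The wedge product of two `1`-forms. -/
def wedge (α β : OneForm M) (x : M) (v w : TangentSpace (𝓡 6) x) : ℝ :=
  α x v * β x w - α x w * β x v

/-- The symmetric bilinear form `(v, w) ↦ α(v) β(w) + α(w) β(v)`. -/
def symProd (α β : OneForm M) : BilinField M :=
  fun x => (α x).smulRight (β x) + (β x).smulRight (α x)

end Forms

/-! ### The Weyl tensor of a nondegenerate metric in dimension six -/

section Coordinates

/-- The partial derivative in the direction of the `a`-th coordinate. -/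
def pd (f : E6 → ℝ) (a : Fin 6) (p : E6) : ℝ := fderiv ℝ f p (EuclideanSpace.single a 1)

variable (G : E6 → Matrix (Fin 6) (Fin 6) ℝ)

/-- The Christoffel symbols `Γ^c_{ab}` of the metric with Gram matrix `G`. -/
def christoffel (p : E6) (c a b : Fin 6) : ℝ :=
  (1 / 2) * ∑ d, (G p)⁻¹ c d *
    (pd (fun q => G q d b) a p + pd (fun q => G q d a) b p - pd (fun q => G q a b) d p)

/-- The Riemann tensor: `R(∂_a, ∂_b) ∂_c = ∑ d, R^d_{cab} ∂_d`, where
`R(X, Y) Z = ∇_X ∇_Y Z - ∇_Y ∇_X Z - ∇_{[X, Y]} Z`. -/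
def riemann (p : E6) (d c a b : Fin 6) : ℝ :=
  pd (fun q => christoffel G q d b c) a p - pd (fun q => christoffel G q d a c) b p +
    ∑ e, (christoffel G p d a e * christoffel G p e b c -
      christoffel G p d b e * christoffel G p e a c)

/-- The Ricci tensor. -/
def ricci (p : E6) (c b : Fin 6) : ℝ := ∑ a, riemann G p a c a b

/-- The Ricci tensor with its first index raised. -/
def ricciUp (p : E6) (d a : Fin 6) : ℝ := ∑ e, (G p)⁻¹ d e * ricci G p e a

/-- The scalar curvature. -/
def scalarCurv (p : E6) : ℝ := ∑ a, ricciUp G p a a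

/-- The Weyl tensor `W^d_{cab}` in dimension `n = 6`, so that `n - 2 = 4`, `(n-1)(n-2) = 20`. -/
def weylCoord (p : E6) (d c a b : Fin 6) : ℝ :=
  riemann G p d c a b -
    (1 / 4) * ((if d = a then ricci G p c b else 0) - (if d = b then ricci G p c a else 0) +
      G p c b * ricciUp G p d a - G p c a * ricciUp G p d b) +
    (1 / 20) * scalarCurv G p *
      ((if d = a then G p c b else 0) - (if d = b then G p c a else 0))

end Coordinates

section Weyl

variable {M : Type*} [TopologicalSpace M] [ChartedSpace E6 M]

/-- The Gram matrix of `g` in the preferred chart at `x`. -/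
def gramInChart (g : BilinField M) (x : M) (p : E6) : Matrix (Fin 6) (Fin 6) ℝ :=
  Matrix.of fun a b => g ((extChartAt (𝓡 6) x).symm p)
    (chartSymmDeriv x p (EuclideanSpace.single a 1))
    (chartSymmDeriv x p (EuclideanSpace.single b 1))

/-- The Weyl tensor of the metric `g`, of type `(1,3)`, written `W(v, w) z`. -/
def weyl (g : BilinField M) (x : M) (v w z : TangentSpace (𝓡 6) x) : TangentSpace (𝓡 6) x :=
  (chartDeriv x).inverse (WithLp.toLp 2 fun d => ∑ c, ∑ a, ∑ b,
    weylCoord (gramInChart g x) (extChartAt (𝓡 6) x x) d c a b *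
      chartDeriv x z c * chartDeriv x v a * chartDeriv x w b)

end Weyl

/-! ### Components of the extended curvature tensor -/

/-- The Levi-Civita symbol on three indices, with `eps 0 1 2 = 1`. -/
def eps (i j k : Fin 3) : ℝ :=
  (((j : ℕ) : ℝ) - ((i : ℕ) : ℝ)) * (((k : ℕ) : ℝ) - ((i : ℕ) : ℝ)) *
    (((k : ℕ) : ℝ) - ((j : ℕ) : ℝ)) / 2

/-- Arrays `(S^{ik}_{jl}, S^i_{jk}, S_{ij})`: for `S : CurvArray`, `S.1 i k j l` is `S^{ik}_{jl}`,
`S.2.1 i j k` is `S^i_{jk}` and `S.2.2 i j` is `S_{ij}`. -/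
abbrev CurvArray : Type :=
  (Fin 3 → Fin 3 → Fin 3 → Fin 3 → ℝ) × (Fin 3 → Fin 3 → Fin 3 → ℝ) × (Fin 3 → Fin 3 → ℝ)

/-- The arrays with the symmetries `S^{ik}_{jl} = S^{ki}_{jl} = S^{ik}_{lj}`, `S^i_{jk} = S^i_{kj}`,
`S_{ij} = S_{ji}` and the trace conditions `S^{ik}_{il} = 0`, `S^i_{ik} = 0`. -/
def curvComponents : Submodule ℝ CurvArray where
  carrier := {S |
    (∀ i k j l, S.1 i k j l = S.1 k i j l) ∧ (∀ i k j l, S.1 i k j l = S.1 i k l j) ∧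
    (∀ k l, ∑ i, S.1 i k i l = 0) ∧
    (∀ i j k, S.2.1 i j k = S.2.1 i k j) ∧ (∀ k, ∑ i, S.2.1 i i k = 0) ∧
    (∀ i j, S.2.2 i j = S.2.2 j i)}
  add_mem' := by
    rintro S T ⟨h1, h2, h3, h4, h5, h6⟩ ⟨k1, k2, k3, k4, k5, k6⟩
    refine ⟨fun i k j l => ?_, fun i k j l => ?_, fun k l => ?_, fun i j k => ?_, fun k => ?_,
      fun i j => ?_⟩
    · simp only [Prod.fst_add, Pi.add_apply]; rw [h1, k1]
    · simp only [Prod.fst_add, Pi.add_apply]; rw [h2, k2]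
    · simp only [Prod.fst_add, Pi.add_apply, Finset.sum_add_distrib, h3, k3, add_zero]
    · simp only [Prod.snd_add, Prod.fst_add, Pi.add_apply]; rw [h4, k4]
    · simp only [Prod.snd_add, Prod.fst_add, Pi.add_apply, Finset.sum_add_distrib, h5, k5, add_zero]
    · simp only [Prod.snd_add, Pi.add_apply]; rw [h6, k6]
  zero_mem' := by
    refine ⟨?_, ?_, ?_, ?_, ?_, ?_⟩ <;> intros <;> simp
  smul_mem' := by
    rintro r S ⟨h1, h2, h3, h4, h5, h6⟩
    refine ⟨fun i k j l => ?_, fun i k j l => ?_, fun k l => ?_, fun i j k => ?_, fun k => ?_,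
      fun i j => ?_⟩
    · simp only [Prod.smul_fst, Pi.smul_apply]; rw [h1]
    · simp only [Prod.smul_fst, Pi.smul_apply]; rw [h2]
    · simp only [Prod.smul_fst, Pi.smul_apply, ← Finset.smul_sum, h3, smul_zero]
    · simp only [Prod.smul_snd, Prod.smul_fst, Pi.smul_apply]; rw [h4]
    · simp only [Prod.smul_snd, Prod.smul_fst, Pi.smul_apply, ← Finset.smul_sum, h5, smul_zero]
    · simp only [Prod.smul_snd, Pi.smul_apply]; rw [h6]

/-- Values of an `ℝ⁶`-valued coframing `(θ₁, θ₂, θ₃, ω¹, ω², ω³)`: `inl i` carries `θ_i` and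
`inr i` carries `ω^i`. -/
abbrev Coord : Type := Fin 3 ⊕ Fin 3 → ℝ

/-- The wedge product of two coordinate covectors of `ℝ⁶`. -/
def wedgeCoord (p q : Fin 3 ⊕ Fin 3) (a b : Coord) : ℝ := a p * b q - a q * b p

/-- The `2`-form `S^i_{jk} ε^{klm} θ_l ∧ θ_m + S^{ik}_{jl} θ_k ∧ ω^l`. -/
def curvA (S : CurvArray) (a b : Coord) (i j : Fin 3) : ℝ :=
  ∑ k, ∑ l, ∑ m, S.2.1 i j k * eps k l m * wedgeCoord (.inl l) (.inl m) a b +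
    ∑ k, ∑ l, S.1 i k j l * wedgeCoord (.inl k) (.inr l) a b

/-- The `2`-form `-2 S^j_{ik} θ_j ∧ ω^k + ε^{jkl} S_{ij} θ_k ∧ θ_l`. -/
def curvB (S : CurvArray) (a b : Coord) (i : Fin 3) : ℝ :=
  -2 * ∑ j, ∑ k, S.2.1 j i k * wedgeCoord (.inl j) (.inr k) a b +
    ∑ j, ∑ k, ∑ l, eps j k l * S.2.2 i j * wedgeCoord (.inl k) (.inl l) a b

/-- The algebraic extended curvature tensor with components `S`: the `2`-form on `ℝ⁶` with values in
the matrices acting on columns `(θ, ω)` whose blocks are `[-ᵗA, 0; (ε^{ikj} B_k), A]`, where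
`A = curvA S` and `B = curvB S`. -/
def extTensor : CurvArray →ₗ[ℝ] (Coord → Coord → Matrix (Fin 3 ⊕ Fin 3) (Fin 3 ⊕ Fin 3) ℝ) where
  toFun S a b := Matrix.fromBlocks (Matrix.of fun i j => -curvA S a b j i) 0
    (Matrix.of fun i j => ∑ k, eps i k j * curvB S a b k) (Matrix.of fun i j => curvA S a b i j)
  map_add' S T := by
    funext a b
    have hA : ∀ i j, curvA (S + T) a b i j = curvA S a b i j + curvA T a b i j := by
      intro i j
      simp only [curvA, Prod.snd_add, Prod.fst_add, Pi.add_apply, add_mul, Finset.sum_add_distrib]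
      ring
    have hB : ∀ i, curvB (S + T) a b i = curvB S a b i + curvB T a b i := by
      intro i
      simp only [curvB, Prod.snd_add, Prod.fst_add, Pi.add_apply, add_mul, mul_add,
        Finset.sum_add_distrib]
      ring
    ext (i | i) (j | j)
    · simp only [hA, Pi.add_apply, Matrix.add_apply, Matrix.fromBlocks_apply₁₁, Matrix.of_apply]
      ring
    · simp
    · simp [hB, mul_add, Finset.sum_add_distrib]
    · simp [hA]
  map_smul' r S := by
    funext a b
    have hA : ∀ i j, curvA (r • S) a b i j = r * curvA S a b i j := by
      intro i j
      simp only [curvA, Prod.smul_snd, Prod.smul_fst, Pi.smul_apply, smul_eq_mul, mul_assoc,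
        ← Finset.mul_sum, mul_add]
    have hB : ∀ i, curvB (r • S) a b i = r * curvB S a b i := by
      intro i
      simp only [curvB, Prod.smul_snd, Prod.smul_fst, Pi.smul_apply, smul_eq_mul, mul_assoc,
        mul_left_comm _ r, ← Finset.mul_sum, mul_add]
    ext (i | i) (j | j)
    · simp [hA]
    · simp
    · simp [hB, mul_left_comm _ r, ← Finset.mul_sum]
    · simp [hA]

/-- The space of algebraic extended curvature tensors, a space of matrix-valued `2`-forms
on `ℝ⁶`. -/
def extTensorSpace :
    Submodule ℝ (Coord → Coord → Matrix (Fin 3 ⊕ Fin 3) (Fin 3 ⊕ Fin 3) ℝ) :=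
  curvComponents.map extTensor

/-- The structure group of `2`-adapted coframings: the matrices
`[det(A) ᵗA⁻¹, 0; A B, A]` with `A` invertible and `B` skew-symmetric. -/
def groupG2 : Set (Matrix (Fin 3 ⊕ Fin 3) (Fin 3 ⊕ Fin 3) ℝ) :=
  {h | ∃ A B : Matrix (Fin 3) (Fin 3) ℝ, IsUnit A.det ∧ Bᵀ = -B ∧
    h = Matrix.fromBlocks (A.det • (A⁻¹)ᵀ) 0 (A * B) A}

/-! ### Nondegenerate `3`-plane fields and their adapted coframings -/

section PlaneFields

variable {M : Type*} [TopologicalSpace M] [ChartedSpace E6 M] [IsManifold (𝓡 6) ∞ M]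

/-- `D` is a smooth `3`-plane field with `D + [D, D] = TM`: locally `D` is spanned by smooth vector
fields `X₁, X₂, X₃` such that `X₁, X₂, X₃, [X₂, X₃], [X₃, X₁], [X₁, X₂]` are everywhere linearly
independent. -/
def IsNondegenerate (D : (x : M) → Submodule ℝ (TangentSpace (𝓡 6) x)) : Prop :=
  ∀ x : M, ∃ U : Set M, IsOpen U ∧ x ∈ U ∧ ∃ X : Fin 3 → (y : M) → TangentSpace (𝓡 6) y,
    (∀ i, SmoothVectorFieldOn U (X i)) ∧
    ∀ y ∈ U, D y = Submodule.span ℝ (Set.range fun i => X i y) ∧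
      LinearIndependent ℝ ![X 0 y, X 1 y, X 2 y,
        VectorField.mlieBracket (𝓡 6) (X 1) (X 2) y,
        VectorField.mlieBracket (𝓡 6) (X 2) (X 0) y,
        VectorField.mlieBracket (𝓡 6) (X 0) (X 1) y]

variable (M) in
/-- The six `1`-forms of a coframing: `θ i` is `θ_i` and `om i` is `ω^i`. -/
structure Coframing where
  θ : Fin 3 → OneForm M
  om : Fin 3 → OneForm M

/-- The `ℝ⁶`-valued `1`-form of a coframing. -/
def Coframing.coord (c : Coframing M) (x : M) (v : TangentSpace (𝓡 6) x) : Coord :=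
  Sum.elim (fun i => c.θ i x v) (fun i => c.om i x v)

/-- The quadratic form `θ_i ∘ ω^i` (up to the factor `2`). -/
def Coframing.metric (c : Coframing M) : BilinField M := ∑ i, symProd (c.θ i) (c.om i)

variable (D : (x : M) → Submodule ℝ (TangentSpace (𝓡 6) x))

/-- `1`-adapted coframings on the open set `U`: the `θ_i` annihilate `D` and
`dθ_i ≡ ε_{ijk} ω^j ∧ ω^k` modulo `θ₁, θ₂, θ₃`, i.e., on vectors killed by the `θ_l`. -/
structure IsOneAdapted (U : Set M) (c : Coframing M) : Prop where
  isOpen : IsOpen U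
  smooth_θ : ∀ i, SmoothOneFormOn U (c.θ i)
  smooth_om : ∀ i, SmoothOneFormOn U (c.om i)
  bijective : ∀ x ∈ U, Function.Bijective (c.coord x)
  annihilates : ∀ x ∈ U, ∀ i, ∀ v ∈ D x, c.θ i x v = 0
  extD_θ : ∀ x ∈ U, ∀ v w : TangentSpace (𝓡 6) x,
    (∀ l, c.θ l x v = 0) → (∀ l, c.θ l x w = 0) →
    ∀ i, extD (c.θ i) x v w = ∑ j, ∑ k, eps i j k * wedge (c.om j) (c.om k) x v w

/-- `2`-adapted coframings on `U`: `1`-adapted coframings whose functions `P^{il}` vanish, i.e., for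
which there are `1`-forms `α^i_j`, `β^{ij}` with
`dθ_i = -α^k_k ∧ θ_i + α^j_i ∧ θ_j + ε_{ijk} ω^j ∧ ω^k`,
`dω^i = -β^{ij} ∧ θ_j - α^i_j ∧ ω^j`. -/
structure IsTwoAdapted (U : Set M) (c : Coframing M) : Prop extends IsOneAdapted D U c where
  exists_pseudoConnection : ∃ α β : Fin 3 → Fin 3 → OneForm M,
    (∀ i j, SmoothOneFormOn U (α i j)) ∧ (∀ i j, SmoothOneFormOn U (β i j)) ∧
    ∀ x ∈ U, ∀ v w : TangentSpace (𝓡 6) x, ∀ i,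
      extD (c.θ i) x v w = -∑ k, wedge (α k k) (c.θ i) x v w + ∑ j, wedge (α j i) (c.θ j) x v w +
        ∑ j, ∑ k, eps i j k * wedge (c.om j) (c.om k) x v w ∧
      extD (c.om i) x v w = -∑ j, wedge (β i j) (c.θ j) x v w - ∑ j, wedge (α i j) (c.om j) x v w

variable (M) in
/-- The `1`-forms of a (local) section of the bundle `B₃ → M`: a coframing with pseudo-connection
forms `α^i_j` (written `α i j`) and `β_i`. -/
structure ThirdOrderFrame extends Coframing M where
  α : Fin 3 → Fin 3 → OneForm M
  β : Fin 3 → OneForm M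

/-- `f` is a section over `U` of the third-order bundle `B₃` of `D`: a `2`-adapted coframing with
pseudo-connection forms such that
`dθ_i = -α^k_k ∧ θ_i + α^j_i ∧ θ_j + ε_{ijk} ω^j ∧ ω^k`,
`dω^i = -ε^{ikj} β_k ∧ θ_j - α^i_j ∧ ω^j`. -/
structure IsThirdOrderFrame (U : Set M) (f : ThirdOrderFrame M) : Prop where
  isTwoAdapted : IsTwoAdapted D U f.toCoframing
  smooth_α : ∀ i j, SmoothOneFormOn U (f.α i j)
  smooth_β : ∀ i, SmoothOneFormOn U (f.β i)
  extD_θ : ∀ x ∈ U, ∀ v w : TangentSpace (𝓡 6) x, ∀ i,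
    extD (f.θ i) x v w = -∑ k, wedge (f.α k k) (f.θ i) x v w + ∑ j, wedge (f.α j i) (f.θ j) x v w +
      ∑ j, ∑ k, eps i j k * wedge (f.om j) (f.om k) x v w
  extD_om : ∀ x ∈ U, ∀ v w : TangentSpace (𝓡 6) x, ∀ i,
    extD (f.om i) x v w = -∑ j, ∑ k, eps i k j * wedge (f.β k) (f.θ j) x v w -
      ∑ j, wedge (f.α i j) (f.om j) x v w

variable (M) in
/-- A section of `B₃` with the pullbacks of the normalized forms `τ^i` and of the curvature
functions `S^{ik}_{jl}`, `S^i_{jk}`, `S_{ij}`. -/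
structure CartanFrame extends ThirdOrderFrame M where
  τ : Fin 3 → OneForm M
  S : M → CurvArray

/-- The pulled back canonical coframing and curvature functions on `B₃`: the forms `τ^i` and the
functions `S`, with their symmetries and normalizations, satisfy
`dα^i_j = -α^i_k ∧ α^k_j - 2 ω^i ∧ β_j + δ^i_j τ^k ∧ θ_k - τ^i ∧ θ_j
  + S^i_{jk} ε^{klm} θ_l ∧ θ_m + S^{ik}_{jl} θ_k ∧ ω^l`,
`dβ_i = α^j_i ∧ β_j + ε_{ijk} τ^j ∧ ω^k - 2 S^j_{ik} θ_j ∧ ω^k + ε^{jkl} S_{ij} θ_k ∧ θ_l`. -/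
structure IsCartanFrame (U : Set M) (f : CartanFrame M) : Prop where
  isThirdOrderFrame : IsThirdOrderFrame D U f.toThirdOrderFrame
  smooth_τ : ∀ i, SmoothOneFormOn U (f.τ i)
  components : ∀ x ∈ U, f.S x ∈ curvComponents
  extD_α : ∀ x ∈ U, ∀ v w : TangentSpace (𝓡 6) x, ∀ i j,
    extD (f.α i j) x v w = -∑ k, wedge (f.α i k) (f.α k j) x v w - 2 * wedge (f.om i) (f.β j) x v w +
      (if i = j then ∑ k, wedge (f.τ k) (f.θ k) x v w else 0) - wedge (f.τ i) (f.θ j) x v w +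
      curvA (f.S x) (f.coord x v) (f.coord x w) i j
  extD_β : ∀ x ∈ U, ∀ v w : TangentSpace (𝓡 6) x, ∀ i,
    extD (f.β i) x v w = ∑ j, wedge (f.α j i) (f.β j) x v w +
      ∑ j, ∑ k, eps i j k * wedge (f.τ j) (f.om k) x v w +
      curvB (f.S x) (f.coord x v) (f.coord x w) i

/-! ### The conformal structure -/

/-- `g` is, on the open set `U`, a smooth nondegenerate metric representing the canonical conformal
structure of `D`: with respect to every `2`-adapted coframing it is pointwise a multiple
of `θ_i ∘ ω^i`. -/
structure RepresentsConformal (U : Set M) (g : BilinField M) : Prop where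
  isOpen : IsOpen U
  smooth : SmoothBilinOn U g
  symm : ∀ x ∈ U, ∀ v w, g x v w = g x w v
  nondegenerate : ∀ x ∈ U, ∀ v, (∀ w, g x v w = 0) → v = 0
  multiple : ∀ V ⊆ U, ∀ c : Coframing M, IsTwoAdapted D V c →
    ∀ x ∈ V, ∃ r : ℝ, ∀ v w, g x v w = r * c.metric x v w

/-- The conformal structure of `D` is conformally flat: near every point it is represented by a flat
metric, i.e., by `dp_i ∘ dq_i` for some functions `p_i, q_i` (which are local coordinates, since a
representing metric is nondegenerate). -/
def IsConformallyFlat : Prop :=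
  ∀ x : M, ∃ U : Set M, x ∈ U ∧ ∃ p q : Fin 3 → M → ℝ,
    (∀ i, SmoothFunOn U (p i)) ∧ (∀ i, SmoothFunOn U (q i)) ∧
    RepresentsConformal D U (∑ i, symProd (fun y => diff (p i) y) (fun y => diff (q i) y))

/-! ### The flat example -/

/-- The quadratic form of type `(4,3)` on `ℝ⁷ = ℝ³ × ℝ × ℝ³`. -/
def form43 (a b : (Fin 3 → ℝ) × ℝ × (Fin 3 → ℝ)) : ℝ :=
  ∑ i, (a.1 i * b.2.2 i + a.2.2 i * b.1 i) + 2 * (a.2.1 * b.2.1)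

/-- `D` is locally equivalent to the flat example, the `SO(4,3)`-invariant `3`-plane field on the
`6`-manifold `SO(4,3)/H` of null `3`-planes `P` in `ℝ^{4,3}`, which consists of those tangent
vectors `φ ∈ Hom(P, ℝ⁷/P)` that take values in `P^⊥/P`: near every point there is a
local diffeomorphism to the space of null `3`-planes, given by a smooth null frame `e₁, e₂, e₃`,
that takes `D` to this plane field. -/
def IsLocallyHomogeneousModel : Prop :=
  ∀ x : M, ∃ U : Set M, IsOpen U ∧ x ∈ U ∧ ∃ e : Fin 3 → M → (Fin 3 → ℝ) × ℝ × (Fin 3 → ℝ),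
    (∀ i, SmoothFunOn U (e i)) ∧
    ∀ y ∈ U, LinearIndependent ℝ (fun i => e i y) ∧ (∀ i j, form43 (e i y) (e j y) = 0) ∧
      (∀ v, (∀ i, diff (e i) y v ∈ Submodule.span ℝ (Set.range fun j => e j y)) → v = 0) ∧
      ∀ v, v ∈ D y ↔ ∀ i j, form43 (diff (e i) y v) (e j y) = 0

/-- Near every point there are local coordinates `(x^j, y_i)` in which `D` is annihilated by the
forms `dy_i + ε_{ijk} x^j dx^k`. -/
def IsLocallyFlatModel : Prop :=
  ∀ x : M, ∃ U : Set M, IsOpen U ∧ x ∈ U ∧ ∃ X Y : Fin 3 → M → ℝ,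
    (∀ i, SmoothFunOn U (X i)) ∧ (∀ i, SmoothFunOn U (Y i)) ∧
    ∀ y ∈ U, (∀ v, (∀ i, diff (X i) y v = 0) → (∀ i, diff (Y i) y v = 0) → v = 0) ∧
      ∀ v, v ∈ D y ↔ ∀ i, diff (Y i) y v + ∑ j, ∑ k, eps i j k * X j y * diff (X k) y v = 0

/-! ### The normal conformal Cartan connection -/

variable (M) in
/-- Fields of `8 × 8` matrices of covectors. -/
abbrev GaugeForm : Type _ := Matrix (Fin 8) (Fin 8) (OneForm M)

/-- The value of a matrix of `1`-forms on a tangent vector. -/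
def GaugeForm.ev (Γ : GaugeForm M) (x : M) (v : TangentSpace (𝓡 6) x) :
    Matrix (Fin 8) (Fin 8) ℝ :=
  Matrix.of fun a b => Γ a b x v

/-- The curvature `dΓ + Γ ∧ Γ`. -/
def GaugeForm.curv (Γ : GaugeForm M) (a b : Fin 8) (x : M) (v w : TangentSpace (𝓡 6) x) : ℝ :=
  extD (Γ a b) x v w + ∑ c, wedge (Γ a c) (Γ c b) x v w

/-- The quadratic form of type `(4,4)` on `ℝ⁸`. -/
def form44 : Matrix (Fin 8) (Fin 8) ℝ :=
  !![ 0, 0, 0, 0, 0, 0, 0, -1;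
      0, 0, 0, 0, 1, 0, 0, 0;
      0, 0, 0, 0, 0, 1, 0, 0;
      0, 0, 0, 0, 0, 0, 1, 0;
      0, 1, 0, 0, 0, 0, 0, 0;
      0, 0, 1, 0, 0, 0, 0, 0;
      0, 0, 0, 1, 0, 0, 0, 0;
     -1, 0, 0, 0, 0, 0, 0, 0]

/-- The indices `1, …, 6` among `0, …, 7`. -/
def mid (a : Fin 6) : Fin 8 := a.succ.castSucc

/-- The metric induced on the tangent spaces by the soldering form `(Γ_{a0})`, `1 ≤ a ≤ 6`. -/
def GaugeForm.metric (Γ : GaugeForm M) : BilinField M :=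
  symProd (Γ 1 0) (Γ 4 0) + symProd (Γ 2 0) (Γ 5 0) + symProd (Γ 3 0) (Γ 6 0)

/-- `Γ` is, on the open set `U`, a local gauge of the normal conformal Cartan connection of the
conformal structure of `D` (the pullback of the connection form by a local section of the Cartan
bundle): it is a smooth `so(4,4)`-valued `1`-form; its part modulo the stabilizer of the null line
of the first basis vector is a soldering form, inducing the conformal structure; it is
torsion-free; and it is normal, i.e., the Ricci contraction of its curvature, which by
torsion-freeness acts on the tangent spaces, vanishes. -/
structure IsNormalConformalGauge (U : Set M) (Γ : GaugeForm M) : Prop where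
  smooth : ∀ a b, SmoothOneFormOn U (Γ a b)
  skew : ∀ x ∈ U, ∀ v, form44 * Γ.ev x v + (Γ.ev x v)ᵀ * form44 = 0
  solder : ∀ x ∈ U, Function.Bijective fun (v : TangentSpace (𝓡 6) x) (a : Fin 6) => Γ (mid a) 0 x v
  conformal : RepresentsConformal D U Γ.metric
  torsion_free : ∀ x ∈ U, ∀ a v w, Γ.curv (mid a) 0 x v w = 0
  normal : ∀ x ∈ U, ∀ X : Fin 6 → TangentSpace (𝓡 6) x,
    (∀ a b, Γ (mid a) 0 x (X b) = if a = b then 1 else 0) →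
    ∀ b w, ∑ a, (Γ.curv (mid a) (mid b) x (X a) w -
      if a = b then Γ.curv 0 0 x (X a) w else 0) = 0

/-- The structure group of the conformal Cartan bundle: the matrices that preserve the quadratic
form up to sign and fix the null ray of the first basis vector. (The sign occurs because
representing metrics of type `(3,3)` are only determined up to a multiple of either sign; fixing the
ray rather than the line removes the center `±1`, which acts trivially on gauges.) -/
def conformalParabolic : Set (Matrix (Fin 8) (Fin 8) ℝ) :=
  {k | (kᵀ * form44 * k = form44 ∨ kᵀ * form44 * k = -form44) ∧
    ∃ c : ℝ, 0 < c ∧ k *ᵥ (Pi.single 0 1) = c • Pi.single 0 1}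

/-- `k : U → conformalParabolic` is a smooth gauge transformation from `Γ` to `Γ'`:
`Γ' = k⁻¹ Γ k + k⁻¹ dk` on `U`. -/
structure IsGaugeTransformation (U : Set M) (Γ Γ' : GaugeForm M)
    (k : M → Matrix (Fin 8) (Fin 8) ℝ) : Prop where
  smooth : ∀ a b, SmoothFunOn U (fun y => k y a b)
  mem : ∀ x ∈ U, k x ∈ conformalParabolic
  eq : ∀ x ∈ U, ∀ v, Γ'.ev x v = (k x)⁻¹ * Γ.ev x v * k x +
    (k x)⁻¹ * Matrix.of fun a b => diff (fun y => k y a b) x v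

/-- The form `φ = α^i_i / 2`. -/
def CartanFrame.φ (f : CartanFrame M) : OneForm M := fun x => (1 / 2 : ℝ) • ∑ i, f.α i i x

/-- The `so(4,4)`-valued `1`-form `γ̂`, pulled back by a section of `B₃`. -/
def CartanFrame.gammaHat (f : CartanFrame M) : GaugeForm M :=
  let φ := f.φ; let α := f.α; let β := f.β; let τ := f.τ; let om := f.om; let θ := f.θ
  !![ -φ,  β 0,         β 1,         β 2,         τ 0,         τ 1,         τ 2,         0;
      om 0, α 0 0 - φ,   α 0 1,       α 0 2,       0,           -β 2,        β 1,         τ 0;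
      om 1, α 1 0,       α 1 1 - φ,   α 1 2,       β 2,         0,           -β 0,        τ 1;
      om 2, α 2 0,       α 2 1,       α 2 2 - φ,   -β 1,        β 0,         0,           τ 2;
      θ 0, 0,           om 2,         -om 1,        φ - α 0 0,   -α 1 0,      -α 2 0,      β 0;
      θ 1, -om 2,        0,           om 0,         -α 0 1,      φ - α 1 1,   -α 2 1,      β 1;
      θ 2, om 1,         -om 0,        0,           -α 0 2,      -α 1 2,      φ - α 2 2,   β 2;
      0,   θ 0,         θ 1,         θ 2,         om 0,         om 1,         om 2,         φ]

end PlaneFields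

end ThreePlane

end

open ThreePlane

noncomputable section

namespace ThreePlane

local notation "𝕋" => TangentSpace (𝓡 6)

local notation "𝒞" => extChartAt (𝓡 6)

lemma two_le_infty : (2 : WithTop ℕ∞) ≤ ∞ :=
  WithTop.coe_le_coe.2 (le_top : (2 : ℕ∞) ≤ ⊤)

section Charts

variable {M : Type*} [TopologicalSpace M] [ChartedSpace E6 M]

/-- The derivative at `y` of the preferred chart at `x`. -/
def chartDerivAt (x y : M) : 𝕋 y →L[ℝ] E6 :=
  mfderiv (𝓡 6) 𝓘(ℝ, E6) (𝒞 x) y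

lemma chartDeriv_eq (x : M) : chartDeriv x = chartDerivAt x x := rfl

lemma extChartAt_symm_eventually_mem {x : M} {U : Set M} (hU : U ∈ nhds x) :
    ∀ᶠ p in nhds (𝒞 x x), p ∈ (𝒞 x).target ∧
      (𝒞 x).symm p ∈ U := by
  refine Filter.Eventually.and (extChartAt_target_mem_nhds (I := 𝓡 6) x) ?_
  have := (continuousAt_extChartAt_symm (I := 𝓡 6) x)
  rw [ContinuousAt, extChartAt_to_inv] at this
  exact this hU

lemma extChartAt_eventually {x : M} {P : E6 → Prop}
    (hP : ∀ᶠ p in nhds (𝒞 x x), P p) :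
    ∀ᶠ y in nhds x, y ∈ (𝒞 x).source ∧ P (𝒞 x y) :=
  Filter.Eventually.and (extChartAt_source_mem_nhds (I := 𝓡 6) x) ((continuousAt_extChartAt (I := 𝓡 6) x) hP)

variable [IsManifold (𝓡 6) ∞ M]

instance isManifold_one : IsManifold (𝓡 6) 1 M := IsManifold.of_le (n := ∞) (by simp)

lemma chartDerivAt_comp_chartSymmDeriv {x : M} {p : E6} (hp : p ∈ (𝒞 x).target) :
    (chartDerivAt x ((𝒞 x).symm p)).comp (chartSymmDeriv x p) =
      ContinuousLinearMap.id ℝ E6 := by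
  have := mfderiv_extChartAt_comp_mfderivWithin_extChartAt_symm (I := 𝓡 6) hp
  simp only [modelWithCornersSelf_coe, range_id, mfderivWithin_univ] at this
  exact this

lemma chartSymmDeriv_comp_chartDerivAt {x : M} {p : E6} (hp : p ∈ (𝒞 x).target) :
    (chartSymmDeriv x p).comp (chartDerivAt x ((𝒞 x).symm p)) =
      ContinuousLinearMap.id ℝ _ := by
  have := mfderivWithin_extChartAt_symm_comp_mfderiv_extChartAt (I := 𝓡 6) hp
  simp only [modelWithCornersSelf_coe, range_id, mfderivWithin_univ] at this
  exact this

lemma chartDerivAt_bijective {x y : M} (hy : y ∈ (𝒞 x).source) :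
    Function.Bijective (chartDerivAt x y) := by
  obtain ⟨p, hp, rfl⟩ : ∃ p ∈ (𝒞 x).target, (𝒞 x).symm p = y :=
    ⟨_, (𝒞 x).map_source hy, (𝒞 x).left_inv hy⟩
  refine Function.bijective_iff_has_inverse.2 ⟨chartSymmDeriv x p, fun v => ?_, fun v => ?_⟩
  · exact DFunLike.congr_fun (chartSymmDeriv_comp_chartDerivAt hp) v
  · exact DFunLike.congr_fun (chartDerivAt_comp_chartSymmDeriv hp) v

lemma OneForm.inChart_apply (α : OneForm M) {x y : M} (hy : y ∈ (𝒞 x).source)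
    (v : 𝕋 y) :
    α.inChart x (𝒞 x y) (chartDerivAt x y v) = α y v := by
  obtain ⟨p, hp, rfl⟩ : ∃ p ∈ (𝒞 x).target, (𝒞 x).symm p = y :=
    ⟨_, (𝒞 x).map_source hy, (𝒞 x).left_inv hy⟩
  rw [(𝒞 x).right_inv hp]
  exact congrArg (α _) (DFunLike.congr_fun (chartSymmDeriv_comp_chartDerivAt hp) v)

omit [IsManifold (𝓡 6) ∞ M] in
lemma contMDiffAt_iff_chart {V : Type*} [NormedAddCommGroup V] [NormedSpace ℝ V] (f : M → V)
    (x : M) : ContMDiffAt (𝓡 6) 𝓘(ℝ, V) ∞ f x ↔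
      ContDiffAt ℝ ∞ (f ∘ (𝒞 x).symm) (𝒞 x x) := by
  rw [contMDiffAt_iff_source]
  simp only [modelWithCornersSelf_coe, range_id, contMDiffWithinAt_univ, contMDiffAt_iff_contDiffAt]

omit [IsManifold (𝓡 6) ∞ M] in
lemma smoothFunOn_iff {V : Type*} [NormedAddCommGroup V] [NormedSpace ℝ V] {U : Set M}
    (hU : IsOpen U) (f : M → V) : SmoothFunOn U f ↔
      ∀ x ∈ U, ContDiffAt ℝ ∞ (f ∘ (𝒞 x).symm) (𝒞 x x) := by
  refine forall₂_congr fun x hx => ?_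
  rw [← contMDiffAt_iff_chart]
  exact ⟨fun h => h.contMDiffAt (hU.mem_nhds hx), fun h => h.contMDiffWithinAt⟩

lemma symmL_trivializationAt_eq {x : M} {p : E6} (hp : p ∈ (𝒞 x).target) :
    (trivializationAt E6 (𝕋 : M → Type _) x).symmL ℝ
      ((𝒞 x).symm p) = chartSymmDeriv x p := by
  have h1 : (𝒞 x).symm p ∈ (chartAt E6 x).source := by
    rw [← extChartAt_source (𝓡 6)]; exact (𝒞 x).map_target hp
  have := TangentBundle.symmL_trivializationAt (I := 𝓡 6) h1
  ext v : 1
  have h2 := DFunLike.congr_fun this v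
  refine h2.trans ?_
  simp only [modelWithCornersSelf_coe, range_id, mfderivWithin_univ]
  rw [(𝒞 x).right_inv hp]
  rfl

lemma smoothOneFormOn_iff {U : Set M} (hU : IsOpen U) (α : OneForm M) : SmoothOneFormOn U α ↔
      ∀ x ∈ U, ContDiffAt ℝ ∞ (α.inChart x) (𝒞 x x) := by
  refine forall₂_congr fun x hx => ?_
  refine (show _ ↔ ContMDiffAt _ _ _ _ _ from
    ⟨fun h => h.contMDiffAt (hU.mem_nhds hx), fun h => h.contMDiffWithinAt⟩).trans ?_
  rw [contMDiffAt_hom_bundle, contMDiffAt_iff_chart]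
  refine (and_iff_right contMDiffAt_id).trans 
    (show _ ↔ _ from ⟨fun h => h.congr_of_eventuallyEq (Filter.EventuallyEq.symm ?_),
      fun h => h.congr_of_eventuallyEq ?_⟩)
  all_goals filter_upwards [extChartAt_symm_eventually_mem (x := x) Filter.univ_mem] with p hp
  all_goals
    ext v
    simp only [Function.comp_apply, OneForm.inChart, ← symmL_trivializationAt_eq hp.1]
    simp [ContinuousLinearMap.inCoordinates]
    rfl

lemma contDiffAt_transition (x : M) {y : M} (hy : y ∈ (𝒞 x).source) :
    ContDiffAt ℝ ∞ (𝒞 x ∘ (𝒞 y).symm) (𝒞 y y) := by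
  rw [← contMDiffAt_iff_chart]
  exact contMDiffAt_extChartAt' (by simpa using hy)

lemma fderiv_transition_comp_chartDerivAt (x : M) {y z : M}
    (hy : z ∈ (𝒞 x).source) (hz : z ∈ (𝒞 y).source)
    (v : 𝕋 z) :
    fderiv ℝ (𝒞 x ∘ (𝒞 y).symm) (𝒞 y z)
      (chartDerivAt y z v) = chartDerivAt x z v := by
  obtain ⟨p, hp, rfl⟩ : ∃ p ∈ (𝒞 y).target, (𝒞 y).symm p = z :=
    ⟨_, (𝒞 y).map_source hz, (𝒞 y).left_inv hz⟩
  rw [(𝒞 y).right_inv hp, ← mfderiv_eq_fderiv]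
  have h1 : MDifferentiableAt (𝓡 6) 𝓘(ℝ, E6) (𝒞 x)
      ((𝒞 y).symm p) := mdifferentiableAt_extChartAt (by simpa using hy)
  have h2 : MDifferentiableAt 𝓘(ℝ, E6) (𝓡 6) (𝒞 y).symm p := by
    have := mdifferentiableWithinAt_extChartAt_symm (I := 𝓡 6) hp
    simpa only [modelWithCornersSelf_coe, range_id, mdifferentiableWithinAt_univ] using this
  rw [mfderiv_comp p h1 h2]
  exact congrArg (chartDerivAt x _) (DFunLike.congr_fun (chartSymmDeriv_comp_chartDerivAt hp) v)

lemma OneForm.inChart_transition (α : OneForm M) (x : M) {y z : M}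
    (hy : z ∈ (𝒞 x).source) (hz : z ∈ (𝒞 y).source) :
    α.inChart y (𝒞 y z) =
      (α.inChart x (𝒞 x z)).comp
        (fderiv ℝ (𝒞 x ∘ (𝒞 y).symm) (𝒞 y z)) := by
  ext w
  obtain ⟨v, rfl⟩ := (chartDerivAt_bijective hz).2 w
  rw [α.inChart_apply hz, ContinuousLinearMap.comp_apply, fderiv_transition_comp_chartDerivAt x hy hz,
    α.inChart_apply hy]

end Charts

/-- Naturality of the exterior derivative of `1`-forms on a vector space. -/
lemma fderiv_pullback_sub_swap {E : Type*} [NormedAddCommGroup E] [NormedSpace ℝ E]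
    {a : E → E →L[ℝ] ℝ} {ψ : E → E} {q : E} (ha : DifferentiableAt ℝ a (ψ q))
    (hψ : ContDiffAt ℝ ∞ ψ q) (v w : E) :
    fderiv ℝ (fun q => (a (ψ q)).comp (fderiv ℝ ψ q)) q v w -
      fderiv ℝ (fun q => (a (ψ q)).comp (fderiv ℝ ψ q)) q w v =
    fderiv ℝ a (ψ q) (fderiv ℝ ψ q v) (fderiv ℝ ψ q w) -
      fderiv ℝ a (ψ q) (fderiv ℝ ψ q w) (fderiv ℝ ψ q v) := by
  have h1 : DifferentiableAt ℝ ψ q := hψ.differentiableAt (by simp)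
  have h2 : DifferentiableAt ℝ (fderiv ℝ ψ) q :=
    (hψ.fderiv_right (m := 1) (one_add_one_eq_two.trans_le two_le_infty)).differentiableAt (by simp)
  have h3 := ((ha.hasFDerivAt.comp q h1.hasFDerivAt).clm_comp h2.hasFDerivAt).fderiv
  have h4 : IsSymmSndFDerivAt ℝ ψ q := by
    exact hψ.isSymmSndFDerivAt (by simpa using two_le_infty)
  simp only [Function.comp_apply] at h3
  have h5 : ∀ u z, fderiv ℝ (fun q => (a (ψ q)).comp (fderiv ℝ ψ q)) q u z =
      a (ψ q) (fderiv ℝ (fderiv ℝ ψ) q u z) + fderiv ℝ a (ψ q) (fderiv ℝ ψ q u) (fderiv ℝ ψ q z) := by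
    intro u z
    have := DFunLike.congr_fun (DFunLike.congr_fun h3 u) z
    simpa using this
  rw [h5, h5, h4 v w]
  ring

/-- The second exterior derivative of a `1`-form on a vector space vanishes. -/
lemma fderiv_sub_swap_cyclic {E : Type*} [NormedAddCommGroup E] [NormedSpace ℝ E]
    {a : E → E →L[ℝ] ℝ} {p : E} (ha : ContDiffAt ℝ ∞ a p) (u v w : E) :
    DifferentiableAt ℝ (fun q => fderiv ℝ a q v w - fderiv ℝ a q w v) p ∧
    fderiv ℝ (fun q => fderiv ℝ a q v w - fderiv ℝ a q w v) p u +
    fderiv ℝ (fun q => fderiv ℝ a q w u - fderiv ℝ a q u w) p v +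
    fderiv ℝ (fun q => fderiv ℝ a q u v - fderiv ℝ a q v u) p w = 0 := by
  have h2 : DifferentiableAt ℝ (fderiv ℝ a) p :=
    (ha.fderiv_right (m := 1) (one_add_one_eq_two.trans_le two_le_infty)).differentiableAt (by simp)
  have h4 : IsSymmSndFDerivAt ℝ a p := ha.isSymmSndFDerivAt (by simpa using two_le_infty)
  have app : ∀ v w, HasFDerivAt (fun q => fderiv ℝ a q v w)
      (((fderiv ℝ (fderiv ℝ a) p).flip v).flip w) p := by
    intro v w
    have := (h2.hasFDerivAt.clm_apply (hasFDerivAt_const v p)).clm_apply (hasFDerivAt_const w p)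
    refine this.congr_fderiv ?_
    ext u
    simp
  have key : ∀ u v w, fderiv ℝ (fun q => fderiv ℝ a q v w - fderiv ℝ a q w v) p u =
      fderiv ℝ (fderiv ℝ a) p u v w - fderiv ℝ (fderiv ℝ a) p u w v := by
    intro u v w
    have h8 := DFunLike.congr_fun ((app v w).fun_sub (app w v)).fderiv u
    simpa using h8
  have s : ∀ u v w, fderiv ℝ (fderiv ℝ a) p u v w = fderiv ℝ (fderiv ℝ a) p v u w :=
    fun u v w => by rw [h4 u v]
  refine ⟨(app v w).differentiableAt.sub (app w v).differentiableAt, ?_⟩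
  rw [key, key, key, s u w v, s v u w, s w v u]
  ring

section ExtD

variable {M : Type*} [TopologicalSpace M] [ChartedSpace E6 M]

/-- Smoothness of a `1`-form at a point. -/
def OneForm.SmoothAt (α : OneForm M) (x : M) : Prop :=
  ContDiffAt ℝ ∞ (α.inChart x) (𝒞 x x)

/-- Smoothness of a function at a point. -/
def FunSmoothAt {V : Type*} [NormedAddCommGroup V] [NormedSpace ℝ V] (f : M → V) (x : M) : Prop :=
  ContDiffAt ℝ ∞ (f ∘ (𝒞 x).symm) (𝒞 x x)

/-- The product of a function and a `1`-form. -/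
def fsmul (f : M → ℝ) (α : OneForm M) : OneForm M := fun x => f x • α x

lemma fsmul_apply (f : M → ℝ) (α : OneForm M) (x : M) (v : 𝕋 x) :
    fsmul f α x v = f x * α x v := rfl

variable {α β : OneForm M} {x : M} {f g : M → ℝ}

lemma OneForm.SmoothAt.add (hα : α.SmoothAt x) (hβ : β.SmoothAt x) : (α + β).SmoothAt x := by
  refine (ContDiffAt.add hα hβ).congr_of_eventuallyEq (.of_forall fun p => ?_)
  ext v; rfl

lemma OneForm.SmoothAt.sub (hα : α.SmoothAt x) (hβ : β.SmoothAt x) : (α - β).SmoothAt x := by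
  refine (ContDiffAt.sub hα hβ).congr_of_eventuallyEq (.of_forall fun p => ?_)
  ext v; rfl

lemma OneForm.SmoothAt.neg (hα : α.SmoothAt x) : (-α).SmoothAt x := by
  refine (ContDiffAt.neg hα).congr_of_eventuallyEq (.of_forall fun p => ?_)
  ext v; rfl

lemma OneForm.SmoothAt.zero : (0 : OneForm M).SmoothAt x := by
  refine (contDiffAt_const (c := (0 : E6 →L[ℝ] ℝ))).congr_of_eventuallyEq (.of_forall fun p => ?_)
  ext v; rfl

lemma OneForm.SmoothAt.fsmul (hf : FunSmoothAt f x) (hα : α.SmoothAt x) :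
    (fsmul f α).SmoothAt x := by
  refine (ContDiffAt.smul hf hα).congr_of_eventuallyEq (.of_forall fun p => ?_)
  ext v; rfl

lemma OneForm.SmoothAt.const_smul (c : ℝ) (hα : α.SmoothAt x) : (c • α).SmoothAt x := by
  refine (ContDiffAt.const_smul c hα).congr_of_eventuallyEq (.of_forall fun p => ?_)
  ext v; rfl

lemma OneForm.SmoothAt.sum {κ : Type*} {s : Finset κ} {α : κ → OneForm M}
    (hα : ∀ i ∈ s, (α i).SmoothAt x) : (∑ i ∈ s, α i).SmoothAt x :=
  Finset.sum_induction _ (fun γ => OneForm.SmoothAt γ x) (fun _ _ => .add) .zero hα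

lemma extD_congr (h : ∀ᶠ y in nhds x, α y = β y) (v w : 𝕋 x) :
    extD α x v w = extD β x v w := by
  have : α.inChart x =ᶠ[nhds (𝒞 x x)] β.inChart x := by
    filter_upwards [extChartAt_symm_eventually_mem h] with p hp
    exact congrArg (fun z => ContinuousLinearMap.comp z (chartSymmDeriv x p)) (hp.2 : α _ = β _)
  rw [extD, extD, this.fderiv_eq]

lemma extD_swap (α : OneForm M) (v w : 𝕋 x) : extD α x v w = -extD α x w v := by
  simp [extD]

lemma extD_self (α : OneForm M) (v : 𝕋 x) : extD α x v v = 0 := by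
  simp [extD]

lemma extD_add_left (α : OneForm M) (u v w : 𝕋 x) :
    extD α x (u + v) w = extD α x u w + extD α x v w := by
  simp only [extD, map_add, add_apply]; ring

lemma extD_smul_left (α : OneForm M) (c : ℝ) (v w : 𝕋 x) :
    extD α x (c • v) w = c * extD α x v w := by
  simp only [extD, map_smul, smul_apply, smul_eq_mul]; ring

/-- The exterior derivative at a point as a bilinear map. -/
def extDBilin (α : OneForm M) (x : M) :
    𝕋 x →ₗ[ℝ] 𝕋 x →ₗ[ℝ] ℝ :=
  LinearMap.mk₂ ℝ (extD α x) (extD_add_left α) (extD_smul_left α)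
    (fun u v w => by rw [extD_swap, extD_add_left, extD_swap α v, extD_swap α w]; ring)
    (fun c v w => by rw [extD_swap, extD_smul_left, extD_swap α w]; simp)

lemma OneForm.SmoothAt.differentiableAt (hα : α.SmoothAt x) :
    DifferentiableAt ℝ (α.inChart x) (𝒞 x x) :=
  ContDiffAt.differentiableAt hα (by simp)

lemma extD_add (hα : α.SmoothAt x) (hβ : β.SmoothAt x) (v w : 𝕋 x) :
    extD (α + β) x v w = extD α x v w + extD β x v w := by
  have : (α + β).inChart x = α.inChart x + β.inChart x := by ext p v; rfl
  rw [extD, this, fderiv_add hα.differentiableAt hβ.differentiableAt]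
  simp only [extD, add_apply]; ring

lemma extD_sub (hα : α.SmoothAt x) (hβ : β.SmoothAt x) (v w : 𝕋 x) :
    extD (α - β) x v w = extD α x v w - extD β x v w := by
  have : (α - β).inChart x = α.inChart x - β.inChart x := by ext p v; rfl
  rw [extD, this, fderiv_sub hα.differentiableAt hβ.differentiableAt]
  simp only [extD, sub_apply]; ring

lemma extD_neg (α : OneForm M) (v w : 𝕋 x) :
    extD (-α) x v w = -extD α x v w := by
  have : (-α).inChart x = -α.inChart x := by ext p v; rfl
  rw [extD, this, fderiv_neg]
  simp only [extD, neg_apply]; ring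

lemma extD_zero (v w : 𝕋 x) : extD (0 : OneForm M) x v w = 0 := by
  have : (0 : OneForm M).inChart x = 0 := by ext p v; rfl
  rw [extD, this]; simp

lemma extD_sum {κ : Type*} (s : Finset κ) {α : κ → OneForm M}
    (hα : ∀ i ∈ s, (α i).SmoothAt x) (v w : 𝕋 x) :
    extD (∑ i ∈ s, α i) x v w = ∑ i ∈ s, extD (α i) x v w := by
  classical
  induction s using Finset.induction_on with
  | empty => simp [extD_zero]
  | insert i s hi ih =>
    rw [Finset.sum_insert hi, Finset.sum_insert hi, extD_add (hα i (by simp))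
      (.sum fun j hj => hα j (by simp [hj])), ih fun j hj => hα j (by simp [hj])]

lemma extD_const_smul (c : ℝ) (hα : α.SmoothAt x) (v w : 𝕋 x) :
    extD (c • α) x v w = c * extD α x v w := by
  have : (c • α).inChart x = c • α.inChart x := by ext p v; rfl
  rw [extD, this, fderiv_const_smul hα.differentiableAt]
  simp only [extD, smul_apply, smul_eq_mul]; ring

variable [IsManifold (𝓡 6) ∞ M]

lemma smoothOneFormOn_iff_smoothAt {U : Set M} (hU : IsOpen U) :
    SmoothOneFormOn U α ↔ ∀ x ∈ U, α.SmoothAt x := smoothOneFormOn_iff hU α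

omit [IsManifold (𝓡 6) ∞ M] in
lemma smoothFunOn_iff_smoothAt {V : Type*} [NormedAddCommGroup V] [NormedSpace ℝ V] {U : Set M}
    (hU : IsOpen U) (f : M → V) : SmoothFunOn U f ↔ ∀ x ∈ U, FunSmoothAt f x := smoothFunOn_iff hU f

lemma diff_apply_of_mem {V : Type*} [NormedAddCommGroup V] [NormedSpace ℝ V] {f : M → V} {y : M}
    (hy : y ∈ (𝒞 x).source)
    (hf : DifferentiableAt ℝ (f ∘ (𝒞 x).symm) (𝒞 x y))
    (v : 𝕋 y) :
    diff f y v = fderiv ℝ (f ∘ (𝒞 x).symm) (𝒞 x y)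
      (chartDerivAt x y v) := by
  have h1 : MDifferentiableAt (𝓡 6) 𝓘(ℝ, E6) (𝒞 x) y :=
    mdifferentiableAt_extChartAt (by simpa using hy)
  have h2 := mfderiv_comp y hf.mdifferentiableAt h1
  have h3 : (f ∘ (𝒞 x).symm) ∘ 𝒞 x =ᶠ[nhds y] f := by
    filter_upwards [extChartAt_source_mem_nhds' hy] with z hz
    exact congrArg f ((𝒞 x).left_inv hz)
  rw [diff, ← h3.mfderiv_eq, h2, mfderiv_eq_fderiv]
  rfl

omit [IsManifold (𝓡 6) ∞ M] in
lemma FunSmoothAt.eventually_differentiableAt {V : Type*} [NormedAddCommGroup V] [NormedSpace ℝ V]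
    {f : M → V} (hf : FunSmoothAt f x) : ∀ᶠ p in nhds (𝒞 x x),
      DifferentiableAt ℝ (f ∘ (𝒞 x).symm) p := by
  have h := (ContDiffAt.of_le hf (m := 1) (by exact_mod_cast le_top)).eventually (by simp)
  filter_upwards [h] with p hp using hp.differentiableAt (by simp)

lemma FunSmoothAt.diff_apply {V : Type*} [NormedAddCommGroup V] [NormedSpace ℝ V]
    {f : M → V} (hf : FunSmoothAt f x) (v : 𝕋 x) :
    diff f x v = fderiv ℝ (f ∘ (𝒞 x).symm) (𝒞 x x)
      (chartDeriv x v) :=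
  diff_apply_of_mem (mem_extChartAt_source x) (hf.eventually_differentiableAt.self_of_nhds) v

lemma FunSmoothAt.inChart_diff (hf : FunSmoothAt f x) :
    OneForm.inChart (fun y => diff f y) x =ᶠ[nhds (𝒞 x x)]
      fderiv ℝ (f ∘ (𝒞 x).symm) := by
  filter_upwards [hf.eventually_differentiableAt,
    extChartAt_symm_eventually_mem (x := x) Filter.univ_mem] with p hp hp'
  ext w
  have hs := (𝒞 x).map_target hp'.1
  obtain ⟨v, rfl⟩ := (chartDerivAt_bijective hs).2 w
  rw [← (𝒞 x).right_inv hp'.1] at hp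
  have h1 := OneForm.inChart_apply (fun y => diff f y) hs v
  have h2 := diff_apply_of_mem hs hp v
  rw [(𝒞 x).right_inv hp'.1] at h1 h2
  rw [h1, h2]

lemma FunSmoothAt.smoothAt_diff (hf : FunSmoothAt f x) :
    OneForm.SmoothAt (fun y => diff f y) x := by
  refine ContDiffAt.congr_of_eventuallyEq ?_ hf.inChart_diff
  exact ContDiffAt.fderiv_right hf (m := ∞) (by simp)

lemma FunSmoothAt.extD_diff (hf : FunSmoothAt f x) (v w : 𝕋 x) :
    extD (fun y => diff f y) x v w = 0 := by
  rw [extD, hf.inChart_diff.fderiv_eq]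
  have h4 : IsSymmSndFDerivAt ℝ (f ∘ (𝒞 x).symm) (𝒞 x x) :=
    ContDiffAt.isSymmSndFDerivAt hf (by simpa using two_le_infty)
  rw [h4, sub_self]

lemma extD_fsmul (hf : FunSmoothAt f x) (hα : α.SmoothAt x) (v w : 𝕋 x) :
    extD (fsmul f α) x v w = diff f x v * α x w - diff f x w * α x v + f x * extD α x v w := by
  have h1 : (fsmul f α).inChart x = fun p => (f ∘ (𝒞 x).symm) p • α.inChart x p := by
    ext p v; rfl
  have h2 := ((ContDiffAt.differentiableAt hf (by simp)).hasFDerivAt.smul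
    hα.differentiableAt.hasFDerivAt).fderiv
  have h3 : ∀ u z : 𝕋 x, fderiv ℝ ((fsmul f α).inChart x) (𝒞 x x)
      (chartDeriv x u) (chartDeriv x z) = diff f x u * α x z +
        f x * fderiv ℝ (α.inChart x) (𝒞 x x) (chartDeriv x u) (chartDeriv x z) := by
    intro u z
    rw [h1]
    have := DFunLike.congr_fun (DFunLike.congr_fun h2 (chartDeriv x u)) (chartDeriv x z)
    refine this.trans ?_
    have h5 := OneForm.inChart_apply α (mem_extChartAt_source (I := 𝓡 6) x) z
    rw [← chartDeriv_eq] at h5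
    simp only [add_apply, smul_apply, ContinuousLinearMap.smulRight_apply, h5, hf.diff_apply,
      Function.comp_apply, extChartAt_to_inv, smul_eq_mul]
    ring
  rw [extD, h3, h3, extD]
  ring

/-- The exterior derivative can be computed in any preferred chart. -/
lemma extD_eventually_eq (hα : ∀ᶠ y in nhds x, α.SmoothAt y) : ∀ᶠ y in nhds x,
    ∀ v w : 𝕋 y, extD α y v w =
      fderiv ℝ (α.inChart x) (𝒞 x y) (chartDerivAt x y v) (chartDerivAt x y w) -
      fderiv ℝ (α.inChart x) (𝒞 x y) (chartDerivAt x y w) (chartDerivAt x y v) := by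
  have h := (ContDiffAt.of_le hα.self_of_nhds (m := 1) (by exact_mod_cast le_top)).eventually
    (by simp)
  filter_upwards [extChartAt_eventually h] with y hy v w
  have hd : DifferentiableAt ℝ (α.inChart x) (𝒞 x y) :=
    hy.2.differentiableAt (by simp)
  set ψ := 𝒞 x ∘ (𝒞 y).symm with hψ
  have e1 : ψ (𝒞 y y) = 𝒞 x y := by simp [hψ]
  have h2 : α.inChart y =ᶠ[nhds (𝒞 y y)]
      fun q => (α.inChart x (ψ q)).comp (fderiv ℝ ψ q) := by
    filter_upwards [extChartAt_symm_eventually_mem (extChartAt_source_mem_nhds' hy.1)] with q hq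
    have := α.inChart_transition x hq.2 ((𝒞 y).map_target hq.1)
    rw [(𝒞 y).right_inv hq.1] at this
    exact this
  have h3 := fderiv_pullback_sub_swap (a := α.inChart x) (ψ := ψ) (q := 𝒞 y y)
    (by rwa [e1]) (contDiffAt_transition x hy.1) (chartDeriv y v) (chartDeriv y w)
  have h4 : ∀ v, fderiv ℝ ψ (𝒞 y y) (chartDeriv y v) = chartDerivAt x y v :=
    fun v => fderiv_transition_comp_chartDerivAt x hy.1 (mem_extChartAt_source y) v
  rw [extD, h2.fderiv_eq, h3, e1, h4, h4]

/-! ### Exterior derivatives of `2`-forms -/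

/-- `T` is the exterior derivative at `x` of the `2`-form `Ω`. -/
def HasD2 (Ω : (x : M) → 𝕋 x → 𝕋 x → ℝ) (x : M)
    (T : 𝕋 x → 𝕋 x → 𝕋 x → ℝ) : Prop :=
  ∃ Ω' : E6 → E6 → E6 → ℝ,
    (∀ v w, DifferentiableAt ℝ (fun p => Ω' p v w) (𝒞 x x)) ∧
    (∀ᶠ y in nhds x, ∀ v w, Ω y v w = Ω' (𝒞 x y) (chartDerivAt x y v)
      (chartDerivAt x y w)) ∧
    ∀ u v w, T u v w =
      fderiv ℝ (fun p => Ω' p (chartDeriv x v) (chartDeriv x w)) (𝒞 x x)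
        (chartDeriv x u) +
      fderiv ℝ (fun p => Ω' p (chartDeriv x w) (chartDeriv x u)) (𝒞 x x)
        (chartDeriv x v) +
      fderiv ℝ (fun p => Ω' p (chartDeriv x u) (chartDeriv x v)) (𝒞 x x)
        (chartDeriv x w)

variable {Ω Ψ : (x : M) → 𝕋 x → 𝕋 x → ℝ}
  {T S : 𝕋 x → 𝕋 x → 𝕋 x → ℝ}

lemma HasD2.unique (h : HasD2 Ω x T) (h' : HasD2 Ψ x S)
    (e : ∀ᶠ y in nhds x, ∀ v w, Ω y v w = Ψ y v w) (u v w : 𝕋 x) :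
    T u v w = S u v w := by
  obtain ⟨Ω₁, -, h2, h3⟩ := h
  obtain ⟨Ω₂, -, k2, k3⟩ := h'
  have key : ∀ v w, (fun p => Ω₁ p v w) =ᶠ[nhds (𝒞 x x)] fun p => Ω₂ p v w := by
    intro v w
    filter_upwards [extChartAt_symm_eventually_mem ((h2.and k2).and e)] with p hp
    have hs := (𝒞 x).map_target hp.1
    obtain ⟨v, rfl⟩ := (chartDerivAt_bijective hs).2 v
    obtain ⟨w, rfl⟩ := (chartDerivAt_bijective hs).2 w
    obtain ⟨⟨a, b⟩, c⟩ := hp.2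
    have a' := a v w
    have b' := b v w
    rw [(𝒞 x).right_inv hp.1] at a' b'
    rw [← a', ← b', c v w]
  rw [h3, k3, (key _ _).fderiv_eq, (key _ _).fderiv_eq, (key _ _).fderiv_eq]

lemma HasD2.add (h : HasD2 Ω x T) (h' : HasD2 Ψ x S) :
    HasD2 (fun y v w => Ω y v w + Ψ y v w) x (fun u v w => T u v w + S u v w) := by
  obtain ⟨Ω₁, h1, h2, h3⟩ := h
  obtain ⟨Ω₂, k1, k2, k3⟩ := h'
  refine ⟨fun p v w => Ω₁ p v w + Ω₂ p v w, fun v w => (h1 v w).add (k1 v w), ?_, ?_⟩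
  · filter_upwards [h2, k2] with y hy ky v w
    rw [hy, ky]
  · intro u v w
    beta_reduce
    rw [h3, k3, fderiv_fun_add (h1 _ _) (k1 _ _), fderiv_fun_add (h1 _ _) (k1 _ _),
      fderiv_fun_add (h1 _ _) (k1 _ _)]
    simp only [add_apply]
    ring

lemma HasD2.const_mul (c : ℝ) (h : HasD2 Ω x T) :
    HasD2 (fun y v w => c * Ω y v w) x (fun u v w => c * T u v w) := by
  obtain ⟨Ω₁, h1, h2, h3⟩ := h
  refine ⟨fun p v w => c * Ω₁ p v w, fun v w => (h1 v w).const_mul c, ?_, ?_⟩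
  · filter_upwards [h2] with y hy v w
    rw [hy]
  · intro u v w
    beta_reduce
    rw [h3, fderiv_const_mul (h1 _ _), fderiv_const_mul (h1 _ _), fderiv_const_mul (h1 _ _)]
    simp only [smul_apply, smul_eq_mul]
    ring

lemma HasD2.neg (h : HasD2 Ω x T) :
    HasD2 (fun y v w => -Ω y v w) x (fun u v w => -T u v w) := by
  simpa using h.const_mul (-1)

lemma HasD2.sub (h : HasD2 Ω x T) (h' : HasD2 Ψ x S) :
    HasD2 (fun y v w => Ω y v w - Ψ y v w) x (fun u v w => T u v w - S u v w) := by
  simpa [sub_eq_add_neg] using h.add h'.neg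

omit [IsManifold (𝓡 6) ∞ M] in
lemma HasD2.zero : HasD2 (M := M) (fun _ _ _ => 0) x (fun _ _ _ => 0) :=
  ⟨fun _ _ _ => 0, by simp, by simp, by simp⟩

lemma HasD2.sum {κ : Type*} (s : Finset κ)
    {Ω : κ → (x : M) → 𝕋 x → 𝕋 x → ℝ}
    {T : κ → 𝕋 x → 𝕋 x → 𝕋 x → ℝ}
    (h : ∀ i, HasD2 (Ω i) x (T i)) :
    HasD2 (fun y v w => ∑ i ∈ s, Ω i y v w) x (fun u v w => ∑ i ∈ s, T i u v w) := by
  classical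
  induction s using Finset.induction_on with
  | empty => simpa using HasD2.zero
  | insert i s hi ih => simpa [Finset.sum_insert hi] using (h i).add ih

lemma HasD2.wedge (hα : α.SmoothAt x) (hβ : β.SmoothAt x) :
    HasD2 (wedge α β) x (fun u v w =>
      extD α x u v * β x w + extD α x v w * β x u + extD α x w u * β x v -
      (α x u * extD β x v w + α x v * extD β x w u + α x w * extD β x u v)) := by
  have ap : ∀ {γ : OneForm M}, γ.SmoothAt x → ∀ v,
      HasFDerivAt (fun p => γ.inChart x p v)
        ((fderiv ℝ (γ.inChart x) (𝒞 x x)).flip v) (𝒞 x x) := by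
    intro γ hγ v
    have := hγ.differentiableAt.hasFDerivAt.clm_apply (hasFDerivAt_const v _)
    refine this.congr_fderiv ?_
    ext u
    simp
  have h := fun v w => ((ap hα v).mul (ap hβ w)).sub ((ap hα w).mul (ap hβ v))
  refine ⟨fun p v w => α.inChart x p v * β.inChart x p w - α.inChart x p w * β.inChart x p v,
    fun v w => (h v w).differentiableAt, ?_, ?_⟩
  · filter_upwards [extChartAt_source_mem_nhds (I := 𝓡 6) x] with y hy v w
    rw [α.inChart_apply hy, α.inChart_apply hy, β.inChart_apply hy, β.inChart_apply hy]
    rfl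
  · intro u v w
    have e : ∀ u v w, fderiv ℝ (fun p => α.inChart x p v * β.inChart x p w -
      α.inChart x p w * β.inChart x p v) (𝒞 x x) u = _ :=
      fun u v w => DFunLike.congr_fun (h v w).fderiv u
    have e1 : ∀ v : 𝕋 x,
      α.inChart x (𝒞 x x) (chartDeriv x v) = α x v :=
      fun v => α.inChart_apply (mem_extChartAt_source x) v
    have e2 : ∀ v : 𝕋 x,
      β.inChart x (𝒞 x x) (chartDeriv x v) = β x v :=
      fun v => β.inChart_apply (mem_extChartAt_source x) v
    rw [e, e, e]
    simp only [sub_apply, add_apply,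
      smul_apply, ContinuousLinearMap.flip_apply, smul_eq_mul, e1, e2, extD]
    ring

lemma HasD2.extD (hα : ∀ᶠ y in nhds x, α.SmoothAt y) : HasD2 (extD α) x (fun _ _ _ => 0) := by
  have h := hα.self_of_nhds
  refine ⟨fun p v w => fderiv ℝ (α.inChart x) p v w - fderiv ℝ (α.inChart x) p w v,
    fun v w => (fderiv_sub_swap_cyclic h 0 v w).1, extD_eventually_eq hα, fun u v w => ?_⟩
  exact (fderiv_sub_swap_cyclic h _ _ _).2.symm

end ExtD

set_option synthInstance.maxHeartbeats 400000 in
lemma contDiffAt_smulRight {E F : Type*} [NormedAddCommGroup E] [NormedSpace ℝ E]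
    [NormedAddCommGroup F] [NormedSpace ℝ F]
    {a : E → E →L[ℝ] ℝ} {b : E → F} {p : E} (h : ContDiffAt ℝ ∞ a p) (h' : ContDiffAt ℝ ∞ b p) :
    ContDiffAt ℝ ∞ (fun p => (a p).smulRight (b p)) p := by
  have h2 : ContDiffAt ℝ ∞ (fun p => ContinuousLinearMap.smulRightL ℝ E F (a p)) p :=
    ContDiffAt.comp p (ContinuousLinearMap.contDiff _).contDiffAt h
  exact h2.clm_apply h'

section VectorFields

variable {M : Type*} [TopologicalSpace M] [ChartedSpace E6 M]

/-- Smoothness of a vector field at a point. -/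
def VecSmoothAt (X : (y : M) → 𝕋 y) (x : M) : Prop :=
  ContDiffAt ℝ ∞ (fun p => chartDerivAt x ((𝒞 x).symm p)
    (X ((𝒞 x).symm p))) (𝒞 x x)

variable {α β : OneForm M} {x : M} {X Y : (y : M) → 𝕋 y}

lemma FunSmoothAt.of_chart {V : Type*} [NormedAddCommGroup V] [NormedSpace ℝ V] {f : M → V}
    {F : E6 → V} (hF : ContDiffAt ℝ ∞ F (𝒞 x x))
    (h : ∀ᶠ y in nhds x, f y = F (𝒞 x y)) : FunSmoothAt f x := by
  refine hF.congr_of_eventuallyEq ?_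
  filter_upwards [extChartAt_symm_eventually_mem h] with p hp
  rw [Function.comp_apply, hp.2, (𝒞 x).right_inv hp.1]

lemma FunSmoothAt.const {V : Type*} [NormedAddCommGroup V] [NormedSpace ℝ V] (c : V) :
    FunSmoothAt (fun _ : M => c) x := contDiffAt_const

variable {f g : M → ℝ}

lemma FunSmoothAt.add (hf : FunSmoothAt f x) (hg : FunSmoothAt g x) :
    FunSmoothAt (fun y => f y + g y) x := ContDiffAt.add hf hg

lemma FunSmoothAt.sub (hf : FunSmoothAt f x) (hg : FunSmoothAt g x) :
    FunSmoothAt (fun y => f y - g y) x := ContDiffAt.sub hf hg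

lemma FunSmoothAt.neg (hf : FunSmoothAt f x) : FunSmoothAt (fun y => -f y) x := ContDiffAt.neg hf

lemma FunSmoothAt.mul (hf : FunSmoothAt f x) (hg : FunSmoothAt g x) :
    FunSmoothAt (fun y => f y * g y) x := ContDiffAt.mul hf hg

lemma FunSmoothAt.inv (hf : FunSmoothAt f x) (h : f x ≠ 0) :
    FunSmoothAt (fun y => (f y)⁻¹) x := ContDiffAt.inv hf (by simpa using h)

lemma FunSmoothAt.comp {F : ℝ → ℝ} (hF : ContDiffAt ℝ ∞ F (f x)) (hf : FunSmoothAt f x) :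
    FunSmoothAt (fun y => F (f y)) x :=
  ContDiffAt.comp (g := F) _ (by simpa using hF) hf

lemma FunSmoothAt.sum {κ : Type*} {s : Finset κ} {f : κ → M → ℝ}
    (h : ∀ i ∈ s, FunSmoothAt (f i) x) : FunSmoothAt (fun y => ∑ i ∈ s, f i y) x :=
  ContDiffAt.sum (f := fun i => f i ∘ (𝒞 x).symm) h

variable [IsManifold (𝓡 6) ∞ M]

omit [IsManifold (𝓡 6) ∞ M] in
lemma VecSmoothAt.eventually (_hX : VecSmoothAt X x) : ∀ᶠ y in nhds x,
    chartDerivAt x y (X y) = (fun p => chartDerivAt x ((𝒞 x).symm p)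
      (X ((𝒞 x).symm p))) (𝒞 x y) := by
  filter_upwards [extChartAt_source_mem_nhds (I := 𝓡 6) x] with y hy
  beta_reduce
  rw [(𝒞 x).left_inv hy]

omit [IsManifold (𝓡 6) ∞ M] in
lemma VecSmoothAt.of_chart {F : E6 → E6} (hF : ContDiffAt ℝ ∞ F (𝒞 x x))
    (h : ∀ᶠ y in nhds x, chartDerivAt x y (X y) = F (𝒞 x y)) :
    VecSmoothAt X x := by
  refine hF.congr_of_eventuallyEq ?_
  filter_upwards [extChartAt_symm_eventually_mem h] with p hp
  rw [hp.2, (𝒞 x).right_inv hp.1]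

lemma contMDiffAt_vectorField_iff : ContMDiffAt (𝓡 6) (𝓡 6).tangent ∞
    (fun x => (⟨x, X x⟩ : TangentBundle (𝓡 6) M)) x ↔ VecSmoothAt X x := by
  rw [contMDiffAt_totalSpace, contMDiffAt_iff_chart]
  refine (and_iff_right contMDiffAt_id).trans
    (show _ ↔ _ from ⟨fun h => h.congr_of_eventuallyEq (Filter.EventuallyEq.symm ?_),
      fun h => h.congr_of_eventuallyEq ?_⟩)
  all_goals filter_upwards [extChartAt_symm_eventually_mem (x := x) Filter.univ_mem] with p hp
  all_goals
    have h1 : (𝒞 x).symm p ∈ (chartAt E6 x).source := by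
      rw [← extChartAt_source (𝓡 6)]; exact (𝒞 x).map_target hp.1
    have h2 := TangentBundle.continuousLinearMapAt_trivializationAt (I := 𝓡 6) h1
    have h3 := DFunLike.congr_fun h2 (X ((𝒞 x).symm p))
    rw [Function.comp_apply]
    refine Eq.trans ?_ h3
    rw [Trivialization.continuousLinearMapAt_apply, Trivialization.linearMapAt_apply,
      if_pos (by simpa using h1)]

lemma smoothVectorFieldOn_iff {U : Set M} (hU : IsOpen U) :
    SmoothVectorFieldOn U X ↔ ∀ x ∈ U, VecSmoothAt X x := by
  refine forall₂_congr fun x hx => ?_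
  rw [← contMDiffAt_vectorField_iff]
  exact ⟨fun h => h.contMDiffAt (hU.mem_nhds hx), fun h => h.contMDiffWithinAt⟩

lemma OneForm.SmoothAt.apply (hα : α.SmoothAt x) (hX : VecSmoothAt X x) :
    FunSmoothAt (fun y => α y (X y)) x := by
  refine .of_chart (ContDiffAt.clm_apply hα hX) ?_
  filter_upwards [extChartAt_source_mem_nhds (I := 𝓡 6) x, hX.eventually] with y hy h
  rw [← h, α.inChart_apply hy]

lemma FunSmoothAt.extD_apply (hα : ∀ᶠ y in nhds x, α.SmoothAt y) (hX : VecSmoothAt X x)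
    (hY : VecSmoothAt Y x) : FunSmoothAt (fun y => extD α y (X y) (Y y)) x := by
  have h1 : ContDiffAt ℝ ∞ (fderiv ℝ (α.inChart x)) (𝒞 x x) :=
    ContDiffAt.fderiv_right hα.self_of_nhds (m := ∞) (by simp)
  refine .of_chart (((h1.clm_apply hX).clm_apply hY).sub ((h1.clm_apply hY).clm_apply hX)) ?_
  filter_upwards [extD_eventually_eq hα, hX.eventually, hY.eventually] with y h1 h2 h3
  rw [h1, h2, h3]

lemma SmoothBilinOn.apply {U : Set M} (hU : IsOpen U) {g : BilinField M} (hg : SmoothBilinOn U g)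
    (hx : x ∈ U) (hX : VecSmoothAt X x) (hY : VecSmoothAt Y x) :
    FunSmoothAt (fun y => g y (X y) (Y y)) x := by
  have h1 := (hg x hx).contMDiffAt (hU.mem_nhds hx)
  have h2 := ContMDiffAt.clm_bundle_apply₂ h1 (contMDiffAt_vectorField_iff.2 hX)
    (contMDiffAt_vectorField_iff.2 hY)
  rw [contMDiffAt_totalSpace] at h2
  exact (contMDiffAt_iff_chart _ _).1 h2.2

set_option synthInstance.maxHeartbeats 400000 in
lemma smoothBilinOn_symProd {U : Set M} (hU : IsOpen U) (hα : SmoothOneFormOn U α)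
    (hβ : SmoothOneFormOn U β) : SmoothBilinOn U (symProd α β) := by
  intro x hx
  refine ContMDiffAt.contMDiffWithinAt ?_
  rw [contMDiffAt_hom_bundle, contMDiffAt_iff_chart]
  refine ⟨contMDiffAt_id, ?_⟩
  have ha : ContDiffAt ℝ ∞ (α.inChart x) (𝒞 x x) :=
    (smoothOneFormOn_iff hU α).1 hα x hx
  have hb : ContDiffAt ℝ ∞ (β.inChart x) (𝒞 x x) :=
    (smoothOneFormOn_iff hU β).1 hβ x hx
  refine ((contDiffAt_smulRight ha hb).add (contDiffAt_smulRight hb ha)).congr_of_eventuallyEq ?_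
  filter_upwards [extChartAt_symm_eventually_mem (x := x) Filter.univ_mem] with p hp
  have h2 : (𝒞 x).symm p ∈ (chartAt E6 x).source := by
    rw [← extChartAt_source (𝓡 6)]; exact (𝒞 x).map_target hp.1
  have key : ∀ φ : 𝕋 ((𝒞 x).symm p) →L[ℝ] Trivial M ℝ
      ((𝒞 x).symm p), (trivializationAt (E6 →L[ℝ] ℝ)
        (fun b : M => 𝕋 b →L[ℝ] Trivial M ℝ b) x).continuousLinearMapAt ℝ
          ((𝒞 x).symm p) φ = φ.comp (chartSymmDeriv x p) := by
    intro φ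
    rw [Trivialization.continuousLinearMapAt_apply, Trivialization.linearMapAt_apply,
      if_pos (by simpa using h2), hom_trivializationAt_apply, ← symmL_trivializationAt_eq hp.1]
    ext v
    simp [ContinuousLinearMap.inCoordinates]
    rfl
  ext v w
  rw [Function.comp_apply, ContinuousLinearMap.inCoordinates, ContinuousLinearMap.comp_apply,
    ContinuousLinearMap.comp_apply, symmL_trivializationAt_eq hp.1]
  exact DFunLike.congr_fun (key _) w

end VectorFields

lemma contDiffAt_clm_apply_iff {E F G : Type*} [NormedAddCommGroup E] [NormedSpace ℝ E]
    [NormedAddCommGroup F] [NormedSpace ℝ F] [NormedAddCommGroup G] [NormedSpace ℝ G]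
    [FiniteDimensional ℝ E] {f : G → E →L[ℝ] F} {p : G} :
    ContDiffAt ℝ ∞ f p ↔ ∀ v, ContDiffAt ℝ ∞ (fun q => f q v) p := by
  refine ⟨fun h v => h.clm_apply contDiffAt_const, fun h => ?_⟩
  let e₁ := ContinuousLinearEquiv.ofFinrankEq
    (Module.finrank_fin_fun ℝ (n := Module.finrank ℝ E)).symm
  let e₂ := (e₁.arrowCongr (1 : F ≃L[ℝ] F)).trans
    (ContinuousLinearEquiv.piRing (Fin (Module.finrank ℝ E)))
  rw [← Function.id_comp f, ← e₂.symm_comp_self]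
  exact e₂.symm.contDiff.contDiffAt.comp p (contDiffAt_pi.mpr fun i => h _)

section Coframes

variable {M : Type*} [TopologicalSpace M] [ChartedSpace E6 M]

/-- A family of covectors at a point is a basis of the cotangent space. -/
def CoframeAt {ι : Type*} (e : ι → OneForm M) (x : M) : Prop :=
  Function.Bijective fun (v : 𝕋 x) (i : ι) => e i x v

/-- The tangent vector with given components with respect to a coframe. -/
def vecOf {ι : Type*} (e : ι → OneForm M) (x : M) (a : ι → ℝ) : 𝕋 x :=
  Function.invFun (fun (v : 𝕋 x) (i : ι) => e i x v) a

/-- The vector fields of the frame dual to a coframe. -/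
def dualVec {ι : Type*} [DecidableEq ι] (e : ι → OneForm M) (i : ι) (x : M) :
    𝕋 x :=
  vecOf e x (Pi.single i 1)

section Pointwise

variable {ι : Type*} {e : ι → OneForm M} {x : M}

lemma CoframeAt.apply_vecOf (h : CoframeAt e x) (a : ι → ℝ) (i : ι) : e i x (vecOf e x a) = a i :=
  congrFun (Function.rightInverse_invFun h.2 a) i

lemma CoframeAt.ext (h : CoframeAt e x) {v w : 𝕋 x}
    (hvw : ∀ i, e i x v = e i x w) : v = w :=
  h.1 (funext hvw)

variable [Fintype ι] [DecidableEq ι]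

lemma CoframeAt.apply_dualVec (h : CoframeAt e x) (i j : ι) :
    e i x (dualVec e j x) = if i = j then 1 else 0 := by
  rw [dualVec, h.apply_vecOf, Pi.single_apply]

lemma CoframeAt.sum_smul_dualVec (h : CoframeAt e x) (v : 𝕋 x) :
    ∑ i, e i x v • dualVec e i x = v :=
  h.ext fun j => by simp [h.apply_dualVec]

lemma CoframeAt.covector_apply (h : CoframeAt e x) (α : 𝕋 x →ₗ[ℝ] ℝ)
    (v : 𝕋 x) : α v = ∑ i, α (dualVec e i x) * e i x v := by
  conv_lhs => rw [← h.sum_smul_dualVec v]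
  simp [mul_comm]

lemma CoframeAt.bilin_apply (h : CoframeAt e x)
    (B : 𝕋 x →ₗ[ℝ] 𝕋 x →ₗ[ℝ] ℝ)
    (v w : 𝕋 x) :
    B v w = ∑ i, ∑ j, B (dualVec e i x) (dualVec e j x) * (e i x v * e j x w) := by
  conv_lhs => rw [← h.sum_smul_dualVec v, ← h.sum_smul_dualVec w]
  simp only [map_sum, map_smul, LinearMap.sum_apply, LinearMap.smul_apply, smul_eq_mul,
    Finset.mul_sum]
  refine (Finset.sum_comm).trans (Finset.sum_congr rfl fun i _ => Finset.sum_congr rfl fun j _ => ?_)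
  ring

end Pointwise

variable [IsManifold (𝓡 6) ∞ M] {ι : Type*} [Fintype ι]

/-- Smooth coframes on an open set. -/
structure IsCoframe (U : Set M) (e : ι → OneForm M) : Prop where
  isOpen : IsOpen U
  smooth : ∀ i, SmoothOneFormOn U (e i)
  coframeAt : ∀ x ∈ U, CoframeAt e x

variable {U : Set M} {e : ι → OneForm M}

lemma IsCoframe.smoothAt (h : IsCoframe U e) {x : M} (hx : x ∈ U) (i : ι) : (e i).SmoothAt x :=
  (smoothOneFormOn_iff_smoothAt h.isOpen).1 (h.smooth i) x hx

lemma SmoothOneFormOn.eventually_smoothAt {α : OneForm M} (h : SmoothOneFormOn U α)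
    (hU : IsOpen U) {x : M} (hx : x ∈ U) : ∀ᶠ y in nhds x, α.SmoothAt y :=
  Filter.mem_of_superset (hU.mem_nhds hx) ((smoothOneFormOn_iff_smoothAt hU).1 h)

lemma IsCoframe.vecSmoothAt_vecOf (h : IsCoframe U e) {x : M} (hx : x ∈ U) (a : ι → ℝ) :
    VecSmoothAt (fun y => vecOf e y a) x := by
  set C : E6 → E6 →L[ℝ] (ι → ℝ) := fun p => ContinuousLinearMap.pi fun i => (e i).inChart x p
    with hC
  have hC1 : ContDiffAt ℝ ∞ C (𝒞 x x) := by
    refine contDiffAt_clm_apply_iff.2 fun v => contDiffAt_pi.2 fun i => ?_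
    exact ContDiffAt.clm_apply (f := (e i).inChart x) (h.smoothAt hx i) contDiffAt_const
  have hCa : ∀ y ∈ (𝒞 x).source, ∀ v,
      C (𝒞 x y) (chartDerivAt x y v) = fun i => e i y v := by
    intro y hy v
    ext i
    exact (e i).inChart_apply hy v
  have hbij : ∀ y ∈ U, y ∈ (𝒞 x).source →
      Function.Bijective (C (𝒞 x y)) := by
    intro y hyU hy
    have h1 := chartDerivAt_bijective hy
    refine (Function.Bijective.of_comp_iff _ h1).1 ?_
    rw [show (C (𝒞 x y)) ∘ (chartDerivAt x y) = _ from funext (hCa y hy)]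
    exact h.coframeAt y hyU
  let E : ∀ y ∈ U, y ∈ (𝒞 x).source → (E6 ≃L[ℝ] (ι → ℝ)) := fun y hyU hy =>
    (LinearEquiv.ofBijective (C (𝒞 x y)).toLinearMap
      (hbij y hyU hy)).toContinuousLinearEquiv
  have hE : ∀ y hyU hy, ((E y hyU hy : E6 ≃L[ℝ] (ι → ℝ)) : E6 →L[ℝ] (ι → ℝ)) =
    C (𝒞 x y) := fun y hyU hy => by ext v; rfl
  have hxs := mem_extChartAt_source (I := 𝓡 6) x
  have hinv : ContDiffAt ℝ ∞ (fun p => (C p).inverse) (𝒞 x x) := by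
    refine ContDiffAt.comp (g := ContinuousLinearMap.inverse) _ ?_ hC1
    rw [← hE x hx hxs]
    exact contDiffAt_map_inverse _
  refine .of_chart (hinv.clm_apply (contDiffAt_const (c := a))) ?_
  filter_upwards [extChartAt_source_mem_nhds (I := 𝓡 6) x, h.isOpen.mem_nhds hx] with y hy hyU
  rw [← hE y hyU hy, ContinuousLinearMap.inverse_equiv]
  refine ((E y hyU hy).eq_symm_apply).2 ?_
  refine (hCa y hy _).trans ?_
  ext i
  exact (h.coframeAt y hyU).apply_vecOf a i

/-- The linear map with columns `X i`. -/
def vecCombination (X : ι → (y : M) → 𝕋 y) (y : M) :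
    (ι → ℝ) →L[ℝ] 𝕋 y :=
  ∑ i, (ContinuousLinearMap.proj i).smulRight (X i y)

/-- The coframe dual to a frame. -/
def dualForm (X : ι → (y : M) → 𝕋 y) (i : ι) : OneForm M := fun y =>
  (ContinuousLinearMap.proj (R := ℝ) (φ := fun _ : ι => ℝ) i).comp (vecCombination X y).inverse

omit [IsManifold (𝓡 6) ∞ M] in
lemma vecCombination_apply (X : ι → (y : M) → 𝕋 y) (y : M) (a : ι → ℝ) :
    vecCombination X y a = ∑ i, a i • X i y := by
  rw [vecCombination, ContinuousLinearMap.sum_apply]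
  rfl

omit [IsManifold (𝓡 6) ∞ M] in
lemma vecCombination_isInvertible {X : ι → (y : M) → 𝕋 y} {y : M}
    (hι : Fintype.card ι = 6) (h : LinearIndependent ℝ fun i => X i y) :
    (vecCombination X y).IsInvertible := by
  have h1 : Function.Injective (vecCombination X y).toLinearMap := by
    rw [← LinearMap.ker_eq_bot, LinearMap.ker_eq_bot']
    intro a ha
    have := Fintype.linearIndependent_iff.1 h a (by rw [← vecCombination_apply]; exact ha)
    exact funext this
  have h2 : Module.finrank ℝ (ι → ℝ) = Module.finrank ℝ (𝕋 y) := by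
    rw [Module.finrank_fintype_fun_eq_card, hι]
    exact (finrank_euclideanSpace_fin (𝕜 := ℝ) (n := 6)).symm
  haveI : FiniteDimensional ℝ (𝕋 y) :=
    inferInstanceAs (FiniteDimensional ℝ E6)
  haveI : T2Space (𝕋 y) := inferInstanceAs (T2Space E6)
  refine ⟨(LinearEquiv.ofBijective (vecCombination X y).toLinearMap
    ⟨h1, (LinearMap.injective_iff_surjective_of_finrank_eq_finrank h2).1 h1⟩).toContinuousLinearEquiv,
    ?_⟩
  ext v; rfl

omit [IsManifold (𝓡 6) ∞ M] in
lemma dualForm_vecCombination {X : ι → (y : M) → 𝕋 y} {y : M}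
    (h : (vecCombination X y).IsInvertible) (a : ι → ℝ) (i : ι) :
    dualForm X i y (vecCombination X y a) = a i := by
  obtain ⟨E, hE⟩ := h
  rw [dualForm, ContinuousLinearMap.comp_apply, ← hE, ContinuousLinearMap.inverse_equiv]
  simp

omit [IsManifold (𝓡 6) ∞ M] in
lemma dualForm_apply [DecidableEq ι] {X : ι → (y : M) → 𝕋 y} {y : M}
    (h : (vecCombination X y).IsInvertible) (i j : ι) :
    dualForm X i y (X j y) = if i = j then 1 else 0 := by
  have := dualForm_vecCombination h (Pi.single j 1) i
  rw [vecCombination_apply] at this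
  simpa [Pi.single_apply] using this

omit [IsManifold (𝓡 6) ∞ M] in
lemma coframeAt_dualForm {X : ι → (y : M) → 𝕋 y} {y : M}
    (h : (vecCombination X y).IsInvertible) : CoframeAt (dualForm X) y := by
  obtain ⟨E, hE⟩ := h
  have : (fun (v : 𝕋 y) (i : ι) => dualForm X i y v) = E.symm := by
    ext v i
    rw [dualForm, ContinuousLinearMap.comp_apply, ← hE, ContinuousLinearMap.inverse_equiv]
    rfl
  rw [CoframeAt, this]
  exact E.symm.bijective

lemma smoothAt_dualForm {X : ι → (y : M) → 𝕋 y} {x : M}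
    (hX : ∀ i, VecSmoothAt (X i) x) (h : ∀ᶠ y in nhds x, (vecCombination X y).IsInvertible) (i : ι) :
    (dualForm X i).SmoothAt x := by
  set B : E6 → (ι → ℝ) →L[ℝ] E6 := fun p => (chartDerivAt x ((𝒞 x).symm p)).comp
    (vecCombination X ((𝒞 x).symm p)) with hB
  have hB1 : ContDiffAt ℝ ∞ B (𝒞 x x) := by
    refine contDiffAt_clm_apply_iff.2 fun a => ?_
    simp only [hB, ContinuousLinearMap.comp_apply, vecCombination_apply, map_sum, map_smul]
    exact ContDiffAt.sum fun i _ => ContDiffAt.const_smul (a i) (hX i)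
  have hinv : ∀ᶠ p in nhds (𝒞 x x), p ∈ (𝒞 x).target ∧
      (vecCombination X ((𝒞 x).symm p)).IsInvertible ∧ (B p).IsInvertible := by
    filter_upwards [extChartAt_symm_eventually_mem h] with p hp
    refine ⟨hp.1, hp.2, ?_⟩
    exact (isInvertible_mfderiv_extChartAt ((𝒞 x).map_target hp.1)).comp hp.2
  obtain ⟨-, -, E, hE⟩ := hinv.self_of_nhds
  have h2 : ContDiffAt ℝ ∞ (fun p => (B p).inverse) (𝒞 x x) := by
    refine ContDiffAt.comp (g := ContinuousLinearMap.inverse) _ ?_ hB1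
    rw [← hE]
    exact contDiffAt_map_inverse _
  refine (contDiffAt_const (c := ContinuousLinearMap.proj (R := ℝ) (φ := fun _ : ι => ℝ) i)).clm_comp
    h2 |>.congr_of_eventuallyEq ?_
  filter_upwards [hinv] with p hp
  obtain ⟨hp1, hp2, E', hE'⟩ := hp
  ext w
  obtain ⟨a, rfl⟩ := E'.surjective w
  have e1 : E' a = chartDerivAt x ((𝒞 x).symm p)
      (vecCombination X ((𝒞 x).symm p) a) := DFunLike.congr_fun hE' a
  rw [ContinuousLinearMap.comp_apply, ← hE', ContinuousLinearMap.inverse_equiv]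
  have e2 := OneForm.inChart_apply (dualForm X i) ((𝒞 x).map_target hp1)
    (vecCombination X ((𝒞 x).symm p) a)
  rw [← e1, (𝒞 x).right_inv hp1, dualForm_vecCombination hp2] at e2
  rw [e2]
  simp

/-- The Lie bracket in the preferred chart. -/
lemma chartDeriv_mlieBracket (X Y : (y : M) → 𝕋 y) (x : M) :
    chartDeriv x (VectorField.mlieBracket (𝓡 6) X Y x) =
      VectorField.lieBracket ℝ
        (fun p => chartDerivAt x ((𝒞 x).symm p) (X ((𝒞 x).symm p)))
        (fun p => chartDerivAt x ((𝒞 x).symm p) (Y ((𝒞 x).symm p)))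
        (𝒞 x x) := by
  have hinv : ∀ Z : (y : M) → 𝕋 y,
      VectorField.mpullbackWithin 𝓘(ℝ, E6) (𝓡 6) (𝒞 x).symm Z (range (𝓡 6))
        =ᶠ[nhds (𝒞 x x)] fun p =>
          chartDerivAt x ((𝒞 x).symm p) (Z ((𝒞 x).symm p)) := by
    intro Z
    filter_upwards [extChartAt_symm_eventually_mem (x := x) Filter.univ_mem] with p hp
    rw [VectorField.mpullbackWithin_apply, modelWithCornersSelf_coe, range_id, mfderivWithin_univ]
    have h1 : (mfderiv 𝓘(ℝ, E6) (𝓡 6) (𝒞 x).symm p).inverse =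
        chartDerivAt x ((𝒞 x).symm p) :=
      ContinuousLinearMap.inverse_eq (chartSymmDeriv_comp_chartDerivAt hp.1)
        (chartDerivAt_comp_chartSymmDeriv hp.1)
    rw [h1]
    rfl
  have h2 : ((𝒞 x).symm ⁻¹' univ ∩ range (𝓡 6) : Set E6) = univ := by simp
  have h3 : ∀ V W V' W' : E6 → E6, V =ᶠ[nhds (𝒞 x x)] V' →
      W =ᶠ[nhds (𝒞 x x)] W' → VectorField.lieBracketWithin ℝ V W
        ((𝒞 x).symm ⁻¹' univ ∩ range (𝓡 6)) (𝒞 x x) =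
      VectorField.lieBracket ℝ V' W' (𝒞 x x) := by
    intro V W V' W' hV hW
    rw [h2, VectorField.lieBracketWithin_univ]
    exact Filter.EventuallyEq.lieBracket_vectorField_eq hV hW
  obtain ⟨E, hE⟩ := isInvertible_mfderiv_extChartAt (I := 𝓡 6) (mem_extChartAt_source x)
  refine Eq.trans (congrArg (fun z => chartDeriv x
    ((mfderiv (𝓡 6) 𝓘(ℝ, E6) (𝒞 x) x).inverse z)) (h3 _ _ _ _ (hinv X) (hinv Y))) ?_
  rw [chartDeriv, ← hE, ContinuousLinearMap.inverse_equiv]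
  exact E.apply_symm_apply _

/-- Cartan's formula for the exterior derivative on vector fields annihilated by the form. -/
lemma extD_apply_of_annihilates {α : OneForm M} {x : M} {X Y : (y : M) → 𝕋 y}
    (hα : α.SmoothAt x) (hX : VecSmoothAt X x) (hY : VecSmoothAt Y x)
    (h1 : ∀ᶠ y in nhds x, α y (X y) = 0) (h2 : ∀ᶠ y in nhds x, α y (Y y) = 0) :
    extD α x (X x) (Y x) = -α x (VectorField.mlieBracket (𝓡 6) X Y x) := by
  rw [← α.inChart_apply (mem_extChartAt_source (I := 𝓡 6) x), ← chartDeriv_eq,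
    chartDeriv_mlieBracket, VectorField.lieBracket]
  have center : ∀ Z : (y : M) → 𝕋 y,
      chartDerivAt x ((𝒞 x).symm (𝒞 x x))
        (Z ((𝒞 x).symm (𝒞 x x))) = chartDeriv x (Z x) := by
    intro Z
    have : ∀ y, y = x → chartDerivAt x y (Z y) = chartDeriv x (Z x) := by rintro _ rfl; rfl
    exact this _ (extChartAt_to_inv x)
  have key : ∀ {Z : (y : M) → 𝕋 y}, VecSmoothAt Z x →
      (∀ᶠ y in nhds x, α y (Z y) = 0) → ∀ u,
      fderiv ℝ (α.inChart x) (𝒞 x x) u (chartDeriv x (Z x)) +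
        α.inChart x (𝒞 x x) (fderiv ℝ (fun p => chartDerivAt x
          ((𝒞 x).symm p) (Z ((𝒞 x).symm p)))
          (𝒞 x x) u) = 0 := by
    intro Z hZ h u
    have h3 := (hα.differentiableAt.hasFDerivAt.clm_apply
      (ContDiffAt.differentiableAt hZ (by simp)).hasFDerivAt).fderiv
    have h4 : (fun p => α.inChart x p (chartDerivAt x
        ((𝒞 x).symm p) (Z ((𝒞 x).symm p))))
        =ᶠ[nhds (𝒞 x x)] fun _ => 0 := by
      filter_upwards [extChartAt_symm_eventually_mem h] with p hp
      have := α.inChart_apply ((𝒞 x).map_target hp.1)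
        (Z ((𝒞 x).symm p))
      rw [(𝒞 x).right_inv hp.1] at this
      rw [this, hp.2]
    rw [h4.fderiv_eq, fderiv_fun_const] at h3
    have h5 := DFunLike.congr_fun h3 u
    simp only [Pi.zero_apply, zero_apply, add_apply,
      ContinuousLinearMap.comp_apply, ContinuousLinearMap.flip_apply, center Z] at h5
    rw [add_comm]
    exact h5.symm
  have hX' := key hX h1 (chartDeriv x (Y x))
  have hY' := key hY h2 (chartDeriv x (X x))
  rw [center X, center Y, map_sub, extD]
  linarith

lemma VecSmoothAt.mlieBracket {X Y : (y : M) → 𝕋 y} {x : M}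
    (hX : VecSmoothAt X x) (hY : VecSmoothAt Y x) :
    VecSmoothAt (fun y => VectorField.mlieBracket (𝓡 6) X Y y) x := by
  haveI : IsManifold (𝓡 6) ((⊤ : ℕ∞) + 1) M := by
    have : ((⊤ : ℕ∞) + 1 : WithTop ℕ∞) = ∞ := by simp
    rw [this]; infer_instance
  haveI : IsManifold (𝓡 6) (minSmoothness ℝ 2) M :=
    IsManifold.of_le (n := ∞) (by simpa using two_le_infty)
  exact contMDiffAt_vectorField_iff.1 (ContMDiffAt.mlieBracket_vectorField (m := ⊤) (n := ⊤)
    (contMDiffAt_vectorField_iff.2 hX) (contMDiffAt_vectorField_iff.2 hY) (by simp))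

end Coframes

section Algebra

lemma eps_swap_right (i j k : Fin 3) : eps i j k = -eps i k j := by simp only [eps]; ring

lemma eps_swap_left (i j k : Fin 3) : eps i j k = -eps j i k := by simp only [eps]; ring

lemma eps_swap_outer (i j k : Fin 3) : eps i j k = -eps k j i := by simp only [eps]; ring

lemma eps_rotate (i j k : Fin 3) : eps i j k = eps j k i := by simp only [eps]; ring

lemma eps_self_left (i j : Fin 3) : eps i i j = 0 := by simp [eps]

lemma eps_self_right (i j : Fin 3) : eps j i i = 0 := by simp [eps]

lemma eps_self_outer (i j : Fin 3) : eps i j i = 0 := by simp [eps]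

lemma eps_012 : eps 0 1 2 = 1 := by norm_num [eps]

lemma eps_120 : eps 1 2 0 = 1 := by rw [← eps_rotate, eps_012]

lemma eps_201 : eps 2 0 1 = 1 := by rw [← eps_rotate, eps_120]

lemma eps_021 : eps 0 2 1 = -1 := by rw [eps_swap_right, eps_012]

lemma eps_210 : eps 2 1 0 = -1 := by rw [eps_swap_right, eps_201]

lemma eps_102 : eps 1 0 2 = -1 := by rw [eps_swap_right, eps_120]

attribute [simp] eps_self_left eps_self_right eps_self_outer eps_012 eps_120 eps_201 eps_021
  eps_210 eps_102

/-- The components of a solution of the first Bianchi identities: the curvature array. -/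
def bianchiArray (Aθω : Fin 3 → Fin 3 → Fin 3 → Fin 3 → ℝ) (Bθω Bθθ : Fin 3 → Fin 3 → Fin 3 → ℝ) :
    CurvArray :=
  (fun i k j l => Aθω i j k l + (if i = j then (-1 / 2) * ∑ m, Aθω m m k l else 0) -
      (if j = k then (-1 / 2) * ∑ m, Aθω m m i l else 0),
    fun k i l => -(1 / 4) * (Bθω i k l + Bθω l k i),
    fun i j => (1 / 4) * ∑ k, ∑ l, eps j k l * Bθθ i k l)

variable {Aθθ Aθω : Fin 3 → Fin 3 → Fin 3 → Fin 3 → ℝ}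
  {Bθθ Bθω Bωω : Fin 3 → Fin 3 → Fin 3 → ℝ}

lemma bianchi_Aθω (h2 : ∀ i j k l, Aθω j i k l - (if j = i then ∑ m, Aθω m m k l else 0) =
      Aθω k i j l - (if k = i then ∑ m, Aθω m m j l else 0))
    (h5 : ∀ i j k l, Aθω i j k l - Aθω i l k j + ∑ m, eps i m k * Bωω m l j = 0) :
    let S := (bianchiArray Aθω Bθω Bθθ).1
    (∀ i k j l, S i k j l = S k i j l) ∧ (∀ i k j l, S i k j l = S i k l j) ∧
      (∀ k l, ∑ i, S i k i l = 0) := by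
  have s1 : ∀ i k j l, (bianchiArray Aθω Bθω Bθθ).1 i k j l =
      (bianchiArray Aθω Bθω Bθθ).1 k i j l := by
    intro i k j l
    have := h2 j i k l
    simp only [bianchiArray, eq_comm (a := j) (b := k), eq_comm (a := j) (b := i)]
    split_ifs at this ⊢ <;> linarith
  refine ⟨s1, fun i k j l => ?_, fun k l => ?_⟩
  · have e1 := s1 i k j l
    have e2 := s1 i k l j
    have e3 := h5 i j k l
    have e4 := h5 k j i l
    have e5 : ∑ m, eps i m k * Bωω m l j = -∑ m, eps k m i * Bωω m l j := by
      rw [← Finset.sum_neg_distrib]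
      exact Finset.sum_congr rfl fun m _ => by rw [eps_swap_outer]; ring
    simp only [bianchiArray, eq_comm (a := j) (b := k), eq_comm (a := l) (b := k),
      eq_comm (a := j) (b := i), eq_comm (a := l) (b := i)] at e1 e2 ⊢
    split_ifs at e1 e2 ⊢ <;> try linarith
  · fin_cases k <;> simp [bianchiArray, Fin.sum_univ_three] <;> ring

lemma bianchi_Bωω (h2 : ∀ i j k l, Aθω j i k l - (if j = i then ∑ m, Aθω m m k l else 0) =
      Aθω k i j l - (if k = i then ∑ m, Aθω m m j l else 0))
    (h5 : ∀ i j k l, Aθω i j k l - Aθω i l k j + ∑ m, eps i m k * Bωω m l j = 0) (m l j : Fin 3) :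
    Bωω m l j = ∑ n, eps m n j * ((-1 / 2) * ∑ i, Aθω i i n l) -
      ∑ n, eps m n l * ((-1 / 2) * ∑ i, Aθω i i n j) := by
  have hs := (bianchi_Aθω (Bθθ := fun _ _ _ => 0) (Bθω := fun _ _ _ => 0) h2 h5).2.1
  have e1 := h5 (m + 1) j (m + 2) l
  have e2 := hs (m + 1) (m + 2) j l
  fin_cases m <;> fin_cases j <;> fin_cases l <;>
    simp [bianchiArray, Fin.sum_univ_three] at e1 e2 ⊢ <;> try linarith

lemma bianchi_trace (hA : ∀ i j k l, Aθθ i j k l = -Aθθ i j l k)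
    (h3 : ∀ i, Aθθ 2 i 0 1 + Aθθ 0 i 1 2 + Aθθ 1 i 2 0 -
      ((if i = 2 then ∑ m, Aθθ m m 0 1 else 0) + (if i = 0 then ∑ m, Aθθ m m 1 2 else 0) +
      (if i = 1 then ∑ m, Aθθ m m 2 0 else 0)) = 0)
    (h6 : ∀ i j k l, Aθθ i j k l - ∑ m, eps i m l * Bθω m k j + ∑ m, eps i m k * Bθω m l j = 0)
    (k : Fin 3) : ∑ i, (bianchiArray Aθω Bθω Bθθ).2.1 i i k = 0 := by
  have e := h3 k
  have f := fun i j => h6 i j 0 1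
  have g := fun i j => h6 i j 1 2
  have h := fun i j => h6 i j 2 0
  simp only [Fin.forall_fin_succ] at f g h
  fin_cases k <;> simp [bianchiArray, Fin.sum_univ_three] at e f g h ⊢ <;> linarith

lemma bianchi_Bθω (m k l : Fin 3) : Bθω m k l =
    ∑ n, eps m n l * ((1 / 2) * ∑ i, ∑ j, eps i n j * Bθω i k j) -
      2 * (bianchiArray Aθω Bθω Bθθ).2.1 k m l := by
  fin_cases m <;> fin_cases l <;> simp [bianchiArray, Fin.sum_univ_three] <;> ring

lemma bianchi_Aθθ (hA : ∀ i j k l, Aθθ i j k l = -Aθθ i j l k)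
    (h3 : ∀ i, Aθθ 2 i 0 1 + Aθθ 0 i 1 2 + Aθθ 1 i 2 0 -
      ((if i = 2 then ∑ m, Aθθ m m 0 1 else 0) + (if i = 0 then ∑ m, Aθθ m m 1 2 else 0) +
      (if i = 1 then ∑ m, Aθθ m m 2 0 else 0)) = 0)
    (h6 : ∀ i j k l, Aθθ i j k l - ∑ m, eps i m l * Bθω m k j + ∑ m, eps i m k * Bθω m l j = 0)
    {t : Fin 3 → Fin 3 → ℝ} (ht : ∀ n k, t n k = (1 / 2) * ∑ i, ∑ j, eps i n j * Bθω i k j)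
    (i j k l : Fin 3) : Aθθ i j k l = (if i = j then t l k - t k l else 0) -
      ((if j = l then t i k else 0) - (if j = k then t i l else 0)) +
      2 * ∑ m, (bianchiArray Aθω Bθω Bθθ).2.1 i j m * eps m k l := by
  have tr := bianchi_trace (Aθω := Aθω) (Bθθ := Bθθ) hA h3 h6
  have sy : ∀ k i l, (bianchiArray Aθω Bθω Bθθ).2.1 k i l = (bianchiArray Aθω Bθω Bθθ).2.1 k l i :=
    fun k i l => by simp only [bianchiArray]; ring
  have hB := bianchi_Bθω (Aθω := Aθω) (Bθω := Bθω) (Bθθ := Bθθ)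
  have e := h6 i j k l
  simp only [← ht] at hB
  simp only [hB] at e
  generalize (bianchiArray Aθω Bθω Bθθ).2.1 = S at *
  have tr0 := tr 0
  have tr1 := tr 1
  have tr2 := tr 2
  have s0 := fun a => sy a 1 0
  have s1 := fun a => sy a 2 0
  have s2 := fun a => sy a 2 1
  clear h6 h3 hB tr sy ht
  simp only [Fin.forall_fin_succ, Fin.sum_univ_three] at tr0 tr1 tr2 s0 s1 s2
  fin_cases i <;> fin_cases j <;> fin_cases k <;> fin_cases l <;>
    simp [Fin.sum_univ_three] at e s0 s1 s2 ⊢ <;> linarith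

lemma bianchi_Bθθ (hB : ∀ i k l, Bθθ i k l = -Bθθ i l k)
    (h7 : ∀ i, ∑ m, eps i m 2 * Bθθ m 0 1 + ∑ m, eps i m 0 * Bθθ m 1 2 +
      ∑ m, eps i m 1 * Bθθ m 2 0 = 0) :
    (∀ i j, (bianchiArray Aθω Bθω Bθθ).2.2 i j = (bianchiArray Aθω Bθω Bθθ).2.2 j i) ∧
    ∀ i k l, Bθθ i k l = 2 * ∑ j, eps j k l * (bianchiArray Aθω Bθω Bθθ).2.2 i j := by
  have b0 := fun i => hB i 1 0
  have b1 := fun i => hB i 2 1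
  have b2 := fun i => hB i 0 2
  have b3 := fun i k => hB i k k
  have e0 := h7 0
  have e1 := h7 1
  have e2 := h7 2
  simp [Fin.sum_univ_three] at e0 e1 e2
  constructor
  · intro i j
    fin_cases i <;> fin_cases j <;> simp [bianchiArray, Fin.sum_univ_three, b0, b1, b2] <;> linarith
  · intro i k l
    fin_cases k <;> fin_cases l <;> simp [bianchiArray, Fin.sum_univ_three, b0, b1, b2]
    any_goals linarith [b3 i 0, b3 i 1, b3 i 2]
    all_goals ring

end Algebra

/-! ### Alternating forms on a `6`-dimensional vector space with a split basis -/

section Alternating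

variable {V : Type*} [AddCommGroup V] [Module ℝ V]

/-- A function of two variables is an alternating bilinear form. -/
def IsAlt (F : V → V → ℝ) : Prop :=
  ∃ B : V →ₗ[ℝ] V →ₗ[ℝ] ℝ, (∀ v, B v v = 0) ∧ ∀ v w, F v w = B v w

variable {F G : V → V → ℝ}

lemma IsAlt.add (hF : IsAlt F) (hG : IsAlt G) : IsAlt fun v w => F v w + G v w := by
  obtain ⟨A, h1, h2⟩ := hF
  obtain ⟨B, k1, k2⟩ := hG
  exact ⟨A + B, fun v => by simp [h1, k1], fun v w => by simp [h2, k2]⟩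

lemma IsAlt.const_mul (c : ℝ) (hF : IsAlt F) : IsAlt fun v w => c * F v w := by
  obtain ⟨A, h1, h2⟩ := hF
  exact ⟨c • A, fun v => by simp [h1], fun v w => by simp [h2]⟩

lemma IsAlt.neg (hF : IsAlt F) : IsAlt fun v w => -F v w := by simpa using hF.const_mul (-1)

lemma IsAlt.sub (hF : IsAlt F) (hG : IsAlt G) : IsAlt fun v w => F v w - G v w := by
  simpa [sub_eq_add_neg] using hF.add hG.neg

lemma IsAlt.zero : IsAlt fun (_ _ : V) => 0 := ⟨0, by simp, by simp⟩

lemma IsAlt.ite (p : Prop) [Decidable p] (hF : IsAlt F) :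
    IsAlt fun v w => if p then F v w else 0 := by
  split_ifs
  exacts [hF, .zero]

lemma IsAlt.sum {κ : Type*} (s : Finset κ) {F : κ → V → V → ℝ} (h : ∀ i, IsAlt (F i)) :
    IsAlt fun v w => ∑ i ∈ s, F i v w := by
  classical
  induction s using Finset.induction_on with
  | empty => simpa using IsAlt.zero
  | insert i s hi ih => simpa [Finset.sum_insert hi] using (h i).add ih

lemma IsAlt.wedge (f g : V →ₗ[ℝ] ℝ) : IsAlt fun v w => f v * g w - f w * g v :=
  ⟨f.smulRight g - g.smulRight f, fun v => by simp [mul_comm], fun v w => by simp [mul_comm]⟩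

lemma IsAlt.swap (hF : IsAlt F) (v w : V) : F v w = -F w v := by
  obtain ⟨A, h1, h2⟩ := hF
  have := h1 (v + w)
  simp only [map_add, LinearMap.add_apply, h1] at this
  rw [h2, h2]
  linarith

/-- The components of a vector, as a column `(θ, ω)`. -/
def splitCoord (θ η : Fin 3 → V →ₗ[ℝ] ℝ) (v : V) : Coord :=
  Sum.elim (fun i => θ i v) (fun i => η i v)

/-- A basis of a `6`-dimensional space with its dual basis. -/
structure IsSplitBasis (θ η : Fin 3 → V →ₗ[ℝ] ℝ) (X Y : Fin 3 → V) : Prop where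
  θX : ∀ i j, θ i (X j) = if i = j then 1 else 0
  θY : ∀ i j, θ i (Y j) = 0
  ηX : ∀ i j, η i (X j) = 0
  ηY : ∀ i j, η i (Y j) = if i = j then 1 else 0
  expand : ∀ v, v = ∑ i, θ i v • X i + ∑ i, η i v • Y i

variable {θ η : Fin 3 → V →ₗ[ℝ] ℝ} {X Y : Fin 3 → V}

lemma IsSplitBasis.linear_ext (h : IsSplitBasis θ η X Y) {f g : V →ₗ[ℝ] ℝ}
    (h1 : ∀ i, f (X i) = g (X i)) (h2 : ∀ i, f (Y i) = g (Y i)) : f = g := by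
  ext v
  rw [h.expand v]
  simp only [map_add, map_sum, map_smul, h1, h2]

lemma IsSplitBasis.alt_ext (h : IsSplitBasis θ η X Y) (hF : IsAlt F) (hG : IsAlt G)
    (h1 : ∀ k l, F (X k) (X l) = G (X k) (X l)) (h2 : ∀ k l, F (X k) (Y l) = G (X k) (Y l))
    (h3 : ∀ k l, F (Y k) (Y l) = G (Y k) (Y l)) (v w : V) : F v w = G v w := by
  have h4 : ∀ k l, F (Y k) (X l) = G (Y k) (X l) := fun k l => by rw [hF.swap, hG.swap, h2]
  obtain ⟨A, -, a⟩ := hF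
  obtain ⟨B, -, b⟩ := hG
  simp only [a, b] at *
  have : A = B := by
    ext v w
    have e1 : ∀ k, A (X k) = B (X k) := fun k => h.linear_ext (h1 k) (h2 k)
    have e2 : ∀ k, A (Y k) = B (Y k) := fun k => h.linear_ext (h4 k) (h3 k)
    rw [h.expand v]
    simp only [map_add, map_sum, map_smul, e1, e2]
  rw [this]

lemma isAlt_wedgeCoord (p q : Fin 3 ⊕ Fin 3) :
    IsAlt fun v w => wedgeCoord p q (splitCoord θ η v) (splitCoord θ η w) := by
  have : ∀ p : Fin 3 ⊕ Fin 3, ∃ f : V →ₗ[ℝ] ℝ, ∀ v, splitCoord θ η v p = f v := by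
    rintro (i | i)
    exacts [⟨θ i, fun _ => rfl⟩, ⟨η i, fun _ => rfl⟩]
  obtain ⟨f, hf⟩ := this p
  obtain ⟨g, hg⟩ := this q
  simp only [wedgeCoord, hf, hg]
  simpa only [mul_comm] using IsAlt.wedge f g

lemma isAlt_curvA (S : CurvArray) (i j : Fin 3) :
    IsAlt fun v w => curvA S (splitCoord θ η v) (splitCoord θ η w) i j :=
  (IsAlt.sum _ fun _ => .sum _ fun _ => .sum _ fun _ => (isAlt_wedgeCoord _ _).const_mul _).add
    (.sum _ fun _ => .sum _ fun _ => (isAlt_wedgeCoord _ _).const_mul _)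

lemma isAlt_curvB (S : CurvArray) (i : Fin 3) :
    IsAlt fun v w => curvB S (splitCoord θ η v) (splitCoord θ η w) i :=
  ((IsAlt.sum _ fun _ => .sum _ fun _ => (isAlt_wedgeCoord _ _).const_mul _).const_mul _).add
    (.sum _ fun _ => .sum _ fun _ => .sum _ fun _ => (isAlt_wedgeCoord _ _).const_mul _)

lemma splitCoord_X (h : IsSplitBasis θ η X Y) (k : Fin 3) :
    splitCoord θ η (X k) = Pi.single (.inl k) 1 := by
  ext (i | i) <;> simp [splitCoord, h.θX, h.ηX, Pi.single_apply]

lemma splitCoord_Y (h : IsSplitBasis θ η X Y) (k : Fin 3) :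
    splitCoord θ η (Y k) = Pi.single (.inr k) 1 := by
  ext (i | i) <;> simp [splitCoord, h.θY, h.ηY, Pi.single_apply]

lemma curvA_inl_inl {S : CurvArray} (i j k l : Fin 3) :
    curvA S (Pi.single (.inl k) 1) (Pi.single (.inl l) 1) i j =
      2 * ∑ m, S.2.1 i j m * eps m k l := by
  simp only [curvA, wedgeCoord, Pi.single_apply]
  simp only [mul_sub, Finset.sum_sub_distrib, Sum.inl.injEq, reduceCtorEq, if_false, mul_ite,
    mul_one, mul_zero, Finset.sum_ite_eq', Finset.mem_univ, if_true, ite_self,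
    Finset.sum_const_zero, sub_self, add_zero, Finset.mul_sum, Finset.sum_ite_irrel, ite_mul,
    zero_mul]
  rw [← Finset.sum_sub_distrib]
  refine Finset.sum_congr rfl fun m _ => ?_
  rw [eps_swap_right m l k]; ring

lemma curvA_inl_inr {S : CurvArray} (i j k l : Fin 3) :
    curvA S (Pi.single (.inl k) 1) (Pi.single (.inr l) 1) i j = S.1 i k j l := by
  simp [curvA, wedgeCoord, Pi.single_apply]

lemma curvA_inr_inr {S : CurvArray} (i j k l : Fin 3) :
    curvA S (Pi.single (.inr k) 1) (Pi.single (.inr l) 1) i j = 0 := by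
  simp [curvA, wedgeCoord, Pi.single_apply]

lemma curvB_inl_inl {S : CurvArray} (i k l : Fin 3) :
    curvB S (Pi.single (.inl k) 1) (Pi.single (.inl l) 1) i = 2 * ∑ j, eps j k l * S.2.2 i j := by
  simp only [curvB, wedgeCoord, Pi.single_apply]
  simp only [mul_sub, Finset.sum_sub_distrib, Sum.inl.injEq, reduceCtorEq, if_false, mul_ite,
    mul_one, mul_zero, Finset.sum_ite_eq', Finset.mem_univ, if_true, ite_self,
    Finset.sum_const_zero, sub_self, zero_add, Finset.mul_sum, Finset.sum_ite_irrel, ite_mul,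
    zero_mul]
  rw [← Finset.sum_sub_distrib]
  refine Finset.sum_congr rfl fun m _ => ?_
  rw [eps_swap_right m l k]; ring

lemma curvB_inl_inr {S : CurvArray} (i k l : Fin 3) :
    curvB S (Pi.single (.inl k) 1) (Pi.single (.inr l) 1) i = -2 * S.2.1 k i l := by
  simp [curvB, wedgeCoord, Pi.single_apply]

lemma curvB_inr_inr {S : CurvArray} (i k l : Fin 3) :
    curvB S (Pi.single (.inr k) 1) (Pi.single (.inr l) 1) i = 0 := by
  simp [curvB, wedgeCoord, Pi.single_apply]

/-- The normalized covectors `τ^j` of a solution of the first Bianchi identities. -/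
def bianchiτ (θ η : Fin 3 → V →ₗ[ℝ] ℝ) (X Y : Fin 3 → V) (A : Fin 3 → Fin 3 → V → V → ℝ)
    (B : Fin 3 → V → V → ℝ) (j : Fin 3) : V →ₗ[ℝ] ℝ :=
  ∑ l, ((1 / 2) * ∑ i, ∑ k, eps i j k * B i (X l) (Y k)) • θ l +
    ∑ l, ((-1 / 2) * ∑ i, A i i (X j) (Y l)) • η l

/-- The curvature array of a solution of the first Bianchi identities. -/
def bianchiS (X Y : Fin 3 → V) (A : Fin 3 → Fin 3 → V → V → ℝ) (B : Fin 3 → V → V → ℝ) :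
    CurvArray :=
  bianchiArray (fun i j k l => A i j (X k) (Y l)) (fun i k l => B i (X k) (Y l))
    (fun i k l => B i (X k) (X l))

lemma IsSplitBasis.bianchiτ_X (h : IsSplitBasis θ η X Y) (A : Fin 3 → Fin 3 → V → V → ℝ)
    (B : Fin 3 → V → V → ℝ) (j l : Fin 3) :
    bianchiτ θ η X Y A B j (X l) = (1 / 2) * ∑ i, ∑ k, eps i j k * B i (X l) (Y k) := by
  simp [bianchiτ, h.θX, h.ηX]

lemma IsSplitBasis.bianchiτ_Y (h : IsSplitBasis θ η X Y) (A : Fin 3 → Fin 3 → V → V → ℝ)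
    (B : Fin 3 → V → V → ℝ) (j l : Fin 3) :
    bianchiτ θ η X Y A B j (Y l) = (-1 / 2) * ∑ i, A i i (X j) (Y l) := by
  simp [bianchiτ, h.θY, h.ηY]

/-- The general solution of the first Bianchi identities. -/
theorem IsSplitBasis.bianchi (h : IsSplitBasis θ η X Y) {A : Fin 3 → Fin 3 → V → V → ℝ}
    {B : Fin 3 → V → V → ℝ} (hA : ∀ i j, IsAlt (A i j)) (hB : ∀ i, IsAlt (B i))
    (hθ : ∀ i u v w, (∑ j, A j i u v * θ j w - (∑ k, A k k u v) * θ i w) +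
      (∑ j, A j i v w * θ j u - (∑ k, A k k v w) * θ i u) +
      (∑ j, A j i w u * θ j v - (∑ k, A k k w u) * θ i v) = 0)
    (hη : ∀ i u v w, (∑ j, A i j u v * η j w + ∑ j, ∑ k, eps i k j * B k u v * θ j w) +
      (∑ j, A i j v w * η j u + ∑ j, ∑ k, eps i k j * B k v w * θ j u) +
      (∑ j, A i j w u * η j v + ∑ j, ∑ k, eps i k j * B k w u * θ j v) = 0) :
    bianchiS X Y A B ∈ curvComponents ∧
    (∀ i j v w, A i j v w =
      (if i = j then ∑ k, (bianchiτ θ η X Y A B k v * θ k w - bianchiτ θ η X Y A B k w * θ k v)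
        else 0) - (bianchiτ θ η X Y A B i v * θ j w - bianchiτ θ η X Y A B i w * θ j v) +
        curvA (bianchiS X Y A B) (splitCoord θ η v) (splitCoord θ η w) i j) ∧
    ∀ i v w, B i v w = ∑ j, ∑ k, eps i j k *
        (bianchiτ θ η X Y A B j v * η k w - bianchiτ θ η X Y A B j w * η k v) +
      curvB (bianchiS X Y A B) (splitCoord θ η v) (splitCoord θ η w) i := by
  have As := fun i j v w => (hA i j).swap v w
  have Bs := fun i v w => (hB i).swap v w
  have gAωω : ∀ j i k l, A j i (Y k) (Y l) = 0 := by
    intro j i k l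
    have e : ∀ i j, A j i (Y k) (Y l) - (if i = j then ∑ m, A m m (Y k) (Y l) else 0) = 0 := by
      intro i j
      simpa [h.θX, h.θY] using hθ i (Y k) (Y l) (X j)
    have t : ∑ m, A m m (Y k) (Y l) = 0 := by
      have e0 := e 0 0
      have e1 := e 1 1
      have e2 := e 2 2
      simp only [if_true, Fin.sum_univ_three] at e0 e1 e2 ⊢
      linarith
    simpa [t] using e i j
  have g2 : ∀ i j k l, A j i (X k) (Y l) - (if j = i then ∑ m, A m m (X k) (Y l) else 0) =
      A k i (X j) (Y l) - (if k = i then ∑ m, A m m (X j) (Y l) else 0) := by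
    intro i j k l
    have e := hθ i (X k) (Y l) (X j)
    simp only [h.θX, h.θY, As _ _ (Y l), mul_ite, mul_one, mul_zero, Finset.sum_ite_eq',
      Finset.mem_univ, if_true, Finset.sum_const_zero, Finset.sum_neg_distrib,
      eq_comm (a := i), Finset.sum_ite_eq, sub_zero, add_zero] at e
    split_ifs at e ⊢ <;> linarith
  have g5 : ∀ i j k l, A i j (X k) (Y l) - A i l (X k) (Y j) +
      ∑ m, eps i m k * B m (Y l) (Y j) = 0 := by
    intro i j k l
    have e := hη i (X k) (Y l) (Y j)
    simp only [h.θX, h.θY, h.ηX, h.ηY, As _ _ (Y j), mul_ite, mul_one, mul_zero,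
      Finset.sum_ite_eq', Finset.mem_univ, if_true, Finset.sum_const_zero, add_zero, zero_add] at e
    rw [Finset.sum_comm] at e
    simp only [Finset.sum_ite_eq', Finset.sum_ite_eq, Finset.mem_univ, if_true] at e
    linarith
  have g3 : ∀ i, A 2 i (X 0) (X 1) + A 0 i (X 1) (X 2) + A 1 i (X 2) (X 0) -
      ((if i = 2 then ∑ m, A m m (X 0) (X 1) else 0) +
      (if i = 0 then ∑ m, A m m (X 1) (X 2) else 0) +
      (if i = 1 then ∑ m, A m m (X 2) (X 0) else 0)) = 0 := by
    intro i
    have e := hθ i (X 0) (X 1) (X 2)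
    simp only [h.θX, mul_ite, mul_one, mul_zero, Finset.sum_ite_eq', Finset.sum_ite_eq,
      Finset.mem_univ, if_true] at e
    linarith
  have g6 : ∀ i j k l, A i j (X k) (X l) - ∑ m, eps i m l * B m (X k) (Y j) +
      ∑ m, eps i m k * B m (X l) (Y j) = 0 := by
    intro i j k l
    have e := hη i (X k) (X l) (Y j)
    simp only [h.θX, h.θY, h.ηX, h.ηY, mul_ite, mul_one, mul_zero,
      Finset.sum_ite_eq', Finset.mem_univ, if_true, Finset.sum_const_zero, add_zero, zero_add] at e
    rw [Finset.sum_comm, Finset.sum_comm (f := fun j m => if j = l then _ else _)] at e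
    simp only [Finset.sum_ite_eq', Finset.sum_ite_eq, Finset.mem_univ, if_true, Bs _ (Y j),
      mul_neg, Finset.sum_neg_distrib] at e
    linarith
  have g7 : ∀ i, ∑ m, eps i m 2 * B m (X 0) (X 1) + ∑ m, eps i m 0 * B m (X 1) (X 2) +
      ∑ m, eps i m 1 * B m (X 2) (X 0) = 0 := by
    intro i
    have e := hη i (X 0) (X 1) (X 2)
    simp only [h.θX, h.ηX, mul_ite, mul_one, mul_zero, Finset.sum_const_zero, zero_add,
      Finset.sum_ite_eq', Finset.mem_univ, if_true] at e
    simp only [Fin.sum_univ_three, Fin.reduceEq, if_true, if_false] at e ⊢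
    linarith
  obtain ⟨s1, s2, s3⟩ := bianchi_Aθω (Bθω := fun i k l => B i (X k) (Y l))
    (Bθθ := fun i k l => B i (X k) (X l)) (Aθω := fun i j k l => A i j (X k) (Y l))
    (Bωω := fun i k l => B i (Y k) (Y l)) g2 g5
  have hBω := bianchi_Bωω (Aθω := fun i j k l => A i j (X k) (Y l))
    (Bωω := fun i k l => B i (Y k) (Y l)) g2 g5
  have ht := bianchi_trace (Aθω := fun i j k l => A i j (X k) (Y l))
    (Bθθ := fun i k l => B i (X k) (X l)) (Aθθ := fun i j k l => A i j (X k) (X l))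
    (Bθω := fun i k l => B i (X k) (Y l)) (fun i j k l => As i j _ _) g3 g6
  have hAθ := bianchi_Aθθ (Aθω := fun i j k l => A i j (X k) (Y l))
    (Bθθ := fun i k l => B i (X k) (X l)) (Aθθ := fun i j k l => A i j (X k) (X l))
    (Bθω := fun i k l => B i (X k) (Y l)) (fun i j k l => As i j _ _) g3 g6
    (t := fun n k => bianchiτ θ η X Y A B n (X k)) (fun n k => h.bianchiτ_X A B n k)
  have hBθω := bianchi_Bθω (Aθω := fun i j k l => A i j (X k) (Y l))
    (Bθθ := fun i k l => B i (X k) (X l)) (Bθω := fun i k l => B i (X k) (Y l))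
  obtain ⟨s4, hBθ⟩ := bianchi_Bθθ (Aθω := fun i j k l => A i j (X k) (Y l))
    (Bθθ := fun i k l => B i (X k) (X l)) (Bθω := fun i k l => B i (X k) (Y l))
    (fun i k l => Bs i _ _) g7
  refine ⟨⟨s1, s2, s3, fun i j k => ?_, ht, s4⟩, fun i j => ?_, fun i => ?_⟩
  · simp only [bianchiS, bianchiArray]
    ring
  · refine h.alt_ext (hA i j) ((((IsAlt.sum _ fun k => .wedge _ _).ite _).sub (.wedge _ _)).add
      (isAlt_curvA _ _ _)) (fun k l => ?_) (fun k l => ?_) (fun k l => ?_)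
    · rw [splitCoord_X h, splitCoord_X h, curvA_inl_inl]
      simp only [h.θX]
      simpa [Finset.sum_sub_distrib, bianchiS] using hAθ i j k l
    · rw [splitCoord_X h, splitCoord_Y h, curvA_inl_inr]
      simp only [h.θX, h.θY, bianchiS, bianchiArray, h.bianchiτ_Y]
      simp [Finset.sum_sub_distrib]
      split_ifs <;> ring
    · rw [splitCoord_Y h, splitCoord_Y h, curvA_inr_inr, gAωω]
      simp [h.θY]
  · refine h.alt_ext (hB i) ((IsAlt.sum _ fun j => .sum _ fun k => (IsAlt.wedge _ _).const_mul _).add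
      (isAlt_curvB _ _)) (fun k l => ?_) (fun k l => ?_) (fun k l => ?_)
    · rw [splitCoord_X h, splitCoord_X h, curvB_inl_inl]
      simpa [h.ηX, bianchiS] using hBθ i k l
    · rw [splitCoord_X h, splitCoord_Y h, curvB_inl_inr, show B i (X k) (Y l) = _ from hBθω i k l]
      simp only [h.ηX, h.ηY, h.bianchiτ_X]
      simp [bianchiS, sub_eq_add_neg]
    · rw [splitCoord_Y h, splitCoord_Y h, curvB_inr_inr, show B i (Y k) (Y l) = _ from hBω i k l]
      simp only [h.ηY, h.bianchiτ_Y]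
      simp [mul_sub, Finset.sum_sub_distrib]

end Alternating

section Manifolds

variable {M : Type*} [TopologicalSpace M] [ChartedSpace E6 M] [IsManifold (𝓡 6) ∞ M]
  {D : (x : M) → Submodule ℝ (𝕋 x)} {U : Set M} {x : M}

section Coframings

/-- The six `1`-forms of a coframing as one family. -/
def Coframing.form (c : Coframing M) : Fin 3 ⊕ Fin 3 → OneForm M := Sum.elim c.θ c.om

/-- The vector fields of the dual frame paired with `θ`. -/
def Coframing.vecθ (c : Coframing M) (i : Fin 3) (x : M) : 𝕋 x :=
  dualVec c.form (.inl i) x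

/-- The vector fields of the dual frame paired with `ω`. -/
def Coframing.vecω (c : Coframing M) (i : Fin 3) (x : M) : 𝕋 x :=
  dualVec c.form (.inr i) x

lemma Coframing.coord_eq (c : Coframing M) (x : M) (v : 𝕋 x) :
    c.coord x v = fun i => c.form i x v := by
  ext (i | i) <;> rfl

lemma Coframing.coframeAt_form {c : Coframing M} {x : M} :
    CoframeAt c.form x ↔ Function.Bijective (c.coord x) := by
  rw [CoframeAt, ← funext (c.coord_eq x)]

lemma exists_values (β : Fin 3 → OneForm M) (x : M) :
    ∃ b : Fin 3 → 𝕋 x → ℝ, ∀ i v, β i x v = b i v := ⟨_, fun _ _ => rfl⟩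

lemma exists_values₂ (α : Fin 3 → Fin 3 → OneForm M) (x : M) :
    ∃ a : Fin 3 → Fin 3 → 𝕋 x → ℝ, ∀ i j v, α i j x v = a i j v :=
  ⟨_, fun _ _ _ => rfl⟩

variable {c : Coframing M}

lemma IsOneAdapted.isCoframe (h : IsOneAdapted D U c) : IsCoframe U c.form where
  isOpen := h.isOpen
  smooth := by
    rintro (i | i)
    exacts [h.smooth_θ i, h.smooth_om i]
  coframeAt x hx := Coframing.coframeAt_form.2 (h.bijective x hx)

lemma Coframing.isSplitBasis (h : CoframeAt c.form x) :
    IsSplitBasis (fun i => (c.θ i x : 𝕋 x →ₗ[ℝ] ℝ)) (fun i => c.om i x)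
      (fun i => c.vecθ i x) (fun i => c.vecω i x) where
  θX i j := (h.apply_dualVec (.inl i) (.inl j)).trans (by simp)
  θY i j := (h.apply_dualVec (.inl i) (.inr j)).trans (by simp)
  ηX i j := (h.apply_dualVec (.inr i) (.inl j)).trans (by simp)
  ηY i j := (h.apply_dualVec (.inr i) (.inr j)).trans (by simp)
  expand v := by
    conv_lhs => rw [← h.sum_smul_dualVec v, Fintype.sum_sum_type]
    rfl

lemma isAlt_wedge (α β : OneForm M) (x : M) : IsAlt (wedge α β x) :=
  IsAlt.wedge (α x : 𝕋 x →ₗ[ℝ] ℝ) (β x : 𝕋 x →ₗ[ℝ] ℝ)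

lemma isAlt_extD (α : OneForm M) (x : M) : IsAlt (extD α x) :=
  ⟨extDBilin α x, extD_self α, fun _ _ => rfl⟩

lemma IsCoframe.eventually_smoothAt {ι : Type*} [Fintype ι] {e : ι → OneForm M}
    (h : IsCoframe U e) (hx : x ∈ U) (i : ι) : ∀ᶠ y in nhds x, (e i).SmoothAt y :=
  (h.smooth i).eventually_smoothAt h.isOpen hx

/-- The curvature form `dα + α ∧ α + 2 ω ∧ β`. -/
def ThirdOrderFrame.curvα (t : ThirdOrderFrame M) (i j : Fin 3) (x : M)
    (v w : 𝕋 x) : ℝ :=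
  extD (t.α i j) x v w + ∑ k, wedge (t.α i k) (t.α k j) x v w + 2 * wedge (t.om i) (t.β j) x v w

/-- The curvature form `dβ - ᵗα ∧ β`. -/
def ThirdOrderFrame.curvβ (t : ThirdOrderFrame M) (i : Fin 3) (x : M)
    (v w : 𝕋 x) : ℝ :=
  extD (t.β i) x v w - ∑ j, wedge (t.α j i) (t.β j) x v w

variable {t : ThirdOrderFrame M}

lemma ThirdOrderFrame.isAlt_curvα (i j : Fin 3) : IsAlt (t.curvα i j x) :=
  ((isAlt_extD _ x).add (.sum _ fun _ => isAlt_wedge _ _ x)).add ((isAlt_wedge _ _ x).const_mul 2)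

lemma ThirdOrderFrame.isAlt_curvβ (i : Fin 3) : IsAlt (t.curvβ i x) :=
  (isAlt_extD _ x).sub (.sum _ fun _ => isAlt_wedge _ _ x)

lemma IsThirdOrderFrame.isOpen (ht : IsThirdOrderFrame D U t) : IsOpen U := ht.isTwoAdapted.isOpen

lemma IsThirdOrderFrame.isCoframe (ht : IsThirdOrderFrame D U t) :
    IsCoframe U t.toCoframing.form := ht.isTwoAdapted.toIsOneAdapted.isCoframe

set_option maxHeartbeats 1000000 in
lemma IsThirdOrderFrame.bianchi_θ (ht : IsThirdOrderFrame D U t) (hx : x ∈ U) (i : Fin 3)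
    (u v w : 𝕋 x) :
    (∑ j, t.curvα j i x u v * t.θ j x w - (∑ k, t.curvα k k x u v) * t.θ i x w) +
    (∑ j, t.curvα j i x v w * t.θ j x u - (∑ k, t.curvα k k x v w) * t.θ i x u) +
    (∑ j, t.curvα j i x w u * t.θ j x v - (∑ k, t.curvα k k x w u) * t.θ i x v) = 0 := by
  have sθ := fun i => ht.isCoframe.smoothAt hx (.inl i)
  have sω := fun i => ht.isCoframe.smoothAt hx (.inr i)
  have sα := fun i j => (smoothOneFormOn_iff_smoothAt ht.isOpen).1 (ht.smooth_α i j) x hx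
  have key := (HasD2.extD (ht.isCoframe.eventually_smoothAt hx (.inl i))).unique
    (((HasD2.sum Finset.univ fun k => (HasD2.wedge (sα k k) (sθ i))).neg.add
      (HasD2.sum Finset.univ fun j => HasD2.wedge (sα j i) (sθ j))).add
      (HasD2.sum Finset.univ fun j => HasD2.sum Finset.univ fun k =>
        (HasD2.wedge (sω j) (sω k)).const_mul (eps i j k)))
    (Filter.mem_of_superset (ht.isOpen.mem_nhds hx) fun y hy v w => ht.extD_θ y hy v w i) u v w
  simp only [Coframing.form, Sum.elim_inl, Sum.elim_inr, ht.extD_θ x hx, ht.extD_om x hx] at key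
  simp only [ThirdOrderFrame.curvα]
  obtain ⟨a, ha⟩ := exists_values₂ t.α x
  obtain ⟨b, hb⟩ := exists_values t.β x
  obtain ⟨p, hp⟩ := exists_values t.θ x
  obtain ⟨q, hq⟩ := exists_values t.om x
  simp only [wedge, ha, hb, hp, hq] at key ⊢
  clear ha hb hp hq
  fin_cases i <;> simp [Fin.sum_univ_three] at key ⊢ <;> linear_combination -key

set_option maxHeartbeats 1000000 in
lemma IsThirdOrderFrame.bianchi_ω (ht : IsThirdOrderFrame D U t) (hx : x ∈ U) (i : Fin 3)
    (u v w : 𝕋 x) :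
    (∑ j, t.curvα i j x u v * t.om j x w + ∑ j, ∑ k, eps i k j * t.curvβ k x u v * t.θ j x w) +
    (∑ j, t.curvα i j x v w * t.om j x u + ∑ j, ∑ k, eps i k j * t.curvβ k x v w * t.θ j x u) +
    (∑ j, t.curvα i j x w u * t.om j x v + ∑ j, ∑ k, eps i k j * t.curvβ k x w u * t.θ j x v) =
      0 := by
  have sθ := fun i => ht.isCoframe.smoothAt hx (.inl i)
  have sω := fun i => ht.isCoframe.smoothAt hx (.inr i)
  have sα := fun i j => (smoothOneFormOn_iff_smoothAt ht.isOpen).1 (ht.smooth_α i j) x hx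
  have sβ := fun i => (smoothOneFormOn_iff_smoothAt ht.isOpen).1 (ht.smooth_β i) x hx
  have key := (HasD2.extD (ht.isCoframe.eventually_smoothAt hx (.inr i))).unique
    ((HasD2.sum Finset.univ fun j => HasD2.sum Finset.univ fun k =>
        (HasD2.wedge (sβ k) (sθ j)).const_mul (eps i k j)).neg.sub
      (HasD2.sum Finset.univ fun j => HasD2.wedge (sα i j) (sω j)))
    (Filter.mem_of_superset (ht.isOpen.mem_nhds hx) fun y hy v w => ht.extD_om y hy v w i) u v w
  simp only [Coframing.form, Sum.elim_inl, Sum.elim_inr, ht.extD_θ x hx, ht.extD_om x hx] at key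
  simp only [ThirdOrderFrame.curvα, ThirdOrderFrame.curvβ]
  obtain ⟨a, ha⟩ := exists_values₂ t.α x
  obtain ⟨b, hb⟩ := exists_values t.β x
  obtain ⟨p, hp⟩ := exists_values t.θ x
  obtain ⟨q, hq⟩ := exists_values t.om x
  simp only [wedge, ha, hb, hp, hq] at key ⊢
  clear ha hb hp hq
  fin_cases i <;> simp [Fin.sum_univ_three] at key ⊢ <;> linear_combination key

end Coframings

section CartanFrames

variable {t : ThirdOrderFrame M}

lemma FunSmoothAt.const_mul {f : M → ℝ} (a : ℝ) (hf : FunSmoothAt f x) :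
    FunSmoothAt (fun y => a * f y) x := (FunSmoothAt.const a).mul hf

lemma FunSmoothAt.wedge_apply {α β : OneForm M} {X Y : (y : M) → 𝕋 y}
    (hα : α.SmoothAt x) (hβ : β.SmoothAt x) (hX : VecSmoothAt X x) (hY : VecSmoothAt Y x) :
    FunSmoothAt (fun y => wedge α β y (X y) (Y y)) x :=
  ((hα.apply hX).mul (hβ.apply hY)).sub ((hα.apply hY).mul (hβ.apply hX))

lemma IsCoframe.vecSmoothAt_dualVec {ι : Type*} [Fintype ι] [DecidableEq ι] {e : ι → OneForm M}
    (h : IsCoframe U e) (hx : x ∈ U) (i : ι) : VecSmoothAt (dualVec e i) x :=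
  h.vecSmoothAt_vecOf hx _

lemma OneForm.sum_apply {κ : Type*} (s : Finset κ) (α : κ → OneForm M) (x : M)
    (v : 𝕋 x) : (∑ i ∈ s, α i) x v = ∑ i ∈ s, α i x v := by
  simp [Finset.sum_apply, ContinuousLinearMap.sum_apply]

/-- The normalized forms `τ` and the curvature functions of a section of `B₃`. -/
def ThirdOrderFrame.toCartanFrame (t : ThirdOrderFrame M) : CartanFrame M where
  toThirdOrderFrame := t
  τ j := ∑ l, fsmul (fun y => (1 / 2) * ∑ i, ∑ k, eps i j k *
      t.curvβ i y (t.vecθ l y) (t.vecω k y)) (t.θ l) +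
    ∑ l, fsmul (fun y => (-1 / 2) * ∑ i, t.curvα i i y (t.vecθ j y) (t.vecω l y)) (t.om l)
  S y := bianchiS (fun i => t.vecθ i y) (fun i => t.vecω i y) (fun i j => t.curvα i j y)
    (fun i => t.curvβ i y)

lemma ThirdOrderFrame.toCartanFrame_τ (t : ThirdOrderFrame M) (j : Fin 3) (x : M)
    (v : 𝕋 x) : t.toCartanFrame.τ j x v =
      bianchiτ (fun i => (t.θ i x : 𝕋 x →ₗ[ℝ] ℝ)) (fun i => t.om i x)
      (fun i => t.vecθ i x) (fun i => t.vecω i x) (fun i j => t.curvα i j x)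
      (fun i => t.curvβ i x) j v := by
  simp [toCartanFrame, bianchiτ, OneForm.sum_apply, fsmul_apply]

/-- Every section of `B₃` carries normalized forms `τ` and curvature functions. -/
theorem IsThirdOrderFrame.isCartanFrame (ht : IsThirdOrderFrame D U t) :
    IsCartanFrame D U t.toCartanFrame where
  isThirdOrderFrame := ht
  smooth_τ j := by
    refine (smoothOneFormOn_iff_smoothAt ht.isOpen).2 fun x hx => ?_
    have sθ := fun i => ht.isCoframe.smoothAt hx (.inl i)
    have sω := fun i => ht.isCoframe.smoothAt hx (.inr i)
    have sα := fun i j => (smoothOneFormOn_iff_smoothAt ht.isOpen).1 (ht.smooth_α i j) x hx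
    have sβ := fun i => (smoothOneFormOn_iff_smoothAt ht.isOpen).1 (ht.smooth_β i) x hx
    have sX : ∀ i, VecSmoothAt (t.vecθ i) x := fun i => ht.isCoframe.vecSmoothAt_dualVec hx (.inl i)
    have sY : ∀ i, VecSmoothAt (t.vecω i) x := fun i => ht.isCoframe.vecSmoothAt_dualVec hx (.inr i)
    refine .add (.sum fun l _ => .fsmul (.const_mul _ ?_) (sθ l))
      (.sum fun l _ => .fsmul (.const_mul _ ?_) (sω l))
    · exact .sum fun i _ => .sum fun k _ => .const_mul _ <|
        (FunSmoothAt.extD_apply ((ht.smooth_β i).eventually_smoothAt ht.isOpen hx)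
          (sX l) (sY k)).sub (.sum fun j _ => .wedge_apply (sα j i) (sβ j) (sX l) (sY k))
    · exact .sum fun i _ => ((FunSmoothAt.extD_apply
        ((ht.smooth_α i i).eventually_smoothAt ht.isOpen hx) (sX j) (sY l)).add
          (.sum fun k _ => .wedge_apply (sα i k) (sα k i) (sX j) (sY l))).add
          (.const_mul _ (.wedge_apply (sω i) (sβ i) (sX j) (sY l)))
  components x hx := ((Coframing.isSplitBasis (ht.isCoframe.coframeAt x hx)).bianchi
    (fun _ _ => t.isAlt_curvα _ _) (fun _ => t.isAlt_curvβ _) (ht.bianchi_θ hx)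
    (ht.bianchi_ω hx)).1
  extD_α x hx v w i j := by
    have := ((Coframing.isSplitBasis (ht.isCoframe.coframeAt x hx)).bianchi
      (fun _ _ => t.isAlt_curvα _ _) (fun _ => t.isAlt_curvβ _) (ht.bianchi_θ hx)
      (ht.bianchi_ω hx)).2.1 i j v w
    simp only [← t.toCartanFrame_τ] at this
    set f := t.toCartanFrame
    change extD (f.α i j) x v w + ∑ k, wedge (f.α i k) (f.α k j) x v w +
      2 * wedge (f.om i) (f.β j) x v w = (if i = j then ∑ k, wedge (f.τ k) (f.θ k) x v w else 0) -
      wedge (f.τ i) (f.θ j) x v w + curvA (f.S x) (f.coord x v) (f.coord x w) i j at this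
    linear_combination this
  extD_β x hx v w i := by
    have := ((Coframing.isSplitBasis (ht.isCoframe.coframeAt x hx)).bianchi
      (fun _ _ => t.isAlt_curvα _ _) (fun _ => t.isAlt_curvβ _) (ht.bianchi_θ hx)
      (ht.bianchi_ω hx)).2.2 i v w
    simp only [← t.toCartanFrame_τ] at this
    set f := t.toCartanFrame
    change extD (f.β i) x v w - ∑ j, wedge (f.α j i) (f.β j) x v w =
      ∑ j, ∑ k, eps i j k * wedge (f.τ j) (f.om k) x v w +
      curvB (f.S x) (f.coord x v) (f.coord x w) i at this
    linear_combination this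

end CartanFrames

section TwoAdapted

variable {c : Coframing M}

lemma Coframing.θ_vecθ (h : CoframeAt c.form x) (i j : Fin 3) :
    c.θ i x (c.vecθ j x) = if i = j then 1 else 0 := (isSplitBasis h).θX i j

lemma Coframing.θ_vecω (h : CoframeAt c.form x) (i j : Fin 3) :
    c.θ i x (c.vecω j x) = 0 := (isSplitBasis h).θY i j

lemma Coframing.om_vecθ (h : CoframeAt c.form x) (i j : Fin 3) :
    c.om i x (c.vecθ j x) = 0 := (isSplitBasis h).ηX i j

lemma Coframing.om_vecω (h : CoframeAt c.form x) (i j : Fin 3) :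
    c.om i x (c.vecω j x) = if i = j then 1 else 0 := (isSplitBasis h).ηY i j

/-- `1`-forms `b_j` with `F = b_j ∧ θ_j`, for a `2`-form `F` vanishing modulo `θ`. -/
def Coframing.halfContract (c : Coframing M)
    (F : (x : M) → 𝕋 x → 𝕋 x → ℝ) (j : Fin 3) : OneForm M :=
  ∑ k, fsmul (fun y => F y (c.vecω k y) (c.vecθ j y)) (c.om k) +
    ∑ k, fsmul (fun y => (1 / 2) * F y (c.vecθ k y) (c.vecθ j y)) (c.θ k)

variable {F : (x : M) → 𝕋 x → 𝕋 x → ℝ}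

lemma Coframing.halfContract_vecθ (h : CoframeAt c.form x) (j k : Fin 3) :
    c.halfContract F j x (c.vecθ k x) = (1 / 2) * F x (c.vecθ k x) (c.vecθ j x) := by
  simp [halfContract, OneForm.sum_apply, fsmul_apply, om_vecθ h, θ_vecθ h]

lemma Coframing.halfContract_vecω (h : CoframeAt c.form x) (j k : Fin 3) :
    c.halfContract F j x (c.vecω k x) = F x (c.vecω k x) (c.vecθ j x) := by
  simp [halfContract, OneForm.sum_apply, fsmul_apply, om_vecω h, θ_vecω h]

lemma Coframing.eq_sum_wedge_halfContract (h : CoframeAt c.form x) (hF : IsAlt (F x))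
    (h0 : ∀ k l, F x (c.vecω k x) (c.vecω l x) = 0) (v w : 𝕋 x) :
    F x v w = ∑ j, wedge (c.halfContract F j) (c.θ j) x v w := by
  refine (isSplitBasis h).alt_ext hF (.sum _ fun j => isAlt_wedge _ _ x) (fun k l => ?_)
    (fun k l => ?_) (fun k l => ?_) v w
  · simp only [wedge, halfContract_vecθ h, θ_vecθ h]
    simp only [mul_ite, mul_one, mul_zero, Finset.sum_sub_distrib, Finset.sum_ite_eq',
      Finset.mem_univ, if_true]
    rw [hF.swap (c.vecθ l x)]
    ring
  · simp only [wedge, halfContract_vecθ h, halfContract_vecω h, θ_vecθ h, θ_vecω h]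
    simp [hF.swap (c.vecω l x)]
  · simp [wedge, θ_vecω h, h0]

/-- A `2`-form has smooth components with respect to a coframing. -/
def SmoothTwoFormAt (F : (x : M) → 𝕋 x → 𝕋 x → ℝ) (x : M) :
    Prop :=
  ∀ X Y : (y : M) → 𝕋 y, VecSmoothAt X x → VecSmoothAt Y x →
    FunSmoothAt (fun y => F y (X y) (Y y)) x

lemma IsCoframe.vecSmoothAt_vecθ (h : IsCoframe U c.form) (hx : x ∈ U) (i : Fin 3) :
    VecSmoothAt (c.vecθ i) x := h.vecSmoothAt_dualVec hx _

lemma IsCoframe.vecSmoothAt_vecω (h : IsCoframe U c.form) (hx : x ∈ U) (i : Fin 3) :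
    VecSmoothAt (c.vecω i) x := h.vecSmoothAt_dualVec hx _

lemma IsCoframe.smoothAt_halfContract (h : IsCoframe U c.form) (hx : x ∈ U)
    (hF : SmoothTwoFormAt F x) (j : Fin 3) : (c.halfContract F j).SmoothAt x :=
  .add (.sum fun k _ => .fsmul (hF _ _ (h.vecSmoothAt_vecω hx k) (h.vecSmoothAt_vecθ hx j))
      (h.smoothAt hx (.inr k)))
    (.sum fun k _ => .fsmul (.const_mul _ (hF _ _ (h.vecSmoothAt_vecθ hx k)
      (h.vecSmoothAt_vecθ hx j))) (h.smoothAt hx (.inl k)))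

/-- The part of `dθ_i` that vanishes modulo `θ`. -/
def Coframing.structθ (c : Coframing M) (i : Fin 3) (x : M) (v w : 𝕋 x) : ℝ :=
  extD (c.θ i) x v w - ∑ j, ∑ k, eps i j k * wedge (c.om j) (c.om k) x v w

lemma Coframing.isAlt_structθ (c : Coframing M) (i : Fin 3) : IsAlt (c.structθ i x) :=
  (isAlt_extD _ x).sub (.sum _ fun _ => .sum _ fun _ => (isAlt_wedge _ _ x).const_mul _)

/-- Connection forms `α^j_i` with
`dθ_i = -α^k_k ∧ θ_i + α^j_i ∧ θ_j + ε_{ijk} ω^j ∧ ω^k`. -/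
def Coframing.conn (c : Coframing M) (j i : Fin 3) : OneForm M :=
  c.halfContract (c.structθ i) j -
    if j = i then (1 / 2 : ℝ) • ∑ k, c.halfContract (c.structθ k) k else 0

lemma Coframing.halfContract_eq_conn (c : Coframing M) (j i : Fin 3) :
    c.halfContract (c.structθ i) j = c.conn j i - if j = i then ∑ k, c.conn k k else 0 := by
  have : ∑ k, c.conn k k = -(1 / 2 : ℝ) • ∑ k, c.halfContract (c.structθ k) k := by
    simp only [conn, if_true, Finset.sum_sub_distrib, Finset.sum_const, Finset.card_univ,
      Fintype.card_fin]
    module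
  rw [this, conn]
  split_ifs <;> module

lemma IsOneAdapted.structθ_vecω (h : IsOneAdapted D U c) (hx : x ∈ U) (i k l : Fin 3) :
    c.structθ i x (c.vecω k x) (c.vecω l x) = 0 := by
  have hc := h.isCoframe.coframeAt x hx
  rw [Coframing.structθ, h.extD_θ x hx _ _ (fun j => c.θ_vecω hc j k) (fun j => c.θ_vecω hc j l),
    sub_self]

lemma IsOneAdapted.extD_vecω (h : IsOneAdapted D U c) (hx : x ∈ U) (i k l : Fin 3) :
    extD (c.θ i) x (c.vecω k x) (c.vecω l x) = 2 * eps i k l := by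
  have hc := h.isCoframe.coframeAt x hx
  rw [h.extD_θ x hx _ _ (fun j => c.θ_vecω hc j k) (fun j => c.θ_vecω hc j l)]
  simp only [wedge, c.om_vecω hc]
  simp [mul_sub, Finset.sum_sub_distrib]
  rw [eps_swap_right i l k]
  ring

lemma IsOneAdapted.extD_θ_eq (h : IsOneAdapted D U c) (hx : x ∈ U) (v w : 𝕋 x)
    (i : Fin 3) : extD (c.θ i) x v w = -∑ k, wedge (c.conn k k) (c.θ i) x v w +
      ∑ j, wedge (c.conn j i) (c.θ j) x v w +
        ∑ j, ∑ k, eps i j k * wedge (c.om j) (c.om k) x v w := by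
  have := Coframing.eq_sum_wedge_halfContract (h.isCoframe.coframeAt x hx)
    (c.isAlt_structθ (x := x) i) (h.structθ_vecω hx i) v w
  rw [Coframing.structθ] at this
  rw [eq_add_of_sub_eq this]
  congr 1
  simp only [c.halfContract_eq_conn]
  have e : ∀ j v, (c.conn j i - if j = i then ∑ k, c.conn k k else 0 : OneForm M) x v =
      c.conn j i x v - if j = i then ∑ k, c.conn k k x v else 0 := by
    intro j v
    split_ifs <;> simp [OneForm.sum_apply]
  simp only [wedge, e, sub_mul, Finset.sum_sub_distrib, ite_mul, zero_mul, Finset.sum_ite_eq',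
    Finset.mem_univ, if_true, Finset.sum_mul]
  ring

lemma SmoothTwoFormAt.extD {α : OneForm M} (h : ∀ᶠ y in nhds x, α.SmoothAt y) :
    SmoothTwoFormAt (extD α) x := fun _ _ hX hY => FunSmoothAt.extD_apply h hX hY

lemma IsCoframe.smoothTwoFormAt_structθ (h : IsCoframe U c.form) (hx : x ∈ U) (i : Fin 3) :
    SmoothTwoFormAt (c.structθ i) x := fun _ _ hX hY =>
  (SmoothTwoFormAt.extD (h.eventually_smoothAt hx (.inl i)) _ _ hX hY).sub <|
    .sum fun j _ => .sum fun k _ => .const_mul _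
      (.wedge_apply (h.smoothAt hx (.inr j)) (h.smoothAt hx (.inr k)) hX hY)

lemma IsCoframe.smoothAt_conn (h : IsCoframe U c.form) (hx : x ∈ U) (j i : Fin 3) :
    (c.conn j i).SmoothAt x := by
  have s := fun i j => h.smoothAt_halfContract hx (h.smoothTwoFormAt_structθ hx i) j
  rw [Coframing.conn]
  split_ifs
  · exact (s i j).sub (.const_smul _ (.sum fun k _ => s k k))
  · exact (s i j).sub .zero

/-- The `2`-forms `dω^i + α^i_j ∧ ω^j`. -/
def Coframing.structω (c : Coframing M) (α : Fin 3 → Fin 3 → OneForm M) (i : Fin 3) (x : M)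
    (v w : 𝕋 x) : ℝ :=
  extD (c.om i) x v w + ∑ j, wedge (α i j) (c.om j) x v w

lemma Coframing.isAlt_structω (c : Coframing M) (α : Fin 3 → Fin 3 → OneForm M) (i : Fin 3) :
    IsAlt (c.structω α i x) :=
  (isAlt_extD _ x).add (.sum _ fun _ => isAlt_wedge _ _ x)

lemma Coframing.structω_vecω (h : CoframeAt c.form x) (α : Fin 3 → Fin 3 → OneForm M)
    (i k l : Fin 3) : c.structω α i x (c.vecω k x) (c.vecω l x) =
      extD (c.om i) x (c.vecω k x) (c.vecω l x) + α i l x (c.vecω k x) - α i k x (c.vecω l x) := by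
  simp only [structω, wedge, c.om_vecω h]
  simp [Finset.sum_sub_distrib]
  ring

/-- A `1`-adapted coframing without torsion is `2`-adapted. -/
lemma IsOneAdapted.isTwoAdapted (h : IsOneAdapted D U c) (h0 : ∀ x ∈ U, ∀ i k l,
      c.structω c.conn i x (c.vecω k x) (c.vecω l x) = 0) : IsTwoAdapted D U c where
  toIsOneAdapted := h
  exists_pseudoConnection := by
    have sα : ∀ i j, SmoothOneFormOn U (c.conn i j) := fun i j =>
      (smoothOneFormOn_iff_smoothAt h.isOpen).2 fun x hx => h.isCoframe.smoothAt_conn hx i j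
    refine ⟨c.conn, fun i j => -c.halfContract (c.structω c.conn i) j, sα, fun i j =>
      (smoothOneFormOn_iff_smoothAt h.isOpen).2 fun x hx => .neg ?_, fun x hx v w i =>
      ⟨h.extD_θ_eq hx v w i, ?_⟩⟩
    · refine h.isCoframe.smoothAt_halfContract hx (fun X Y hX hY => ?_) j
      exact (SmoothTwoFormAt.extD (h.isCoframe.eventually_smoothAt hx (.inr i)) _ _ hX hY).add
        (.sum fun j _ => .wedge_apply (h.isCoframe.smoothAt_conn hx i j)
          (h.isCoframe.smoothAt hx (.inr j)) hX hY)
    · have := Coframing.eq_sum_wedge_halfContract (h.isCoframe.coframeAt x hx)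
        (c.isAlt_structω c.conn (x := x) i) (h0 x hx i) v w
      rw [Coframing.structω] at this
      rw [eq_sub_of_add_eq this, ← Finset.sum_neg_distrib]
      congr 1
      refine Finset.sum_congr rfl fun j _ => ?_
      simp only [wedge, Pi.neg_apply, neg_apply]
      ring

end TwoAdapted

section Normalization

variable {c : Coframing M}

lemma IsOneAdapted.torsion_symm (h : IsOneAdapted D U c) (hx : x ∈ U) (i : Fin 3) :
    ∑ j, (eps i j 2 * c.structω c.conn j x (c.vecω 0 x) (c.vecω 1 x) +
      eps i j 0 * c.structω c.conn j x (c.vecω 1 x) (c.vecω 2 x) +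
      eps i j 1 * c.structω c.conn j x (c.vecω 2 x) (c.vecω 0 x)) = 0 := by
  have hc := h.isCoframe.coframeAt x hx
  have sθ := fun i => h.isCoframe.smoothAt hx (.inl i)
  have sω := fun i => h.isCoframe.smoothAt hx (.inr i)
  have sα := fun i j => h.isCoframe.smoothAt_conn hx i j
  have key := (HasD2.extD (h.isCoframe.eventually_smoothAt hx (.inl i))).unique
    (((HasD2.sum Finset.univ fun k => (HasD2.wedge (sα k k) (sθ i))).neg.add
      (HasD2.sum Finset.univ fun j => HasD2.wedge (sα j i) (sθ j))).add
      (HasD2.sum Finset.univ fun j => HasD2.sum Finset.univ fun k =>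
        (HasD2.wedge (sω j) (sω k)).const_mul (eps i j k)))
    (Filter.mem_of_superset (h.isOpen.mem_nhds hx) fun y hy v w => h.extD_θ_eq hy v w i)
    (c.vecω 0 x) (c.vecω 1 x) (c.vecω 2 x)
  simp only [Coframing.form, Sum.elim_inl, Sum.elim_inr, h.extD_vecω hx, c.θ_vecω hc,
    c.om_vecω hc] at key
  simp only [c.structω_vecω hc]
  have s := fun j k => extD_swap (c.om j) (c.vecω k x) (c.vecω 2 x)
  fin_cases i <;> simp [Fin.sum_univ_three] at key ⊢ <;> linear_combination -(1 / 2) * key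

lemma symm_of_cyclic {T : Fin 3 → Fin 3 → Fin 3 → ℝ} (hT : ∀ i k l, T i k l = -T i l k)
    (h : ∀ i, ∑ j, (eps i j 2 * T j 0 1 + eps i j 0 * T j 1 2 + eps i j 1 * T j 2 0) = 0)
    (i m : Fin 3) : ∑ k, ∑ l, eps m k l * T i k l = ∑ k, ∑ l, eps i k l * T m k l := by
  have h0 := h 0
  have h1 := h 1
  have h2 := h 2
  have t0 := fun i => hT i 1 0
  have t1 := fun i => hT i 2 0
  have t2 := fun i => hT i 2 1
  simp [Fin.sum_univ_three] at h0 h1 h2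
  fin_cases i <;> fin_cases m <;> simp [Fin.sum_univ_three, t0, t1, t2] at h0 h1 h2 ⊢ <;> linarith

/-- The coframing `(θ, ω + C θ)`. -/
def Coframing.shift (c : Coframing M) (C : Fin 3 → Fin 3 → M → ℝ) : Coframing M where
  θ := c.θ
  om i := c.om i + ∑ m, fsmul (C i m) (c.θ m)

variable {C : Fin 3 → Fin 3 → M → ℝ}

lemma Coframing.shift_om_apply (c : Coframing M) (i : Fin 3) (v : 𝕋 x) :
    (c.shift C).om i x v = c.om i x v + ∑ m, C i m x * c.θ m x v := by
  simp [shift, OneForm.sum_apply, fsmul_apply]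

lemma Coframing.shift_coframeAt (h : CoframeAt c.form x) : CoframeAt (c.shift C).form x := by
  refine ⟨fun v w hvw => h.ext ?_, fun a => ?_⟩
  · have h1 : ∀ i, c.θ i x v = c.θ i x w := fun i => congrFun hvw (.inl i)
    have h2 : ∀ i, (c.shift C).om i x v = (c.shift C).om i x w := fun i => congrFun hvw (.inr i)
    simp only [shift_om_apply, h1] at h2
    rintro (i | i)
    exacts [h1 i, add_right_cancel (h2 i)]
  · refine ⟨vecOf c.form x (Sum.elim (fun i => a (.inl i))
      (fun i => a (.inr i) - ∑ m, C i m x * a (.inl m))), ?_⟩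
    have h1 := h.apply_vecOf (Sum.elim (fun i => a (.inl i))
      (fun i => a (.inr i) - ∑ m, C i m x * a (.inl m)))
    have h2 := fun i => h1 (.inl i)
    have h3 := fun i => h1 (.inr i)
    simp only [form, Sum.elim_inl, Sum.elim_inr] at h2 h3
    ext (i | i)
    · exact h2 i
    · refine (c.shift_om_apply i _).trans ?_
      simp only [h2, h3, form]
      ring

lemma Coframing.shift_vecω (h : CoframeAt c.form x) (i : Fin 3) :
    (c.shift C).vecω i x = c.vecω i x := by
  have h' := shift_coframeAt (C := C) h
  refine h'.ext ?_
  rintro (j | j)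
  · exact ((c.shift C).θ_vecω h' j i).trans (c.θ_vecω h j i).symm
  · refine ((c.shift C).om_vecω h' j i).trans ?_
    exact ((c.shift_om_apply j _).trans (by simp [c.θ_vecω h, c.om_vecω h])).symm

lemma Coframing.shift_vecθ (h : CoframeAt c.form x) (i : Fin 3) :
    (c.shift C).vecθ i x = c.vecθ i x - ∑ m, C m i x • c.vecω m x := by
  have h' := shift_coframeAt (C := C) h
  refine h'.ext ?_
  rintro (j | j)
  · refine ((c.shift C).θ_vecθ h' j i).trans ?_
    change _ = c.θ j x _
    simp [c.θ_vecθ h, c.θ_vecω h]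
  · refine ((c.shift C).om_vecθ h' j i).trans ?_
    refine Eq.trans ?_ (c.shift_om_apply j _).symm
    simp [c.θ_vecθ h, c.θ_vecω h, c.om_vecω h, c.om_vecθ h]

lemma IsOneAdapted.shift (h : IsOneAdapted D U c) (hC : ∀ i j, SmoothFunOn U (C i j)) :
    IsOneAdapted D U (c.shift C) where
  isOpen := h.isOpen
  smooth_θ := h.smooth_θ
  smooth_om i := (smoothOneFormOn_iff_smoothAt h.isOpen).2 fun x hx =>
    .add (h.isCoframe.smoothAt hx (.inr i)) (.sum fun m _ => .fsmul
      ((smoothFunOn_iff_smoothAt h.isOpen _).1 (hC i m) x hx) (h.isCoframe.smoothAt hx (.inl m)))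
  bijective x hx := Coframing.coframeAt_form.1
    (Coframing.shift_coframeAt (Coframing.coframeAt_form.2 (h.bijective x hx)))
  annihilates := h.annihilates
  extD_θ x hx v w hv hw i := by
    refine (h.extD_θ x hx v w hv hw i).trans ?_
    have e : ∀ v, (∀ l, (c.shift C).θ l x v = 0) → ∀ j, (c.shift C).om j x v = c.om j x v := by
      intro v hv j
      have hv' : ∀ l, c.θ l x v = 0 := hv
      simp [c.shift_om_apply, hv']
    simp only [wedge, e v hv, e w hw]

lemma Coframing.conn_vecω (h : CoframeAt c.form x) (i l k : Fin 3) :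
    c.conn i l x (c.vecω k x) = c.structθ l x (c.vecω k x) (c.vecθ i x) -
      if i = l then (1 / 2) * ∑ m, c.structθ m x (c.vecω k x) (c.vecθ m x) else 0 := by
  rw [conn]
  split_ifs <;> simp [OneForm.sum_apply, c.halfContract_vecω h]

lemma Coframing.structθ_vecω_vecθ (h : CoframeAt c.form x) (i k j : Fin 3) :
    c.structθ i x (c.vecω k x) (c.vecθ j x) = extD (c.θ i) x (c.vecω k x) (c.vecθ j x) := by
  simp [structθ, wedge, c.om_vecθ h]

lemma IsOneAdapted.shift_torsion (h : IsOneAdapted D U c) (hC : ∀ i j, SmoothFunOn U (C i j))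
    (hs : ∀ i j y, C i j y = C j i y) (hx : x ∈ U) (i k l : Fin 3) :
    (c.shift C).structω (c.shift C).conn i x ((c.shift C).vecω k x) ((c.shift C).vecω l x) =
      c.structω c.conn i x (c.vecω k x) (c.vecω l x) + 6 * ∑ m, C i m x * eps m k l := by
  have hc := h.isCoframe.coframeAt x hx
  have hc' := Coframing.shift_coframeAt (C := C) hc
  have sθ : ∀ i, (c.θ i).SmoothAt x := fun i => h.isCoframe.smoothAt hx (.inl i)
  have sC := fun i m => (smoothFunOn_iff_smoothAt h.isOpen _).1 (hC i m) x hx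
  have e : extD ((c.shift C).om i) x (c.vecω k x) (c.vecω l x) =
      extD (c.om i) x (c.vecω k x) (c.vecω l x) + 2 * ∑ m, C i m x * eps m k l := by
    refine (extD_add (h.isCoframe.smoothAt hx (.inr i)) (.sum fun m _ => .fsmul (sC i m) (sθ m))
      _ _).trans ?_
    rw [extD_sum _ (fun m _ => .fsmul (sC i m) (sθ m))]
    simp only [extD_fsmul (sC i _) (sθ _), Coframing.form, Sum.elim_inl, Sum.elim_inr,
      c.θ_vecω hc, h.extD_vecω hx, Finset.mul_sum]
    congr 1
    refine Finset.sum_congr rfl fun m _ => ?_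
    ring
  have e2 : ∀ i k j, extD (c.θ i) x (c.vecω k x) (c.vecθ j x - ∑ m, C m j x • c.vecω m x) =
      extD (c.θ i) x (c.vecω k x) (c.vecθ j x) - 2 * ∑ m, C m j x * eps i k m := by
    intro i k j
    change extDBilin (c.θ i) x _ _ = _
    simp only [map_sub, map_sum, map_smul, smul_eq_mul]
    change extD _ _ _ _ - ∑ m, C m j x * extD (c.θ i) x (c.vecω k x) (c.vecω m x) = _
    simp only [h.extD_vecω hx, Finset.mul_sum]
    congr 1
    refine Finset.sum_congr rfl fun m _ => ?_
    ring
  have e3 : ∀ i l k, (c.shift C).conn i l x (c.vecω k x) =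
      extD (c.θ l) x (c.vecω k x) (c.vecθ i x) - 2 * ∑ m, C m i x * eps l k m -
      if i = l then (1 / 2) * ∑ m, extD (c.θ m) x (c.vecω k x) (c.vecθ m x) else 0 := by
    intro i l k
    have t : ∑ m, 2 * ∑ n, C n m x * eps m k n = 0 := by
      have h0 := hs 1 0 x
      have h1 := hs 2 0 x
      have h2 := hs 2 1 x
      fin_cases k <;> simp [Fin.sum_univ_three, h0, h1, h2]
    rw [← c.shift_vecω (C := C) hc, (c.shift C).conn_vecω hc']
    simp only [(c.shift C).structθ_vecω_vecθ hc']
    simp only [c.shift_vecω hc, c.shift_vecθ hc]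
    change extD (c.θ l) _ _ _ - (if i = l then (1 / 2) * ∑ m, extD (c.θ m) _ _ _ else 0) = _
    simp only [e2, Finset.sum_sub_distrib, t, sub_zero]
  rw [(c.shift C).structω_vecω hc', c.structω_vecω hc]
  simp only [e3, c.conn_vecω hc, c.structθ_vecω_vecθ hc, c.shift_vecω hc, e]
  have s1 : ∑ m, C m i x * eps l k m = -∑ m, C i m x * eps m k l := by
    rw [← Finset.sum_neg_distrib]
    exact Finset.sum_congr rfl fun m _ => by rw [hs m i, eps_swap_outer l k m]; ring
  have s2 : ∑ m, C m i x * eps k l m = ∑ m, C i m x * eps m k l := by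
    exact Finset.sum_congr rfl fun m _ => by rw [hs m i, eps_rotate m k l]
  rw [s1, s2]
  ring

/-- Every `1`-adapted coframing can be modified to a `2`-adapted one. -/
theorem IsOneAdapted.exists_isTwoAdapted (h : IsOneAdapted D U c) :
    ∃ c' : Coframing M, IsTwoAdapted D U c' := by
  set T : Fin 3 → Fin 3 → Fin 3 → M → ℝ := fun i k l y =>
    c.structω c.conn i y (c.vecω k y) (c.vecω l y) with hT
  set C : Fin 3 → Fin 3 → M → ℝ := fun i m y => (-1 / 12) * ∑ k, ∑ l, eps m k l * T i k l y with hC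
  have sT : ∀ i k l, ∀ x ∈ U, FunSmoothAt (T i k l) x := by
    intro i k l x hx
    have hX := h.isCoframe.vecSmoothAt_vecω hx k
    have hY := h.isCoframe.vecSmoothAt_vecω hx l
    exact (SmoothTwoFormAt.extD (h.isCoframe.eventually_smoothAt hx (.inr i)) _ _ hX hY).add
        (.sum fun j _ => .wedge_apply (h.isCoframe.smoothAt_conn hx i j)
          (h.isCoframe.smoothAt hx (.inr j)) hX hY)
  have aT : ∀ i k l y, T i k l y = -T i l k y := fun i k l y => (c.isAlt_structω _ i).swap _ _
  classical
  set C' : Fin 3 → Fin 3 → M → ℝ := fun i m y => (1 / 2) * (C i m y + C m i y) with hC'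
  have sC : ∀ i m, SmoothFunOn U (C' i m) := fun i m =>
    (smoothFunOn_iff_smoothAt h.isOpen _).2 fun x hx => .const_mul _ (.add
      (.const_mul _ (.sum fun k _ => .sum fun l _ => .const_mul _ (sT _ _ _ x hx)))
      (.const_mul _ (.sum fun k _ => .sum fun l _ => .const_mul _ (sT _ _ _ x hx))))
  have hs : ∀ i j y, C' i j y = C' j i y := fun i j y => by simp only [hC']; ring
  refine ⟨c.shift C', (h.shift sC).isTwoAdapted fun x hx i k l => ?_⟩
  rw [h.shift_torsion sC hs hx]
  have e : ∀ i m, C' i m x = C i m x := by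
    intro i m
    have := symm_of_cyclic (fun i k l => aT i k l x) (fun i => h.torsion_symm hx i) i m
    simp only [hC', hC, this]
    ring
  change T i k l x + _ = 0
  simp only [e, hC]
  have t0 := aT i 1 0 x
  have t1 := aT i 2 0 x
  have t2 := aT i 2 1 x
  have t3 := fun k => aT i k k x
  have t4 := t3 0
  have t5 := t3 1
  have t6 := t3 2
  clear_value T
  fin_cases k <;> fin_cases l <;> simp [Fin.sum_univ_three, t0, t1, t2] at t4 t5 t6 ⊢ <;> linarith

end Normalization

section Existence

/-- Every point has a neighborhood with a `2`-adapted coframing. -/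
theorem IsNondegenerate.exists_isTwoAdapted (hD : IsNondegenerate D) (x : M) :
    ∃ U : Set M, x ∈ U ∧ ∃ c : Coframing M, IsTwoAdapted D U c := by
  obtain ⟨U, hU, hx, X, hX, hspan⟩ := hD x
  refine ⟨U, hx, IsOneAdapted.exists_isTwoAdapted (?_ : ∃ c, IsOneAdapted D U c).choose_spec⟩
  set Z : Fin 3 ⊕ Fin 3 → (y : M) → 𝕋 y := Sum.elim
    (fun i => VectorField.mlieBracket (𝓡 6) (X (i + 1)) (X (i + 2))) X with hZ
  have sX := fun y hy i => (smoothVectorFieldOn_iff hU).1 (hX i) y hy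
  have sZ : ∀ y ∈ U, ∀ p, VecSmoothAt (Z p) y := by
    rintro y hy (i | i)
    · exact (sX y hy _).mlieBracket (sX y hy _)
    · exact sX y hy i
  have lZ : ∀ y ∈ U, LinearIndependent ℝ fun p => Z p y := by
    intro y hy
    have := (hspan y hy).2.comp (Sum.elim ![3, 4, 5] ![0, 1, 2]) (by decide)
    convert this using 1
    ext1 (i | i) <;> fin_cases i <;> rfl
  have hinv : ∀ y ∈ U, (vecCombination Z y).IsInvertible := fun y hy =>
    vecCombination_isInvertible (by simp) (lZ y hy)
  set c : Coframing M := ⟨fun i => (-2 : ℝ) • dualForm Z (.inl i), fun i => dualForm Z (.inr i)⟩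
    with hc
  have dZ : ∀ y ∈ U, ∀ p q, dualForm Z p y (Z q y) = if p = q then 1 else 0 := fun y hy p q =>
    dualForm_apply (hinv y hy) p q
  have θX : ∀ y ∈ U, ∀ i j, c.θ i y (X j y) = 0 := fun y hy i j => by
    have : dualForm Z (.inl i) y (X j y) = 0 := (dZ y hy (.inl i) (.inr j)).trans (by simp)
    simp [hc, this]
  have ωX : ∀ y ∈ U, ∀ i j, c.om i y (X j y) = if i = j then 1 else 0 := fun y hy i j =>
    (dZ y hy (.inr i) (.inr j)).trans (by simp)
  have sd : ∀ y ∈ U, ∀ p, (dualForm Z p).SmoothAt y := fun y hy p =>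
    smoothAt_dualForm (sZ y hy) (Filter.mem_of_superset (hU.mem_nhds hy) hinv) p
  have sθ : ∀ y ∈ U, ∀ i, (c.θ i).SmoothAt y := fun y hy i => (sd y hy _).const_smul _
  have cof : ∀ y ∈ U, CoframeAt c.form y := by
    intro y hy
    have h := coframeAt_dualForm (hinv y hy)
    refine ⟨fun v w hvw => h.ext ?_, fun a => ?_⟩
    · rintro (i | i)
      · have h1 : (-2 : ℝ) * dualForm Z (.inl i) y v = -2 * dualForm Z (.inl i) y w :=
          congrFun hvw (.inl i)
        linarith
      · exact congrFun hvw (.inr i)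
    · refine ⟨vecOf (dualForm Z) y (Sum.elim (fun i => (-1 / 2) * a (.inl i)) (fun i => a (.inr i))),
        ?_⟩
      have h1 := h.apply_vecOf (Sum.elim (fun i => (-1 / 2) * a (.inl i)) (fun i => a (.inr i)))
      ext (i | i)
      · change (-2 : ℝ) * dualForm Z (.inl i) y _ = _
        rw [h1, Sum.elim_inl]
        ring
      · exact h1 (.inr i)
  have key : ∀ y ∈ U, ∀ i j k, extD (c.θ i) y (X j y) (X k y) = 2 * eps i j k := by
    intro y hy i j k
    rw [extD_apply_of_annihilates (sθ y hy i) (sX y hy j) (sX y hy k)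
      (Filter.mem_of_superset (hU.mem_nhds hy) fun z hz => θX z hz i j)
      (Filter.mem_of_superset (hU.mem_nhds hy) fun z hz => θX z hz i k)]
    have b : ∀ l, c.θ i y (VectorField.mlieBracket (𝓡 6) (X (l + 1)) (X (l + 2)) y) =
        if i = l then -2 else 0 := by
      intro l
      have : dualForm Z (.inl i) y (VectorField.mlieBracket (𝓡 6) (X (l + 1)) (X (l + 2)) y) =
        if i = l then 1 else 0 := (dZ y hy (.inl i) (.inl l)).trans (by simp)
      refine (congrArg (fun r : ℝ => -2 * r) this).trans ?_
      split_ifs <;> norm_num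
    have b0 := b 0
    have b1 := b 1
    have b2 := b 2
    have sw : ∀ j k, c.θ i y (VectorField.mlieBracket (𝓡 6) (X j) (X k) y) =
        -c.θ i y (VectorField.mlieBracket (𝓡 6) (X k) (X j) y) := by
      intro j k
      rw [VectorField.mlieBracket_swap, Pi.neg_apply, map_neg]
    have s10 := sw 1 0
    have s21 := sw 2 1
    have s02 := sw 0 2
    have s0 := sw 0 0
    have s1 := sw 1 1
    have s2 := sw 2 2
    simp only [Fin.reduceAdd, zero_add] at b0 b1 b2
    fin_cases i <;> fin_cases j <;> fin_cases k <;>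
      simp at b0 b1 b2 s10 s21 s02 s0 s1 s2 ⊢ <;> linarith
  refine ⟨c, hU, fun i => (smoothOneFormOn_iff_smoothAt hU).2 fun y hy => sθ y hy i,
    fun i => (smoothOneFormOn_iff_smoothAt hU).2 fun y hy => sd y hy _,
    fun y hy => Coframing.coframeAt_form.1 (cof y hy), fun y hy i v hv => ?_,
    fun y hy v w hv hw i => ?_⟩
  · rw [(hspan y hy).1] at hv
    induction hv using Submodule.span_induction with
    | mem v hv =>
      obtain ⟨j, rfl⟩ := hv
      exact θX y hy i j
    | zero => exact map_zero _
    | add v w _ _ h1 h2 => rw [map_add, h1, h2, add_zero]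
    | smul a v _ h1 => rw [map_smul, h1, smul_zero]
  · have ex : ∀ v, (∀ l, c.θ l y v = 0) → v = ∑ j, c.om j y v • X j y := by
      intro v hv
      refine (cof y hy).ext ?_
      rintro (l | l)
      · change c.θ l y v = c.θ l y _
        simp [hv, θX y hy]
      · change c.om l y v = c.om l y _
        simp [ωX y hy]
    have e : extD (c.θ i) y v w = ∑ k, ∑ j, c.om k y w * (c.om j y v * (2 * eps i j k)) := by
      conv_lhs => rw [ex v hv, ex w hw]
      change extDBilin (c.θ i) y _ _ = _
      simp only [map_sum, map_smul, LinearMap.sum_apply, LinearMap.smul_apply, smul_eq_mul,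
        Finset.mul_sum]
      exact Finset.sum_congr rfl fun k _ => Finset.sum_congr rfl fun j _ => by
        rw [← key y hy i j k]; rfl
    rw [e]
    simp only [wedge]
    fin_cases i <;> simp [Fin.sum_univ_three] <;> ring

end Existence

section ThirdOrder

variable {c : Coframing M} {α β : Fin 3 → Fin 3 → OneForm M}

/-- The curvature `dα + α ∧ α` of the connection forms. -/
def connCurv (α : Fin 3 → Fin 3 → OneForm M) (i j : Fin 3) (x : M) (v w : 𝕋 x) : ℝ :=
  extD (α i j) x v w + ∑ k, wedge (α i k) (α k j) x v w

set_option maxHeartbeats 1000000 in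
lemma Coframing.bianchi_structω (hU : IsOpen U) (hc : IsCoframe U c.form)
    (hα : ∀ i j, SmoothOneFormOn U (α i j))
    (hθ : ∀ x ∈ U, ∀ v w : 𝕋 x, ∀ i,
      extD (c.θ i) x v w = -∑ k, wedge (α k k) (c.θ i) x v w + ∑ j, wedge (α j i) (c.θ j) x v w +
        ∑ j, ∑ k, eps i j k * wedge (c.om j) (c.om k) x v w)
    (hx : x ∈ U) (i : Fin 3) (u v w : 𝕋 x) :
    (∑ j, connCurv α j i x u v * c.θ j x w - (∑ k, connCurv α k k x u v) * c.θ i x w) +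
    (∑ j, connCurv α j i x v w * c.θ j x u - (∑ k, connCurv α k k x v w) * c.θ i x u) +
    (∑ j, connCurv α j i x w u * c.θ j x v - (∑ k, connCurv α k k x w u) * c.θ i x v) +
    2 * ∑ j, ∑ k, eps i j k * (c.structω α j x u v * c.om k x w + c.structω α j x v w * c.om k x u +
      c.structω α j x w u * c.om k x v) = 0 := by
  have sθ := fun i => hc.smoothAt hx (.inl i)
  have sω := fun i => hc.smoothAt hx (.inr i)
  have sα := fun i j => (smoothOneFormOn_iff_smoothAt hU).1 (hα i j) x hx
  have key := (HasD2.extD (hc.eventually_smoothAt hx (.inl i))).unique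
    (((HasD2.sum Finset.univ fun k => (HasD2.wedge (sα k k) (sθ i))).neg.add
      (HasD2.sum Finset.univ fun j => HasD2.wedge (sα j i) (sθ j))).add
      (HasD2.sum Finset.univ fun j => HasD2.sum Finset.univ fun k =>
        (HasD2.wedge (sω j) (sω k)).const_mul (eps i j k)))
    (Filter.mem_of_superset (hU.mem_nhds hx) fun y hy v w => hθ y hy v w i) u v w
  simp only [Coframing.form, Sum.elim_inl, Sum.elim_inr, hθ x hx] at key
  simp only [connCurv, Coframing.structω]
  obtain ⟨a, ha⟩ := exists_values₂ α x
  obtain ⟨p, hp⟩ := exists_values c.θ x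
  obtain ⟨q, hq⟩ := exists_values c.om x
  have s := fun j v w => extD_swap (c.om j) (x := x) v w
  simp only [wedge, ha, hp, hq] at key ⊢
  clear ha hp hq
  fin_cases i <;> simp [Fin.sum_univ_three] at key ⊢ <;> linear_combination -key

/-- The trace condition on the second-order part of a `2`-adapted coframing. -/
lemma IsTwoAdapted.trace_eq_zero (h : IsTwoAdapted D U c)
    (hα : ∀ i j, SmoothOneFormOn U (α i j)) (hβ : ∀ i j, SmoothOneFormOn U (β i j))
    (hs : ∀ x ∈ U, ∀ v w : 𝕋 x, ∀ i,
      extD (c.θ i) x v w = -∑ k, wedge (α k k) (c.θ i) x v w + ∑ j, wedge (α j i) (c.θ j) x v w +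
        ∑ j, ∑ k, eps i j k * wedge (c.om j) (c.om k) x v w ∧
      extD (c.om i) x v w = -∑ j, wedge (β i j) (c.θ j) x v w - ∑ j, wedge (α i j) (c.om j) x v w)
    (hx : x ∈ U) (i : Fin 3) : ∑ j, (β i j x (c.vecω j x) + β j i x (c.vecω j x)) = 0 := by
  have hU := h.isOpen
  have hf := h.toIsOneAdapted.isCoframe
  have hc := hf.coframeAt x hx
  have sθ := fun i => hf.smoothAt hx (.inl i)
  have sω := fun i => hf.smoothAt hx (.inr i)
  have sα := fun i j => (smoothOneFormOn_iff_smoothAt hU).1 (hα i j) x hx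
  have sβ := fun i j => (smoothOneFormOn_iff_smoothAt hU).1 (hβ i j) x hx
  have hF : ∀ i v w, c.structω α i x v w = -∑ j, wedge (β i j) (c.θ j) x v w := fun i v w => by
    rw [Coframing.structω, (hs x hx v w i).2]; ring
  have keyθ := fun i a b j => Coframing.bianchi_structω hU hf hα
    (fun x hx v w i => (hs x hx v w i).1) hx i (c.vecω a x) (c.vecω b x) (c.vecθ j x)
  simp only [hF, c.θ_vecω hc, c.om_vecω hc, c.θ_vecθ hc, c.om_vecθ hc, wedge] at keyθ
  have keyω := (HasD2.extD (hf.eventually_smoothAt hx (.inr i))).unique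
    ((HasD2.sum Finset.univ fun j => (HasD2.wedge (sβ i j) (sθ j))).neg.sub
      (HasD2.sum Finset.univ fun j => HasD2.wedge (sα i j) (sω j)))
    (Filter.mem_of_superset (hU.mem_nhds hx) fun y hy v w => (hs y hy v w i).2)
    (c.vecω 0 x) (c.vecω 1 x) (c.vecω 2 x)
  simp only [Coframing.form, Sum.elim_inl, Sum.elim_inr, fun i v w => (hs x hx v w i).1,
    fun i v w => (hs x hx v w i).2, wedge, c.θ_vecω hc, c.om_vecω hc] at keyω
  have keyA : ∑ j, 2 * β i j x (c.vecω j x) = connCurv α i 2 x (c.vecω 0 x) (c.vecω 1 x) +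
      connCurv α i 0 x (c.vecω 1 x) (c.vecω 2 x) + connCurv α i 1 x (c.vecω 2 x) (c.vecω 0 x) := by
    simp only [connCurv, wedge]
    simp [Fin.sum_univ_three] at keyω ⊢
    linear_combination -keyω
  have k0 := fun i j => keyθ i 0 1 j
  have k1 := fun i j => keyθ i 1 2 j
  have k2 := fun i j => keyθ i 2 0 j
  clear keyθ keyω
  fin_cases i
  · have e0 := k0 2 0
    have e1 := k1 0 0
    have e2 := k1 1 1
    have e3 := k1 2 2
    have e4 := k2 1 0
    clear k0 k1 k2
    simp [Fin.sum_univ_three] at *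
    linarith
  · have e0 := k0 2 1
    have e1 := k1 0 1
    have e2 := k2 0 0
    have e3 := k2 1 1
    have e4 := k2 2 2
    clear k0 k1 k2
    simp [Fin.sum_univ_three] at *
    linarith
  · have e0 := k0 0 0
    have e1 := k0 1 1
    have e2 := k0 2 2
    have e3 := k1 0 2
    have e4 := k2 1 2
    clear k0 k1 k2
    simp [Fin.sum_univ_three] at *
    linarith

lemma eq_eps_of_skew {f : Fin 3 → Fin 3 → Fin 3 → ℝ} (hf : ∀ i k l, f i k l = -f i l k)
    {g : Fin 3 → Fin 3 → ℝ} (hg : ∀ n a, g n a = (1 / 2) * ∑ i, ∑ j, eps n i j * f a i j -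
      (if n = a then 1 / 4 else 0) * ∑ m, ∑ i, ∑ j, eps m i j * f m i j) (i k l : Fin 3) :
    f i k l = -∑ j, ∑ n, eps i n j * (g n k * (if j = l then 1 else 0) -
      g n l * (if j = k then 1 else 0)) := by
  have a0 := fun i => hf i 1 0
  have a1 := fun i => hf i 2 0
  have a2 := fun i => hf i 2 1
  have a3 := hf i 0 0
  have a4 := hf i 1 1
  have a5 := hf i 2 2
  have b0 : ∀ a, ∑ i, ∑ j, eps 0 i j * f a i j = 2 * f a 1 2 := fun a => by
    simp [Fin.sum_univ_three, a2]; ring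
  have b1 : ∀ a, ∑ i, ∑ j, eps 1 i j * f a i j = -2 * f a 0 2 := fun a => by
    simp [Fin.sum_univ_three, a1]; ring
  have b2 : ∀ a, ∑ i, ∑ j, eps 2 i j * f a i j = 2 * f a 0 1 := fun a => by
    simp [Fin.sum_univ_three, a0]; ring
  have hT := Fin.sum_univ_three fun m => ∑ i, ∑ j, eps m i j * f m i j
  rw [b0, b1, b2] at hT
  simp only [hT] at hg
  have g0 := fun a => b0 a ▸ hg 0 a
  have g1 := fun a => b1 a ▸ hg 1 a
  have g2 := fun a => b2 a ▸ hg 2 a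
  clear hg hf b0 b1 b2
  simp only [Fin.sum_univ_three, g0, g1, g2]
  fin_cases i <;> fin_cases k <;> fin_cases l <;> simp [a0, a1, a2] at a3 a4 a5 ⊢ <;> linarith

lemma skew_eq_eps {b : Fin 3 → Fin 3 → ℝ} (hb : ∀ i k, b i k = -b k i) (i k : Fin 3) :
    b i k = ∑ n, eps i n k * ((1 / 2) * ∑ a, ∑ j, eps a n j * b a j) := by
  have a0 := hb 1 0
  have a1 := hb 2 0
  have a2 := hb 2 1
  have a3 := hb i i
  fin_cases i <;> fin_cases k <;> simp [Fin.sum_univ_three, a0, a1, a2] at a3 ⊢ <;> linarith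

set_option maxHeartbeats 1000000 in
/-- Every `2`-adapted coframing extends to a section of `B₃`. -/
theorem IsTwoAdapted.exists_isThirdOrderFrame (h : IsTwoAdapted D U c) :
    ∃ f : ThirdOrderFrame M, f.toCoframing = c ∧ IsThirdOrderFrame D U f := by
  obtain ⟨α, β, hα, hβ, hs⟩ := h.exists_pseudoConnection
  have hU := h.isOpen
  have hf := h.toIsOneAdapted.isCoframe
  set s : Fin 3 → Fin 3 → Fin 3 → M → ℝ := fun i k j y =>
    (-1 / 2) * (β i k y (c.vecω j y) + β k i y (c.vecω j y)) with hs'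
  have ss : ∀ i k j y, s i k j y = s k i j y := fun i k j y => by simp only [hs']; ring
  have ts : ∀ x ∈ U, ∀ k, ∑ i, s i k i x = 0 := by
    intro x hx k
    have := h.trace_eq_zero hα hβ hs hx k
    simp only [hs', ← Finset.mul_sum]
    rw [← mul_zero (-1 / 2 : ℝ), ← this]
    congr 1
    exact Finset.sum_congr rfl fun i _ => add_comm _ _
  set α' : Fin 3 → Fin 3 → OneForm M := fun i j => α i j + ∑ k, fsmul (s i k j) (c.θ k) with hα'
  have α'_apply : ∀ i j x v, α' i j x v = α i j x v + ∑ k, s i k j x * c.θ k x v := by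
    intro i j x v
    simp [hα', OneForm.sum_apply, fsmul_apply]
  have sα : ∀ i j, ∀ x ∈ U, (α' i j).SmoothAt x := fun i j x hx =>
    .add ((smoothOneFormOn_iff_smoothAt hU).1 (hα i j) x hx) (.sum fun k _ => .fsmul
      (.const_mul _ (.add (((smoothOneFormOn_iff_smoothAt hU).1 (hβ _ _) x hx).apply
        (hf.vecSmoothAt_vecω hx _)) (((smoothOneFormOn_iff_smoothAt hU).1 (hβ _ _) x hx).apply
        (hf.vecSmoothAt_vecω hx _)))) (hf.smoothAt hx (.inl k)))
  set F := c.structω α' with hF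
  have aF : ∀ i x, IsAlt (F i x) := fun i x => c.isAlt_structω α' i
  have sF : ∀ i, ∀ x ∈ U, SmoothTwoFormAt (F i) x := fun i x hx X Y hX hY =>
    (SmoothTwoFormAt.extD (hf.eventually_smoothAt hx (.inr i)) _ _ hX hY).add
      (.sum fun j _ => .wedge_apply (sα i j x hx) (hf.smoothAt hx (.inr j)) hX hY)
  have F_apply : ∀ x ∈ U, ∀ i v w, F i x v w = -∑ j, wedge (β i j) (c.θ j) x v w +
      ∑ j, ∑ k, s i k j x * wedge (c.θ k) (c.om j) x v w := by
    intro x hx i v w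
    simp only [hF, Coframing.structω, (hs x hx v w i).2, wedge, α'_apply, add_mul,
      Finset.sum_sub_distrib, Finset.sum_add_distrib, Finset.sum_mul, mul_sub, mul_assoc]
    ring
  have F_ωω : ∀ x ∈ U, ∀ i k l, F i x (c.vecω k x) (c.vecω l x) = 0 := by
    intro x hx i k l
    have hc := hf.coframeAt x hx
    rw [F_apply x hx]
    simp [wedge, c.θ_vecω hc]
  have F_θω : ∀ x ∈ U, ∀ i j k, F i x (c.vecθ j x) (c.vecω k x) =
      (1 / 2) * (β i j x (c.vecω k x) - β j i x (c.vecω k x)) := by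
    intro x hx i j k
    have hc := hf.coframeAt x hx
    rw [F_apply x hx]
    simp [wedge, c.θ_vecω hc, c.om_vecω hc, c.θ_vecθ hc, c.om_vecθ hc, hs']
    ring
  set B : Fin 3 → OneForm M := fun n =>
    ∑ k, fsmul (fun y => (1 / 2) * ∑ i, ∑ j, eps i n j * F i y (c.vecθ j y) (c.vecω k y)) (c.om k) +
    ∑ a, fsmul (fun y => (1 / 2) * ∑ i, ∑ j, eps n i j * F a y (c.vecθ i y) (c.vecθ j y) -
      (if n = a then 1 / 4 else 0) *
        ∑ m, ∑ i, ∑ j, eps m i j * F m y (c.vecθ i y) (c.vecθ j y)) (c.θ a) with hB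
  have B_θ : ∀ x ∈ U, ∀ n a, B n x (c.vecθ a x) =
      (1 / 2) * ∑ i, ∑ j, eps n i j * F a x (c.vecθ i x) (c.vecθ j x) -
      (if n = a then 1 / 4 else 0) *
        ∑ m, ∑ i, ∑ j, eps m i j * F m x (c.vecθ i x) (c.vecθ j x) := by
    intro x hx n a
    have hc := hf.coframeAt x hx
    simp [hB, OneForm.sum_apply, fsmul_apply, c.om_vecθ hc, c.θ_vecθ hc]
  have B_ω : ∀ x ∈ U, ∀ n k, B n x (c.vecω k x) =
      (1 / 2) * ∑ i, ∑ j, eps i n j * F i x (c.vecθ j x) (c.vecω k x) := by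
    intro x hx n a
    have hc := hf.coframeAt x hx
    simp [hB, OneForm.sum_apply, fsmul_apply, c.om_vecω hc, c.θ_vecω hc]
  have F_eq : ∀ x ∈ U, ∀ i v w, F i x v w = -∑ j, ∑ k, eps i k j * wedge (B k) (c.θ j) x v w := by
    intro x hx i
    have hc := hf.coframeAt x hx
    refine (Coframing.isSplitBasis hc).alt_ext (aF i x)
      (.neg (.sum _ fun j => .sum _ fun k => (isAlt_wedge _ _ x).const_mul _)) (fun k l => ?_)
      (fun k l => ?_) (fun k l => ?_)
    · simp only [wedge, c.θ_vecθ hc]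
      exact eq_eps_of_skew (f := fun i k l => F i x (c.vecθ k x) (c.vecθ l x))
        (fun i k l => (aF i x).swap _ _) (B_θ x hx) i k l
    · have := skew_eq_eps (b := fun i j => F i x (c.vecθ j x) (c.vecω l x))
        (fun i k => by simp only [F_θω x hx]; ring) i k
      simp only [wedge, c.θ_vecθ hc, c.θ_vecω hc, B_ω x hx]
      refine this.trans ?_
      simp only [mul_zero, zero_sub, mul_neg, Finset.sum_neg_distrib, neg_neg, mul_ite, mul_one]
      rw [Finset.sum_comm]
      simp only [Finset.sum_ite_eq', Finset.mem_univ, if_true]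
    · simp [wedge, c.θ_vecω hc, F_ωω x hx]
  refine ⟨⟨c, α', B⟩, rfl, h, fun i j => (smoothOneFormOn_iff_smoothAt hU).2 (sα i j), fun n =>
    (smoothOneFormOn_iff_smoothAt hU).2 fun x hx => ?_, fun x hx v w i => ?_, fun x hx v w i => ?_⟩
  · have hX := fun i => hf.vecSmoothAt_vecθ hx i
    have hY := fun i => hf.vecSmoothAt_vecω hx i
    refine .add (.sum fun k _ => .fsmul (.const_mul _ (.sum fun i _ => .sum fun j _ =>
        .const_mul _ (sF i x hx _ _ (hX j) (hY k)))) (hf.smoothAt hx (.inr k)))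
      (.sum fun a _ => .fsmul (.sub (.const_mul _ (.sum fun i _ => .sum fun j _ =>
        .const_mul _ (sF a x hx _ _ (hX i) (hX j)))) (.const_mul _ (.sum fun m _ => .sum fun i _ =>
        .sum fun j _ => .const_mul _ (sF m x hx _ _ (hX i) (hX j))))) (hf.smoothAt hx (.inl a)))
  · change extD (c.θ i) x v w = -∑ k, wedge (α' k k) (c.θ i) x v w +
      ∑ j, wedge (α' j i) (c.θ j) x v w + ∑ j, ∑ k, eps i j k * wedge (c.om j) (c.om k) x v w
    rw [(hs x hx v w i).1]
    have t0 := ts x hx 0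
    have t1 := ts x hx 1
    have t2 := ts x hx 2
    have u0 := fun i => ss 1 0 i x
    have u1 := fun i => ss 2 0 i x
    have u2 := fun i => ss 2 1 i x
    simp only [wedge, α'_apply]
    clear_value s
    simp only [Fin.sum_univ_three, u0, u1, u2] at t0 t1 t2 ⊢
    fin_cases i <;> simp only [Fin.zero_eta, Fin.mk_one, Fin.reduceFinMk]
    · linear_combination (c.θ 1 x v * c.θ 0 x w - c.θ 1 x w * c.θ 0 x v) * t1 +
        (c.θ 2 x v * c.θ 0 x w - c.θ 2 x w * c.θ 0 x v) * t2
    · linear_combination (c.θ 0 x v * c.θ 1 x w - c.θ 0 x w * c.θ 1 x v) * t0 +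
        (c.θ 2 x v * c.θ 1 x w - c.θ 2 x w * c.θ 1 x v) * t2
    · linear_combination (c.θ 1 x v * c.θ 2 x w - c.θ 1 x w * c.θ 2 x v) * t1 +
        (c.θ 0 x v * c.θ 2 x w - c.θ 0 x w * c.θ 2 x v) * t0
  · change extD (c.om i) x v w = -∑ j, ∑ k, eps i k j * wedge (B k) (c.θ j) x v w -
      ∑ j, wedge (α' i j) (c.om j) x v w
    rw [← F_eq x hx, hF, Coframing.structω]
    ring

end ThirdOrder

section ConformalAlgebra

lemma eps_trace_right (a : Fin 3 → Fin 3 → ℝ) (u v : Fin 3 → ℝ) (i : Fin 3) :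
    (∑ k, a k k) * ∑ p, ∑ q, eps i p q * (u p * v q) -
      ∑ j, a j i * ∑ p, ∑ q, eps j p q * (u p * v q) =
    ∑ p, ∑ q, eps i p q * ((∑ r, a p r * u r) * v q + u p * ∑ r, a q r * v r) := by
  fin_cases i <;> simp [Fin.sum_univ_three] <;> ring

lemma eps_trace_left (a : Fin 3 → Fin 3 → ℝ) (j m n : Fin 3) :
    ∑ l, a l j * eps l m n - (∑ k, a k k) * eps j m n =
      -∑ p, (eps j p n * a p m + eps j m p * a p n) := by
  fin_cases j <;> fin_cases m <;> fin_cases n <;> simp [Fin.sum_univ_three] <;> ring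

lemma skew_of_normalized {e : Fin 3 → Fin 3 → ℝ} {w : Fin 3 → Fin 3 → Fin 3 → ℝ}
    (h1 : ∀ i k l, w k i l - w l i k + 2 * ∑ j, e i j * eps j k l = 0)
    (h2 : ∀ s k m n, ∑ r, (eps s r n * w k r m + eps s m r * w k r n) =
      2 * ∑ l, (∑ r, eps s k r * e r l) * eps l m n) (l m : Fin 3) : e l m + e m l = 0 := by
  have h3 : ∀ s k l, (if s = l then ∑ a, w k a a else 0) - w k l s = 2 * ∑ r, eps s k r * e r l := by
    intro s k l
    fin_cases l
    · have := h2 s k 1 2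
      simp [Fin.sum_univ_three] at this ⊢
      fin_cases s <;> simp at this ⊢ <;> linarith
    · have := h2 s k 2 0
      simp [Fin.sum_univ_three] at this ⊢
      fin_cases s <;> simp at this ⊢ <;> linarith
    · have := h2 s k 0 1
      simp [Fin.sum_univ_three] at this ⊢
      fin_cases s <;> simp at this ⊢ <;> linarith
  have h4 : ∀ k l s, w k l s =
      (if s = l then ∑ a, ∑ r, eps a k r * e r a else 0) - 2 * ∑ r, eps s k r * e r l := by
    intro k l s
    have a0 := h3 0 k 0
    have a1 := h3 1 k 1
    have a2 := h3 2 k 2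
    have a3 := h3 s k l
    simp only [Fin.sum_univ_three] at a0 a1 a2 a3 ⊢
    split_ifs at a0 a1 a2 a3 ⊢ <;> linarith
  simp only [h4] at h1
  have b0 := fun i => h1 i 0 1
  have b1 := fun i => h1 i 1 2
  have b2 := fun i => h1 i 2 0
  have c0 := b0 0
  have c1 := b0 1
  have c2 := b0 2
  have d0 := b1 0
  have d1 := b1 1
  have d2 := b1 2
  have e0 := b2 0
  have e1 := b2 1
  have e2 := b2 2
  clear b0 b1 b2 h1 h2 h3 h4
  simp [Fin.sum_univ_three] at c0 c1 c2 d0 d1 d2 e0 e1 e2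
  fin_cases l <;> fin_cases m <;> simp <;> linarith

lemma sum_eps_of_conn {A P E dA dP a a' : Fin 3 → Fin 3 → ℝ} {b : Fin 3 → ℝ}
    (hP : ∀ i m n, ∑ l, P i l * eps l m n = ∑ p, ∑ q, eps i p q * (A p m * A q n))
    (hdP : ∀ i m n, ∑ l, dP i l * eps l m n =
      ∑ p, ∑ q, eps i p q * (dA p m * A q n + A p m * dA q n))
    (h : ∀ i l, dP i l + ∑ j, P i j * (a l j - if j = l then ∑ k, a k k else 0) =
      -(∑ k, a' k k) * P i l + ∑ j, a' j i * P j l + 2 * ∑ p, ∑ q, eps i p q * (b p * E q l))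
    (i m n : Fin 3) : ∑ p, ∑ q, eps i p q *
      ((dA p m - ∑ r, A p r * a r m + ∑ r, a' p r * A r m) * A q n +
      A p m * (dA q n - ∑ r, A q r * a r n + ∑ r, a' q r * A r n)) =
      2 * ∑ l, (∑ p, ∑ q, eps i p q * (b p * E q l)) * eps l m n := by
  have e1 := eps_trace_right a' (fun p => A p m) (fun q => A q n) i
  simp only [← hP] at e1
  have e2 : ∑ p, ∑ q, eps i p q *
      ((∑ r, A p r * a r m) * A q n + A p m * ∑ r, A q r * a r n) =
      ∑ r, (a r m * (∑ p, ∑ q, eps i p q * (A p r * A q n)) +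
        a r n * ∑ p, ∑ q, eps i p q * (A p m * A q r)) := by
    simp only [Fin.sum_univ_three]
    ring
  simp only [← hP] at e2
  have e3 := fun j => eps_trace_left a j m n
  have e4 := fun l => h i l
  have e5 := hdP i m n
  have s0 := e3 0
  have s1 := e3 1
  have s2 := e3 2
  have t0 := e4 0
  have t1 := e4 1
  have t2 := e4 2
  clear e3 e4 h hP hdP
  simp only [Fin.sum_univ_three, Fin.reduceEq, if_true, if_false] at *
  linear_combination -e1 - e2 - e5 - P i 0 * s0 - P i 1 * s1 - P i 2 * s2 + t0 * eps 0 m n +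
    t1 * eps 1 m n + t2 * eps 2 m n

lemma sum_mul_inverse {ι : Type*} [Fintype ι] [DecidableEq ι] {A A' : ι → ι → ℝ}
    (hA : ∀ i j, ∑ k, A i k * A' k j = if i = j then 1 else 0) (f : ι → ℝ) (i : ι) :
    ∑ k, A i k * ∑ j, A' k j * f j = f i := by
  simp only [Finset.mul_sum, ← mul_assoc]
  rw [Finset.sum_comm]
  simp only [← Finset.sum_mul, hA]
  simp

/-- The arrays of two `2`-adapted coframings at a point. -/
lemma skew_of_eps {A A' P P' E : Fin 3 → Fin 3 → ℝ} {W : Fin 3 → Fin 3 → Fin 3 → ℝ}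
    (hA : ∀ i j, ∑ k, A i k * A' k j = if i = j then 1 else 0)
    (hA' : ∀ i j, ∑ k, A' i k * A k j = if i = j then 1 else 0)
    (hP' : ∀ i j, ∑ k, P' i k * P k j = if i = j then 1 else 0)
    (hP : ∀ i m n, ∑ l, P i l * eps l m n = ∑ p, ∑ q, eps i p q * (A p m * A q n))
    (h1 : ∀ i k l, W k i l - W l i k + 2 * ∑ j, E i j * eps j k l = 0)
    (h2 : ∀ i k m n, ∑ p, ∑ q, eps i p q * (W k p m * A q n + A p m * W k q n) =
      2 * ∑ l, (∑ p, ∑ q, eps i p q * (A p k * E q l)) * eps l m n) :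
    ∃ r : ℝ, (∀ l m, ∑ i, P i l * A i m = if l = m then r else 0) ∧
      ∀ l m, ∑ i, (P i l * E i m + P i m * E i l) = 0 := by
  obtain ⟨r, hr⟩ : ∃ r, ∀ l m, ∑ i, P i l * A i m = if l = m then r else 0 := by
    refine ⟨∑ i, P i 0 * A i 0, fun l m => ?_⟩
    have p0 := fun i => hP i 1 2
    have p1 := fun i => hP i 2 0
    have p2 := fun i => hP i 0 1
    simp [Fin.sum_univ_three] at p0 p1 p2
    fin_cases l <;> fin_cases m <;> simp [Fin.sum_univ_three, p0, p1, p2] <;> ring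
  refine ⟨_, hr, fun l m => ?_⟩
  set w : Fin 3 → Fin 3 → Fin 3 → ℝ := fun k r m => ∑ i, A' r i * W k i m with hw
  set e : Fin 3 → Fin 3 → ℝ := fun r l => ∑ i, A' r i * E i l with he
  have hW : ∀ k p m, W k p m = ∑ r, A p r * w k r m := fun k p m =>
    (sum_mul_inverse hA (fun i => W k i m) p).symm
  have hE : ∀ p l, E p l = ∑ r, A p r * e r l := fun p l =>
    (sum_mul_inverse hA (fun i => E i l) p).symm
  clear_value w e
  set Q : Fin 3 → Fin 3 → Fin 3 → ℝ := fun i a b => ∑ p, ∑ q, eps i p q * (A p a * A q b) with hQ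
  have hPQ : ∀ s a b, ∑ i, P' s i * Q i a b = eps s a b := by
    intro s a b
    simp only [hQ, ← hP]
    exact sum_mul_inverse hP' (fun l => eps l a b) s
  have key := skew_of_normalized (e := e) (w := w) (fun i k l => ?_) (fun s k m n => ?_) l m
  · calc _ = (∑ i, P i l * A i 0) * e 0 m + (∑ i, P i l * A i 1) * e 1 m +
          (∑ i, P i l * A i 2) * e 2 m + (∑ i, P i m * A i 0) * e 0 l +
          (∑ i, P i m * A i 1) * e 1 l + (∑ i, P i m * A i 2) * e 2 l := by
          simp only [hE, Fin.sum_univ_three]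
          ring
      _ = r * (e l m + e m l) := by
          simp only [hr]
          fin_cases l <;> fin_cases m <;> simp <;> ring
      _ = 0 := by rw [key, mul_zero]
  · have f : ∀ i, ∑ r, A i r * (w k r l - w l r k + 2 * ∑ j, e r j * eps j k l) = 0 := by
      intro i
      rw [← h1 i k l]
      simp only [hW, hE, Fin.sum_univ_three]
      ring
    rw [← sum_mul_inverse hA' (fun r => w k r l - w l r k + 2 * ∑ j, e r j * eps j k l) i]
    simp only [f, mul_zero, Finset.sum_const_zero]
  · have f : ∀ i, ∑ r, (Q i r n * w k r m + Q i m r * w k r n) =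
        2 * ∑ l, (∑ r, Q i k r * e r l) * eps l m n := by
      intro i
      have := h2 i k m n
      simp only [hW, hE] at this
      simp only [hQ]
      simp only [Fin.sum_univ_three] at this ⊢
      linear_combination this
    simp only [← hPQ s]
    have f0 := f 0
    have f1 := f 1
    have f2 := f 2
    simp only [Fin.sum_univ_three] at *
    linear_combination P' s 0 * f0 + P' s 1 * f1 + P' s 2 * f2

end ConformalAlgebra

section Diff

variable {f g : M → ℝ}

lemma diff_congr {f g : M → ℝ} (h : ∀ᶠ y in nhds x, f y = g y) (v : 𝕋 x) :
    diff f x v = diff g x v := by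
  have h' : f =ᶠ[nhds x] g := h
  have := h'.mfderiv_eq (I := 𝓡 6) (I' := 𝓘(ℝ, ℝ))
  exact DFunLike.congr_fun this v

lemma diff_const (a : ℝ) (v : 𝕋 x) : diff (fun _ : M => a) x v = 0 := by
  rw [(FunSmoothAt.const a).diff_apply]
  simp [Function.comp_def]

lemma FunSmoothAt.differentiableAt (hf : FunSmoothAt f x) :
    DifferentiableAt ℝ (f ∘ (𝒞 x).symm) (𝒞 x x) :=
  ContDiffAt.differentiableAt hf (by simp)

lemma FunSmoothAt.diff_add (hf : FunSmoothAt f x) (hg : FunSmoothAt g x)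
    (v : 𝕋 x) : diff (fun y => f y + g y) x v = diff f x v + diff g x v := by
  rw [(hf.add hg).diff_apply, hf.diff_apply, hg.diff_apply]
  exact DFunLike.congr_fun (fderiv_add hf.differentiableAt hg.differentiableAt) _

lemma FunSmoothAt.diff_mul (hf : FunSmoothAt f x) (hg : FunSmoothAt g x)
    (v : 𝕋 x) :
    diff (fun y => f y * g y) x v = diff f x v * g x + f x * diff g x v := by
  rw [(hf.mul hg).diff_apply, hf.diff_apply, hg.diff_apply]
  refine (DFunLike.congr_fun (fderiv_mul hf.differentiableAt hg.differentiableAt) _).trans ?_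
  simp
  ring

lemma FunSmoothAt.diff_const_mul (a : ℝ) (hf : FunSmoothAt f x) (v : 𝕋 x) :
    diff (fun y => a * f y) x v = a * diff f x v := by
  rw [(FunSmoothAt.const a).diff_mul hf, diff_const]
  ring

lemma FunSmoothAt.diff_sum {κ : Type*} {s : Finset κ} {f : κ → M → ℝ}
    (h : ∀ i, FunSmoothAt (f i) x) (v : 𝕋 x) :
    diff (fun y => ∑ i ∈ s, f i y) x v = ∑ i ∈ s, diff (f i) x v := by
  classical
  induction s using Finset.induction_on with
  | empty => simpa using diff_const 0 v
  | insert i s hi ih =>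
    simp only [Finset.sum_insert hi]
    rw [(h i).diff_add (.sum fun j _ => h j), ih]

end Diff

section ConformalStructure

variable {V : Set M} {c c' : Coframing M}

lemma IsNondegenerate.finrank_eq (hD : IsNondegenerate D) (x : M) : Module.finrank ℝ (D x) = 3 := by
  obtain ⟨U, -, hx, X, -, h⟩ := hD x
  rw [(h x hx).1]
  have := (h x hx).2.comp ![0, 1, 2] (by decide)
  refine (finrank_span_eq_card (b := fun i => X i x) ?_).trans (by simp)
  convert this using 1
  ext1 i
  fin_cases i <;> rfl

lemma IsOneAdapted.mem_iff (hD : IsNondegenerate D) (h : IsOneAdapted D U c) (hx : x ∈ U)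
    (v : 𝕋 x) : v ∈ D x ↔ ∀ i, c.θ i x v = 0 := by
  have hc := h.isCoframe.coframeAt x hx
  refine ⟨fun hv i => h.annihilates x hx i v hv, fun hv => ?_⟩
  have hle : D x ≤ Submodule.span ℝ (Set.range fun i => c.vecω i x) := by
    intro w hw
    have := (Coframing.isSplitBasis hc).expand w
    simp only [ContinuousLinearMap.coe_coe, h.annihilates x hx _ w hw, zero_smul,
      Finset.sum_const_zero, zero_add] at this
    rw [this]
    exact Submodule.sum_mem _ fun i _ => Submodule.smul_mem _ _ (Submodule.subset_span ⟨i, rfl⟩)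
  have hfin : Module.finrank ℝ (Submodule.span ℝ (Set.range fun i => c.vecω i x)) ≤
      Module.finrank ℝ (D x) := by
    rw [hD.finrank_eq]
    exact (finrank_range_le_card _).trans (by simp)
  haveI : FiniteDimensional ℝ (𝕋 x) := inferInstanceAs (FiniteDimensional ℝ E6)
  rw [Submodule.eq_of_le_of_finrank_le hle hfin]
  have := (Coframing.isSplitBasis hc).expand v
  simp only [ContinuousLinearMap.coe_coe, hv, zero_smul, Finset.sum_const_zero, zero_add] at this
  rw [this]
  exact Submodule.sum_mem _ fun i _ => Submodule.smul_mem _ _ (Submodule.subset_span ⟨i, rfl⟩)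

lemma IsOneAdapted.mono (h : IsOneAdapted D U c) (hV : IsOpen V) (hVU : V ⊆ U) :
    IsOneAdapted D V c where
  isOpen := hV
  smooth_θ i := (h.smooth_θ i).mono hVU
  smooth_om i := (h.smooth_om i).mono hVU
  bijective x hx := h.bijective x (hVU hx)
  annihilates x hx := h.annihilates x (hVU hx)
  extD_θ x hx := h.extD_θ x (hVU hx)

lemma IsTwoAdapted.mono (h : IsTwoAdapted D U c) (hV : IsOpen V) (hVU : V ⊆ U) :
    IsTwoAdapted D V c where
  toIsOneAdapted := h.toIsOneAdapted.mono hV hVU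
  exists_pseudoConnection := by
    obtain ⟨α, β, h1, h2, h3⟩ := h.exists_pseudoConnection
    exact ⟨α, β, fun i j => (h1 i j).mono hVU, fun i j => (h2 i j).mono hVU,
      fun x hx => h3 x (hVU hx)⟩

lemma Coframing.form_apply (h : CoframeAt c.form x) (α : 𝕋 x →L[ℝ] ℝ)
    (v : 𝕋 x) :
    α v = ∑ i, α (c.vecθ i x) * c.θ i x v + ∑ i, α (c.vecω i x) * c.om i x v := by
  refine (h.covector_apply (α : 𝕋 x →ₗ[ℝ] ℝ) v).trans ?_
  rw [Fintype.sum_sum_type]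
  rfl

lemma Coframing.metric_apply (c : Coframing M) (v w : 𝕋 x) :
    c.metric x v w = ∑ i, (c.θ i x v * c.om i x w + c.om i x v * c.θ i x w) := by
  simp only [metric, Finset.sum_apply, ContinuousLinearMap.sum_apply]
  rfl

/-- Any two `2`-adapted coframings induce the same conformal structure. -/
theorem IsTwoAdapted.metric_eq (hD : IsNondegenerate D) (h : IsTwoAdapted D V c)
    (h' : IsTwoAdapted D V c') (hx : x ∈ V) :
    ∃ r : ℝ, ∀ v w, c'.metric x v w = r * c.metric x v w := by
  have hV := h.isOpen
  obtain ⟨a, b, sa, sb, hab⟩ := h.exists_pseudoConnection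
  obtain ⟨a', b', sa', sb', hab'⟩ := h'.exists_pseudoConnection
  have f := h.toIsOneAdapted.isCoframe
  have f' := h'.toIsOneAdapted.isCoframe
  have hc := f.coframeAt x hx
  have hc' := f'.coframeAt x hx
  have hz : ∀ y ∈ V, ∀ i j, c'.θ i y (c.vecω j y) = 0 := fun y hy i j =>
    (h'.toIsOneAdapted.mem_iff hD hy _).1 ((h.toIsOneAdapted.mem_iff hD hy _).2
      fun k => c.θ_vecω (f.coframeAt y hy) k j) i
  have hz' : ∀ i j, c.θ i x (c'.vecω j x) = 0 := fun i j =>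
    (h.toIsOneAdapted.mem_iff hD hx _).1 ((h'.toIsOneAdapted.mem_iff hD hx _).2
      fun k => c'.θ_vecω hc' k j) i
  set A : Fin 3 → Fin 3 → M → ℝ := fun i j y => c'.om i y (c.vecω j y) with hA
  set P : Fin 3 → Fin 3 → M → ℝ := fun i j y => c'.θ i y (c.vecθ j y) with hP
  set E : Fin 3 → Fin 3 → M → ℝ := fun i j y => c'.om i y (c.vecθ j y) with hE
  have sA : ∀ i j, ∀ y ∈ V, FunSmoothAt (A i j) y := fun i j y hy =>
    (f'.smoothAt hy (.inr i)).apply (f.vecSmoothAt_vecω hy j)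
  have sP : ∀ i j, ∀ y ∈ V, FunSmoothAt (P i j) y := fun i j y hy =>
    (f'.smoothAt hy (.inl i)).apply (f.vecSmoothAt_vecθ hy j)
  have sE : ∀ i j, ∀ y ∈ V, FunSmoothAt (E i j) y := fun i j y hy =>
    (f'.smoothAt hy (.inr i)).apply (f.vecSmoothAt_vecθ hy j)
  have sθ : ∀ i, ∀ y ∈ V, (c.θ i).SmoothAt y := fun i y hy => f.smoothAt hy (.inl i)
  have sω : ∀ i, ∀ y ∈ V, (c.om i).SmoothAt y := fun i y hy => f.smoothAt hy (.inr i)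
  have θ'_apply : ∀ y ∈ V, ∀ i v, c'.θ i y v = ∑ l, P i l y * c.θ l y v := by
    intro y hy i v
    rw [Coframing.form_apply (f.coframeAt y hy) (c'.θ i y) v]
    simp [hz y hy, hP]
  have ω'_apply : ∀ y ∈ V, ∀ i v, c'.om i y v = ∑ l, E i l y * c.θ l y v +
      ∑ l, A i l y * c.om l y v := fun y hy i v =>
    Coframing.form_apply (f.coframeAt y hy) (c'.om i y) v
  have dθ' : ∀ y ∈ V, ∀ i v w, extD (c'.θ i) y v w = ∑ l, (diff (P i l) y v * c.θ l y w -
      diff (P i l) y w * c.θ l y v + P i l y * extD (c.θ l) y v w) := by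
    intro y hy i v w
    have e : ∀ᶠ z in nhds y, c'.θ i z = (∑ l, fsmul (P i l) (c.θ l)) z := by
      filter_upwards [hV.mem_nhds hy] with z hz
      ext v
      rw [OneForm.sum_apply, θ'_apply z hz]
      rfl
    rw [extD_congr e, extD_sum _ fun l _ => .fsmul (sP i l y hy) (sθ l y hy)]
    exact Finset.sum_congr rfl fun l _ => extD_fsmul (sP i l y hy) (sθ l y hy) v w
  have dω' : ∀ y ∈ V, ∀ i v w, extD (c'.om i) y v w = ∑ l, (diff (E i l) y v * c.θ l y w -
      diff (E i l) y w * c.θ l y v + E i l y * extD (c.θ l) y v w) + ∑ l, (diff (A i l) y v *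
      c.om l y w - diff (A i l) y w * c.om l y v + A i l y * extD (c.om l) y v w) := by
    intro y hy i v w
    have e : ∀ᶠ z in nhds y, c'.om i z =
        (∑ l, fsmul (E i l) (c.θ l) + ∑ l, fsmul (A i l) (c.om l) : OneForm M) z := by
      filter_upwards [hV.mem_nhds hy] with z hz
      ext v
      rw [Pi.add_apply, add_apply, OneForm.sum_apply, OneForm.sum_apply, ω'_apply z hz]
      rfl
    rw [extD_congr e, extD_add (.sum fun l _ => .fsmul (sE i l y hy) (sθ l y hy))
      (.sum fun l _ => .fsmul (sA i l y hy) (sω l y hy)),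
      extD_sum _ fun l _ => .fsmul (sE i l y hy) (sθ l y hy),
      extD_sum _ fun l _ => .fsmul (sA i l y hy) (sω l y hy)]
    exact congrArg₂ _ (Finset.sum_congr rfl fun l _ => extD_fsmul (sE i l y hy) (sθ l y hy) v w)
      (Finset.sum_congr rfl fun l _ => extD_fsmul (sA i l y hy) (sω l y hy) v w)
  have hPA : ∀ y ∈ V, ∀ i m n, ∑ l, P i l y * eps l m n =
      ∑ p, ∑ q, eps i p q * (A p m y * A q n y) := by
    intro y hy i m n
    have hcy := f.coframeAt y hy
    have e1 := dθ' y hy i (c.vecω m y) (c.vecω n y)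
    rw [h'.extD_θ y hy _ _ (fun l => hz y hy l m) (fun l => hz y hy l n)] at e1
    simp only [c.θ_vecω hcy, h.toIsOneAdapted.extD_vecω hy, wedge] at e1
    change ∑ j, ∑ k, eps i j k * (A j m y * A k n y - A j n y * A k m y) = _ at e1
    have e2 : ∑ j, ∑ k, eps i j k * (A j m y * A k n y - A j n y * A k m y) =
        2 * ∑ p, ∑ q, eps i p q * (A p m y * A q n y) := by
      fin_cases i <;> simp [Fin.sum_univ_three] <;> ring
    have e3 : ∑ l, (diff (P i l) y (c.vecω m y) * 0 - diff (P i l) y (c.vecω n y) * 0 +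
        P i l y * (2 * eps l m n)) = 2 * ∑ l, P i l y * eps l m n := by
      rw [Finset.mul_sum]
      exact Finset.sum_congr rfl fun l _ => by ring
    linarith
  have hdP : ∀ v i m n, ∑ l, diff (P i l) x v * eps l m n =
      ∑ p, ∑ q, eps i p q * (diff (A p m) x v * A q n x + A p m x * diff (A q n) x v) := by
    intro v i m n
    have e := diff_congr (x := x) (Filter.mem_of_superset (hV.mem_nhds hx) fun y hy =>
      hPA y hy i m n) v
    rw [FunSmoothAt.diff_sum fun l => (sP i l x hx).mul (.const _), FunSmoothAt.diff_sum fun p =>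
      .sum fun q _ => .const_mul _ ((sA p m x hx).mul (sA q n x hx))] at e
    refine Eq.trans (Finset.sum_congr rfl fun l _ => ?_) (e.trans (Finset.sum_congr rfl fun p _ => ?_))
    · rw [(sP i l x hx).diff_mul (.const _), diff_const]
      ring
    · rw [FunSmoothAt.diff_sum fun q => .const_mul _ ((sA p m x hx).mul (sA q n x hx))]
      refine Finset.sum_congr rfl fun q _ => ?_
      rw [FunSmoothAt.diff_const_mul _ ((sA p m x hx).mul (sA q n x hx)),
        (sA p m x hx).diff_mul (sA q n x hx)]
  have gA : ∀ i j, ∑ k, A i k x * c.om k x (c'.vecω j x) = if i = j then 1 else 0 := by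
    intro i j
    have := ω'_apply x hx i (c'.vecω j x)
    simp only [hz', mul_zero, Finset.sum_const_zero, zero_add] at this
    rw [← this, c'.om_vecω hc']
  have gA' : ∀ i j, ∑ k, c.om i x (c'.vecω k x) * A k j x = if i = j then 1 else 0 := by
    intro i j
    have := Coframing.form_apply hc' (c.om i x) (c.vecω j x)
    simp only [hz x hx, mul_zero, Finset.sum_const_zero, zero_add] at this
    rw [← c.om_vecω hc i j, this]
  have gP' : ∀ i j, ∑ k, c.θ i x (c'.vecθ k x) * P k j x = if i = j then 1 else 0 := by
    intro i j
    have := Coframing.form_apply hc' (c.θ i x) (c.vecθ j x)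
    simp only [hz', zero_mul, Finset.sum_const_zero, add_zero] at this
    rw [← c.θ_vecθ hc i j, this]
  set W : Fin 3 → Fin 3 → Fin 3 → ℝ := fun k p m => diff (A p m) x (c.vecω k x) -
    ∑ r, A p r x * a r m x (c.vecω k x) + ∑ r, a' p r x (c.vecω k x) * A r m x with hW
  have g1 : ∀ i k l, W k i l - W l i k + 2 * ∑ j, E i j x * eps j k l = 0 := by
    intro i k l
    have e1 := dω' x hx i (c.vecω k x) (c.vecω l x)
    rw [(hab' x hx _ _ i).2] at e1
    simp only [(hab x hx _ _ _).2, wedge, hz x hx, c.θ_vecω hc, c.om_vecω hc,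
      h.toIsOneAdapted.extD_vecω hx] at e1
    change -∑ j, (b' i j x (c.vecω k x) * 0 - b' i j x (c.vecω l x) * 0) -
      ∑ j, (a' i j x (c.vecω k x) * A j l x - a' i j x (c.vecω l x) * A j k x) = _ at e1
    simp only [hW]
    simp [Finset.sum_sub_distrib, Finset.sum_add_distrib, mul_sub, mul_neg] at e1 ⊢
    simp only [Fin.sum_univ_three] at e1 ⊢
    linear_combination -e1
  have g2 : ∀ i k m n, ∑ p, ∑ q, eps i p q * (W k p m * A q n x + A p m x * W k q n) =
      2 * ∑ l, (∑ p, ∑ q, eps i p q * (A p k x * E q l x)) * eps l m n := by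
    intro i k m n
    refine sum_eps_of_conn (a := fun r m => a r m x (c.vecω k x))
      (a' := fun r m => a' r m x (c.vecω k x)) (dP := fun i l => diff (P i l) x (c.vecω k x))
      (P := fun i j => P i j x) (hPA x hx) (hdP _) (fun i l => ?_) i m n
    have e1 := dθ' x hx i (c.vecω k x) (c.vecθ l x)
    rw [(hab' x hx _ _ i).1] at e1
    simp only [(hab x hx _ _ _).1, wedge, hz x hx, c.θ_vecω hc, c.om_vecω hc, c.θ_vecθ hc,
      c.om_vecθ hc] at e1
    change -∑ k', (a' k' k' x (c.vecω k x) * P i l x - a' k' k' x (c.vecθ l x) * 0) +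
      ∑ j, (a' j i x (c.vecω k x) * P j l x - a' j i x (c.vecθ l x) * 0) + ∑ p, ∑ q, eps i p q *
      (A p k x * E q l x - E p l x * A q k x) = _ at e1
    have e2 : ∑ p, ∑ q, eps i p q * (A p k x * E q l x - E p l x * A q k x) =
        2 * ∑ p, ∑ q, eps i p q * (A p k x * E q l x) := by
      fin_cases i <;> simp [Fin.sum_univ_three] <;> ring
    rw [e2] at e1
    simp [Finset.sum_sub_distrib, Finset.sum_add_distrib, mul_sub, mul_add, ← Finset.sum_mul]
      at e1 ⊢
    linear_combination -e1
  obtain ⟨r, h1, h2⟩ := skew_of_eps gA gA' gP' (hPA x hx) g1 g2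
  refine ⟨r, fun v w => ?_⟩
  rw [c'.metric_apply, c.metric_apply]
  simp only [θ'_apply x hx, ω'_apply x hx]
  have h00 := h1 0 0
  have h01 := h1 0 1
  have h02 := h1 0 2
  have h10 := h1 1 0
  have h11 := h1 1 1
  have h12 := h1 1 2
  have h20 := h1 2 0
  have h21 := h1 2 1
  have h22 := h1 2 2
  have k00 := h2 0 0
  have k01 := h2 0 1
  have k02 := h2 0 2
  have k11 := h2 1 1
  have k12 := h2 1 2
  have k22 := h2 2 2
  clear h1 h2
  clear_value A P E
  simp only [Fin.sum_univ_three, Fin.reduceEq, if_true, if_false] at h00 h01 h02 h10 h11 h12 h20 h21 h22 k00 k01 k02 k11 k12 k22 ⊢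
  linear_combination (c.θ 0 x v * c.om 0 x w + c.om 0 x v * c.θ 0 x w) * h00 +
    (c.θ 0 x v * c.om 1 x w + c.om 1 x v * c.θ 0 x w) * h01 +
    (c.θ 0 x v * c.om 2 x w + c.om 2 x v * c.θ 0 x w) * h02 +
    (c.θ 1 x v * c.om 0 x w + c.om 0 x v * c.θ 1 x w) * h10 +
    (c.θ 1 x v * c.om 1 x w + c.om 1 x v * c.θ 1 x w) * h11 +
    (c.θ 1 x v * c.om 2 x w + c.om 2 x v * c.θ 1 x w) * h12 +
    (c.θ 2 x v * c.om 0 x w + c.om 0 x v * c.θ 2 x w) * h20 +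
    (c.θ 2 x v * c.om 1 x w + c.om 1 x v * c.θ 2 x w) * h21 +
    (c.θ 2 x v * c.om 2 x w + c.om 2 x v * c.θ 2 x w) * h22 +
    c.θ 0 x v * c.θ 0 x w * k00 + c.θ 1 x v * c.θ 1 x w * k11 + c.θ 2 x v * c.θ 2 x w * k22 +
    (c.θ 0 x v * c.θ 1 x w + c.θ 1 x v * c.θ 0 x w) * k01 +
    (c.θ 0 x v * c.θ 2 x w + c.θ 2 x v * c.θ 0 x w) * k02 +
    (c.θ 1 x v * c.θ 2 x w + c.θ 2 x v * c.θ 1 x w) * k12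

set_option synthInstance.maxHeartbeats 400000 in
/-- The metric of a `2`-adapted coframing represents the conformal structure. -/
theorem IsTwoAdapted.representsConformal (hD : IsNondegenerate D) (h : IsTwoAdapted D U c) :
    RepresentsConformal D U c.metric where
  isOpen := h.isOpen
  smooth := by
    have e : ∀ i ∈ Finset.univ, SmoothBilinOn U (symProd (c.θ i) (c.om i)) := fun i _ =>
      smoothBilinOn_symProd h.isOpen (h.smooth_θ i) (h.smooth_om i)
    have := ContMDiffOn.sum_section e
    simpa only [SmoothBilinOn, Coframing.metric, Finset.sum_apply] using this
  symm x hx v w := by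
    rw [c.metric_apply, c.metric_apply]
    exact Finset.sum_congr rfl fun i _ => by ring
  nondegenerate x hx v hv := by
    have hc := h.toIsOneAdapted.isCoframe.coframeAt x hx
    have h1 := fun i => hv (c.vecθ i x)
    have h2 := fun i => hv (c.vecω i x)
    simp only [c.metric_apply, c.θ_vecθ hc, c.θ_vecω hc, c.om_vecθ hc, c.om_vecω hc] at h1 h2
    refine hc.ext ?_
    rintro (i | i)
    · simpa [Coframing.form] using h2 i
    · simpa [Coframing.form] using h1 i
  multiple V hV c' h' x hx := h'.metric_eq hD (h.mono h'.isOpen hV) hx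

end ConformalStructure

section Rank

/-- Arrays with the symmetries of the curvature components, without trace conditions. -/
abbrev SymCurvArray : Type :=
  (Sym2 (Fin 3) → Sym2 (Fin 3) → ℝ) × (Fin 3 → Sym2 (Fin 3) → ℝ) × (Sym2 (Fin 3) → ℝ)

/-- The symmetric arrays as arrays. -/
def SymCurvArray.toCurvArray : SymCurvArray →ₗ[ℝ] CurvArray where
  toFun S := (fun i k j l => S.1 s(i, k) s(j, l), fun i j k => S.2.1 i s(j, k),
    fun i j => S.2.2 s(i, j))
  map_add' _ _ := rfl
  map_smul' _ _ := rfl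

/-- The traces of a symmetric array. -/
def SymCurvArray.traces : SymCurvArray →ₗ[ℝ] (Fin 3 → Fin 3 → ℝ) × (Fin 3 → ℝ) where
  toFun S := (fun k l => ∑ i, S.1 s(i, k) s(i, l), fun k => ∑ i, S.2.1 i s(i, k))
  map_add' _ _ := by
    ext <;> simp [Finset.sum_add_distrib]
  map_smul' _ _ := by
    ext <;> simp [Finset.mul_sum]

lemma SymCurvArray.toCurvArray_injective : Function.Injective toCurvArray := by
  intro S T h
  have h1 : ∀ i k j l, S.1 s(i, k) s(j, l) = T.1 s(i, k) s(j, l) := fun i k j l =>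
    congrFun (congrFun (congrFun (congrFun (congrArg Prod.fst h) i) k) j) l
  have h2 : ∀ i j k, S.2.1 i s(j, k) = T.2.1 i s(j, k) := fun i j k =>
    congrFun (congrFun (congrFun (congrArg (fun S => S.2.1) h) i) j) k
  have h3 : ∀ j k, S.2.2 s(j, k) = T.2.2 s(j, k) := fun j k =>
    congrFun (congrFun (congrArg (fun S => S.2.2) h) j) k
  refine Prod.ext (funext fun p => funext fun q => ?_) (Prod.ext (funext fun i => funext fun p => ?_)
    (funext fun p => ?_))
  · induction p using Sym2.ind with | _ i k => induction q using Sym2.ind with | _ j l => exact h1 ..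
  · induction p using Sym2.ind with | _ j k => exact h2 ..
  · induction p using Sym2.ind with | _ j k => exact h3 ..

lemma curvComponents_eq_map :
    curvComponents = (LinearMap.ker SymCurvArray.traces).map SymCurvArray.toCurvArray := by
  ext S
  constructor
  · rintro ⟨h1, h2, h3, h4, h5, h6⟩
    refine ⟨(fun p q => Sym2.lift ⟨fun i k => Sym2.lift ⟨fun j l => S.1 i k j l, h2 i k⟩ q,
      fun i k => by simp only [h1 i k]⟩ p, fun i => Sym2.lift ⟨fun j k => S.2.1 i j k, h4 i⟩,
      Sym2.lift ⟨fun i j => S.2.2 i j, h6⟩), ?_, rfl⟩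
    exact Prod.ext (funext fun k => funext fun l => h3 k l) (funext fun k => h5 k)
  · rintro ⟨S, hS, rfl⟩
    have t1 : ∀ k l, ∑ i, S.1 s(i, k) s(i, l) = 0 := fun k l =>
      congrFun (congrFun (congrArg Prod.fst hS) k) l
    have t2 : ∀ k, ∑ i, S.2.1 i s(i, k) = 0 := fun k => congrFun (congrArg Prod.snd hS) k
    refine ⟨fun i k j l => ?_, fun i k j l => ?_, t1, fun i j k => ?_, t2, fun i j => ?_⟩
    all_goals simp only [SymCurvArray.toCurvArray, LinearMap.coe_mk, AddHom.coe_mk]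
    · rw [Sym2.eq_swap]
    · rw [Sym2.eq_swap (a := j)]
    · rw [Sym2.eq_swap]
    · rw [Sym2.eq_swap]

lemma SymCurvArray.traces_surjective : Function.Surjective traces := by
  rintro ⟨t, u⟩
  let δ : Fin 3 → Fin 3 → ℝ := fun i j => if i = j then 1 else 0
  let f : Fin 3 → Fin 3 → Fin 3 → Fin 3 → ℝ := fun i k j l =>
    (1 / 5) * (δ i j * t k l + δ k j * t i l + δ i l * t k j + δ k l * t i j) -
      (1 / 20) * (∑ m, t m m) * (δ i j * δ k l + δ i l * δ k j)
  let g : Fin 3 → Fin 3 → Fin 3 → ℝ := fun i j k => (1 / 4) * (δ i j * u k + δ i k * u j)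
  refine ⟨(fun p q => Sym2.lift ⟨fun i k => Sym2.lift ⟨fun j l => f i k j l, fun j l => ?_⟩ q,
    fun i k => ?_⟩ p, fun i => Sym2.lift ⟨fun j k => g i j k, fun j k => ?_⟩, 0), ?_⟩
  · simp only [f]; ring
  · induction q using Sym2.ind with | _ j l => simp only [Sym2.lift_mk, f]; ring
  · simp only [g]; ring
  · refine Prod.ext (funext fun k => funext fun l => ?_) (funext fun k => ?_)
    · change ∑ i, f i k i l = t k l
      simp only [f, δ]
      fin_cases k <;> fin_cases l <;> simp [Fin.sum_univ_three] <;> ring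
    · change ∑ i, g i i k = u k
      simp only [g, δ]
      fin_cases k <;> simp [Fin.sum_univ_three] <;> ring

lemma finrank_curvComponents : Module.finrank ℝ curvComponents = 48 := by
  have h1 : Module.finrank ℝ (LinearMap.ker SymCurvArray.traces) =
      Module.finrank ℝ curvComponents := by
    rw [curvComponents_eq_map]
    exact (Submodule.equivMapOfInjective SymCurvArray.toCurvArray
      SymCurvArray.toCurvArray_injective _).finrank_eq
  have h2 := LinearMap.finrank_range_add_finrank_ker SymCurvArray.traces
  have h3 : Fintype.card (Sym2 (Fin 3)) = 6 := by decide
  rw [LinearMap.range_eq_top.2 SymCurvArray.traces_surjective, finrank_top] at h2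
  simp [Module.finrank_prod, Module.finrank_pi_fintype, h3] at h2
  omega

lemma extTensor_injective : Function.Injective extTensor := by
  intro S T h
  have hA : ∀ a b i j, curvA S a b i j = curvA T a b i j := fun a b i j =>
    congrFun (congrFun (congrFun (congrFun h a) b) (.inr i)) (.inr j)
  have hB' : ∀ a b i j, ∑ k, eps i k j * curvB S a b k = ∑ k, eps i k j * curvB T a b k :=
    fun a b i j => congrFun (congrFun (congrFun (congrFun h a) b) (.inr i)) (.inl j)
  have hB : ∀ a b k, curvB S a b k = curvB T a b k := by
    intro a b k
    have := hB' a b (k + 2) (k + 1)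
    fin_cases k <;> simpa [Fin.sum_univ_three] using this
  refine Prod.ext ?_ (Prod.ext ?_ ?_)
  · ext i k j l
    have := hA (Pi.single (.inl k) 1) (Pi.single (.inr l) 1) i j
    rwa [curvA_inl_inr, curvA_inl_inr] at this
  · ext k i l
    have := hB (Pi.single (.inl k) 1) (Pi.single (.inr l) 1) i
    rw [curvB_inl_inr, curvB_inl_inr] at this
    linarith
  · ext i j
    have := hB (Pi.single (.inl (j + 1)) 1) (Pi.single (.inl (j + 2)) 1) i
    rw [curvB_inl_inl, curvB_inl_inl] at this
    fin_cases j <;> simpa [Fin.sum_univ_three] using this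

theorem finrank_extTensorSpace : Module.finrank ℝ extTensorSpace = 48 := by
  rw [extTensorSpace, ← finrank_curvComponents]
  exact (Submodule.equivMapOfInjective extTensor extTensor_injective _).finrank_eq.symm

end Rank

section Invariance

open Matrix

lemma IsAlt.eq_sum_sum {ι : Type*} [Fintype ι] [DecidableEq ι] {F : (ι → ℝ) → (ι → ℝ) → ℝ}
    (h : IsAlt F) (a b : ι → ℝ) :
    F a b = ∑ p, ∑ q, a p * b q * F (Pi.single p 1) (Pi.single q 1) := by
  obtain ⟨B, -, hB⟩ := h
  have e : ∀ a : ι → ℝ, a = ∑ p, a p • (Pi.single p 1 : ι → ℝ) := fun a => by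
    ext q; simp [Finset.sum_apply, Pi.single_apply]
  simp only [hB]
  conv_lhs => rw [e a, e b]
  simp only [map_sum, map_smul, LinearMap.sum_apply, LinearMap.smul_apply, smul_eq_mul, mul_assoc]
  rw [Finset.sum_comm]
  exact Finset.sum_congr rfl fun p _ => by
    rw [Finset.mul_sum]
    exact Finset.sum_congr rfl fun q _ => by ring

lemma IsAlt.comp {V W : Type*} [AddCommGroup V] [Module ℝ V] [AddCommGroup W] [Module ℝ W]
    {F : W → W → ℝ} (h : IsAlt F) (f : V →ₗ[ℝ] W) : IsAlt fun v w => F (f v) (f w) := by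
  obtain ⟨B, h1, h2⟩ := h
  exact ⟨B.compl₁₂ f f, fun v => h1 _, fun v w => h2 _ _⟩

lemma IsAlt.eq_zero_of_trilinear {ι : Type*} [Fintype ι] [DecidableEq ι]
    {F : (ι → ℝ) → (ι → ℝ) → Matrix ι ι ℝ} (h : ∀ s q, IsAlt fun a b => F a b s q)
    (hF : ∀ s p q r, F (Pi.single p 1) (Pi.single q 1) s r + F (Pi.single q 1) (Pi.single r 1) s p +
      F (Pi.single r 1) (Pi.single p 1) s q = 0) (a b c : ι → ℝ) :
    F a b *ᵥ c + F b c *ᵥ a + F c a *ᵥ b = 0 := by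
  ext s
  have rot : ∀ f : ι → ι → ι → ℝ, ∑ x, ∑ y, ∑ z, f x y z = ∑ x, ∑ y, ∑ z, f y z x := fun f => by
    rw [Finset.sum_comm_cycle]
  have e : ∀ a b c : ι → ℝ, (F a b *ᵥ c) s = ∑ p, ∑ q, ∑ r, a p * b q * c r *
      F (Pi.single p 1) (Pi.single q 1) s r := fun a b c => by
    simp only [mulVec, dotProduct]
    rw [rot]
    refine Finset.sum_congr rfl fun r _ => ?_
    rw [(h s r).eq_sum_sum a b, Finset.sum_mul]
    refine Finset.sum_congr rfl fun p _ => ?_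
    rw [Finset.sum_mul]
    exact Finset.sum_congr rfl fun q _ => by ring
  simp only [Pi.add_apply, Pi.zero_apply, e]
  rw [rot (fun p q r => b p * c q * a r * F (Pi.single p 1) (Pi.single q 1) s r),
    rot (fun p q r => c p * a q * b r * F (Pi.single p 1) (Pi.single q 1) s r),
    rot (fun x y z => c y * a z * b x * F (Pi.single y 1) (Pi.single z 1) s x)]
  simp only [← Finset.sum_add_distrib]
  refine Finset.sum_eq_zero fun p _ => Finset.sum_eq_zero fun q _ => Finset.sum_eq_zero fun r _ => ?_
  linear_combination (a p * b q * c r) * hF s p q r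

/-- The matrix of the neutral metric of `ℝ⁶`. -/
def neutral : Matrix (Fin 3 ⊕ Fin 3) (Fin 3 ⊕ Fin 3) ℝ := Matrix.fromBlocks 0 1 1 0

/-- Matrix-valued `2`-forms with the symmetries of a Weyl tensor of the neutral metric that
preserves the splitting up to a unipotent part. -/
structure IsCurvTensor (F : Coord → Coord → Matrix (Fin 3 ⊕ Fin 3) (Fin 3 ⊕ Fin 3) ℝ) : Prop where
  alt : ∀ p q, IsAlt fun a b => F a b p q
  skew : ∀ a b, (F a b)ᵀ * neutral + neutral * F a b = 0
  upper : ∀ a b, (F a b).toBlocks₁₂ = 0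
  trace : ∀ a b, (F a b).toBlocks₂₂.trace = 0
  bianchi : ∀ a b c, F a b *ᵥ c + F b c *ᵥ a + F c a *ᵥ b = 0
  ricci : ∀ b c, ∑ p, (F (Pi.single p 1) b *ᵥ c) p = 0

lemma skew_iff (F : Matrix (Fin 3 ⊕ Fin 3) (Fin 3 ⊕ Fin 3) ℝ) :
    Fᵀ * neutral + neutral * F = 0 ↔ (∀ i j, F (.inl i) (.inl j) = -F (.inr j) (.inr i)) ∧
      (∀ i j, F (.inl i) (.inr j) = -F (.inl j) (.inr i)) ∧
      ∀ i j, F (.inr i) (.inl j) = -F (.inr j) (.inl i) := by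
  rw [← Matrix.fromBlocks_toBlocks F, neutral, Matrix.fromBlocks_transpose,
    Matrix.fromBlocks_multiply, Matrix.fromBlocks_multiply, Matrix.fromBlocks_add,
    ← Matrix.fromBlocks_zero, Matrix.fromBlocks_inj]
  simp only [mul_zero, mul_one, zero_add, zero_mul, one_mul, add_zero, ← Matrix.ext_iff]
  simp only [Matrix.add_apply, Matrix.transpose_apply, Matrix.zero_apply, Matrix.fromBlocks_apply₁₁,
    Matrix.fromBlocks_apply₁₂, Matrix.fromBlocks_apply₂₁, Matrix.fromBlocks_apply₂₂]
  constructor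
  · rintro ⟨h1, h2, h3, h4⟩
    exact ⟨fun i j => by linarith [h2 j i], fun i j => by linarith [h4 i j],
      fun i j => by linarith [h1 i j]⟩
  · rintro ⟨h1, h2, h3⟩
    exact ⟨fun i j => by linarith [h3 i j], fun i j => by linarith [h1 j i],
      fun i j => by linarith [h1 i j], fun i j => by linarith [h2 i j]⟩

section

variable {S : CurvArray}

lemma bianchi_array_A (h4 : ∀ i j k, S.2.1 i j k = S.2.1 i k j)
    (h5 : ∀ k, ∑ i, S.2.1 i i k = 0) (i k l m : Fin 3) :
    ∑ n, S.2.1 m i n * eps n k l + ∑ n, S.2.1 k i n * eps n l m + ∑ n, S.2.1 l i n * eps n m k =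
      0 := by
  have e := h5 i
  simp only [Fin.sum_univ_three] at e
  rw [h4 0, h4 1, h4 2] at e
  fin_cases k <;> fin_cases l <;> fin_cases m <;> simp [Fin.sum_univ_three] <;> linarith

lemma bianchi_array_B (h6 : ∀ i j, S.2.2 i j = S.2.2 j i) (i k l m : Fin 3) :
    (∑ n, eps i n m * ∑ p, eps p k l * S.2.2 n p) + (∑ n, eps i n k * ∑ p, eps p l m * S.2.2 n p) +
      (∑ n, eps i n l * ∑ p, eps p m k * S.2.2 n p) = 0 := by
  fin_cases k <;> fin_cases l <;> fin_cases m <;> simp [Fin.sum_univ_three] <;> fin_cases i <;> 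
    simp [h6 1 0, h6 2 0, h6 2 1]

lemma bianchi_array_AB (h4 : ∀ i j k, S.2.1 i j k = S.2.1 i k j) (h5 : ∀ k, ∑ i, S.2.1 i i k = 0)
    (i k l m : Fin 3) :
    ∑ n, S.2.1 i m n * eps n k l - ∑ n, eps i n k * S.2.1 l n m + ∑ n, eps i n l * S.2.1 k n m =
      0 := by
  have e0 := h5 0
  have e1 := h5 1
  have e2 := h5 2
  simp only [Fin.sum_univ_three] at e0 e1 e2
  fin_cases k <;> fin_cases l <;> fin_cases m <;> simp [Fin.sum_univ_three] <;> fin_cases i <;> 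
    simp [h4 _ 1 0, h4 _ 2 0, h4 _ 2 1] at * <;> linarith

end

lemma blockLower_mul {P Q : Matrix (Fin 3 ⊕ Fin 3) (Fin 3 ⊕ Fin 3) ℝ} (hP : P.toBlocks₁₂ = 0)
    (hQ : Q.toBlocks₁₂ = 0) : (P * Q).toBlocks₁₂ = 0 ∧
      (P * Q).toBlocks₂₂ = P.toBlocks₂₂ * Q.toBlocks₂₂ := by
  rw [← fromBlocks_toBlocks P, ← fromBlocks_toBlocks Q, fromBlocks_multiply, hP, hQ]
  simp

lemma neutral_mul_self : neutral * neutral = 1 := by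
  simp [neutral, fromBlocks_multiply]

lemma groupG2_conformal {h : Matrix (Fin 3 ⊕ Fin 3) (Fin 3 ⊕ Fin 3) ℝ} (hh : h ∈ groupG2) :
    ∃ d : ℝ, d ≠ 0 ∧ hᵀ * neutral * h = d • neutral := by
  obtain ⟨A, B, hA, hB, rfl⟩ := hh
  refine ⟨A.det, hA.ne_zero, ?_⟩
  have e1 : A⁻¹ * A = 1 := nonsing_inv_mul A hA
  have e2 : Aᵀ * (A⁻¹)ᵀ = 1 := by rw [← transpose_mul, e1, transpose_one]
  simp only [neutral, fromBlocks_transpose, fromBlocks_multiply, fromBlocks_smul, transpose_smul,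
    transpose_transpose, transpose_mul, transpose_zero, mul_zero, mul_one, zero_add, add_zero,
    zero_mul, Matrix.smul_mul, Matrix.mul_smul, e1, e2, hB, smul_zero, ← mul_assoc, one_mul]
  simp [mul_assoc, e2]

lemma IsCurvTensor.conj {F : Coord → Coord → Matrix (Fin 3 ⊕ Fin 3) (Fin 3 ⊕ Fin 3) ℝ}
    (hF : IsCurvTensor F) {h : Matrix (Fin 3 ⊕ Fin 3) (Fin 3 ⊕ Fin 3) ℝ} (hh : h ∈ groupG2) :
    IsCurvTensor fun a b => h⁻¹ * F (h *ᵥ a) (h *ᵥ b) * h := by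
  obtain ⟨d, hd, hq⟩ := groupG2_conformal hh
  have hinv' : (d⁻¹ • (neutral * hᵀ * neutral)) * h = 1 := by
    rw [smul_mul_assoc, mul_assoc, mul_assoc, ← mul_assoc hᵀ, hq, Matrix.mul_smul, neutral_mul_self,
      smul_smul, inv_mul_cancel₀ hd, one_smul]
  have hinv : h⁻¹ = d⁻¹ • (neutral * hᵀ * neutral) := inv_eq_left_inv hinv'
  have hi : h⁻¹ * h = 1 := by rw [hinv, hinv']
  have hi' : h * h⁻¹ = 1 := mul_eq_one_comm.1 hi
  have hup : h.toBlocks₁₂ = 0 := by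
    obtain ⟨A, B, -, -, rfl⟩ := hh; simp
  have hiup : (h⁻¹).toBlocks₁₂ = 0 := by
    rw [hinv, ← fromBlocks_toBlocks h, hup]
    simp [neutral, fromBlocks_transpose, fromBlocks_multiply, fromBlocks_smul]
  have hqi : neutral * h⁻¹ = d⁻¹ • (hᵀ * neutral) := by
    rw [hinv, Matrix.mul_smul, ← mul_assoc, ← mul_assoc, neutral_mul_self, one_mul]
  have hqi' : (h⁻¹)ᵀ * neutral = d⁻¹ • (neutral * h) := by
    have := congrArg transpose hqi
    rwa [transpose_mul, transpose_smul, transpose_mul, transpose_transpose,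
      show neutralᵀ = neutral by simp [neutral, fromBlocks_transpose]] at this
  refine ⟨fun p q => ?_, fun a b => ?_, fun a b => ?_, fun a b => ?_, fun a b c => ?_,
    fun b c => ?_⟩
  · have : ∀ a b, (h⁻¹ * F (h *ᵥ a) (h *ᵥ b) * h) p q =
        ∑ s, ∑ r, (h s q * h⁻¹ p r) * F (h *ᵥ a) (h *ᵥ b) r s := fun a b => by
      simp only [Matrix.mul_apply, Finset.sum_mul]
      exact Finset.sum_congr rfl fun s _ => Finset.sum_congr rfl fun r _ => by ring
    simp only [this]
    exact .sum _ fun s => .sum _ fun r => ((hF.alt r s).comp (Matrix.mulVecLin h)).const_mul _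
  · have := hF.skew (h *ᵥ a) (h *ᵥ b)
    set G := F (h *ᵥ a) (h *ᵥ b)
    have e1 : (h⁻¹ * G * h)ᵀ * neutral = d⁻¹ • (hᵀ * (Gᵀ * neutral) * h) := by
      rw [transpose_mul, transpose_mul, mul_assoc, mul_assoc, hqi']
      simp only [Matrix.mul_smul, mul_assoc]
    have e2 : neutral * (h⁻¹ * G * h) = d⁻¹ • (hᵀ * (neutral * G) * h) := by
      rw [← mul_assoc, ← mul_assoc, hqi]
      simp only [Matrix.smul_mul, mul_assoc]
    rw [e1, e2, ← smul_add, ← add_mul, ← mul_add, this]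
    simp
  · exact (blockLower_mul (blockLower_mul hiup (hF.upper _ _)).1 hup).1
  · rw [(blockLower_mul (blockLower_mul hiup (hF.upper _ _)).1 hup).2,
      (blockLower_mul hiup (hF.upper _ _)).2, trace_mul_comm, ← mul_assoc,
      ← (blockLower_mul hup hiup).2, hi']
    have := hF.trace (h *ᵥ a) (h *ᵥ b)
    rwa [show (1 : Matrix (Fin 3 ⊕ Fin 3) (Fin 3 ⊕ Fin 3) ℝ).toBlocks₂₂ = 1 by
      rw [← fromBlocks_one, toBlocks_fromBlocks₂₂], one_mul]
  · simp only [← mulVec_mulVec, mul_assoc]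
    rw [← mulVec_add, ← mulVec_add, hF.bianchi, mulVec_zero]
  · have hr := hF.ricci (h *ᵥ b) (h *ᵥ c)
    let T : Matrix (Fin 3 ⊕ Fin 3) (Fin 3 ⊕ Fin 3) ℝ :=
      Matrix.of fun p q => (F (Pi.single q 1) (h *ᵥ b) *ᵥ (h *ᵥ c)) p
    have hT : ∀ a, F a (h *ᵥ b) *ᵥ (h *ᵥ c) = T *ᵥ a := by
      intro a
      ext p
      simp only [mulVec, dotProduct, T, of_apply, Finset.sum_mul]
      rw [Finset.sum_comm]
      refine Finset.sum_congr rfl fun q _ => ?_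
      obtain ⟨B, -, hB⟩ := hF.alt p q
      have e : a = ∑ r, a r • (Pi.single r 1 : Coord) := by
        ext q; simp [Finset.sum_apply, Pi.single_apply]
      simp only [hB]
      conv_lhs => rw [e]
      simp only [map_sum, map_smul, LinearMap.sum_apply, LinearMap.smul_apply, smul_eq_mul,
        Finset.sum_mul]
      exact Finset.sum_congr rfl fun r _ => by ring
    have e : ∀ p, ((h⁻¹ * F (h *ᵥ Pi.single p 1) (h *ᵥ b) * h) *ᵥ c) p = (h⁻¹ * T * h) p p := by
      intro p
      rw [← mulVec_mulVec, ← mulVec_mulVec, hT, mulVec_mulVec, mulVec_mulVec]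
      simp [Matrix.mulVec_single_one, mul_assoc]
    simp only [e]
    change (h⁻¹ * T * h).trace = 0
    rw [trace_mul_comm, ← mul_assoc, hi', one_mul]
    exact hr

section

variable {S : CurvArray}

lemma extTensor_inl_inl (a b : Coord) (i j : Fin 3) :
    extTensor S a b (.inl i) (.inl j) = -curvA S a b j i := rfl

lemma extTensor_inl_inr (a b : Coord) (i j : Fin 3) :
    extTensor S a b (.inl i) (.inr j) = 0 := rfl

lemma extTensor_inr_inl (a b : Coord) (i j : Fin 3) :
    extTensor S a b (.inr i) (.inl j) = ∑ k, eps i k j * curvB S a b k := rfl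

lemma extTensor_inr_inr (a b : Coord) (i j : Fin 3) :
    extTensor S a b (.inr i) (.inr j) = curvA S a b i j := rfl

lemma splitBasis_coord : IsSplitBasis (V := Coord) (fun i => LinearMap.proj (.inl i))
    (fun i => LinearMap.proj (.inr i)) (fun i => Pi.single (.inl i) 1)
    (fun i => Pi.single (.inr i) 1) := by
  refine ⟨?_, ?_, ?_, ?_, fun v => ?_⟩
  · intro i j; simp [Pi.single_apply]
  · intro i j; simp [Pi.single_apply]
  · intro i j; simp [Pi.single_apply]
  · intro i j; simp [Pi.single_apply]
  · ext (i | i) <;> simp [Finset.sum_apply, Pi.single_apply]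

lemma splitCoord_coord (v : Coord) : splitCoord (V := Coord) (fun i => LinearMap.proj (.inl i))
    (fun i => LinearMap.proj (.inr i)) v = v := by
  ext (i | i) <;> rfl

lemma isAlt_curvA_coord (S : CurvArray) (i j : Fin 3) : IsAlt fun v w : Coord => curvA S v w i j := by
  simpa only [splitCoord_coord] using isAlt_curvA (V := Coord)
    (θ := fun i => LinearMap.proj (.inl i)) (η := fun i => LinearMap.proj (.inr i)) S i j

lemma isAlt_curvB_coord (S : CurvArray) (i : Fin 3) : IsAlt fun v w : Coord => curvB S v w i := by
  simpa only [splitCoord_coord] using isAlt_curvB (V := Coord)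
    (θ := fun i => LinearMap.proj (.inl i)) (η := fun i => LinearMap.proj (.inr i)) S i

lemma isAlt_extTensor (S : CurvArray) (p q : Fin 3 ⊕ Fin 3) :
    IsAlt fun a b => extTensor S a b p q := by
  rcases p with i | i <;> rcases q with j | j
  · exact (isAlt_curvA_coord S j i).neg
  · exact .zero
  · exact IsAlt.sum Finset.univ fun k => (isAlt_curvB_coord S k).const_mul (eps i k j)
  · exact isAlt_curvA_coord S i j

lemma curvA_trace (hS : S ∈ curvComponents) (a b : Coord) : ∑ i, curvA S a b i i = 0 := by
  obtain ⟨h1, h2, h3, h4, h5, h6⟩ := hS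
  have e1 : ∀ k, ∑ i, S.2.1 i i k = 0 := h5
  have e2 : ∀ k l, ∑ i, S.1 i k i l = 0 := h3
  simp only [curvA, Finset.sum_add_distrib]
  rw [Finset.sum_comm, Finset.sum_comm (f := fun i k => ∑ l, S.1 i k i l * _)]
  have a1 : ∀ k, ∑ i, ∑ l, ∑ m, S.2.1 i i k * eps k l m * wedgeCoord (.inl l) (.inl m) a b = 0 := by
    intro k
    simp only [mul_assoc, ← Finset.mul_sum]
    rw [← Finset.sum_mul, e1, zero_mul]
  have a2 : ∀ k, ∑ i, ∑ l, S.1 i k i l * wedgeCoord (.inl k) (.inr l) a b = 0 := by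
    intro k
    rw [Finset.sum_comm]
    simp only [← Finset.sum_mul, e2, zero_mul, Finset.sum_const_zero]
  simp only [a1, a2, Finset.sum_const_zero, add_zero]

lemma IsAlt.single_swap {F : Coord → Coord → ℝ} (h : IsAlt F) (p q : Fin 3 ⊕ Fin 3) :
    F (Pi.single p 1) (Pi.single q 1) = -F (Pi.single q 1) (Pi.single p 1) := h.swap _ _

lemma isCurvTensor_extTensor (hS : S ∈ curvComponents) : IsCurvTensor (extTensor S) := by
  have hS' := hS
  obtain ⟨h1, h2, h3, h4, h5, h6⟩ := hS
  have s1 : ∀ i j k l, curvA S (Pi.single (.inr l) 1) (Pi.single (.inl k) 1) i j = -S.1 i k j l :=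
    fun i j k l => by rw [(isAlt_curvA_coord S i j).single_swap, curvA_inl_inr]
  have s2 : ∀ i k l, curvB S (Pi.single (.inr l) 1) (Pi.single (.inl k) 1) i = 2 * S.2.1 k i l :=
    fun i k l => by rw [(isAlt_curvB_coord S i).single_swap, curvB_inl_inr]; ring
  refine ⟨isAlt_extTensor S, fun a b => (skew_iff _).2 ⟨fun i j => ?_, fun i j => ?_, fun i j => ?_⟩,
    fun a b => ?_, curvA_trace hS', IsAlt.eq_zero_of_trilinear (isAlt_extTensor S) ?_, ?_⟩
  · rfl
  · simp [extTensor_inl_inr]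
  · simp only [extTensor_inr_inl, ← Finset.sum_neg_distrib]
    exact Finset.sum_congr rfl fun k _ => by rw [eps_swap_outer]; ring
  · rfl
  · rintro (i | i) (p | p) (q | q) (r | r) <;>
      simp only [extTensor_inl_inl, extTensor_inl_inr, extTensor_inr_inl, extTensor_inr_inr,
        curvA_inl_inl, curvA_inl_inr, curvA_inr_inr, curvB_inl_inl, curvB_inl_inr, curvB_inr_inr,
        s1, s2]
    · have := bianchi_array_A h4 h5 i p q r
      linarith
    · linarith [h1 q p i r]
    · linarith [h1 p r i q]
    · ring
    · linarith [h1 r q i p]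
    · ring
    · ring
    · ring
    · have := bianchi_array_B h6 i p q r
      simp only [Fin.sum_univ_three] at this ⊢
      linarith
    · have := bianchi_array_AB h4 h5 i p q r
      simp only [Fin.sum_univ_three] at this ⊢
      linarith
    · have := bianchi_array_AB h4 h5 i r p q
      simp only [Fin.sum_univ_three] at this ⊢
      linarith
    · simp only [mul_zero, Finset.sum_const_zero]
      linarith [h2 i p r q]
    · have := bianchi_array_AB h4 h5 i q r p
      simp only [Fin.sum_univ_three] at this ⊢
      linarith
    · simp only [mul_zero, Finset.sum_const_zero]
      linarith [h2 i q p r]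
    · simp only [mul_zero, Finset.sum_const_zero]
      linarith [h2 i r p q]
    · ring
  · intro b c
    have e : ∀ p q, extTensor S (Pi.single p 1) b p q =
        ∑ r, b r * extTensor S (Pi.single p 1) (Pi.single r 1) p q := fun p q => by
      rw [(isAlt_extTensor S p q).eq_sum_sum]
      simp [Pi.single_apply]
    have t : ∀ q r, ∑ p, extTensor S (Pi.single p 1) (Pi.single r 1) p q = 0 := by
      rintro (j | j) (l | l) <;> rw [Fintype.sum_sum_type] <;>
      simp only [extTensor_inl_inl, extTensor_inl_inr, extTensor_inr_inl, extTensor_inr_inr,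
        curvA_inl_inl, curvA_inl_inr, curvA_inr_inr, curvB_inl_inl, curvB_inl_inr, curvB_inr_inr,
        s1, s2]
      · fin_cases j <;> fin_cases l <;> simp [Fin.sum_univ_three] <;>
          linarith [h4 0 0 1, h4 0 0 2, h4 0 1 2, h4 1 0 1, h4 1 0 2, h4 1 1 2, h4 2 0 1, h4 2 0 2,
            h4 2 1 2]
      · have := h3 j l
        simp only [h1 _ j] at this
        simp [this]
      · have := h3 l j
        simp only [h2 _ _ _ j] at this
        simp [this]
      · simp
    simp only [mulVec, dotProduct, e, Finset.sum_mul]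
    rw [Finset.sum_comm]
    refine Finset.sum_eq_zero fun q _ => ?_
    rw [Finset.sum_comm]
    refine Finset.sum_eq_zero fun r _ => ?_
    have := congrArg (fun s => b r * c q * s) (t q r)
    simp only [Finset.mul_sum, mul_zero] at this
    rw [← this]
    exact Finset.sum_congr rfl fun p _ => by ring

lemma IsCurvTensor.mem {F : Coord → Coord → Matrix (Fin 3 ⊕ Fin 3) (Fin 3 ⊕ Fin 3) ℝ}
    (hF : IsCurvTensor F) : F ∈ extTensorSpace := by
  have sk := fun a b => (skew_iff (F a b)).1 (hF.skew a b)
  have up : ∀ a b i j, F a b (.inl i) (.inr j) = 0 := fun a b i j =>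
    congrFun (congrFun (hF.upper a b) i) j
  have tr : ∀ a b, ∑ k, F a b (.inr k) (.inr k) = 0 := hF.trace
  let A : Fin 3 → Fin 3 → Coord → Coord → ℝ := fun i j a b => F a b (.inr i) (.inr j)
  let B : Fin 3 → Coord → Coord → ℝ := fun k a b => F a b (.inr (k + 2)) (.inl (k + 1))
  have hB : ∀ a b i j, F a b (.inr i) (.inl j) = ∑ k, eps i k j * B k a b := by
    intro a b i j
    have d : ∀ i, F a b (.inr i) (.inl i) = 0 := fun i => by linarith [(sk a b).2.2 i i]
    have s := (sk a b).2.2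
    fin_cases i <;> fin_cases j <;> simp [Fin.sum_univ_three, B, d] <;> exact s _ _
  have key := splitBasis_coord.bianchi (A := A) (B := B) (fun i j => hF.alt _ _)
    (fun i => hF.alt _ _) ?_ ?_
  · obtain ⟨hS, eA, eB⟩ := key
    set S := bianchiS (fun i => Pi.single (.inl i) 1) (fun i => Pi.single (.inr i) 1) A B
    set τ := bianchiτ (V := Coord) (fun i => LinearMap.proj (.inl i))
      (fun i => LinearMap.proj (.inr i)) (fun i => Pi.single (.inl i) 1)
      (fun i => Pi.single (.inr i) 1) A B
    simp only [splitCoord_coord, LinearMap.proj_apply] at eA eB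
    have tS := curvA_trace hS
    have trτ : ∀ v w : Coord, ∑ k, (τ k v * w (.inl k) - τ k w * v (.inl k)) = 0 := by
      intro v w
      have e := tr v w
      change ∑ k, A k k v w = 0 at e
      simp only [eA, Finset.sum_add_distrib, tS] at e
      simp only [Fin.sum_univ_three, if_true] at e ⊢
      linarith
    have u : ∀ k l, τ k (Pi.single (.inr l) 1) = 0 := by
      intro k l
      simpa [Pi.single_apply] using trτ (Pi.single (.inr l) 1) (Pi.single (.inl k) 1)
    have t : ∀ j l, τ j (Pi.single (.inl l) 1) = 0 := by
      intro j l
      have r1 := hF.ricci (Pi.single (.inl l) 1) (Pi.single (.inl j) 1)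
      have r2 := (isCurvTensor_extTensor hS).ricci (Pi.single (.inl l) 1) (Pi.single (.inl j) 1)
      simp only [Fintype.sum_sum_type, mulVec_single_one, col_apply, (sk _ _).1, hB,
        extTensor_inl_inl, extTensor_inr_inl] at r1 r2
      change ∑ x, -A j x _ _ + _ = 0 at r1
      simp only [eA, eB, trτ] at r1
      simp only [Fin.sum_univ_three, Pi.single_apply, reduceCtorEq, if_false, Sum.inl.injEq,
        Sum.inr.injEq, mul_zero, sub_zero, zero_sub, u] at r1 r2
      fin_cases j <;> fin_cases l <;> simp at r1 r2 ⊢ <;> linarith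
    have t0 : ∀ j, τ j = 0 := fun j => splitBasis_coord.linear_ext
      (fun l => by rw [t]; rfl) (fun l => by rw [u]; rfl)
    refine ⟨S, hS, ?_⟩
    funext a b
    simp only [t0, LinearMap.zero_apply, zero_mul, sub_self, Finset.sum_const_zero, mul_zero,
      ite_self, zero_add] at eA eB
    ext (i | i) (j | j)
    · rw [extTensor_inl_inl, ← eA, (sk a b).1]
    · rw [extTensor_inl_inr, up]
    · simp only [extTensor_inr_inl, ← eB, hB]
    · rw [extTensor_inr_inr, ← eA]
  · intro i u v w
    have := congrFun (hF.bianchi u v w) (.inl i)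
    simp only [Pi.add_apply, mulVec, dotProduct, Fintype.sum_sum_type, up, (sk _ _).1, zero_mul,
      Finset.sum_const_zero, add_zero, Pi.zero_apply] at this
    simp only [A, tr, zero_mul, sub_zero, LinearMap.proj_apply]
    simp only [neg_mul, Finset.sum_neg_distrib] at this
    linarith
  · intro i u v w
    have := congrFun (hF.bianchi u v w) (.inr i)
    simp only [Pi.add_apply, mulVec, dotProduct, Fintype.sum_sum_type, hB, Pi.zero_apply,
      Finset.sum_mul] at this
    simp only [A, LinearMap.proj_apply]
    linarith

theorem extTensorSpace_invariant {h : Matrix (Fin 3 ⊕ Fin 3) (Fin 3 ⊕ Fin 3) ℝ} (hh : h ∈ groupG2)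
    {F : Coord → Coord → Matrix (Fin 3 ⊕ Fin 3) (Fin 3 ⊕ Fin 3) ℝ} (hF : F ∈ extTensorSpace) :
    (fun a b => h⁻¹ * F (h *ᵥ a) (h *ᵥ b) * h) ∈ extTensorSpace := by
  obtain ⟨S, hS, rfl⟩ := hF
  exact ((isCurvTensor_extTensor hS).conj hh).mem

end

end Invariance

section Gauge

open Matrix

variable {ι : Type*} [Fintype ι]

/-- The value on a tangent vector of a matrix of `1`-forms. -/
def evM (Γ : Matrix ι ι (OneForm M)) (x : M) (v : 𝕋 x) : Matrix ι ι ℝ :=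
  Matrix.of fun a b => Γ a b x v

/-- The exterior derivative of a matrix of `1`-forms. -/
def extDM (Γ : Matrix ι ι (OneForm M)) (x : M) (v w : 𝕋 x) : Matrix ι ι ℝ :=
  Matrix.of fun a b => extD (Γ a b) x v w

/-- The curvature `dΓ + Γ ∧ Γ` of a matrix of `1`-forms. -/
def curvM (Γ : Matrix ι ι (OneForm M)) (x : M) (v w : 𝕋 x) : Matrix ι ι ℝ :=
  extDM Γ x v w + (evM Γ x v * evM Γ x w - evM Γ x w * evM Γ x v)

/-- The differential of a matrix of functions. -/
def diffM (k : M → Matrix ι ι ℝ) (x : M) (v : 𝕋 x) : Matrix ι ι ℝ :=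
  Matrix.of fun a b => diff (fun y => k y a b) x v

lemma GaugeForm.ev_eq (Γ : GaugeForm M) (x : M) (v : 𝕋 x) : Γ.ev x v = evM Γ x v :=
  rfl

lemma GaugeForm.curv_eq (Γ : GaugeForm M) (a b : Fin 8) (x : M) (v w : 𝕋 x) :
    Γ.curv a b x v w = curvM Γ x v w a b := by
  simp [curv, curvM, extDM, evM, wedge, Matrix.mul_apply, Finset.sum_sub_distrib, mul_comm]

theorem curvM_gauge {Γ Γ' : Matrix ι ι (OneForm M)} {k : M → Matrix ι ι ℝ}
    (hΓ : ∀ a b, (Γ a b).SmoothAt x) (hΓ' : ∀ a b, (Γ' a b).SmoothAt x)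
    (hk : ∀ a b, FunSmoothAt (fun y => k y a b) x)
    (h : ∀ᶠ y in nhds x, ∀ v, k y * evM Γ' y v = evM Γ y v * k y + diffM k y v)
    (v w : 𝕋 x) : k x * curvM Γ' x v w = curvM Γ x v w * k x := by
  have e : ∀ v, diffM k x v = k x * evM Γ' x v - evM Γ x v * k x := fun v => by
    rw [h.self_of_nhds v]; abel
  have key : k x * extDM Γ' x v w + (diffM k x v * evM Γ' x w - diffM k x w * evM Γ' x v) =
      extDM Γ x v w * k x + (evM Γ x w * diffM k x v - evM Γ x v * diffM k x w) := by
    ext a b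
    have e1 : extD (∑ c, fsmul (fun y => k y a c) (Γ' c b)) x v w =
        extD (∑ c, fsmul (fun y => k y c b) (Γ a c) + fun y => diff (fun y => k y a b) y) x v w := by
      refine extD_congr (h.mono fun y hy => ?_) v w
      ext v
      have := congrFun (congrFun (hy v) a) b
      simp only [Matrix.mul_apply, Matrix.add_apply, evM, diffM, Matrix.of_apply] at this
      change (∑ c, fsmul (fun y => k y a c) (Γ' c b)) y v =
        (∑ c, fsmul (fun y => k y c b) (Γ a c)) y v + diff (fun y => k y a b) y v
      simp only [OneForm.sum_apply, fsmul_apply, this, mul_comm]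
    rw [extD_sum _ fun c _ => (hΓ' c b).fsmul (hk a c),
      extD_add (.sum fun c _ => (hΓ a c).fsmul (hk c b)) (hk a b).smoothAt_diff,
      extD_sum _ fun c _ => (hΓ a c).fsmul (hk c b), (hk a b).extD_diff] at e1
    simp only [extD_fsmul (hk _ _) (hΓ' _ _), extD_fsmul (hk _ _) (hΓ _ _),
      Finset.sum_add_distrib, Finset.sum_sub_distrib] at e1
    simp only [Matrix.mul_apply, Matrix.add_apply, Matrix.sub_apply, extDM, evM, diffM,
      Matrix.of_apply]
    simp only [mul_comm (extD _ _ _ _), mul_comm (Γ _ _ _ _) (diff _ _ _)]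
    linarith
  rw [e, e] at key
  rw [curvM, curvM]
  simp only [sub_mul, mul_sub, mul_add, add_mul, mul_assoc] at key ⊢
  rw [← sub_eq_zero] at key ⊢
  rw [← key]
  abel

/-! ### Skewness of the curvature -/

lemma extDM_skew {Γ : Matrix ι ι (OneForm M)} {Q : Matrix ι ι ℝ}
    (hΓ : ∀ a b, (Γ a b).SmoothAt x)
    (h : ∀ᶠ y in nhds x, ∀ v, Q * evM Γ y v + (evM Γ y v)ᵀ * Q = 0) (v w : 𝕋 x) :
    Q * extDM Γ x v w + (extDM Γ x v w)ᵀ * Q = 0 := by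
  ext a b
  have e1 : extD (∑ c, Q a c • Γ c b + ∑ c, Q c b • Γ c a) x v w = extD (0 : OneForm M) x v w := by
    refine extD_congr (h.mono fun y hy => ?_) v w
    ext v
    have := congrFun (congrFun (hy v) a) b
    simp only [Matrix.mul_apply, Matrix.add_apply, evM, Matrix.of_apply, Matrix.transpose_apply,
      Matrix.zero_apply] at this
    change (∑ c, Q a c • Γ c b) y v + (∑ c, Q c b • Γ c a) y v = 0
    simp only [OneForm.sum_apply]
    rw [← this]
    simp only [mul_comm (Γ _ _ _ _)]
    rfl
  rw [extD_zero, extD_add (.sum fun c _ => (hΓ c b).const_smul _)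
    (.sum fun c _ => (hΓ c a).const_smul _), extD_sum _ fun c _ => (hΓ c b).const_smul _,
    extD_sum _ fun c _ => (hΓ c a).const_smul _] at e1
  simp only [extD_const_smul _ (hΓ _ _)] at e1
  simp only [Matrix.mul_apply, Matrix.add_apply, extDM, Matrix.of_apply, Matrix.transpose_apply,
    mul_comm (extD _ _ _ _), e1, Matrix.zero_apply]

lemma curvM_skew {Γ : Matrix ι ι (OneForm M)} {Q : Matrix ι ι ℝ}
    (hΓ : ∀ a b, (Γ a b).SmoothAt x)
    (h : ∀ᶠ y in nhds x, ∀ v, Q * evM Γ y v + (evM Γ y v)ᵀ * Q = 0) (v w : 𝕋 x) :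
    Q * curvM Γ x v w + (curvM Γ x v w)ᵀ * Q = 0 := by
  have h1 := extDM_skew hΓ h v w
  have hv := h.self_of_nhds v
  have hw := h.self_of_nhds w
  rw [curvM]
  set A := evM Γ x v
  set B := evM Γ x w
  have : Q * (A * B - B * A) + (A * B - B * A)ᵀ * Q = (Q * A + Aᵀ * Q) * B - (Q * B + Bᵀ * Q) * A -
      Aᵀ * (Q * B + Bᵀ * Q) + Bᵀ * (Q * A + Aᵀ * Q) := by
    simp only [transpose_sub, transpose_mul, mul_sub, sub_mul, add_mul, mul_add, mul_assoc]
    abel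
  rw [hv, hw] at this
  rw [transpose_add, mul_add, add_mul, add_add_add_comm, h1, this]
  simp

/-! ### Smoothness of matrix operations -/

variable [DecidableEq ι]

lemma FunSmoothAt.prod {κ : Type*} {s : Finset κ} {f : κ → M → ℝ}
    (h : ∀ i ∈ s, FunSmoothAt (f i) x) : FunSmoothAt (fun y => ∏ i ∈ s, f i y) x := by
  have := contDiffAt_prod (𝕜 := ℝ) (n := ∞) (x := 𝒞 x x) (t := s)
    (f := fun i => f i ∘ (𝒞 x).symm) h
  refine this.congr_of_eventuallyEq (.of_forall fun p => ?_)
  simp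

lemma FunSmoothAt.det {k : M → Matrix ι ι ℝ} (h : ∀ a b, FunSmoothAt (fun y => k y a b) x) :
    FunSmoothAt (fun y => (k y).det) x := by
  simp only [Matrix.det_apply']
  exact .sum fun s _ => (FunSmoothAt.const _).mul (.prod fun i _ => h _ _)

lemma FunSmoothAt.matrix_inv {k : M → Matrix ι ι ℝ} (h : ∀ a b, FunSmoothAt (fun y => k y a b) x)
    (hk : (k x).det ≠ 0) (a b : ι) : FunSmoothAt (fun y => (k y)⁻¹ a b) x := by
  simp only [Matrix.inv_def, Matrix.smul_apply, smul_eq_mul, Ring.inverse_eq_inv',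
    Matrix.adjugate_apply]
  refine ((FunSmoothAt.det h).inv hk).mul (.det fun c d => ?_)
  simp only [Matrix.updateRow_apply]
  by_cases hc : c = b
  · simpa [hc] using FunSmoothAt.const _
  · simpa [hc] using h c d

end Gauge

section Indices

open Matrix

lemma sum_fin8 (f : Fin 8 → ℝ) : ∑ c, f c = f 0 + ∑ a, f (mid a) + f 7 := by
  rw [Fin.sum_univ_castSucc, Fin.sum_univ_succ]
  rfl

lemma forall_fin8 {P : Fin 8 → Prop} : (∀ c, P c) ↔ P 0 ∧ (∀ a, P (mid a)) ∧ P 7 := by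
  constructor
  · exact fun h => ⟨h _, fun a => h _, h _⟩
  · rintro ⟨h0, h, h7⟩ c
    refine Fin.lastCases h7 (fun c => ?_) c
    exact Fin.cases h0 h c

lemma add_three_add_three (a : Fin 6) : a + 3 + 3 = a := by
  fin_cases a <;> rfl

lemma form44_transpose : form44ᵀ = form44 := by
  ext a b; fin_cases a <;> fin_cases b <;> rfl

lemma form44_mul_zero_left (N : Matrix (Fin 8) (Fin 8) ℝ) (b : Fin 8) :
    (form44 * N) 0 b = -N 7 b := by
  simp [Matrix.mul_apply, Fin.sum_univ_eight, form44]

lemma form44_mul_seven_left (N : Matrix (Fin 8) (Fin 8) ℝ) (b : Fin 8) :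
    (form44 * N) 7 b = -N 0 b := by
  simp [Matrix.mul_apply, Fin.sum_univ_eight, form44]

lemma form44_mul_mid_left (N : Matrix (Fin 8) (Fin 8) ℝ) (a : Fin 6) (b : Fin 8) :
    (form44 * N) (mid a) b = N (mid (a + 3)) b := by
  fin_cases a <;> simp [Matrix.mul_apply, Fin.sum_univ_eight, form44, mid] <;> rfl

lemma form44_mul_self : form44 * form44 = 1 := by
  ext a b
  revert a
  rw [forall_fin8]
  refine ⟨?_, fun a => ?_, ?_⟩
  · rw [form44_mul_zero_left]; fin_cases b <;> simp [form44] <;> rfl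
  · rw [form44_mul_mid_left]; fin_cases a <;> fin_cases b <;> rfl
  · rw [form44_mul_seven_left]; fin_cases b <;> simp [form44] <;> rfl

/-- The entries of a matrix of `so(4,4)`. -/
structure IsSkewMatrix (N : Matrix (Fin 8) (Fin 8) ℝ) : Prop where
  e70 : N 7 0 = 0
  e07 : N 0 7 = 0
  e77 : N 7 7 = -N 0 0
  e7m : ∀ a, N 7 (mid a) = N (mid (a + 3)) 0
  em7 : ∀ a, N (mid a) 7 = N 0 (mid (a + 3))
  emm : ∀ a b, N (mid (a + 3)) (mid b) = -N (mid (b + 3)) (mid a)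

lemma isSkewMatrix_iff {N : Matrix (Fin 8) (Fin 8) ℝ} :
    form44 * N + Nᵀ * form44 = 0 ↔ IsSkewMatrix N := by
  have e : ∀ a b, (form44 * N + Nᵀ * form44) a b = (form44 * N) a b + (form44 * N) b a := by
    intro a b
    rw [Matrix.add_apply, show Nᵀ * form44 = (form44 * N)ᵀ by
      rw [transpose_mul, form44_transpose], transpose_apply]
  constructor
  · intro h
    have h' : ∀ a b, (form44 * N) a b + (form44 * N) b a = 0 := fun a b => by
      rw [← e, h, Matrix.zero_apply]
    refine ⟨?_, ?_, ?_, fun a => ?_, fun a => ?_, fun a b => ?_⟩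
    · have := h' 0 0; rw [form44_mul_zero_left] at this; linarith
    · have := h' 7 7; rw [form44_mul_seven_left] at this; linarith
    · have := h' 0 7; rw [form44_mul_zero_left, form44_mul_seven_left] at this; linarith
    · have := h' 0 (mid a); rw [form44_mul_zero_left, form44_mul_mid_left] at this; linarith
    · have := h' 7 (mid (a + 3))
      rw [form44_mul_seven_left, form44_mul_mid_left, add_three_add_three] at this; linarith
    · have := h' (mid a) (mid b); rw [form44_mul_mid_left, form44_mul_mid_left] at this; linarith
  · intro h
    ext a b
    rw [e, Matrix.zero_apply]
    revert b
    rw [forall_fin8]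
    revert a
    rw [forall_fin8]
    simp only [form44_mul_zero_left, form44_mul_mid_left, form44_mul_seven_left]
    simp only [forall_fin8, form44_mul_zero_left, form44_mul_mid_left, form44_mul_seven_left, h.e70,
      h.e07, h.e77, h.e7m, h.em7, add_three_add_three]
    refine ⟨⟨by ring, fun _ => by ring, by ring⟩, fun a => ⟨by ring, fun b => ?_, by ring⟩, by ring,
      fun _ => by ring, by ring⟩
    rw [h.emm]; ring

/-- The positions of `θ_i` (`inl i`) and `ω^i` (`inr i`) among `0, …, 5`. -/
def idx6 : Fin 3 ⊕ Fin 3 ≃ Fin 6 := (Equiv.sumComm _ _).trans finSumFinEquiv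

/-- The positions of `θ_i` (`inl i`) and `ω^i` (`inr i`) among `0, …, 7`. -/
def idx8 (p : Fin 3 ⊕ Fin 3) : Fin 8 := mid (idx6 p)

lemma idx6_inr_add (i : Fin 3) : idx6 (.inr i) + 3 = idx6 (.inl i) := by
  fin_cases i <;> rfl

lemma idx6_inl_add (i : Fin 3) : idx6 (.inl i) + 3 = idx6 (.inr i) := by
  fin_cases i <;> rfl

lemma sum_idx8 (f : Fin 8 → ℝ) :
    ∑ c, f c = f 0 + (∑ i, f (idx8 (.inl i)) + ∑ i, f (idx8 (.inr i))) + f 7 := by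
  rw [sum_fin8, ← Equiv.sum_comp idx6 (fun a => f (mid a)), Fintype.sum_sum_type]
  rfl

lemma forall_idx8 {P : Fin 8 → Prop} :
    (∀ c, P c) ↔ P 0 ∧ ((∀ i, P (idx8 (.inl i))) ∧ ∀ i, P (idx8 (.inr i))) ∧ P 7 := by
  rw [forall_fin8, ← Sum.forall (p := fun p => P (idx8 p)), ← idx6.forall_congr_right]
  rfl

end Indices

section GammaHat

variable {M : Type*} [TopologicalSpace M] [ChartedSpace E6 M] (f : CartanFrame M)

lemma gammaHat_00 : f.gammaHat 0 0 = -f.φ := rfl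
lemma gammaHat_07 : f.gammaHat 0 7 = 0 := rfl
lemma gammaHat_70 : f.gammaHat 7 0 = 0 := rfl
lemma gammaHat_77 : f.gammaHat 7 7 = f.φ := rfl
lemma gammaHat_0r (i : Fin 3) : f.gammaHat 0 (idx8 (.inr i)) = f.β i := by fin_cases i <;> rfl
lemma gammaHat_0l (i : Fin 3) : f.gammaHat 0 (idx8 (.inl i)) = f.τ i := by fin_cases i <;> rfl
lemma gammaHat_r0 (i : Fin 3) : f.gammaHat (idx8 (.inr i)) 0 = f.om i := by fin_cases i <;> rfl
lemma gammaHat_l0 (i : Fin 3) : f.gammaHat (idx8 (.inl i)) 0 = f.θ i := by fin_cases i <;> rfl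
lemma gammaHat_7r (i : Fin 3) : f.gammaHat 7 (idx8 (.inr i)) = f.θ i := by fin_cases i <;> rfl
lemma gammaHat_7l (i : Fin 3) : f.gammaHat 7 (idx8 (.inl i)) = f.om i := by fin_cases i <;> rfl
lemma gammaHat_r7 (i : Fin 3) : f.gammaHat (idx8 (.inr i)) 7 = f.τ i := by fin_cases i <;> rfl
lemma gammaHat_l7 (i : Fin 3) : f.gammaHat (idx8 (.inl i)) 7 = f.β i := by fin_cases i <;> rfl

lemma gammaHat_rr (i j : Fin 3) : f.gammaHat (idx8 (.inr i)) (idx8 (.inr j)) =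
    f.α i j - if i = j then f.φ else 0 := by
  fin_cases i <;> fin_cases j <;> first | exact (sub_zero _).symm | rfl

lemma gammaHat_ll (i j : Fin 3) : f.gammaHat (idx8 (.inl i)) (idx8 (.inl j)) =
    (if i = j then f.φ else 0) - f.α j i := by
  fin_cases i <;> fin_cases j <;> first | exact (zero_sub _).symm | rfl

lemma gammaHat_rl (i j : Fin 3) : f.gammaHat (idx8 (.inr i)) (idx8 (.inl j)) =
    ∑ k, eps i k j • f.β k := by
  fin_cases i <;> fin_cases j <;> simp [Fin.sum_univ_three] <;>
    first | exact (neg_one_smul ℝ _).symm | rfl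

lemma gammaHat_lr (i j : Fin 3) : f.gammaHat (idx8 (.inl i)) (idx8 (.inr j)) =
    ∑ k, eps i j k • f.om k := by
  fin_cases i <;> fin_cases j <;> simp [Fin.sum_univ_three] <;>
    first | exact (neg_one_smul ℝ _).symm | rfl

end GammaHat

section GammaHatNormal

open Matrix

variable {f : CartanFrame M}

lemma CartanFrame.φ_eq (f : CartanFrame M) : f.φ = (1 / 2 : ℝ) • ∑ i, f.α i i := by
  funext x
  simp [CartanFrame.φ, Finset.sum_apply]

lemma CartanFrame.φ_apply (f : CartanFrame M) (v : 𝕋 x) :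
    f.φ x v = (1 / 2) * ∑ i, f.α i i x v := by
  simp [CartanFrame.φ, ContinuousLinearMap.sum_apply]

/-- The forms of a Cartan frame are smooth. -/
structure CartanFrame.SmoothAt (f : CartanFrame M) (x : M) : Prop where
  θ : ∀ i, (f.θ i).SmoothAt x
  om : ∀ i, (f.om i).SmoothAt x
  α : ∀ i j, (f.α i j).SmoothAt x
  β : ∀ i, (f.β i).SmoothAt x
  τ : ∀ i, (f.τ i).SmoothAt x

lemma IsCartanFrame.isOpen (h : IsCartanFrame D U f) : IsOpen U := h.isThirdOrderFrame.isOpen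

lemma IsCartanFrame.smoothAt (h : IsCartanFrame D U f) (hx : x ∈ U) : f.SmoothAt x where
  θ i := (smoothOneFormOn_iff_smoothAt h.isOpen).1
    (h.isThirdOrderFrame.isTwoAdapted.smooth_θ i) x hx
  om i := (smoothOneFormOn_iff_smoothAt h.isOpen).1
    (h.isThirdOrderFrame.isTwoAdapted.smooth_om i) x hx
  α i j := (smoothOneFormOn_iff_smoothAt h.isOpen).1 (h.isThirdOrderFrame.smooth_α i j) x hx
  β i := (smoothOneFormOn_iff_smoothAt h.isOpen).1 (h.isThirdOrderFrame.smooth_β i) x hx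
  τ i := (smoothOneFormOn_iff_smoothAt h.isOpen).1 (h.smooth_τ i) x hx

lemma CartanFrame.SmoothAt.φ (h : f.SmoothAt x) : f.φ.SmoothAt x := by
  rw [f.φ_eq]
  exact (OneForm.SmoothAt.sum fun i _ => h.α i i).const_smul _

lemma CartanFrame.SmoothAt.gammaHat (h : f.SmoothAt x) (a b : Fin 8) :
    (f.gammaHat a b).SmoothAt x := by
  have hi : ∀ p : Prop, ∀ [Decidable p], (if p then f.φ else 0 : OneForm M).SmoothAt x := by
    intro p _
    split_ifs
    exacts [h.φ, .zero]
  revert b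
  rw [forall_idx8]
  revert a
  rw [forall_idx8]
  simp only [forall_idx8, gammaHat_00, gammaHat_07, gammaHat_70, gammaHat_77, gammaHat_0r,
    gammaHat_0l, gammaHat_r0, gammaHat_l0, gammaHat_7r, gammaHat_7l, gammaHat_r7, gammaHat_l7,
    gammaHat_rr, gammaHat_ll, gammaHat_rl, gammaHat_lr]
  refine ⟨⟨h.φ.neg, ⟨h.τ, h.β⟩, .zero⟩, ⟨fun i => ⟨h.θ i, ⟨fun j => (hi _).sub (h.α _ _), fun j =>
    .sum fun k _ => (h.om k).const_smul _⟩, h.β i⟩, fun i => ⟨h.om i, ⟨fun j =>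
    .sum fun k _ => (h.β k).const_smul _, fun j => (h.α _ _).sub (hi _)⟩, h.τ i⟩⟩, .zero,
    ⟨h.om, h.θ⟩, h.φ⟩

lemma isSkewMatrix_gammaHat (f : CartanFrame M) (v : 𝕋 x) :
    IsSkewMatrix (f.gammaHat.ev x v) := by
  have hmid : ∀ p, mid (idx6 p) = idx8 p := fun _ => rfl
  constructor
  · rfl
  · rfl
  · exact (neg_neg (f.φ x v)).symm
  · rw [← idx6.forall_congr_right, Sum.forall]
    simp only [idx6_inl_add, idx6_inr_add, hmid, GaugeForm.ev, of_apply, gammaHat_r0, gammaHat_l0,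
      gammaHat_7r, gammaHat_7l, implies_true, and_self]
  · rw [← idx6.forall_congr_right, Sum.forall]
    simp only [idx6_inl_add, idx6_inr_add, hmid, GaugeForm.ev, of_apply, gammaHat_r7, gammaHat_l7,
      gammaHat_0r, gammaHat_0l, implies_true, and_self]
  · rw [← idx6.forall_congr_right, Sum.forall]
    simp only [← idx6.forall_congr_right, Sum.forall, idx6_inl_add, idx6_inr_add, hmid,
      GaugeForm.ev, of_apply, gammaHat_rr, gammaHat_ll, gammaHat_lr, gammaHat_rl]
    refine ⟨fun i => ⟨fun j => ?_, fun j => ?_⟩, fun i => ⟨fun j => ?_, fun j => ?_⟩⟩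
    · simp only [OneForm.sum_apply, ← Finset.sum_neg_distrib]
      refine Finset.sum_congr rfl fun k _ => ?_
      rw [eps_swap_outer]
      change -eps j k i * f.β k x v = -(eps j k i * f.β k x v)
      ring
    · rcases eq_or_ne i j with rfl | hij
      · simp
      · simp [hij, hij.symm]
    · rcases eq_or_ne i j with rfl | hij
      · simp
      · simp [hij, hij.symm]
    · simp only [OneForm.sum_apply, ← Finset.sum_neg_distrib]
      refine Finset.sum_congr rfl fun k _ => ?_
      rw [eps_swap_left]
      change -eps j i k * f.om k x v = -(eps j i k * f.om k x v)
      ring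

lemma wedge_sum_left {κ : Type*} (s : Finset κ) (a : κ → ℝ) (α : κ → OneForm M) (β : OneForm M)
    (v w : 𝕋 x) :
    wedge (∑ k ∈ s, a k • α k) β x v w = ∑ k ∈ s, a k * wedge (α k) β x v w := by
  simp only [wedge, OneForm.sum_apply, Finset.sum_mul, ← Finset.sum_sub_distrib]
  refine Finset.sum_congr rfl fun k _ => ?_
  change a k * α k x v * _ - a k * α k x w * _ = _
  ring

lemma wedge_sum_right {κ : Type*} (s : Finset κ) (a : κ → ℝ) (α : κ → OneForm M) (β : OneForm M)
    (v w : 𝕋 x) :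
    wedge β (∑ k ∈ s, a k • α k) x v w = ∑ k ∈ s, a k * wedge β (α k) x v w := by
  simp only [wedge, OneForm.sum_apply, Finset.mul_sum, ← Finset.sum_sub_distrib]
  refine Finset.sum_congr rfl fun k _ => ?_
  change β x v * (a k * α k x w) - β x w * (a k * α k x v) = _
  ring

/-- `δ φ`. -/
def CartanFrame.φδ (f : CartanFrame M) (i j : Fin 3) : OneForm M := if i = j then f.φ else 0

lemma CartanFrame.φδ_apply (f : CartanFrame M) (i j : Fin 3) (v : 𝕋 x) :
    f.φδ i j x v = if i = j then (1 / 2) * ∑ i, f.α i i x v else 0 := by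
  rw [φδ]
  split_ifs
  exacts [f.φ_apply v, rfl]

lemma IsCartanFrame.extD_φ (h : IsCartanFrame D U f) (hx : x ∈ U) (v w : 𝕋 x) :
    extD f.φ x v w = ∑ k, wedge (f.τ k) (f.θ k) x v w - ∑ k, wedge (f.om k) (f.β k) x v w := by
  have hs := h.smoothAt hx
  have tr := curvA_trace (h.components x hx) (f.coord x v) (f.coord x w)
  rw [f.φ_eq, extD_const_smul _ (.sum fun i _ => hs.α i i), extD_sum _ fun i _ => hs.α i i]
  simp only [h.extD_α x hx]
  simp only [Fin.sum_univ_three, if_true, wedge] at tr ⊢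
  linear_combination (1 / 2) * tr

lemma IsCartanFrame.curv_00 (h : IsCartanFrame D U f) (hx : x ∈ U) (v w : 𝕋 x) :
    f.gammaHat.curv 0 0 x v w = 0 := by
  rw [GaugeForm.curv, sum_idx8]
  simp only [gammaHat_00, gammaHat_07, gammaHat_70, gammaHat_0r, gammaHat_0l, gammaHat_r0,
    gammaHat_l0, extD_neg, h.extD_φ hx]
  simp only [Fin.sum_univ_three, wedge]
  simp only [Pi.neg_apply, Pi.zero_apply, ContinuousLinearMap.neg_apply,
    ContinuousLinearMap.zero_apply]
  ring

lemma IsCartanFrame.curv_r0 (h : IsCartanFrame D U f) (hx : x ∈ U) (i : Fin 3)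
    (v w : 𝕋 x) : f.gammaHat.curv (idx8 (.inr i)) 0 x v w = 0 := by
  rw [GaugeForm.curv, sum_idx8]
  simp only [gammaHat_00, gammaHat_07, gammaHat_70, gammaHat_0r, gammaHat_0l, gammaHat_r0,
    gammaHat_l0, gammaHat_r7, gammaHat_rl, gammaHat_rr, wedge_sum_left]
  rw [h.isThirdOrderFrame.extD_om x hx]
  change _ + (wedge (f.om i) (-f.φ) x v w + (_ + ∑ j, wedge (f.α i j - f.φδ i j) _ x v w) +
    wedge (f.τ i) 0 x v w) = 0
  fin_cases i <;> simp [Fin.sum_univ_three, wedge, CartanFrame.φ_apply, CartanFrame.φδ_apply] <;>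
    ring

lemma IsCartanFrame.curv_l0 (h : IsCartanFrame D U f) (hx : x ∈ U) (i : Fin 3)
    (v w : 𝕋 x) : f.gammaHat.curv (idx8 (.inl i)) 0 x v w = 0 := by
  rw [GaugeForm.curv, sum_idx8]
  simp only [gammaHat_00, gammaHat_07, gammaHat_70, gammaHat_0r, gammaHat_0l, gammaHat_r0,
    gammaHat_l0, gammaHat_l7, gammaHat_ll, gammaHat_lr, wedge_sum_left]
  rw [h.isThirdOrderFrame.extD_θ x hx]
  change _ + (wedge (f.θ i) (-f.φ) x v w + (∑ j, wedge (f.φδ i j - f.α j i) _ x v w + _) +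
    wedge (f.β i) 0 x v w) = 0
  fin_cases i <;> simp [Fin.sum_univ_three, wedge, CartanFrame.φ_apply, CartanFrame.φδ_apply] <;>
    ring

lemma IsCartanFrame.curv_rr (h : IsCartanFrame D U f) (hx : x ∈ U) (i j : Fin 3)
    (v w : 𝕋 x) : f.gammaHat.curv (idx8 (.inr i)) (idx8 (.inr j)) x v w =
      curvA (f.S x) (f.coord x v) (f.coord x w) i j := by
  have hs := h.smoothAt hx
  have hφ : (f.φδ i j).SmoothAt x := by
    rw [CartanFrame.φδ]
    split_ifs
    exacts [hs.φ, .zero]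
  have hd : extD (f.φδ i j) x v w = if i = j then extD f.φ x v w else 0 := by
    rw [CartanFrame.φδ]
    split_ifs
    exacts [rfl, extD_zero v w]
  rw [GaugeForm.curv, sum_idx8]
  simp only [gammaHat_00, gammaHat_07, gammaHat_70, gammaHat_0r, gammaHat_0l, gammaHat_r0,
    gammaHat_l0, gammaHat_r7, gammaHat_7r, gammaHat_rl, gammaHat_rr, gammaHat_lr]
  change extD (f.α i j - f.φδ i j) x v w + (wedge (f.om i) (f.β j) x v w + (_ +
    ∑ k, wedge (f.α i k - f.φδ i k) (f.α k j - f.φδ k j) x v w) + wedge (f.τ i) (f.θ j) x v w) = _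
  rw [extD_sub (hs.α i j) hφ, hd, h.extD_φ hx, h.extD_α x hx]
  simp only [wedge_sum_left, wedge_sum_right]
  generalize curvA (f.S x) (f.coord x v) (f.coord x w) i j = A
  simp only [wedge, Pi.sub_apply, ContinuousLinearMap.sub_apply, CartanFrame.φδ_apply]
  obtain ⟨a, ha⟩ := exists_values₂ f.α x
  obtain ⟨b, hb⟩ := exists_values f.β x
  obtain ⟨t, ht⟩ := exists_values f.τ x
  obtain ⟨o, ho⟩ := exists_values f.om x
  obtain ⟨p, hp⟩ := exists_values f.θ x
  simp only [ha, hb, ht, ho, hp]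
  fin_cases i <;> fin_cases j <;> simp [Fin.sum_univ_three] <;> ring

lemma IsCartanFrame.curv_rl (h : IsCartanFrame D U f) (hx : x ∈ U) (i j : Fin 3)
    (v w : 𝕋 x) : f.gammaHat.curv (idx8 (.inr i)) (idx8 (.inl j)) x v w =
      ∑ k, eps i k j * curvB (f.S x) (f.coord x v) (f.coord x w) k := by
  have hs := h.smoothAt hx
  rw [GaugeForm.curv, sum_idx8]
  simp only [gammaHat_00, gammaHat_07, gammaHat_70, gammaHat_0r, gammaHat_0l, gammaHat_r0,
    gammaHat_l0, gammaHat_r7, gammaHat_7l, gammaHat_rl, gammaHat_rr, gammaHat_ll]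
  change extD (∑ k, eps i k j • f.β k) x v w + (wedge (f.om i) (f.τ j) x v w + (∑ k, wedge _
    (f.φδ k j - f.α j k) x v w + ∑ k, wedge (f.α i k - f.φδ i k) _ x v w) +
    wedge (f.τ i) (f.om j) x v w) = _
  rw [extD_sum _ fun k _ => (hs.β k).const_smul _]
  simp only [extD_const_smul _ (hs.β _), h.extD_β x hx]
  simp only [wedge_sum_left, wedge_sum_right]
  generalize curvB (f.S x) (f.coord x v) (f.coord x w) = B
  simp only [wedge, Pi.sub_apply, ContinuousLinearMap.sub_apply, CartanFrame.φδ_apply]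
  obtain ⟨a, ha⟩ := exists_values₂ f.α x
  obtain ⟨b, hb⟩ := exists_values f.β x
  obtain ⟨t, ht⟩ := exists_values f.τ x
  obtain ⟨o, ho⟩ := exists_values f.om x
  simp only [ha, hb, ht, ho]
  fin_cases i <;> fin_cases j <;> simp [Fin.sum_univ_three] <;> ring

lemma IsCartanFrame.curv_lr (h : IsCartanFrame D U f) (hx : x ∈ U) (i j : Fin 3)
    (v w : 𝕋 x) : f.gammaHat.curv (idx8 (.inl i)) (idx8 (.inr j)) x v w = 0 := by
  have hs := h.smoothAt hx
  rw [GaugeForm.curv, sum_idx8]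
  simp only [gammaHat_00, gammaHat_07, gammaHat_70, gammaHat_0r, gammaHat_0l, gammaHat_r0,
    gammaHat_l0, gammaHat_l7, gammaHat_7r, gammaHat_lr, gammaHat_rr, gammaHat_ll]
  change extD (∑ k, eps i j k • f.om k) x v w + (wedge (f.θ i) (f.β j) x v w + (∑ k, wedge
    (f.φδ i k - f.α k i) _ x v w + ∑ k, wedge _ (f.α k j - f.φδ k j) x v w) +
    wedge (f.β i) (f.θ j) x v w) = _
  rw [extD_sum _ fun k _ => (hs.om k).const_smul _]
  simp only [extD_const_smul _ (hs.om _), h.isThirdOrderFrame.extD_om x hx]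
  simp only [wedge_sum_left, wedge_sum_right]
  simp only [wedge, Pi.sub_apply, ContinuousLinearMap.sub_apply, CartanFrame.φδ_apply]
  obtain ⟨a, ha⟩ := exists_values₂ f.α x
  obtain ⟨b, hb⟩ := exists_values f.β x
  obtain ⟨o, ho⟩ := exists_values f.om x
  obtain ⟨p, hp⟩ := exists_values f.θ x
  simp only [ha, hb, ho, hp]
  fin_cases i <;> fin_cases j <;> simp [Fin.sum_univ_three] <;> ring

lemma IsCartanFrame.isSkewMatrix_curv (h : IsCartanFrame D U f) (hx : x ∈ U)
    (v w : 𝕋 x) : IsSkewMatrix (curvM f.gammaHat x v w) :=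
  isSkewMatrix_iff.1 (curvM_skew (fun a b => (h.smoothAt hx).gammaHat a b)
    (.of_forall fun y v => isSkewMatrix_iff.2 (isSkewMatrix_gammaHat f v)) v w)

theorem IsCartanFrame.curv_mid (h : IsCartanFrame D U f) (hx : x ∈ U) (p q : Fin 3 ⊕ Fin 3)
    (v w : 𝕋 x) : f.gammaHat.curv (idx8 p) (idx8 q) x v w =
      extTensor (f.S x) (f.coord x v) (f.coord x w) p q := by
  rcases p with i | i <;> rcases q with j | j
  · have := (h.isSkewMatrix_curv hx v w).emm (idx6 (.inr i)) (idx6 (.inl j))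
    rw [idx6_inr_add, idx6_inl_add, ← GaugeForm.curv_eq, ← GaugeForm.curv_eq] at this
    exact this.trans (congrArg Neg.neg (h.curv_rr hx j i v w))
  · exact h.curv_lr hx i j v w
  · exact h.curv_rl hx i j v w
  · exact h.curv_rr hx i j v w

lemma symProd_comm (α β : OneForm M) : symProd α β = symProd β α := by
  funext x
  refine ContinuousLinearMap.ext fun v => ContinuousLinearMap.ext fun w => ?_
  change α x v * β x w + β x v * α x w = β x v * α x w + α x v * β x w
  ring

lemma gammaHat_metric (f : CartanFrame M) : f.gammaHat.metric = f.metric := by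
  rw [Coframing.metric, Fin.sum_univ_three, symProd_comm (f.θ 0), symProd_comm (f.θ 1),
    symProd_comm (f.θ 2)]
  rfl

lemma gammaHat_solder (f : CartanFrame M) (p : Fin 3 ⊕ Fin 3) (v : 𝕋 x) :
    f.gammaHat (mid (idx6 p)) 0 x v = f.coord x v p := by
  rcases p with i | i
  · exact congrArg (fun α : OneForm M => α x v) (gammaHat_l0 f i)
  · exact congrArg (fun α : OneForm M => α x v) (gammaHat_r0 f i)

theorem IsCartanFrame.isNormalConformalGauge (hD : IsNondegenerate D) (h : IsCartanFrame D U f) :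
    IsNormalConformalGauge D U f.gammaHat where
  smooth a b := (smoothOneFormOn_iff_smoothAt h.isOpen).2 fun x hx => (h.smoothAt hx).gammaHat a b
  skew x hx v := isSkewMatrix_iff.2 (isSkewMatrix_gammaHat f v)
  solder x hx := by
    have h1 := h.isThirdOrderFrame.isTwoAdapted.bijective x hx
    have h2 : (fun (v : 𝕋 x) (a : Fin 6) => f.gammaHat (mid a) 0 x v) =
        (Equiv.arrowCongr idx6 (Equiv.refl ℝ)) ∘ f.coord x := by
      funext v a
      obtain ⟨p, rfl⟩ := idx6.surjective a
      rw [gammaHat_solder]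
      simp
    rw [h2]
    exact (Equiv.bijective _).comp h1
  conformal := by
    rw [gammaHat_metric]
    exact h.isThirdOrderFrame.isTwoAdapted.representsConformal hD
  torsion_free x hx a v w := by
    obtain ⟨i | i, rfl⟩ := idx6.surjective a
    exacts [h.curv_l0 hx i v w, h.curv_r0 hx i v w]
  normal x hx X hX b w := by
    obtain ⟨q, rfl⟩ := idx6.surjective b
    have hX' : ∀ p, f.coord x (X (idx6 p)) = Pi.single p 1 := by
      intro p
      ext q
      rw [← gammaHat_solder, hX]
      simp [Pi.single_apply]
    rw [← Equiv.sum_comp idx6]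
    simp only [h.curv_00 hx, ite_self, sub_zero]
    have := (isCurvTensor_extTensor (h.components x hx)).ricci (f.coord x w) (Pi.single q 1)
    simp only [mulVec_single_one, col_apply] at this
    rw [← this]
    refine Finset.sum_congr rfl fun p _ => ?_
    rw [← hX']
    exact h.curv_mid hx p q _ _

end GammaHatNormal

section DiffMatrix

open Matrix

variable {ι : Type*} [Fintype ι] {k l : M → Matrix ι ι ℝ}

/-- Entrywise smoothness of a matrix-valued function. -/
def MatSmoothAt (k : M → Matrix ι ι ℝ) (x : M) : Prop := ∀ a b, FunSmoothAt (fun y => k y a b) x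

lemma MatSmoothAt.mul (hk : MatSmoothAt k x) (hl : MatSmoothAt l x) :
    MatSmoothAt (fun y => k y * l y) x := fun a b => by
  simp only [Matrix.mul_apply]
  exact .sum fun c _ => (hk a c).mul (hl c b)

lemma MatSmoothAt.const (N : Matrix ι ι ℝ) : MatSmoothAt (fun _ : M => N) x := fun _ _ => .const _

lemma MatSmoothAt.transpose (hk : MatSmoothAt k x) : MatSmoothAt (fun y => (k y)ᵀ) x :=
  fun a b => hk b a

lemma diffM_mul (hk : MatSmoothAt k x) (hl : MatSmoothAt l x) (v : 𝕋 x) :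
    diffM (fun y => k y * l y) x v = diffM k x v * l x + k x * diffM l x v := by
  ext a b
  simp only [diffM, Matrix.of_apply, Matrix.add_apply, Matrix.mul_apply]
  rw [FunSmoothAt.diff_sum fun c => (hk a c).mul (hl c b), ← Finset.sum_add_distrib]
  exact Finset.sum_congr rfl fun c _ => (hk a c).diff_mul (hl c b) v

lemma diffM_const (N : Matrix ι ι ℝ) (v : 𝕋 x) :
    diffM (fun _ : M => N) x v = 0 := by
  ext a b
  exact diff_const _ v

lemma diffM_transpose (v : 𝕋 x) :
    diffM (fun y => (k y)ᵀ) x v = (diffM k x v)ᵀ := rfl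

lemma diffM_congr (h : ∀ᶠ y in nhds x, k y = l y) (v : 𝕋 x) :
    diffM k x v = diffM l x v := by
  ext a b
  exact diff_congr (h.mono fun y hy => by rw [hy]) v

end DiffMatrix

section Parabolic

open Matrix

lemma form44_apply_mid (a b : Fin 6) : form44 (mid a) (mid b) = if b = a + 3 then 1 else 0 := by
  fin_cases a <;> fin_cases b <;> rfl

lemma form44_0mid (b : Fin 6) : form44 0 (mid b) = 0 := by fin_cases b <;> rfl
lemma form44_mid0 (b : Fin 6) : form44 (mid b) 0 = 0 := by fin_cases b <;> rfl
lemma form44_7mid (b : Fin 6) : form44 7 (mid b) = 0 := by fin_cases b <;> rfl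
lemma form44_mid7 (b : Fin 6) : form44 (mid b) 7 = 0 := by fin_cases b <;> rfl

lemma transpose_form44_mul (k : Matrix (Fin 8) (Fin 8) ℝ) (a b : Fin 8) :
    (kᵀ * form44 * k) a b = -k 0 a * k 7 b + ∑ c, k (mid c) a * k (mid (c + 3)) b - k 7 a * k 0 b := by
  rw [mul_assoc, Matrix.mul_apply, sum_fin8]
  simp only [transpose_apply, form44_mul_zero_left, form44_mul_mid_left, form44_mul_seven_left]
  ring

/-- A similarity of the quadratic form with factor `ε` that multiplies `e₀` by `c`. -/
structure IsParabolic (ε c : ℝ) (k : Matrix (Fin 8) (Fin 8) ℝ) : Prop where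
  sq : ε * ε = 1
  pos : 0 < c
  form : kᵀ * form44 * k = ε • form44
  e00 : k 0 0 = c
  em0 : ∀ a, k (mid a) 0 = 0
  e70 : k 7 0 = 0

lemma mem_conformalParabolic_iff {k : Matrix (Fin 8) (Fin 8) ℝ} :
    k ∈ conformalParabolic ↔ ∃ ε c, IsParabolic ε c k := by
  have h0 : ∀ c : ℝ, k *ᵥ (Pi.single 0 1) = c • Pi.single 0 1 ↔
      k 0 0 = c ∧ (∀ a, k (mid a) 0 = 0) ∧ k 7 0 = 0 := by
    intro c
    rw [mulVec_single_one, funext_iff, forall_fin8]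
    have e7 : (7 : Fin 8) ≠ 0 := by decide
    have em : ∀ a, mid a ≠ 0 := by decide
    simp [Pi.single_apply, e7, em]
  constructor
  · rintro ⟨h | h, c, hc, hk⟩
    · obtain ⟨h1, h2, h3⟩ := (h0 c).1 hk
      exact ⟨1, c, by norm_num, hc, by rw [h, one_smul], h1, h2, h3⟩
    · obtain ⟨h1, h2, h3⟩ := (h0 c).1 hk
      exact ⟨-1, c, by norm_num, hc, by rw [h, neg_smul, one_smul], h1, h2, h3⟩
  · rintro ⟨ε, c, h⟩
    refine ⟨?_, c, h.pos, (h0 c).2 ⟨h.e00, h.em0, h.e70⟩⟩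
    rcases mul_self_eq_one_iff.1 h.sq with rfl | rfl
    · exact .inl (by rw [h.form, one_smul])
    · exact .inr (by rw [h.form, neg_smul, one_smul])

namespace IsParabolic

variable {ε c : ℝ} {k : Matrix (Fin 8) (Fin 8) ℝ}

lemma apply_form (h : IsParabolic ε c k) (a b : Fin 8) :
    -k 0 a * k 7 b + ∑ c, k (mid c) a * k (mid (c + 3)) b - k 7 a * k 0 b = ε * form44 a b := by
  rw [← transpose_form44_mul, h.form]; rfl

lemma e7m (h : IsParabolic ε c k) (b : Fin 6) : k 7 (mid b) = 0 := by
  have := h.apply_form 0 (mid b)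
  simp only [h.e00, h.em0, h.e70, form44_0mid] at this
  simpa [h.pos.ne'] using this

lemma e77 (h : IsParabolic ε c k) : k 7 7 = ε / c := by
  have := h.apply_form 0 7
  simp only [h.e00, h.em0, h.e70, show form44 0 7 = -1 from rfl] at this
  have hc := h.pos.ne'
  field_simp
  simp at this
  linarith

lemma emm (h : IsParabolic ε c k) (a b : Fin 6) :
    ∑ c, k (mid c) (mid a) * k (mid (c + 3)) (mid b) = if b = a + 3 then ε else 0 := by
  have := h.apply_form (mid a) (mid b)
  simpa [h.e7m, form44_apply_mid] using this

lemma em7 (h : IsParabolic ε c k) (a : Fin 6) :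
    ∑ c, k (mid c) (mid a) * k (mid (c + 3)) 7 = k 0 (mid a) * (ε / c) := by
  have := h.apply_form (mid a) 7
  simp only [h.e7m, h.e77, form44_mid7] at this
  linarith

lemma e07 (h : IsParabolic ε c k) :
    ∑ c, k (mid c) 7 * k (mid (c + 3)) 7 = 2 * k 0 7 * (ε / c) := by
  have := h.apply_form 7 7
  simp only [h.e77, show form44 7 7 = 0 from rfl] at this
  linarith

/-- The inverse of the block on the indices `1, …, 6`. -/
lemma mid_inverse (h : IsParabolic ε c k) (a b : Fin 6) :
    ∑ c, (ε * k (mid (c + 3)) (mid (a + 3))) * k (mid c) (mid b) = if a = b then 1 else 0 := by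
  have := h.emm b (a + 3)
  simp only [mul_assoc, ← Finset.mul_sum]
  simp only [mul_comm (k (mid (_ + 3)) _), this, add_left_inj]
  split_ifs <;> simp [h.sq]

lemma mid_inverse' (h : IsParabolic ε c k) (a b : Fin 6) :
    ∑ c, k (mid a) (mid c) * (ε * k (mid (b + 3)) (mid (c + 3))) = if a = b then 1 else 0 := by
  have e : (Matrix.of fun a c => ε * k (mid (c + 3)) (mid (a + 3)) : Matrix (Fin 6) (Fin 6) ℝ) *
      Matrix.of (fun a b => k (mid a) (mid b)) = 1 := by
    ext a b
    rw [Matrix.mul_apply, Matrix.one_apply, ← h.mid_inverse a b]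
    rfl
  have e' := mul_eq_one_comm.1 e
  have := congrFun (congrFun e' a) b
  rw [Matrix.mul_apply, Matrix.one_apply] at this
  exact this

lemma mul_inv (h : IsParabolic ε c k) : (ε • (form44 * kᵀ * form44)) * k = 1 := by
  rw [smul_mul_assoc, mul_assoc, mul_assoc, ← mul_assoc kᵀ, h.form, Matrix.mul_smul,
    form44_mul_self, smul_smul, h.sq, one_smul]

lemma inv_mul_self (h : IsParabolic ε c k) : k⁻¹ * k = 1 := by
  rw [inv_eq_left_inv h.mul_inv, h.mul_inv]

lemma mul_inv_self (h : IsParabolic ε c k) : k * k⁻¹ = 1 := mul_eq_one_comm.1 h.inv_mul_self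

lemma det_ne_zero (h : IsParabolic ε c k) : k.det ≠ 0 := by
  intro h0
  have := congrArg Matrix.det h.inv_mul_self
  rw [Matrix.det_mul, h0, mul_zero, Matrix.det_one] at this
  exact zero_ne_one this

end IsParabolic

/-- The vector with entries `x, u₁, …, u₆, z`. -/
def vec8 {α : Type*} (x : α) (u : Fin 6 → α) (z : α) : Fin 8 → α :=
  Fin.snoc (α := fun _ => α) (Fin.cons (α := fun _ => α) x u) z

section

variable {α : Type*} (x : α) (u : Fin 6 → α) (z : α)

lemma vec8_zero : vec8 x u z 0 = x := rfl
lemma vec8_mid (a : Fin 6) : vec8 x u z (mid a) = u a := by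
  rw [vec8, mid, Fin.snoc_castSucc, Fin.cons_succ]
lemma vec8_seven : vec8 x u z 7 = z := Fin.snoc_last (α := fun _ => α) _ _

end

/-- The parabolic matrix with given diagonal blocks and first row. -/
def parabolicMatrix (ε c : ℝ) (h : Fin 6 → Fin 6 → ℝ) (ξ : Fin 6 → ℝ) : Matrix (Fin 8) (Fin 8) ℝ :=
  Matrix.of (vec8 (vec8 c ξ ((1 / 2) * c⁻¹ * ∑ b, ξ b * ξ (b + 3)))
    (fun a => vec8 0 (h a) (c⁻¹ * ∑ b, h a b * ξ (b + 3))) (vec8 0 0 (ε * c⁻¹)))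

section

variable {ε c : ℝ} {h : Fin 6 → Fin 6 → ℝ} {ξ : Fin 6 → ℝ}

lemma sum_add_three (f : Fin 6 → ℝ) : ∑ b, f (b + 3) = ∑ b, f b :=
  Equiv.sum_comp (Equiv.addRight (3 : Fin 6)) f

lemma isParabolic_parabolicMatrix (hε : ε * ε = 1) (hc : 0 < c)
    (hh : ∀ a b, ∑ c, h c a * h (c + 3) b = if b = a + 3 then ε else 0) :
    IsParabolic ε c (parabolicMatrix ε c h ξ) := by
  have hc' := hc.ne'
  have e1 : ∀ a, ∑ d, h d a * ∑ b, h (d + 3) b * ξ (b + 3) = ε * ξ a := by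
    intro a
    simp only [Finset.mul_sum, ← mul_assoc]
    rw [Finset.sum_comm]
    simp only [← Finset.sum_mul, hh]
    simp [add_three_add_three]
  have e2 : ∀ a, ∑ d, h (d + 3) a * ∑ b, h d b * ξ (b + 3) = ε * ξ a := by
    intro a
    rw [← e1 a, ← sum_add_three]
    simp only [add_three_add_three]
  have e3 : ∀ S : Fin 6 → ℝ, (∀ a, ∑ d, h d a * S d = ε * ξ a) → ∑ d, (∑ b, h d b * ξ (b + 3)) * S d =
      ε * ∑ b, ξ b * ξ (b + 3) := by
    intro S e1
    have e4 : ∀ d, (∑ b, h d b * ξ (b + 3)) * S d = ∑ b, ξ (b + 3) * (h d b * S d) := fun d => by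
      rw [Finset.sum_mul]
      exact Finset.sum_congr rfl fun b _ => by ring
    simp only [e4]
    rw [Finset.sum_comm, Finset.mul_sum]
    refine Finset.sum_congr rfl fun b _ => ?_
    rw [← Finset.mul_sum, e1]
    ring
  refine ⟨hε, hc, ?_, rfl, fun a => ?_, rfl⟩
  · ext a b
    rw [transpose_form44_mul, Matrix.smul_apply, smul_eq_mul]
    have p0 : parabolicMatrix ε c h ξ 0 = vec8 c ξ ((1 / 2) * c⁻¹ * ∑ b, ξ b * ξ (b + 3)) := rfl
    have pm : ∀ a, parabolicMatrix ε c h ξ (mid a) =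
        vec8 0 (h a) (c⁻¹ * ∑ b, h a b * ξ (b + 3)) := fun a => vec8_mid _ _ _ a
    have p7 : parabolicMatrix ε c h ξ 7 = vec8 0 0 (ε * c⁻¹) :=
      vec8_seven (vec8 c ξ ((1 / 2) * c⁻¹ * ∑ b, ξ b * ξ (b + 3)))
        (fun a => vec8 0 (h a) (c⁻¹ * ∑ b, h a b * ξ (b + 3))) _
    rw [p0, p7]
    simp only [pm]
    revert b
    rw [forall_fin8]
    revert a
    rw [forall_fin8]
    simp only [vec8_zero, vec8_mid, vec8_seven]
    refine ⟨⟨?_, fun a => ?_, ?_⟩, fun b => ⟨?_, fun a => ?_, ?_⟩, ⟨?_, fun a => ?_, ?_⟩⟩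
    · simp [show form44 0 0 = 0 from rfl]
    · simp [form44_0mid]
    · rw [show form44 0 7 = -1 from rfl]
      field_simp
      simp
    · simp [form44_mid0]
    · rw [hh, form44_apply_mid]
      simp
    · rw [form44_mid7]
      have : ∑ d, h d b * (c⁻¹ * ∑ b, h (d + 3) b * ξ (b + 3)) =
          c⁻¹ * ∑ d, h d b * ∑ b, h (d + 3) b * ξ (b + 3) := by
        rw [Finset.mul_sum]
        exact Finset.sum_congr rfl fun d _ => by ring
      rw [this, e1, Pi.zero_apply]
      ring
    · rw [show form44 7 0 = -1 from rfl]
      field_simp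
      simp
    · rw [form44_7mid]
      have : ∑ d, c⁻¹ * (∑ b, h d b * ξ (b + 3)) * h (d + 3) a =
          c⁻¹ * ∑ d, h (d + 3) a * ∑ b, h d b * ξ (b + 3) := by
        rw [Finset.mul_sum]
        exact Finset.sum_congr rfl fun d _ => by ring
      rw [this, e2, Pi.zero_apply]
      ring
    · rw [show form44 7 7 = 0 from rfl]
      have : ∑ d, c⁻¹ * (∑ b, h d b * ξ (b + 3)) * (c⁻¹ * ∑ b, h (d + 3) b * ξ (b + 3)) =
          c⁻¹ * c⁻¹ * ∑ d, (∑ b, h d b * ξ (b + 3)) * ∑ b, h (d + 3) b * ξ (b + 3) := by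
        rw [Finset.mul_sum]
        exact Finset.sum_congr rfl fun d _ => by ring
      rw [this, e3 _ e1]
      ring
  · simp [parabolicMatrix, vec8_mid, vec8_zero]

end

end Parabolic

section Transform

open Matrix

variable {Γ Γ' : GaugeForm M} {k : M → Matrix (Fin 8) (Fin 8) ℝ}

lemma FunSmoothAt.continuousAt {f : M → ℝ} (h : FunSmoothAt f x) : ContinuousAt f x :=
  ((contMDiffAt_iff_chart f x).2 h).continuousAt

lemma eventually_eq_of_sq_eq_one {f : M → ℝ} (h : ContinuousAt f x)
    (h1 : ∀ᶠ y in nhds x, f y * f y = 1) : ∀ᶠ y in nhds x, f y = f x := by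
  have h2 : ∀ᶠ y in nhds x, |f y - f x| < 1 := by
    have := (Metric.continuousAt_iff'.1 h) 1 one_pos
    simpa [Real.dist_eq] using this
  have h3 := h1.self_of_nhds
  filter_upwards [h1, h2] with y h1 h2
  rcases mul_self_eq_one_iff.1 h1 with e | e <;>
    rcases mul_self_eq_one_iff.1 h3 with e' | e' <;> rw [e, e'] at h2 ⊢ <;>
    norm_num at h2

/-- A smooth map to the structure group of the conformal Cartan bundle relating two gauges. -/
structure GaugeMap (U : Set M) (Γ Γ' : GaugeForm M) (k : M → Matrix (Fin 8) (Fin 8) ℝ) : Prop where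
  isOpen : IsOpen U
  smooth : ∀ x ∈ U, MatSmoothAt k x
  parabolic : ∀ x ∈ U, ∃ ε c, IsParabolic ε c (k x)
  eq : ∀ x ∈ U, ∀ v, k x * evM Γ' x v = evM Γ x v * k x + diffM k x v

namespace GaugeMap

lemma eventually_form (g : GaugeMap U Γ Γ' k) (hx : x ∈ U) {ε c : ℝ} (hk : IsParabolic ε c (k x)) :
    ∀ᶠ y in nhds x, (k y)ᵀ * form44 * k y = ε • form44 := by
  let E : M → ℝ := fun y => -((k y)ᵀ * form44 * k y) 0 7
  have e1 : ∀ y ε c, IsParabolic ε c (k y) → E y = ε := by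
    intro y ε c h
    simp only [E, h.form, Matrix.smul_apply, show form44 0 7 = -1 from rfl, smul_eq_mul]
    ring
  have hU := g.isOpen.mem_nhds hx
  have hE : ContinuousAt E x := FunSmoothAt.continuousAt
    ((((g.smooth x hx).transpose.mul (.const form44)).mul (g.smooth x hx)) 0 7).neg
  have h2 := eventually_eq_of_sq_eq_one hE (by
    filter_upwards [hU] with y hy
    obtain ⟨ε, c, h⟩ := g.parabolic y hy
    rw [e1 y ε c h, h.sq])
  filter_upwards [hU, h2] with y hy h2
  obtain ⟨ε', c', h⟩ := g.parabolic y hy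
  rw [h.form, ← e1 y ε' c' h, h2, e1 x ε c hk]

lemma skew (g : GaugeMap U Γ Γ' k) (h : ∀ x ∈ U, ∀ v, IsSkewMatrix (evM Γ x v)) (hx : x ∈ U)
    (v : 𝕋 x) : IsSkewMatrix (evM Γ' x v) := by
  obtain ⟨ε, c, hk⟩ := g.parabolic x hx
  have hs := g.smooth x hx
  have hd := diffM_congr (l := fun _ => ε • form44) (g.eventually_form hx hk) v
  rw [diffM_const, diffM_mul (hs.transpose.mul (.const form44)) hs, diffM_mul hs.transpose
    (.const form44), diffM_transpose, diffM_const, mul_zero, add_zero] at hd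
  have hΓ := isSkewMatrix_iff.2 (h x hx v)
  have heq := g.eq x hx v
  refine isSkewMatrix_iff.1 ?_
  have e1 : ε • (form44 * evM Γ' x v) = (k x)ᵀ * (form44 * evM Γ x v) * k x +
      (k x)ᵀ * form44 * diffM k x v := by
    rw [← Matrix.smul_mul, ← hk.form, mul_assoc, heq]
    simp only [mul_add, mul_assoc]
  have e2 : ε • ((evM Γ' x v)ᵀ * form44) = (k x)ᵀ * ((evM Γ x v)ᵀ * form44) * k x +
      (diffM k x v)ᵀ * form44 * k x := by
    have := congrArg Matrix.transpose e1
    simp only [transpose_smul, transpose_add, transpose_mul, transpose_transpose,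
      form44_transpose] at this
    rw [this]
    simp only [mul_assoc]
  have e3 : ε • (form44 * evM Γ' x v + (evM Γ' x v)ᵀ * form44) = 0 := by
    have : (k x)ᵀ * (form44 * evM Γ x v + (evM Γ x v)ᵀ * form44) * k x = 0 := by rw [hΓ]; simp
    rw [mul_add, add_mul] at this
    rw [smul_add, e1, e2]
    calc _ = ((k x)ᵀ * (form44 * evM Γ x v) * k x + (k x)ᵀ * ((evM Γ x v)ᵀ * form44) * k x) +
          ((diffM k x v)ᵀ * form44 * k x + (k x)ᵀ * form44 * diffM k x v) := by abel
      _ = 0 := by rw [this, hd, add_zero]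
  refine (smul_eq_zero.1 e3).resolve_left fun h0 => ?_
  have := hk.sq
  rw [h0] at this
  norm_num at this

lemma curv (g : GaugeMap U Γ Γ' k) (hΓ : ∀ a b, (Γ a b).SmoothAt x)
    (hΓ' : ∀ a b, (Γ' a b).SmoothAt x) (hx : x ∈ U) (v w : 𝕋 x) :
    k x * curvM Γ' x v w = curvM Γ x v w * k x :=
  curvM_gauge hΓ hΓ' (g.smooth x hx)
    (Filter.mem_of_superset (g.isOpen.mem_nhds hx) fun y hy => g.eq y hy) v w

lemma diff_mid0 (g : GaugeMap U Γ Γ' k) (hx : x ∈ U) (a : Fin 6) (v : 𝕋 x) :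
    diffM k x v (mid a) 0 = 0 := by
  refine (diff_congr (g := fun _ => (0 : ℝ)) ?_ v).trans (diff_const 0 v)
  filter_upwards [g.isOpen.mem_nhds hx] with y hy
  obtain ⟨ε, c, hk⟩ := g.parabolic y hy
  exact hk.em0 a

/-- The soldering forms of two gauges. -/
lemma solder_eq (g : GaugeMap U Γ Γ' k) (h : ∀ x ∈ U, ∀ v, IsSkewMatrix (evM Γ x v)) (hx : x ∈ U)
    {ε c : ℝ} (hk : IsParabolic ε c (k x)) (a : Fin 6) (v : 𝕋 x) :
    ∑ b, k x (mid a) (mid b) * Γ' (mid b) 0 x v = c * Γ (mid a) 0 x v := by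
  have h1 := congrFun (congrFun (g.eq x hx v) (mid a)) 0
  rw [Matrix.add_apply, g.diff_mid0 hx, add_zero, Matrix.mul_apply, Matrix.mul_apply, sum_fin8,
    sum_fin8, (g.skew h hx v).e70] at h1
  simp only [hk.em0, hk.e70, hk.e00] at h1
  change 0 * _ + ∑ b, k x (mid a) (mid b) * Γ' (mid b) 0 x v + k x (mid a) 7 * 0 =
    Γ (mid a) 0 x v * c + ∑ b, _ * 0 + _ * 0 at h1
  simp only [mul_zero, Finset.sum_const_zero] at h1
  linarith

/-- The top left entries of two gauges. -/
lemma zero_zero_eq (g : GaugeMap U Γ Γ' k) (h : ∀ x ∈ U, ∀ v, IsSkewMatrix (evM Γ x v)) (hx : x ∈ U)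
    {ε c : ℝ} (hk : IsParabolic ε c (k x)) (v : 𝕋 x) :
    c * Γ' 0 0 x v + ∑ b, k x 0 (mid b) * Γ' (mid b) 0 x v =
      c * Γ 0 0 x v + diff (fun y => k y 0 0) x v := by
  have h1 := congrFun (congrFun (g.eq x hx v) 0) 0
  rw [Matrix.add_apply, Matrix.mul_apply, Matrix.mul_apply, sum_fin8,
    sum_fin8, (g.skew h hx v).e70] at h1
  simp only [hk.em0, hk.e70, hk.e00] at h1
  change c * Γ' 0 0 x v + ∑ b, k x 0 (mid b) * Γ' (mid b) 0 x v + _ * 0 =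
    Γ 0 0 x v * c + ∑ b, _ * 0 + _ * 0 + diff (fun y => k y 0 0) x v at h1
  simp only [mul_zero, Finset.sum_const_zero] at h1
  linarith

end GaugeMap

lemma GaugeForm.metric_apply (Γ : GaugeForm M) (v w : 𝕋 x) :
    Γ.metric x v w = ∑ a, Γ (mid a) 0 x v * Γ (mid (a + 3)) 0 x w := by
  rw [Fin.sum_univ_six]
  change Γ 1 0 x v * Γ 4 0 x w + Γ 4 0 x v * Γ 1 0 x w + (Γ 2 0 x v * Γ 5 0 x w +
    Γ 5 0 x v * Γ 2 0 x w) + (Γ 3 0 x v * Γ 6 0 x w + Γ 6 0 x v * Γ 3 0 x w) =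
    Γ 1 0 x v * Γ 4 0 x w + Γ 2 0 x v * Γ 5 0 x w + Γ 3 0 x v * Γ 6 0 x w +
    Γ 4 0 x v * Γ 1 0 x w + Γ 5 0 x v * Γ 2 0 x w + Γ 6 0 x v * Γ 3 0 x w
  ring

lemma GaugeMap.metric_eq (g : GaugeMap U Γ Γ' k) (h : ∀ x ∈ U, ∀ v, IsSkewMatrix (evM Γ x v))
    (hx : x ∈ U) {ε c : ℝ} (hk : IsParabolic ε c (k x)) (v w : 𝕋 x) :
    ε * Γ'.metric x v w = c * c * Γ.metric x v w := by
  rw [GaugeForm.metric_apply, GaugeForm.metric_apply, Finset.mul_sum]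
  have e : ∀ a, c * c * (Γ (mid a) 0 x v * Γ (mid (a + 3)) 0 x w) =
      ∑ d, ∑ b, Γ' (mid b) 0 x v * Γ' (mid d) 0 x w *
        (k x (mid a) (mid b) * k x (mid (a + 3)) (mid d)) := fun a => by
    rw [mul_mul_mul_comm, ← g.solder_eq h hx hk, ← g.solder_eq h hx hk, Finset.mul_sum]
    refine Finset.sum_congr rfl fun d _ => ?_
    rw [Finset.sum_mul]
    exact Finset.sum_congr rfl fun b _ => by ring
  have e2 : ∑ a, ∑ d, ∑ b, Γ' (mid b) 0 x v * Γ' (mid d) 0 x w *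
      (k x (mid a) (mid b) * k x (mid (a + 3)) (mid d)) =
      ∑ b, ∑ d, Γ' (mid b) 0 x v * Γ' (mid d) 0 x w * if d = b + 3 then ε else 0 := by
    simp only [← hk.emm, Finset.mul_sum]
    rw [Finset.sum_comm_cycle]
    exact Finset.sum_congr rfl fun b _ => Finset.sum_comm
  rw [Finset.mul_sum]
  simp only [e, e2]
  refine Finset.sum_congr rfl fun b _ => ?_
  simp only [mul_ite, mul_zero, Finset.sum_ite_eq', Finset.mem_univ, if_true]
  ring

end Transform

section NormalTransform

open Matrix

variable {Γ Γ' : GaugeForm M} {k : M → Matrix (Fin 8) (Fin 8) ℝ}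

lemma isAlt_curvM (Γ : GaugeForm M) (a b : Fin 8) : IsAlt fun v w => curvM Γ x v w a b := by
  have e : (fun v w => curvM Γ x v w a b) = fun v w => extD (Γ a b) x v w +
      ∑ c, wedge (Γ a c) (Γ c b) x v w := by
    funext v w
    rw [← GaugeForm.curv_eq]
    rfl
  rw [e]
  exact (isAlt_extD _ x).add (.sum _ fun c => isAlt_wedge _ _ x)

lemma IsNormalConformalGauge.isOpen (h : IsNormalConformalGauge D U Γ) : IsOpen U :=
  h.conformal.isOpen

lemma IsNormalConformalGauge.smoothAt (h : IsNormalConformalGauge D U Γ) (hx : x ∈ U)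
    (a b : Fin 8) : (Γ a b).SmoothAt x :=
  (smoothOneFormOn_iff_smoothAt h.isOpen).1 (h.smooth a b) x hx

lemma IsNormalConformalGauge.isSkewMatrix (h : IsNormalConformalGauge D U Γ) (hx : x ∈ U)
    (v : 𝕋 x) : IsSkewMatrix (evM Γ x v) := isSkewMatrix_iff.1 (h.skew x hx v)

set_option synthInstance.maxHeartbeats 400000 in
lemma Coframing.smoothBilinOn_metric {c : Coframing M} (hU : IsOpen U)
    (hθ : ∀ i, SmoothOneFormOn U (c.θ i)) (hω : ∀ i, SmoothOneFormOn U (c.om i)) :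
    SmoothBilinOn U c.metric := by
  have e : ∀ i ∈ Finset.univ, SmoothBilinOn U (symProd (c.θ i) (c.om i)) := fun i _ =>
    smoothBilinOn_symProd hU (hθ i) (hω i)
  have := ContMDiffOn.sum_section e
  simpa only [SmoothBilinOn, Coframing.metric, Finset.sum_apply] using this

/-- The coframing of a gauge. -/
def GaugeForm.coframing (Γ : GaugeForm M) : Coframing M where
  θ i := Γ (idx8 (.inl i)) 0
  om i := Γ (idx8 (.inr i)) 0

lemma GaugeForm.coframing_metric (Γ : GaugeForm M) : Γ.coframing.metric = Γ.metric := by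
  rw [Coframing.metric, Fin.sum_univ_three, symProd_comm (Γ.coframing.θ 0),
    symProd_comm (Γ.coframing.θ 1), symProd_comm (Γ.coframing.θ 2)]
  rfl

lemma smoothBilinOn_gaugeMetric (hU : IsOpen U) (h : ∀ a b, SmoothOneFormOn U (Γ a b)) :
    SmoothBilinOn U Γ.metric := by
  rw [← Γ.coframing_metric]
  exact Coframing.smoothBilinOn_metric hU (fun i => h _ _) fun i => h _ _

namespace GaugeMap

variable (g : GaugeMap U Γ Γ' k) (h : IsNormalConformalGauge D U Γ)

include g h

lemma solder' (hx : x ∈ U) {ε c : ℝ} (hk : IsParabolic ε c (k x)) (a : Fin 6)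
    (v : 𝕋 x) : Γ' (mid a) 0 x v =
      ∑ b, (ε * k x (mid (b + 3)) (mid (a + 3))) * (c * Γ (mid b) 0 x v) := by
  have := fun b => g.solder_eq (fun x hx v => h.isSkewMatrix hx v) hx hk b v
  simp only [← this, Finset.mul_sum, ← mul_assoc]
  rw [Finset.sum_comm]
  simp only [← Finset.sum_mul, hk.mid_inverse]
  simp

lemma conformal (hS : ∀ a b, SmoothOneFormOn U (Γ' a b)) : RepresentsConformal D U Γ'.metric where
  isOpen := h.isOpen
  smooth := smoothBilinOn_gaugeMetric h.isOpen hS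
  symm x hx v w := by
    simp only [GaugeForm.metric_apply]
    rw [← sum_add_three]
    simp only [add_three_add_three, mul_comm]
  nondegenerate x hx v hv := by
    obtain ⟨ε, c, hk⟩ := g.parabolic x hx
    refine h.conformal.nondegenerate x hx v fun w => ?_
    have := g.metric_eq (fun x hx v => h.isSkewMatrix hx v) hx hk v w
    rw [hv, mul_zero] at this
    have hc := mul_pos hk.pos hk.pos
    exact (mul_eq_zero.1 this.symm).resolve_left hc.ne'
  multiple V hV c hc x hx := by
    obtain ⟨ε, r, hk⟩ := g.parabolic x (hV hx)
    obtain ⟨s, hs⟩ := h.conformal.multiple V hV c hc x hx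
    refine ⟨ε * (r * r) * s, fun v w => ?_⟩
    have := g.metric_eq (fun x hx v => h.isSkewMatrix hx v) (hV hx) hk v w
    rw [hs] at this
    linear_combination ε * this - Γ'.metric x v w * hk.sq

lemma curv_col0 (hS : ∀ a b, (Γ' a b).SmoothAt x) (hx : x ∈ U) (v w : 𝕋 x) :
    (∀ a, curvM Γ' x v w (mid a) 0 = 0) ∧ curvM Γ' x v w 0 0 = curvM Γ x v w 0 0 := by
  obtain ⟨ε, c, hk⟩ := g.parabolic x hx
  have hF := g.curv (h.smoothAt hx) hS hx v w
  have h7 : curvM Γ' x v w 7 0 = 0 :=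
    (isSkewMatrix_iff.1 (curvM_skew hS (Filter.mem_of_superset (h.isOpen.mem_nhds hx)
      fun y hy v => isSkewMatrix_iff.2 (g.skew (fun x hx v => h.isSkewMatrix hx v) hy v)) v w)).e70
  have h0 : ∀ a, curvM Γ x v w (mid a) 0 = 0 := fun a => by
    rw [← GaugeForm.curv_eq, h.torsion_free x hx]
  have e1 : ∀ a, ∑ b, k x (mid a) (mid b) * curvM Γ' x v w (mid b) 0 = 0 := by
    intro a
    have := congrFun (congrFun hF (mid a)) 0
    rw [Matrix.mul_apply, Matrix.mul_apply, sum_fin8, sum_fin8] at this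
    simpa [hk.em0, hk.e70, hk.e00, h7, h0] using this
  have e2 : ∀ a, curvM Γ' x v w (mid a) 0 = 0 := by
    intro a
    have : ∑ b, (ε * k x (mid (b + 3)) (mid (a + 3))) *
        ∑ d, k x (mid b) (mid d) * curvM Γ' x v w (mid d) 0 = 0 := by
      simp only [e1, mul_zero, Finset.sum_const_zero]
    simp only [Finset.mul_sum, ← mul_assoc] at this
    rw [Finset.sum_comm] at this
    simp only [← Finset.sum_mul, hk.mid_inverse] at this
    simpa using this
  refine ⟨e2, ?_⟩
  have := congrFun (congrFun hF 0) 0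
  rw [Matrix.mul_apply, Matrix.mul_apply, sum_fin8, sum_fin8] at this
  simp only [hk.em0, hk.e70, hk.e00, h7, e2, mul_zero, Finset.sum_const_zero, add_zero] at this
  exact mul_left_cancel₀ hk.pos.ne' (this.trans (mul_comm _ _))

lemma curv_mid (hS : ∀ a b, (Γ' a b).SmoothAt x) (hx : x ∈ U) (a b : Fin 6)
    (v w : 𝕋 x) :
    ∑ d, k x (mid a) (mid d) * curvM Γ' x v w (mid d) (mid b) =
      ∑ d, curvM Γ x v w (mid a) (mid d) * k x (mid d) (mid b) := by
  obtain ⟨ε, c, hk⟩ := g.parabolic x hx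
  have hF := g.curv (h.smoothAt hx) hS hx v w
  have h7 := (isSkewMatrix_iff.1 (curvM_skew hS (Filter.mem_of_superset (h.isOpen.mem_nhds hx)
      fun y hy v => isSkewMatrix_iff.2 (g.skew (fun x hx v => h.isSkewMatrix hx v) hy v)) v w)).e7m
  have h0 : ∀ a, curvM Γ x v w (mid a) 0 = 0 := fun a => by
    rw [← GaugeForm.curv_eq, h.torsion_free x hx]
  have := congrFun (congrFun hF (mid a)) (mid b)
  rw [Matrix.mul_apply, Matrix.mul_apply, sum_fin8, sum_fin8] at this
  simpa [hk.em0, hk.e7m, h7, h0, (curv_col0 g h hS hx v w).1] using this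

theorem isNormalConformalGauge (hS : ∀ a b, SmoothOneFormOn U (Γ' a b)) :
    IsNormalConformalGauge D U Γ' where
  smooth := hS
  skew x hx v := isSkewMatrix_iff.2 (g.skew (fun x hx v => h.isSkewMatrix hx v) hx v)
  solder x hx := by
    obtain ⟨ε, c, hk⟩ := g.parabolic x hx
    have hs := fun a v => g.solder_eq (fun x hx v => h.isSkewMatrix hx v) hx hk a v
    have hc := hk.pos.ne'
    constructor
    · intro v w hvw
      refine (h.solder x hx).1 (funext fun a => mul_left_cancel₀ hc ?_)
      change c * Γ (mid a) 0 x v = c * Γ (mid a) 0 x w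
      rw [← hs, ← hs]
      exact Finset.sum_congr rfl fun b _ => congrArg _ (congrFun hvw b)
    · intro u
      obtain ⟨v, hv⟩ := (h.solder x hx).2 fun a => c⁻¹ * ∑ b, k x (mid a) (mid b) * u b
      refine ⟨v, funext fun a => ?_⟩
      change Γ' (mid a) 0 x v = u a
      have hv' : ∀ b, Γ (mid b) 0 x v = c⁻¹ * ∑ d, k x (mid b) (mid d) * u d := congrFun hv
      rw [solder' g h hx hk]
      simp only [hv', mul_inv_cancel_left₀ hc, Finset.mul_sum, ← mul_assoc]
      rw [Finset.sum_comm]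
      simp only [← Finset.sum_mul, hk.mid_inverse]
      simp
  conformal := g.conformal h hS
  torsion_free x hx a v w := by
    rw [GaugeForm.curv_eq]
    exact (g.curv_col0 h (fun a b => (smoothOneFormOn_iff_smoothAt h.isOpen).1 (hS a b) x hx)
      hx v w).1 a
  normal x hx X' hX' b w := by
    have hS' := fun a b => (smoothOneFormOn_iff_smoothAt h.isOpen).1 (hS a b) x hx
    obtain ⟨ε, c, hk⟩ := g.parabolic x hx
    simp only [GaugeForm.curv_eq, (g.curv_col0 h hS' hx _ _).2]
    have hc := hk.pos.ne'
    let H : Matrix (Fin 6) (Fin 6) ℝ := Matrix.of fun a b => k x (mid a) (mid b)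
    let Hi : Matrix (Fin 6) (Fin 6) ℝ := Matrix.of fun a b => ε * k x (mid (b + 3)) (mid (a + 3))
    let F : 𝕋 x → Matrix (Fin 6) (Fin 6) ℝ := fun v =>
      Matrix.of fun a b => curvM Γ x v w (mid a) (mid b)
    let F' : 𝕋 x → Matrix (Fin 6) (Fin 6) ℝ := fun v =>
      Matrix.of fun a b => curvM Γ' x v w (mid a) (mid b)
    have hHi : Hi * H = 1 := by
      ext a b
      rw [Matrix.mul_apply, Matrix.one_apply, ← hk.mid_inverse a b]
      rfl
    have hHi' : H * Hi = 1 := mul_eq_one_comm.1 hHi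
    have hF : ∀ v, Hi * F v = F' v * Hi := by
      intro v
      have e : H * F' v = F v * H := by
        ext a b
        rw [Matrix.mul_apply, Matrix.mul_apply]
        exact g.curv_mid h hS' hx a b v w
      calc Hi * F v = Hi * (F v * H) * Hi := by rw [mul_assoc, mul_assoc, hHi', mul_one]
        _ = F' v * Hi := by rw [← e, ← mul_assoc, hHi, one_mul]
    let X : Fin 6 → 𝕋 x := fun d => ∑ b, (c * Hi b d) • X' b
    have hX : ∀ a d, Γ (mid a) 0 x (X d) = if a = d then 1 else 0 := by
      intro a d
      have e1 : ∀ b, c * Γ (mid a) 0 x (X' b) = H a b := fun b => by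
        rw [← g.solder_eq (fun x hx v => h.isSkewMatrix hx v) hx hk]
        simp [hX', H]
      have e2 := congrFun (congrFun hHi' a) d
      rw [Matrix.mul_apply, Matrix.one_apply] at e2
      simp only [X, map_sum, map_smul, smul_eq_mul, ← e2, ← e1]
      exact Finset.sum_congr rfl fun b _ => by ring
    have key := h.normal x hx X hX
    simp only [GaugeForm.curv_eq] at key
    have lin : ∀ a b d, curvM Γ x (X d) w a b = ∑ e, c * Hi e d * curvM Γ x (X' e) w a b := by
      intro a b d
      obtain ⟨B, -, hB⟩ := isAlt_curvM (x := x) Γ a b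
      simp only [hB, X, map_sum, map_smul, LinearMap.sum_apply, LinearMap.smul_apply, smul_eq_mul]
    have split : ∀ (G : Fin 6 → ℝ) (L : Fin 6 → ℝ) (b : Fin 6),
        ∑ a, (G a - if a = b then L a else 0) = ∑ a, G a - L b := by
      intro G L b
      simp [Finset.sum_sub_distrib]
    simp only [split] at key ⊢
    have key' : ∀ b, ∑ d, (∑ e, F' (X' e) e d - curvM Γ x (X' d) w 0 0) * Hi d b = 0 := by
      intro b
      have k1 := key b w
      simp only [lin] at k1
      rw [Finset.sum_comm] at k1
      have k2 : ∀ e, ∑ a, c * Hi e a * curvM Γ x (X' e) w (mid a) (mid b) =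
          c * ∑ d, F' (X' e) e d * Hi d b := by
        intro e
        have := congrFun (congrFun (hF (X' e)) e) b
        rw [Matrix.mul_apply, Matrix.mul_apply] at this
        rw [← this, Finset.mul_sum]
        exact Finset.sum_congr rfl fun a _ => mul_assoc _ _ _
      simp only [k2] at k1
      simp only [mul_assoc, ← Finset.mul_sum, ← mul_sub] at k1
      have k3 := (mul_eq_zero.1 k1).resolve_left hc
      have a1 : ∑ d, curvM Γ x (X' d) w 0 0 * Hi d b = ∑ d, Hi d b * curvM Γ x (X' d) w 0 0 :=
        Finset.sum_congr rfl fun a _ => mul_comm _ _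
      simp only [sub_mul, Finset.sum_sub_distrib, Finset.sum_mul]
      rw [a1, Finset.sum_comm]
      exact k3
    have fin : ∀ b, ∑ e, F' (X' e) e b - curvM Γ x (X' b) w 0 0 = 0 := by
      intro b
      have : ∑ a, (∑ d, (∑ e, F' (X' e) e d - curvM Γ x (X' d) w 0 0) * Hi d a) * H a b = 0 := by
        simp only [key', zero_mul, Finset.sum_const_zero]
      simp only [Finset.sum_mul (s := Finset.univ) (f := fun d => _ * Hi d _)] at this
      rw [Finset.sum_comm] at this
      simp only [mul_assoc, ← Finset.mul_sum] at this
      simp only [← Matrix.mul_apply, hHi, Matrix.one_apply] at this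
      simpa using this
    exact fin b

end GaugeMap

end NormalTransform

section Uniqueness

open Matrix

variable {Γ Γ' : GaugeForm M}

lemma eq_zero_of_skew_symm {ι : Type*} {f : ι → ι → ι → ℝ} (h1 : ∀ a b c, f a b c = -f b a c)
    (h2 : ∀ a b c, f a b c = f a c b) (a b c : ι) : f a b c = 0 := by
  linarith [h1 a b c, h2 b a c, h1 b c a, h2 c b a, h1 c a b, h2 a c b]

/-- A frame dual to the soldering form. -/
lemma IsNormalConformalGauge.exists_dual (h : IsNormalConformalGauge D U Γ) (hx : x ∈ U) :
    ∃ X : Fin 6 → 𝕋 x, (∀ a b, Γ (mid a) 0 x (X b) = if a = b then 1 else 0) ∧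
      ∀ v, v = ∑ a, Γ (mid a) 0 x v • X a := by
  choose X hX using fun b : Fin 6 => (h.solder x hx).2 fun a => if a = b then 1 else 0
  have hX' : ∀ a b, Γ (mid a) 0 x (X b) = if a = b then 1 else 0 := fun a b => congrFun (hX b) a
  refine ⟨X, hX', fun v => (h.solder x hx).1 (funext fun a => ?_)⟩
  change Γ (mid a) 0 x v = Γ (mid a) 0 x (∑ b, Γ (mid b) 0 x v • X b)
  simp [hX']

variable (h : IsNormalConformalGauge D U Γ) (h' : IsNormalConformalGauge D U Γ') (hs : ∀ x ∈ U, ∀ a, Γ' (mid a) 0 x = Γ (mid a) 0 x) (h0 : ∀ x ∈ U, Γ' 0 0 x = Γ 0 0 x)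

include h h' hs h0

lemma IsNormalConformalGauge.mid_eq (hx : x ∈ U) (a b : Fin 6) :
    Γ' (mid a) (mid b) x = Γ (mid a) (mid b) x := by
  obtain ⟨X, hX, hX'⟩ := h.exists_dual hx
  have hU := h.isOpen.mem_nhds hx
  have e1 : ∀ a v w, ∑ b, (wedge (Γ' (mid a) (mid b)) (Γ' (mid b) 0) x v w -
      wedge (Γ (mid a) (mid b)) (Γ (mid b) 0) x v w) = 0 := by
    intro a v w
    have t := h.torsion_free x hx a v w
    have t' := h'.torsion_free x hx a v w
    have d : extD (Γ' (mid a) 0) x v w = extD (Γ (mid a) 0) x v w :=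
      extD_congr (Filter.mem_of_superset hU fun y hy => hs y hy a) v w
    rw [GaugeForm.curv, sum_fin8] at t t'
    have z : ∀ v, Γ 7 0 x v = 0 := fun v => (h.isSkewMatrix hx v).e70
    have z' : ∀ v, Γ' 7 0 x v = 0 := fun v => (h'.isSkewMatrix hx v).e70
    rw [d] at t'
    simp only [wedge, hs x hx, h0 x hx, z, z', mul_zero, sub_zero, add_zero] at t t' ⊢
    rw [Finset.sum_sub_distrib]
    linarith
  have e2 : ∀ a c d, Γ' (mid a) (mid d) x (X c) - Γ (mid a) (mid d) x (X c) =
      Γ' (mid a) (mid c) x (X d) - Γ (mid a) (mid c) x (X d) := by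
    intro a c d
    have := e1 a (X c) (X d)
    simp only [wedge, hs x hx, hX, Finset.sum_sub_distrib, mul_ite, mul_one, mul_zero,
      Finset.sum_ite_eq', Finset.mem_univ, if_true] at this
    linarith
  have e3 : ∀ a b c, Γ' (mid (a + 3)) (mid b) x (X c) - Γ (mid (a + 3)) (mid b) x (X c) = 0 :=
    eq_zero_of_skew_symm (fun a b c => by
      have s : Γ (mid (a + 3)) (mid b) x (X c) = -Γ (mid (b + 3)) (mid a) x (X c) :=
        (h.isSkewMatrix hx (X c)).emm a b
      have s' : Γ' (mid (a + 3)) (mid b) x (X c) = -Γ' (mid (b + 3)) (mid a) x (X c) :=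
        (h'.isSkewMatrix hx (X c)).emm a b
      rw [s, s']
      ring) fun a b c => e2 _ _ _
  ext v
  rw [hX' v]
  simp only [map_sum, map_smul]
  refine Finset.sum_congr rfl fun c _ => ?_
  have := e3 (a + 3) b c
  rw [add_three_add_three] at this
  rw [sub_eq_zero.1 this]

lemma IsNormalConformalGauge.zero_mid_eq (hx : x ∈ U) (b : Fin 6) :
    Γ' 0 (mid b) x = Γ 0 (mid b) x := by
  obtain ⟨X, hX, hX'⟩ := h.exists_dual hx
  have hU := h.isOpen.mem_nhds hx
  let P : Fin 6 → Fin 6 → ℝ := fun b d => Γ' 0 (mid b) x (X d) - Γ 0 (mid b) x (X d)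
  have s := fun v => h.isSkewMatrix hx v
  have s' := fun v => h'.isSkewMatrix hx v
  have z : ∀ v, Γ 7 0 x v = 0 := fun v => (h.isSkewMatrix hx v).e70
  have z' : ∀ v, Γ' 7 0 x v = 0 := fun v => (h'.isSkewMatrix hx v).e70
  have m7 : ∀ a v, Γ (mid a) 7 x v = Γ 0 (mid (a + 3)) x v := fun a v => (s v).em7 a
  have m7' : ∀ a v, Γ' (mid a) 7 x v = Γ' 0 (mid (a + 3)) x v := fun a v => (s' v).em7 a
  have n7 : ∀ a v, Γ 7 (mid a) x v = Γ (mid (a + 3)) 0 x v := fun a v => (s v).e7m a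
  have n7' : ∀ a v, Γ' 7 (mid a) x v = Γ (mid (a + 3)) 0 x v := fun a v =>
    ((s' v).e7m a).trans (by rw [evM, of_apply, hs x hx])
  have c1 : ∀ a b v w, Γ'.curv (mid a) (mid b) x v w = Γ.curv (mid a) (mid b) x v w +
      (wedge (Γ (mid a) 0) (Γ' 0 (mid b)) x v w - wedge (Γ (mid a) 0) (Γ 0 (mid b)) x v w) +
      (wedge (Γ' 0 (mid (a + 3))) (Γ (mid (b + 3)) 0) x v w -
        wedge (Γ 0 (mid (a + 3))) (Γ (mid (b + 3)) 0) x v w) := by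
    intro a b v w
    have d : extD (Γ' (mid a) (mid b)) x v w = extD (Γ (mid a) (mid b)) x v w :=
      extD_congr (Filter.mem_of_superset hU fun y hy => h.mid_eq h' hs h0 hy a b) v w
    rw [GaugeForm.curv, GaugeForm.curv, sum_fin8, sum_fin8, d]
    simp only [wedge, hs x hx, h.mid_eq h' hs h0 hx, m7, m7', n7, n7']
    ring
  have c2 : ∀ v w, Γ'.curv 0 0 x v w = Γ.curv 0 0 x v w +
      ∑ c, (wedge (Γ' 0 (mid c)) (Γ (mid c) 0) x v w - wedge (Γ 0 (mid c)) (Γ (mid c) 0) x v w) := by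
    intro v w
    have d : extD (Γ' 0 0) x v w = extD (Γ 0 0) x v w :=
      extD_congr (Filter.mem_of_superset hU fun y hy => h0 y hy) v w
    rw [GaugeForm.curv, GaugeForm.curv, sum_fin8, sum_fin8, d, Finset.sum_sub_distrib]
    simp only [wedge, hs x hx, h0 x hx, z, z']
    ring
  have key : ∀ b d, 5 * P b d - P d b + (if b + 3 = d then ∑ a, P (a + 3) a else 0) = 0 := by
    intro b d
    have n := h.normal x hx X hX b (X d)
    have n' := h'.normal x hx X (fun a b => by rw [hs x hx, hX]) b (X d)
    simp only [c1, c2] at n'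
    have split : ∀ (G : Fin 6 → ℝ) (L : Fin 6 → ℝ) (b : Fin 6),
        ∑ a, (G a - if a = b then L a else 0) = ∑ a, G a - L b := by
      intro G L b
      simp [Finset.sum_sub_distrib]
    rw [split] at n n'
    simp only [Finset.sum_add_distrib] at n'
    have t1 : ∑ a, (wedge (Γ (mid a) 0) (Γ' 0 (mid b)) x (X a) (X d) -
        wedge (Γ (mid a) 0) (Γ 0 (mid b)) x (X a) (X d)) = 5 * P b d := by
      simp only [wedge, hX, P, Finset.sum_sub_distrib, ite_mul, one_mul, zero_mul,
        Finset.sum_ite_eq', Finset.sum_ite_eq, Finset.mem_univ, if_true, Finset.sum_const,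
        Finset.card_univ, Fintype.card_fin, nsmul_eq_mul]
      push_cast
      ring
    have t2 : ∑ a, (wedge (Γ' 0 (mid (a + 3))) (Γ (mid (b + 3)) 0) x (X a) (X d) -
        wedge (Γ 0 (mid (a + 3))) (Γ (mid (b + 3)) 0) x (X a) (X d)) =
        (if b + 3 = d then ∑ a, P (a + 3) a else 0) - P b d := by
      simp only [wedge, hX, P, Finset.sum_sub_distrib, mul_ite, mul_one, mul_zero,
        Finset.sum_ite_eq', Finset.sum_ite_eq, Finset.mem_univ, if_true, add_three_add_three,
        Finset.sum_ite_irrel, Finset.sum_const_zero]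
      split_ifs <;> ring
    have t3 : ∑ c, (wedge (Γ' 0 (mid c)) (Γ (mid c) 0) x (X b) (X d) -
        wedge (Γ 0 (mid c)) (Γ (mid c) 0) x (X b) (X d)) = P d b - P b d := by
      simp only [wedge, hX, P, Finset.sum_sub_distrib, mul_ite, mul_one, mul_zero,
        Finset.sum_ite_eq', Finset.mem_univ, if_true]
      ring
    rw [t1, t2, t3] at n'
    linarith
  have t0 : ∑ a, P (a + 3) a = 0 := by
    have k1 : ∀ b, 5 * P b (b + 3) - P (b + 3) b + ∑ a, P (a + 3) a = 0 := fun b => by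
      simpa using key b (b + 3)
    have k2 : ∑ b, P b (b + 3) = ∑ b, P (b + 3) b := by
      rw [← sum_add_three]
      simp only [add_three_add_three]
    have k3 := Finset.sum_congr (rfl : Finset.univ = Finset.univ) fun b _ => k1 b
    simp only [Finset.sum_add_distrib, Finset.sum_sub_distrib, ← Finset.mul_sum, k2,
      Finset.sum_const, Finset.card_univ, Fintype.card_fin, nsmul_eq_mul] at k3
    push_cast at k3
    linarith
  have P0 : ∀ b d, P b d = 0 := by
    intro b d
    have k1 := key b d
    have k2 := key d b
    simp only [t0, ite_self, add_zero] at k1 k2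
    linarith
  ext v
  rw [hX' v]
  simp only [map_sum, map_smul]
  exact Finset.sum_congr rfl fun c _ => by rw [sub_eq_zero.1 (P0 b c)]

/-- A normal gauge is determined by its soldering form and its top left entry. -/
theorem IsNormalConformalGauge.ev_eq (hx : x ∈ U) (v : 𝕋 x) :
    evM Γ' x v = evM Γ x v := by
  have s := h.isSkewMatrix hx v
  have s' := h'.isSkewMatrix hx v
  have e0 : evM Γ' x v 0 0 = evM Γ x v 0 0 := by simp only [evM, of_apply, h0 x hx]
  have e1 : ∀ a, evM Γ' x v (mid a) 0 = evM Γ x v (mid a) 0 := fun a => by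
    simp only [evM, of_apply, hs x hx]
  have e2 : ∀ a, evM Γ' x v 0 (mid a) = evM Γ x v 0 (mid a) := fun a => by
    simp only [evM, of_apply, h.zero_mid_eq h' hs h0 hx]
  ext a b
  revert b
  rw [forall_fin8]
  revert a
  rw [forall_fin8]
  refine ⟨⟨e0, e2, ?_⟩, fun b => ⟨e1 b, fun a => ?_, ?_⟩, ⟨?_, fun a => ?_, ?_⟩⟩
  · rw [s.e07, s'.e07]
  · simp only [evM, of_apply, h.mid_eq h' hs h0 hx]
  · rw [s.em7, s'.em7, e2]
  · rw [s.e70, s'.e70]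
  · rw [s.e7m, s'.e7m, e1]
  · rw [s.e77, s'.e77, e0]

end Uniqueness

section ExistsGauge

open Matrix

variable {Γ Γ' : GaugeForm M} {k : M → Matrix (Fin 8) (Fin 8) ℝ}

section Transform

variable {ι : Type*} [Fintype ι] [DecidableEq ι]

/-- The gauge transform `k⁻¹ Γ k + k⁻¹ dk`. -/
def gaugeTransform (Γ : Matrix ι ι (OneForm M)) (k : M → Matrix ι ι ℝ) : Matrix ι ι (OneForm M) :=
  fun a b => ∑ c, ∑ d, fsmul (fun y => (k y)⁻¹ a c * k y d b) (Γ c d) +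
    ∑ c, fsmul (fun y => (k y)⁻¹ a c) fun y => diff (fun z => k z c b) y

lemma mul_evM_gaugeTransform (Γ : Matrix ι ι (OneForm M)) {k : M → Matrix ι ι ℝ}
    (hk : IsUnit (k x).det) (v : 𝕋 x) :
    k x * evM (gaugeTransform Γ k) x v = evM Γ x v * k x + diffM k x v := by
  have : evM (gaugeTransform Γ k) x v =
      (k x)⁻¹ * evM Γ x v * k x + (k x)⁻¹ * diffM k x v := by
    ext a b
    simp only [Matrix.add_apply, Matrix.mul_apply, evM, of_apply, diffM]
    change (∑ c, ∑ d, fsmul (fun y => (k y)⁻¹ a c * k y d b) (Γ c d)) x v +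
      (∑ c, fsmul (fun y => (k y)⁻¹ a c) fun y => diff (fun z => k z c b) y) x v = _
    simp only [OneForm.sum_apply, fsmul_apply, Finset.sum_mul]
    rw [Finset.sum_comm]
    congr 1
    exact Finset.sum_congr rfl fun d _ => Finset.sum_congr rfl fun c _ => by ring
  rw [this, mul_add, ← mul_assoc, ← mul_assoc, ← mul_assoc, Matrix.mul_nonsing_inv _ hk, one_mul,
    one_mul]

lemma smoothAt_gaugeTransform {Γ : Matrix ι ι (OneForm M)} {k : M → Matrix ι ι ℝ}
    (hΓ : ∀ a b, (Γ a b).SmoothAt x) (hk : ∀ a b, FunSmoothAt (fun y => k y a b) x)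
    (h : (k x).det ≠ 0) (a b : ι) : (gaugeTransform Γ k a b).SmoothAt x := by
  have hi := FunSmoothAt.matrix_inv hk h
  exact (OneForm.SmoothAt.sum fun c _ => .sum fun d _ => (hΓ c d).fsmul ((hi a c).mul (hk d b))).add
    (.sum fun c _ => (hk c b).smoothAt_diff.fsmul (hi a c))

end Transform

lemma GaugeForm.gaugeMap_transform (hU : IsOpen U) (hk : ∀ x ∈ U, MatSmoothAt k x)
    (hp : ∀ x ∈ U, ∃ ε c, IsParabolic ε c (k x)) : GaugeMap U Γ (gaugeTransform Γ k) k where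
  isOpen := hU
  smooth := hk
  parabolic := hp
  eq x hx v := by
    obtain ⟨ε, c, h⟩ := hp x hx
    exact mul_evM_gaugeTransform Γ h.det_ne_zero.isUnit v

lemma GaugeForm.smooth_transform (hU : IsOpen U) (hΓ : ∀ a b, SmoothOneFormOn U (Γ a b))
    (hk : ∀ x ∈ U, MatSmoothAt k x) (hp : ∀ x ∈ U, ∃ ε c, IsParabolic ε c (k x)) (a b : Fin 8) :
    SmoothOneFormOn U (gaugeTransform Γ k a b) := by
  refine (smoothOneFormOn_iff_smoothAt hU).2 fun x hx => ?_
  obtain ⟨ε, c, h⟩ := hp x hx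
  exact smoothAt_gaugeTransform (fun c d => (smoothOneFormOn_iff_smoothAt hU).1 (hΓ c d) x hx)
    (hk x hx) h.det_ne_zero a b

lemma IsNormalConformalGauge.isCoframe (h : IsNormalConformalGauge D U Γ) :
    IsCoframe U fun a => Γ (mid a) 0 where
  isOpen := h.isOpen
  smooth a := h.smooth _ _
  coframeAt x hx := h.solder x hx

/-- A normal gauge can be transformed to one with a prescribed soldering form and top left entry. -/
theorem IsNormalConformalGauge.exists_gaugeMap (h : IsNormalConformalGauge D U Γ) {ε c : M → ℝ}
    {H : M → Fin 6 → Fin 6 → ℝ} {σ : OneForm M} (sε : ∀ x ∈ U, FunSmoothAt ε x)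
    (sc : ∀ x ∈ U, FunSmoothAt c x) (sH : ∀ x ∈ U, ∀ a b, FunSmoothAt (fun y => H y a b) x)
    (sσ : ∀ x ∈ U, σ.SmoothAt x) (hε : ∀ x ∈ U, ε x * ε x = 1) (hc : ∀ x ∈ U, 0 < c x)
    (hH : ∀ x ∈ U, ∀ a b, ∑ d, H x d a * H x (d + 3) b = if b = a + 3 then ε x else 0) :
    ∃ (Γ' : GaugeForm M) (k : M → Matrix (Fin 8) (Fin 8) ℝ), IsNormalConformalGauge D U Γ' ∧
      GaugeMap U Γ Γ' k ∧ (∀ x ∈ U, ∀ v, Γ' 0 0 x v = σ x v) ∧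
      (∀ x ∈ U, IsParabolic (ε x) (c x) (k x)) ∧ ∀ x a b, k x (mid a) (mid b) = H x a b := by
  have he := h.isCoframe
  let X : Fin 6 → (y : M) → 𝕋 y := dualVec fun a => Γ (mid a) 0
  let lam : OneForm M := fsmul c (Γ 0 0 - σ) + fun y => diff c y
  have slam : ∀ x ∈ U, lam.SmoothAt x := fun x hx =>
    (((h.smoothAt hx 0 0).sub (sσ x hx)).fsmul (sc x hx)).add (sc x hx).smoothAt_diff
  let ξ : Fin 6 → M → ℝ := fun b y => (c y)⁻¹ * ∑ a, H y a b * lam y (X a y)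
  have sci : ∀ x ∈ U, FunSmoothAt (fun y => (c y)⁻¹) x := fun x hx => (sc x hx).inv (hc x hx).ne'
  have sξ : ∀ x ∈ U, ∀ b, FunSmoothAt (ξ b) x := fun x hx b => (sci x hx).mul
    (.sum fun a _ => (sH x hx a b).mul ((slam x hx).apply (he.vecSmoothAt_dualVec hx a)))
  let k : M → Matrix (Fin 8) (Fin 8) ℝ := fun y => parabolicMatrix (ε y) (c y) (H y) fun b => ξ b y
  have hk : ∀ x ∈ U, IsParabolic (ε x) (c x) (k x) := fun x hx =>
    isParabolic_parabolicMatrix (hε x hx) (hc x hx) (hH x hx)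
  have sk : ∀ x ∈ U, MatSmoothAt k x := by
    intro x hx a b
    have s1 : FunSmoothAt (fun y => (1 / 2) * (c y)⁻¹ * ∑ b, ξ b y * ξ (b + 3) y) x :=
      ((sci x hx).const_mul _).mul (.sum fun b _ => (sξ x hx b).mul (sξ x hx _))
    have s2 : ∀ a, FunSmoothAt (fun y => (c y)⁻¹ * ∑ b, H y a b * ξ (b + 3) y) x := fun a =>
      (sci x hx).mul (.sum fun b _ => (sH x hx a b).mul (sξ x hx _))
    revert b
    rw [forall_fin8]
    revert a
    rw [forall_fin8]
    simp only [k, parabolicMatrix, of_apply, vec8_zero, vec8_mid, vec8_seven, Pi.zero_apply]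
    exact ⟨⟨sc x hx, sξ x hx, s1⟩, fun a => ⟨.const 0, sH x hx a, s2 a⟩, .const 0,
      fun _ => .const 0, (sε x hx).mul (sci x hx)⟩
  have hp : ∀ x ∈ U, ∃ ε c, IsParabolic ε c (k x) := fun x hx => ⟨_, _, hk x hx⟩
  have kmm : ∀ x a b, k x (mid a) (mid b) = H x a b := by
    intro x a b
    simp only [k, parabolicMatrix, of_apply, vec8_mid]
  have k0m : ∀ x b, k x 0 (mid b) = ξ b x := by
    intro x b
    simp only [k, parabolicMatrix, of_apply, vec8_zero, vec8_mid]
  have g : GaugeMap U Γ (gaugeTransform Γ k) k := GaugeForm.gaugeMap_transform h.isOpen sk hp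
  refine ⟨gaugeTransform Γ k, k, g.isNormalConformalGauge h (GaugeForm.smooth_transform h.isOpen
    h.smooth sk hp), g, fun x hx v => ?_, hk, kmm⟩
  have h00 := g.zero_zero_eq (fun x hx v => h.isSkewMatrix hx v) hx (hk x hx) v
  have hc0 := (hc x hx).ne'
  have e1 : lam x v = c x * (Γ 0 0 x v - σ x v) + diff c x v := rfl
  have e2 : lam x v = ∑ a, lam x (X a x) * Γ (mid a) 0 x v :=
    (he.coframeAt x hx).covector_apply (lam x : 𝕋 x →ₗ[ℝ] ℝ) v
  have e3 : diff (fun y => k y 0 0) x v = diff c x v := rfl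
  have e4 : ∑ b, ξ b x * gaugeTransform Γ k (mid b) 0 x v = lam x v := by
    have e5 : ∀ a, ∑ b, H x a b * gaugeTransform Γ k (mid b) 0 x v = c x * Γ (mid a) 0 x v := fun a => by
      rw [← g.solder_eq (fun x hx v => h.isSkewMatrix hx v) hx (hk x hx)]
      simp only [kmm]
    rw [e2]
    simp only [ξ, Finset.mul_sum, Finset.sum_mul]
    rw [Finset.sum_comm]
    refine Finset.sum_congr rfl fun a _ => ?_
    have : ∑ b, (c x)⁻¹ * (H x a b * lam x (X a x)) * gaugeTransform Γ k (mid b) 0 x v =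
        (c x)⁻¹ * lam x (X a x) * ∑ b, H x a b * gaugeTransform Γ k (mid b) 0 x v := by
      rw [Finset.mul_sum]
      exact Finset.sum_congr rfl fun b _ => by ring
    rw [this, e5]
    field_simp
  simp only [k0m, e4, e1, e3] at h00
  refine mul_left_cancel₀ hc0 ?_
  linarith

end ExistsGauge

section NormalEmbedding

open Matrix

lemma IsParabolic.ext {ε c : ℝ} {k k' : Matrix (Fin 8) (Fin 8) ℝ} (h : IsParabolic ε c k)
    (h' : IsParabolic ε c k') (hm : ∀ a b, k' (mid a) (mid b) = k (mid a) (mid b))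
    (h0 : ∀ b, k' 0 (mid b) = k 0 (mid b)) : k' = k := by
  have hc := h.pos.ne'
  have hε : ε ≠ 0 := by rintro rfl; simpa using h.sq
  have m7 : ∀ a, k' (mid a) 7 = k (mid a) 7 := by
    have e1 : ∀ a, ∑ d, k (mid d) (mid a) * (k' (mid (d + 3)) 7 - k (mid (d + 3)) 7) = 0 := by
      intro a
      have t := h.em7 a
      have t' := h'.em7 a
      simp only [hm, h0] at t'
      simp only [mul_sub, Finset.sum_sub_distrib, t, t', sub_self]
    have e2 : ∀ b, k' (mid (b + 3)) 7 - k (mid (b + 3)) 7 = 0 := by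
      intro b
      have : ∑ a, (ε * k (mid (b + 3)) (mid (a + 3))) *
          ∑ d, k (mid d) (mid a) * (k' (mid (d + 3)) 7 - k (mid (d + 3)) 7) = 0 := by
        simp only [e1, mul_zero, Finset.sum_const_zero]
      simp only [Finset.mul_sum, ← mul_assoc] at this
      rw [Finset.sum_comm] at this
      simp only [← Finset.sum_mul] at this
      have e3 : ∀ d, ∑ a, ε * k (mid (b + 3)) (mid (a + 3)) * k (mid d) (mid a) =
          if d = b then 1 else 0 := fun d => by
        rw [← h.mid_inverse' d b]
        exact Finset.sum_congr rfl fun a _ => mul_comm _ _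
      simp only [e3] at this
      simpa using this
    intro a
    have := e2 (a + 3)
    rw [add_three_add_three] at this
    linarith
  have e07 : k' 0 7 = k 0 7 := by
    have t := h.e07
    have t' := h'.e07
    simp only [m7] at t'
    rw [t] at t'
    have : ε / c ≠ 0 := div_ne_zero hε hc
    have := mul_right_cancel₀ this t'
    linarith
  ext a b
  revert b
  rw [forall_fin8]
  revert a
  rw [forall_fin8]
  refine ⟨⟨h'.e00.trans h.e00.symm, h0, e07⟩, fun b => ⟨?_, hm b, m7 b⟩, ⟨?_, fun a => ?_, ?_⟩⟩
  · rw [h.em0, h'.em0]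
  · rw [h.e70, h'.e70]
  · rw [h.e7m, h'.e7m]
  · rw [h.e77, h'.e77]

variable {Γ Γ' : GaugeForm M} {k k' : M → Matrix (Fin 8) (Fin 8) ℝ}

lemma GaugeMap.isGaugeTransformation (g : GaugeMap U Γ Γ' k) : IsGaugeTransformation U Γ Γ' k where
  smooth a b := (smoothFunOn_iff_smoothAt g.isOpen _).2 fun x hx => g.smooth x hx a b
  mem x hx := mem_conformalParabolic_iff.2 (g.parabolic x hx)
  eq x hx v := by
    obtain ⟨ε, c, hk⟩ := g.parabolic x hx
    change evM Γ' x v = (k x)⁻¹ * evM Γ x v * k x + (k x)⁻¹ * diffM k x v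
    rw [mul_assoc, ← mul_add, ← g.eq x hx, ← mul_assoc, hk.inv_mul_self, one_mul]

lemma IsGaugeTransformation.gaugeMap (hU : IsOpen U) (g : IsGaugeTransformation U Γ Γ' k) :
    GaugeMap U Γ Γ' k where
  isOpen := hU
  smooth x hx a b := (smoothFunOn_iff_smoothAt hU _).1 (g.smooth a b) x hx
  parabolic x hx := mem_conformalParabolic_iff.1 (g.mem x hx)
  eq x hx v := by
    obtain ⟨ε, c, hk⟩ := mem_conformalParabolic_iff.1 (g.mem x hx)
    have : evM Γ' x v = (k x)⁻¹ * evM Γ x v * k x + (k x)⁻¹ * diffM k x v := g.eq x hx v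
    rw [this, mul_add, ← mul_assoc, ← mul_assoc, ← mul_assoc, hk.mul_inv_self, one_mul, one_mul]

lemma GaugeForm.metric_dualVec (h : IsNormalConformalGauge D U Γ) (hx : x ∈ U) (a b : Fin 6) :
    Γ.metric x (dualVec (fun a => Γ (mid a) 0) a x) (dualVec (fun a => Γ (mid a) 0) b x) =
      if b = a + 3 then 1 else 0 := by
  have e := (h.isCoframe.coframeAt x hx).apply_dualVec
  rw [GaugeForm.metric_apply]
  simp only [e]
  rw [Finset.sum_eq_single a (fun d _ hd => by simp [hd]) (by simp)]
  simp [eq_comm]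

lemma GaugeMap.unique (g : GaugeMap U Γ Γ' k) (g' : GaugeMap U Γ Γ' k')
    (h : IsNormalConformalGauge D U Γ) (h' : IsNormalConformalGauge D U Γ') (hx : x ∈ U) :
    k' x = k x := by
  have hs : ∀ x ∈ U, ∀ v, IsSkewMatrix (evM Γ x v) := fun x hx v => h.isSkewMatrix hx v
  have key : ∀ x ∈ U, ∃ ε c, IsParabolic ε c (k x) ∧ IsParabolic ε c (k' x) := by
    intro x hx
    obtain ⟨ε, c, hk⟩ := g.parabolic x hx
    obtain ⟨ε', c', hk'⟩ := g'.parabolic x hx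
    have m := g.metric_eq hs hx hk (dualVec (fun a => Γ' (mid a) 0) 0 x)
      (dualVec (fun a => Γ' (mid a) 0) 3 x)
    have m' := g'.metric_eq hs hx hk' (dualVec (fun a => Γ' (mid a) 0) 0 x)
      (dualVec (fun a => Γ' (mid a) 0) 3 x)
    rw [GaugeForm.metric_dualVec h' hx, if_pos (show (3 : Fin 6) = 0 + 3 by decide), mul_one] at m m'
    set r := Γ.metric x (dualVec (fun a => Γ' (mid a) 0) 0 x)
      (dualVec (fun a => Γ' (mid a) 0) 3 x)
    have e1 := hk.pos
    have e2 := hk'.pos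
    have e3 : ε * (c' * c') = ε' * (c * c) := by rw [m, m']; ring
    have e4 := mul_pos e1 e1
    have e5 := mul_pos e2 e2
    have e6 : ε' = ε := by
      rcases mul_self_eq_one_iff.1 hk.sq with rfl | rfl <;>
      rcases mul_self_eq_one_iff.1 hk'.sq with rfl | rfl <;> first | rfl | (exfalso; linarith)
    have e7 : c' = c := by
      rw [e6] at e3
      have hε : ε ≠ 0 := by rintro rfl; simpa using hk.sq
      have := mul_left_cancel₀ hε e3
      nlinarith
    exact ⟨ε, c, hk, by rw [← e6, ← e7]; exact hk'⟩
  obtain ⟨ε, c, hk, hk'⟩ := key x hx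
  have he := h'.isCoframe.coframeAt x hx
  refine hk.ext hk' (fun a b => ?_) fun b => ?_
  · have s := g.solder_eq hs hx hk a (dualVec (fun a => Γ' (mid a) 0) b x)
    have s' := g'.solder_eq hs hx hk' a (dualVec (fun a => Γ' (mid a) 0) b x)
    simp only [he.apply_dualVec] at s s'
    simp only [mul_ite, mul_one, mul_zero, Finset.sum_ite_eq', Finset.mem_univ, if_true] at s s'
    rw [s, s']
  · have s := g.zero_zero_eq hs hx hk (dualVec (fun a => Γ' (mid a) 0) b x)
    have s' := g'.zero_zero_eq hs hx hk' (dualVec (fun a => Γ' (mid a) 0) b x)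
    simp only [he.apply_dualVec] at s s'
    simp only [mul_ite, mul_one, mul_zero, Finset.sum_ite_eq', Finset.mem_univ, if_true] at s s'
    have d : ∀ v, diff (fun y => k' y 0 0) x v = diff (fun y => k y 0 0) x v := fun v =>
      diff_congr (Filter.mem_of_superset (g.isOpen.mem_nhds hx) fun y hy => by
        obtain ⟨ε, c, hk, hk'⟩ := key y hy
        exact hk'.e00.trans hk.e00.symm) v
    rw [d] at s'
    linarith

lemma FunSmoothAt.abs {f : M → ℝ} (h : FunSmoothAt f x) (h0 : f x ≠ 0) :
    FunSmoothAt (fun y => |f y|) x := .comp (contDiffAt_abs h0) h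

lemma FunSmoothAt.sqrt {f : M → ℝ} (h : FunSmoothAt f x) (h0 : f x ≠ 0) :
    FunSmoothAt (fun y => √(f y)) x := .comp (Real.contDiffAt_sqrt h0) h

/-- A representing metric is a multiple of the metric of a normal gauge by a smooth function. -/
lemma IsNormalConformalGauge.exists_conformalFactor (h : IsNormalConformalGauge D U Γ)
    {g : BilinField M} (hg : RepresentsConformal D U g)
    (hm : ∀ x ∈ U, ∃ r, ∀ v w, g x v w = r * Γ.metric x v w) : ∃ r : M → ℝ,
    (∀ x ∈ U, FunSmoothAt r x) ∧ (∀ x ∈ U, r x ≠ 0) ∧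
      ∀ x ∈ U, ∀ v w, g x v w = r x * Γ.metric x v w := by
  have he := h.isCoframe
  let X : Fin 6 → (y : M) → 𝕋 y := dualVec fun a => Γ (mid a) 0
  have hr : ∀ x ∈ U, ∀ v w, g x v w = g x (X 0 x) (X 3 x) * Γ.metric x v w := by
    intro x hx v w
    obtain ⟨s, hs⟩ := hm x hx
    simp [hs, X, GaugeForm.metric_dualVec h hx]
  refine ⟨fun y => g y (X 0 y) (X 3 y), fun x hx =>
    hg.smooth.apply h.isOpen hx (he.vecSmoothAt_dualVec hx 0) (he.vecSmoothAt_dualVec hx 3),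
    fun x hx h0 => ?_, hr⟩
  have : X 0 x = 0 := hg.nondegenerate x hx _ fun w => by
    rw [hr x hx, show g x (X 0 x) (X 3 x) = 0 from h0, zero_mul]
  have e := (he.coframeAt x hx).apply_dualVec 0 0
  change Γ (mid 0) 0 x (X 0 x) = _ at e
  rw [this] at e
  simp at e

/-- Two normal gauges are related by a gauge transformation. -/
theorem IsNormalConformalGauge.exists_gaugeMap_of_metric (h : IsNormalConformalGauge D U Γ)
    (h' : IsNormalConformalGauge D U Γ')
    (hm : ∀ x ∈ U, ∃ r, ∀ v w, Γ.metric x v w = r * Γ'.metric x v w) :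
    ∃ k, GaugeMap U Γ Γ' k := by
  have he := h'.isCoframe
  let X : Fin 6 → (y : M) → 𝕋 y := dualVec fun a => Γ' (mid a) 0
  let N : M → Fin 6 → Fin 6 → ℝ := fun y a b => Γ (mid a) 0 y (X b y)
  obtain ⟨r, sr, hr0, hr⟩ := h'.exists_conformalFactor h.conformal hm
  have sN : ∀ x ∈ U, ∀ a b, FunSmoothAt (fun y => N y a b) x := fun x hx a b =>
    (h.smoothAt hx _ _).apply (he.vecSmoothAt_dualVec hx b)
  have hN : ∀ x ∈ U, ∀ a b, ∑ d, N x d a * N x (d + 3) b = if b = a + 3 then r x else 0 := by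
    intro x hx a b
    have := hr x hx (X a x) (X b x)
    rw [GaugeForm.metric_apply, GaugeForm.metric_dualVec h' hx] at this
    simpa using this
  have ha : ∀ x ∈ U, 0 < |r x| := fun x hx => abs_pos.2 (hr0 x hx)
  have sa : ∀ x ∈ U, FunSmoothAt (fun y => |r y|) x := fun x hx => (sr x hx).abs (hr0 x hx)
  have sq : ∀ x ∈ U, (√|r x|)⁻¹ * (√|r x|)⁻¹ = |r x|⁻¹ := fun x hx => by
    rw [← mul_inv, Real.mul_self_sqrt (abs_nonneg _)]
  have sc : ∀ x ∈ U, FunSmoothAt (fun y => (√|r y|)⁻¹) x := fun x hx =>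
    ((sa x hx).sqrt (ha x hx).ne').inv (Real.sqrt_pos.2 (ha x hx)).ne'
  obtain ⟨Γ₁, k, h1, g, h00, hk, hkm⟩ := h.exists_gaugeMap (ε := fun y => r y * |r y|⁻¹)
    (c := fun y => (√|r y|)⁻¹) (H := fun y a b => (√|r y|)⁻¹ * N y a b) (σ := Γ' 0 0)
    (fun x hx => (sr x hx).mul ((sa x hx).inv (ha x hx).ne')) sc
    (fun x hx a b => (sc x hx).mul (sN x hx a b)) (fun x hx => h'.smoothAt hx _ _)
    (fun x hx => by
      have := (ha x hx).ne'
      field_simp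
      rw [sq_abs])
    (fun x hx => inv_pos.2 (Real.sqrt_pos.2 (ha x hx)))
    (fun x hx a b => by
      simp only [mul_mul_mul_comm _ (N x _ _), sq x hx, ← Finset.mul_sum, hN x hx]
      split_ifs <;> ring)
  refine ⟨k, ⟨h.isOpen, g.smooth, g.parabolic, fun x hx v => ?_⟩⟩
  have hs : ∀ x ∈ U, ∀ a, Γ' (mid a) 0 x = Γ₁ (mid a) 0 x := by
    intro x hx a
    ext v
    have e1 : ∀ a, ∑ b, k x (mid a) (mid b) * Γ' (mid b) 0 x v =
        (√|r x|)⁻¹ * Γ (mid a) 0 x v := by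
      intro a
      have : Γ (mid a) 0 x v = ∑ b, N x a b * Γ' (mid b) 0 x v :=
        (he.coframeAt x hx).covector_apply (Γ (mid a) 0 x : 𝕋 x →ₗ[ℝ] ℝ) v
      rw [this, Finset.mul_sum]
      exact Finset.sum_congr rfl fun b _ => by rw [hkm, mul_assoc]
    rw [g.solder' h hx (hk x hx)]
    simp only [← e1, Finset.mul_sum, ← mul_assoc]
    rw [Finset.sum_comm]
    simp only [← Finset.sum_mul, (hk x hx).mid_inverse]
    simp
  rw [h1.ev_eq h' hs (fun x hx => by ext v; exact (h00 x hx v).symm) hx]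
  exact g.eq x hx v

theorem IsCartanFrame.exists_gaugeTransformation {f : CartanFrame M} (hD : IsNondegenerate D)
    (hf : IsCartanFrame D U f) (h : IsNormalConformalGauge D U Γ) :
    ∃ k, IsGaugeTransformation U Γ f.gammaHat k ∧
      ∀ k', IsGaugeTransformation U Γ f.gammaHat k' → ∀ x ∈ U, k' x = k x := by
  have h' := hf.isNormalConformalGauge hD
  obtain ⟨k, g⟩ := h.exists_gaugeMap_of_metric h' fun x hx => by
    rw [gammaHat_metric]
    exact h.conformal.multiple U subset_rfl _ hf.isThirdOrderFrame.isTwoAdapted x hx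
  exact ⟨k, g.isGaugeTransformation, fun k' g' x hx => g.unique (g'.gaugeMap h.isOpen) h h' hx⟩

end NormalEmbedding

section WeylAlgebra

open Matrix

variable {G : E6 → Matrix (Fin 6) (Fin 6) ℝ} {p : E6}

lemma sum_inv_mul (hG : IsUnit (G p).det) (c d : Fin 6) :
    ∑ e, (G p)⁻¹ c e * G p e d = if c = d then 1 else 0 := by
  rw [← Matrix.mul_apply, Matrix.nonsing_inv_mul _ hG, Matrix.one_apply]

/-- A symmetric connection preserving the metric is the Levi-Civita connection. -/
lemma christoffel_eq (hG : IsUnit (G p).det) (hs : ∀ a b, G p a b = G p b a)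
    {T : Fin 6 → Fin 6 → Fin 6 → ℝ} (hT : ∀ c a b, T c a b = T c b a)
    (h : ∀ a b d, pd (fun q => G q d b) a p = ∑ e, (T e a d * G p e b + G p d e * T e a b))
    (c a b : Fin 6) : christoffel G p c a b = T c a b := by
  have key : ∀ d, pd (fun q => G q d b) a p + pd (fun q => G q d a) b p -
      pd (fun q => G q a b) d p = 2 * ∑ e, G p d e * T e a b := by
    intro d
    simp only [h, ← Finset.sum_add_distrib, ← Finset.sum_sub_distrib, Finset.mul_sum]
    refine Finset.sum_congr rfl fun e _ => ?_
    rw [hT e d a, hT e d b, hT e b a, hs e b, hs a e]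
    ring
  simp only [christoffel, key, mul_left_comm _ (2 : ℝ), ← Finset.mul_sum]
  rw [← mul_assoc, show (2 : ℝ) * (1 / 2) = 1 by norm_num, one_mul]
  simp only [Finset.mul_sum, ← mul_assoc]
  rw [Finset.sum_comm]
  simp only [← Finset.sum_mul, sum_inv_mul hG]
  simp

/-- The Weyl tensor is the trace-free part of the Riemann tensor. -/
lemma weylCoord_eq (hG : IsUnit (G p).det) (hs : ∀ a b, G p a b = G p b a)
    {W : Fin 6 → Fin 6 → Fin 6 → Fin 6 → ℝ} {P Q : Fin 6 → Fin 6 → ℝ}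
    (hW : ∀ c b, ∑ a, W a c a b = 0) (hQ : ∀ a b, ∑ d, G p a d * Q d b = P a b)
    (h : ∀ d c a b, riemann G p d c a b = W d c a b - (if d = a then P c b else 0) +
      (if d = b then P c a else 0) - G p c b * Q d a + G p c a * Q d b) (d c a b : Fin 6) :
    weylCoord G p d c a b = W d c a b := by
  have h1 : ∀ c b, ricci G p c b = -4 * P c b - G p c b * ∑ a, Q a a := by
    intro c b
    simp only [ricci, h, Finset.sum_add_distrib, Finset.sum_sub_distrib, hW, hQ, ← Finset.mul_sum]
    simp
    ring
  have h2 : ∀ d a, ricciUp G p d a = -4 * Q d a - if d = a then ∑ a, Q a a else 0 := by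
    intro d a
    have e1 : ∑ e, (G p)⁻¹ d e * P e a = Q d a := by
      simp only [← hQ _ a, Finset.mul_sum, ← mul_assoc]
      rw [Finset.sum_comm]
      simp only [← Finset.sum_mul, sum_inv_mul hG]
      simp
    have e2 := sum_inv_mul hG d a
    simp only [ricciUp, h1, mul_sub, Finset.sum_sub_distrib, mul_left_comm _ (-4 : ℝ),
      ← Finset.mul_sum, e1]
    simp only [← mul_assoc, ← Finset.sum_mul, e2]
    simp
  have h3 : scalarCurv G p = -10 * ∑ a, Q a a := by
    simp only [scalarCurv, h2, Finset.sum_sub_distrib, ← Finset.mul_sum]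
    simp
    ring
  rw [weylCoord, h, h1, h1, h2, h2, h3]
  split_ifs <;> ring

end WeylAlgebra

section ChartFrame

open Matrix

variable {x y : M}

/-- The coordinate `1`-forms of the preferred chart at `x`. -/
def coordForm (x : M) (i : Fin 6) : OneForm M :=
  fun y => diff (fun z => 𝒞 x z i) y

lemma smoothFunOn_extChartAt (x : M) (i : Fin 6) :
    SmoothFunOn (𝒞 x).source fun z => 𝒞 x z i := by
  intro y hy
  have h := contMDiffAt_extChartAt' (I := 𝓡 6) (n := ∞) (x := x) (by simpa using hy)
  have h2 : ContMDiff 𝓘(ℝ, E6) 𝓘(ℝ, ℝ) ∞ fun p : E6 => p i :=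
    (EuclideanSpace.proj (𝕜 := ℝ) i).contMDiff
  exact (h2.contMDiffAt.comp y h).contMDiffWithinAt

lemma coordForm_apply (hy : y ∈ (𝒞 x).source) (i : Fin 6)
    (v : 𝕋 y) : coordForm x i y v = chartDerivAt x y v i := by
  have h := (contMDiffAt_extChartAt' (I := 𝓡 6) (n := ∞) (x := x) (x' := y)
    (by simpa using hy)).mdifferentiableAt (by simp)
  have h2 := ((EuclideanSpace.proj (𝕜 := ℝ) i : E6 →L[ℝ] ℝ).hasMFDerivAt
    (x := 𝒞 x y)).comp y h.hasMFDerivAt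
  have h3 := h2.mfderiv
  exact DFunLike.congr_fun h3 v

lemma isCoframe_coordForm (x : M) : IsCoframe (𝒞 x).source (coordForm x) where
  isOpen := isOpen_extChartAt_source x
  smooth i := (smoothOneFormOn_iff_smoothAt (isOpen_extChartAt_source x)).2 fun y hy =>
    ((smoothFunOn_iff_smoothAt (isOpen_extChartAt_source x) _).1
      (smoothFunOn_extChartAt x i) y hy).smoothAt_diff
  coframeAt y hy := by
    have hb := chartDerivAt_bijective hy
    refine ⟨fun v w h => hb.1 (PiLp.ext fun i => ?_), fun a => ?_⟩
    · rw [← coordForm_apply hy, ← coordForm_apply hy]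
      exact congrFun h i
    · obtain ⟨v, hv⟩ := hb.2 (WithLp.toLp 2 a)
      exact ⟨v, funext fun i => (coordForm_apply hy i v).trans (by rw [hv])⟩

lemma extD_coordForm (hy : y ∈ (𝒞 x).source) (i : Fin 6)
    (v w : 𝕋 y) : extD (coordForm x i) y v w = 0 :=
  FunSmoothAt.extD_diff ((smoothFunOn_iff_smoothAt (isOpen_extChartAt_source x) _).1
      (smoothFunOn_extChartAt x i) y hy) v w

lemma chartDerivAt_coordVec (hy : y ∈ (𝒞 x).source) (i : Fin 6) :
    chartDerivAt x y (dualVec (coordForm x) i y) = EuclideanSpace.single i 1 := by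
  refine PiLp.ext fun j => ?_
  rw [← coordForm_apply hy, ((isCoframe_coordForm x).coframeAt y hy).apply_dualVec]
  simp

lemma chartSymmDeriv_single {p : E6} (hp : p ∈ (𝒞 x).target) (i : Fin 6) :
    chartSymmDeriv x p (EuclideanSpace.single i 1) =
      dualVec (coordForm x) i ((𝒞 x).symm p) := by
  have hy := (𝒞 x).map_target hp
  refine (chartDerivAt_bijective hy).1 ?_
  rw [chartDerivAt_coordVec hy]
  exact DFunLike.congr_fun (chartDerivAt_comp_chartSymmDeriv hp) _

lemma pd_comp_chart {f : M → ℝ} {p : E6} (hp : p ∈ (𝒞 x).target)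
    (hf : FunSmoothAt f ((𝒞 x).symm p)) (a : Fin 6) :
    pd (fun q => f ((𝒞 x).symm q)) a p =
      diff f ((𝒞 x).symm p)
        (dualVec (coordForm x) a ((𝒞 x).symm p)) := by
  have h1 := (contMDiffAt_iff_chart f _).2 hf
  have h2 : ContMDiffAt 𝓘(ℝ, E6) (𝓡 6) ∞ (𝒞 x).symm p :=
    (contMDiffOn_extChartAt_symm x).contMDiffAt
      ((isOpen_extChartAt_target (I := 𝓡 6) x).mem_nhds hp)
  have h3 := (h1.mdifferentiableAt (by simp)).hasMFDerivAt.comp p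
    (h2.mdifferentiableAt (by simp)).hasMFDerivAt
  rw [← chartSymmDeriv_single hp, pd, ← mfderiv_eq_fderiv]
  exact DFunLike.congr_fun h3.mfderiv _

end ChartFrame

section LeviCivita

open Matrix

variable {x y : M} {Γ : GaugeForm M}

/-- The Gram matrix of the soldering form. -/
def neutral6 : Matrix (Fin 6) (Fin 6) ℝ := of fun a b => if b = a + 3 then 1 else 0

lemma neutral6_mul_apply (A : Matrix (Fin 6) (Fin 6) ℝ) (a b : Fin 6) :
    (neutral6 * A) a b = A (a + 3) b := by
  simp [neutral6, Matrix.mul_apply]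

lemma neutral6_mul_self : neutral6 * neutral6 = 1 := by
  ext a b
  rw [neutral6_mul_apply, neutral6, of_apply, add_three_add_three, Matrix.one_apply]
  simp only [eq_comm]

/-- The components of the soldering form in the preferred chart at `x`. -/
def solderMatrix (Γ : GaugeForm M) (x y : M) : Matrix (Fin 6) (Fin 6) ℝ :=
  of fun a i => Γ (mid a) 0 y (dualVec (coordForm x) i y)

/-- The block of a gauge acting on the tangent spaces. -/
def midBlock (Γ : GaugeForm M) : Matrix (Fin 6) (Fin 6) (OneForm M) :=
  of fun a b => Γ (mid a) (mid b)

/-- The connection of the block `midBlock Γ` in the coordinate frame. -/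
def coordConnection (Γ : GaugeForm M) (x : M) : Matrix (Fin 6) (Fin 6) (OneForm M) :=
  gaugeTransform (midBlock Γ) (solderMatrix Γ x)

lemma solder_eq_sum (hy : y ∈ (𝒞 x).source) (a : Fin 6) (v : 𝕋 y) :
    Γ (mid a) 0 y v = ∑ i, solderMatrix Γ x y a i * coordForm x i y v :=
  ((isCoframe_coordForm x).coframeAt y hy).covector_apply
    (Γ (mid a) 0 y : 𝕋 y →ₗ[ℝ] ℝ) v

namespace IsNormalConformalGauge

variable (h : IsNormalConformalGauge D U Γ) (h0 : ∀ y ∈ U, ∀ v, Γ 0 0 y v = 0)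

lemma smoothAt_solderMatrix (h : IsNormalConformalGauge D U Γ) (hy : y ∈ U)
    (hx : y ∈ (𝒞 x).source) : MatSmoothAt (solderMatrix Γ x) y := fun a i =>
  (h.smoothAt hy (mid a) 0).apply ((isCoframe_coordForm x).vecSmoothAt_dualVec hx i)

lemma det_solderMatrix (h : IsNormalConformalGauge D U Γ) (hy : y ∈ U)
    (hx : y ∈ (𝒞 x).source) : (solderMatrix Γ x y).det ≠ 0 := by
  obtain ⟨X, hX, -⟩ := h.exists_dual hy
  have : solderMatrix Γ x y * (of fun i b => coordForm x i y (X b)) = 1 := by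
    ext a b
    rw [Matrix.mul_apply, Matrix.one_apply, ← hX a b, solder_eq_sum hx]
    rfl
  exact (Matrix.isUnit_det_of_right_inverse this).ne_zero

lemma smoothAt_coordConnection (h : IsNormalConformalGauge D U Γ) (hy : y ∈ U)
    (hx : y ∈ (𝒞 x).source) (a b : Fin 6) : (coordConnection Γ x a b).SmoothAt y :=
  smoothAt_gaugeTransform (fun a b => h.smoothAt hy (mid a) (mid b)) (h.smoothAt_solderMatrix hy hx)
    (h.det_solderMatrix hy hx) a b

lemma mul_coordConnection (h : IsNormalConformalGauge D U Γ) (hy : y ∈ U)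
    (hx : y ∈ (𝒞 x).source) (v : 𝕋 y) :
    solderMatrix Γ x y * evM (coordConnection Γ x) y v =
      evM (midBlock Γ) y v * solderMatrix Γ x y + diffM (solderMatrix Γ x) y v :=
  mul_evM_gaugeTransform _ (h.det_solderMatrix hy hx).isUnit v

lemma coordConnection_symm (h : IsNormalConformalGauge D U Γ) (h0 : ∀ y ∈ U, ∀ v, Γ 0 0 y v = 0)
    (hy : y ∈ U) (hx : y ∈ (𝒞 x).source) (c i j : Fin 6) :
    coordConnection Γ x c i y (dualVec (coordForm x) j y) =
      coordConnection Γ x c j y (dualVec (coordForm x) i y) := by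
  set X := fun i => dualVec (coordForm x) i y with hX
  have hd : ∀ i j, coordForm x i y (X j) = if i = j then 1 else 0 :=
    ((isCoframe_coordForm x).coframeAt y hx).apply_dualVec
  have key : ∀ a, (evM (midBlock Γ) y (X j) * solderMatrix Γ x y +
      diffM (solderMatrix Γ x) y (X j)) a i =
      (evM (midBlock Γ) y (X i) * solderMatrix Γ x y + diffM (solderMatrix Γ x) y (X i)) a j := by
    intro a
    have t := h.torsion_free y hy a (X j) (X i)
    have hE : extD (Γ (mid a) 0) y (X j) (X i) =
        diffM (solderMatrix Γ x) y (X j) a i - diffM (solderMatrix Γ x) y (X i) a j := by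
      have e : ∀ᶠ z in nhds y, Γ (mid a) 0 z =
          (∑ l, fsmul (fun z => solderMatrix Γ x z a l) (coordForm x l)) z := by
        filter_upwards [(isOpen_extChartAt_source x).mem_nhds hx] with z hz
        ext v
        rw [OneForm.sum_apply]
        exact solder_eq_sum hz a v
      have s1 := fun l => (isCoframe_coordForm x).smoothAt hx l
      have s2 := h.smoothAt_solderMatrix hy hx a
      rw [extD_congr e, extD_sum _ fun l _ => (s1 l).fsmul (s2 l)]
      simp only [extD_fsmul (s2 _) (s1 _), extD_coordForm hx, hd, mul_zero, add_zero,
        Finset.sum_sub_distrib, mul_ite, mul_one, Finset.sum_ite_eq', Finset.mem_univ, if_true]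
      rfl
    rw [GaugeForm.curv, hE, sum_fin8] at t
    have e70 : ∀ v, Γ 7 0 y v = 0 := fun v => (h.isSkewMatrix hy v).e70
    simp only [wedge, h0 y hy, e70, mul_zero, sub_zero, zero_add, add_zero,
      Finset.sum_sub_distrib] at t
    simp only [Matrix.add_apply, Matrix.mul_apply]
    change ∑ b, Γ (mid a) (mid b) y (X j) * Γ (mid b) 0 y (X i) + _ =
      ∑ b, Γ (mid a) (mid b) y (X i) * Γ (mid b) 0 y (X j) + _
    linarith
  simp only [← h.mul_coordConnection hy hx, Matrix.mul_apply] at key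
  have := Matrix.eq_zero_of_mulVec_eq_zero (h.det_solderMatrix hy hx)
    (v := fun c => coordConnection Γ x c i y (X j) - coordConnection Γ x c j y (X i))
    (funext fun a => by
      simp only [Matrix.mulVec, dotProduct, mul_sub, Finset.sum_sub_distrib, Pi.zero_apply]
      exact sub_eq_zero.2 (key a))
  exact sub_eq_zero.1 (congrFun this c)

lemma diffM_gram (h : IsNormalConformalGauge D U Γ) (hy : y ∈ U)
    (hx : y ∈ (𝒞 x).source) (v : 𝕋 y) :
    diffM (fun y => (solderMatrix Γ x y)ᵀ * neutral6 * solderMatrix Γ x y) y v =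
      (evM (coordConnection Γ x) y v)ᵀ * ((solderMatrix Γ x y)ᵀ * neutral6 * solderMatrix Γ x y) +
      (solderMatrix Γ x y)ᵀ * neutral6 * solderMatrix Γ x y * evM (coordConnection Γ x) y v := by
  have s := h.smoothAt_solderMatrix hy hx
  have e : diffM (solderMatrix Γ x) y v = solderMatrix Γ x y * evM (coordConnection Γ x) y v -
      evM (midBlock Γ) y v * solderMatrix Γ x y := by
    rw [h.mul_coordConnection hy hx]; abel
  have hs : (evM (midBlock Γ) y v)ᵀ * neutral6 + neutral6 * evM (midBlock Γ) y v = 0 := by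
    have : (evM (midBlock Γ) y v)ᵀ * neutral6 = (neutral6 * evM (midBlock Γ) y v)ᵀ := by
      rw [Matrix.transpose_mul]
      congr 1
      ext a b
      simp only [neutral6, transpose_apply, of_apply]
      congr 1
      exact propext ⟨fun hb => by rw [hb, add_three_add_three],
        fun hb => by rw [hb, add_three_add_three]⟩
    rw [this]
    ext a b
    rw [Matrix.add_apply, transpose_apply, neutral6_mul_apply, neutral6_mul_apply]
    change Γ _ _ y v + Γ _ _ y v = 0
    rw [show Γ (mid (a + 3)) (mid b) y v = _ from (h.isSkewMatrix hy v).emm a b]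
    exact add_neg_cancel _
  rw [diffM_mul (s.transpose.mul (.const _)) s, diffM_mul s.transpose (.const _), diffM_const,
    diffM_transpose, e, Matrix.transpose_sub, Matrix.transpose_mul, Matrix.transpose_mul]
  generalize solderMatrix Γ x y = E at *
  generalize evM (midBlock Γ) y v = W at *
  have : Eᵀ * (Wᵀ * neutral6 + neutral6 * W) * E = 0 := by rw [hs]; simp
  simp only [mul_add, add_mul, sub_mul, mul_sub, mul_assoc, mul_zero, add_zero] at this ⊢
  rw [← sub_eq_zero, ← neg_eq_zero, ← this]
  abel

end IsNormalConformalGauge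

end LeviCivita

section WeylTensor

open Matrix

variable {x y : M} {Γ : GaugeForm M} {g : BilinField M} {s : ℝ}

lemma metric_coordVec (i j : Fin 6) :
    Γ.metric y (dualVec (coordForm x) i y) (dualVec (coordForm x) j y) =
      ((solderMatrix Γ x y)ᵀ * neutral6 * solderMatrix Γ x y) i j := by
  rw [GaugeForm.metric_apply, mul_assoc, Matrix.mul_apply]
  simp only [neutral6_mul_apply, transpose_apply]
  rfl

lemma gramInChart_eventuallyEq (hg : ∀ᶠ y in nhds x, ∀ v w, g y v w = s * Γ.metric y v w) :
    gramInChart g x =ᶠ[nhds (𝒞 x x)] fun p =>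
      s • ((solderMatrix Γ x ((𝒞 x).symm p))ᵀ * neutral6 *
        solderMatrix Γ x ((𝒞 x).symm p)) := by
  filter_upwards [extChartAt_symm_eventually_mem hg] with p hp
  ext i j
  rw [gramInChart, of_apply, hp.2, chartSymmDeriv_single hp.1, chartSymmDeriv_single hp.1,
    metric_coordVec, Matrix.smul_apply, smul_eq_mul]

namespace IsNormalConformalGauge

lemma isUnit_det_gram (h : IsNormalConformalGauge D U Γ) (hs : s ≠ 0) (hy : y ∈ U)
    (hx : y ∈ (𝒞 x).source) :
    IsUnit (s • ((solderMatrix Γ x y)ᵀ * neutral6 * solderMatrix Γ x y)).det := by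
  have h1 := h.det_solderMatrix hy hx
  have h2 : neutral6.det ≠ 0 := (Matrix.isUnit_det_of_right_inverse neutral6_mul_self).ne_zero
  rw [Matrix.det_smul, Matrix.det_mul, Matrix.det_mul, Matrix.det_transpose]
  exact (mul_ne_zero (pow_ne_zero _ hs) (mul_ne_zero (mul_ne_zero h1 h2) h1)).isUnit

lemma gram_symm (E : Matrix (Fin 6) (Fin 6) ℝ) (a b : Fin 6) :
    (Eᵀ * neutral6 * E) a b = (Eᵀ * neutral6 * E) b a := by
  have : neutral6ᵀ = neutral6 := by
    ext a b
    simp only [neutral6, transpose_apply, of_apply]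
    congr 1
    exact propext ⟨fun hb => by rw [hb, add_three_add_three],
      fun hb => by rw [hb, add_three_add_three]⟩
  rw [← transpose_apply (Eᵀ * neutral6 * E)]
  simp only [Matrix.transpose_mul, transpose_transpose, this, mul_assoc]

lemma christoffel_gramInChart (h : IsNormalConformalGauge D U Γ)
    (h0 : ∀ y ∈ U, ∀ v, Γ 0 0 y v = 0) (hx : x ∈ U) (hs : s ≠ 0)
    (hg : ∀ᶠ y in nhds x, ∀ v w, g y v w = s * Γ.metric y v w) :
    ∀ᶠ p in nhds (𝒞 x x), ∀ c a b, christoffel (gramInChart g x) p c a b =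
      coordConnection Γ x c b ((𝒞 x).symm p)
        (dualVec (coordForm x) a ((𝒞 x).symm p)) := by
  have e := gramInChart_eventuallyEq hg
  filter_upwards [e.eventually_nhds, extChartAt_symm_eventually_mem (h.isOpen.mem_nhds hx)]
    with p hp hpU c a b
  obtain ⟨hpt, hpU⟩ := hpU
  have hsrc := (𝒞 x).map_target hpt
  have sE := h.smoothAt_solderMatrix hpU hsrc
  refine christoffel_eq (T := fun c a b => coordConnection Γ x c b ((𝒞 x).symm p)
    (dualVec (coordForm x) a ((𝒞 x).symm p))) ?_ ?_ ?_ ?_ c a b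
  · rw [hp.self_of_nhds]
    exact h.isUnit_det_gram hs hpU hsrc
  · intro a b
    rw [hp.self_of_nhds, Matrix.smul_apply, Matrix.smul_apply, gram_symm]
  · exact fun c a b => h.coordConnection_symm h0 hpU hsrc c b a
  · intro a b d
    have e1 : (fun q => gramInChart g x q d b) =ᶠ[nhds p] fun q =>
        (fun y => s * ((solderMatrix Γ x y)ᵀ * neutral6 * solderMatrix Γ x y) d b)
          ((𝒞 x).symm q) := hp.mono fun q hq =>
      congrFun (congrFun hq d) b
    have sG : FunSmoothAt (fun y => ((solderMatrix Γ x y)ᵀ * neutral6 * solderMatrix Γ x y) d b)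
        ((𝒞 x).symm p) := (sE.transpose.mul (.const _)).mul sE d b
    rw [pd, e1.fderiv_eq, ← pd, pd_comp_chart (f := fun y =>
      s * ((solderMatrix Γ x y)ᵀ * neutral6 * solderMatrix Γ x y) d b) hpt
      ((FunSmoothAt.const s).mul sG), sG.diff_const_mul]
    have e2 := congrFun (congrFun (h.diffM_gram hpU hsrc
      (dualVec (coordForm x) a ((𝒞 x).symm p))) d) b
    have e3 : ∀ A G : Matrix (Fin 6) (Fin 6) ℝ, s * (Aᵀ * G + G * A) d b =
        ∑ e, (A e d * (s • G) e b + (s • G) d e * A e b) := by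
      intro A G
      simp only [Matrix.add_apply, Matrix.mul_apply, transpose_apply, Matrix.smul_apply,
        smul_eq_mul, mul_add, Finset.mul_sum, Finset.sum_add_distrib]
      congr 1 <;> exact Finset.sum_congr rfl fun e _ => by ring
    rw [hp.self_of_nhds]
    exact (congrArg (s * ·) e2).trans (e3 _ _)

lemma riemann_gramInChart (h : IsNormalConformalGauge D U Γ)
    (h0 : ∀ y ∈ U, ∀ v, Γ 0 0 y v = 0) (hx : x ∈ U) (hs : s ≠ 0)
    (hg : ∀ᶠ y in nhds x, ∀ v w, g y v w = s * Γ.metric y v w) (d c a b : Fin 6) :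
    riemann (gramInChart g x) (𝒞 x x) d c a b =
      curvM (coordConnection Γ x) x (dualVec (coordForm x) a x) (dualVec (coordForm x) b x) d c := by
  have e := h.christoffel_gramInChart h0 hx hs hg
  have hsrc := mem_extChartAt_source (I := 𝓡 6) x
  have e1 : ∀ a b, pd (fun q => christoffel (gramInChart g x) q d b c) a (𝒞 x x) =
      fderiv ℝ ((coordConnection Γ x d c).inChart x) (𝒞 x x)
        (EuclideanSpace.single a 1) (EuclideanSpace.single b 1) := by
    intro a b
    have e2 : (fun q => christoffel (gramInChart g x) q d b c) =ᶠ[nhds (𝒞 x x)]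
        fun q => (coordConnection Γ x d c).inChart x q (EuclideanSpace.single b 1) := by
      filter_upwards [e, extChartAt_symm_eventually_mem Filter.univ_mem] with q hq hq'
      rw [hq, ← chartSymmDeriv_single hq'.1]
      rfl
    rw [pd, e2.fderiv_eq, fderiv_clm_apply
      (h.smoothAt_coordConnection hx hsrc d c).differentiableAt (differentiableAt_const _)]
    simp
  have e3 : ∀ c a b, christoffel (gramInChart g x) (𝒞 x x) c a b =
      coordConnection Γ x c b x (dualVec (coordForm x) a x) := fun c a b =>
    (e.self_of_nhds c a b).trans (congrArg (fun y => coordConnection Γ x c b y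
      (dualVec (coordForm x) a y)) ((𝒞 x).left_inv hsrc))
  rw [riemann, e1, e1]
  simp only [e3, Finset.sum_sub_distrib]
  rw [curvM, Matrix.add_apply, Matrix.sub_apply, Matrix.mul_apply, Matrix.mul_apply]
  simp only [extDM, of_apply, extD, chartDeriv_eq, chartDerivAt_coordVec hsrc]
  rfl

end IsNormalConformalGauge

end WeylTensor

section WeylTensor

open Matrix

variable {Γ : GaugeForm M} {g : BilinField M} {s : ℝ}

/-- The block of the curvature acting on the tangent spaces, along coordinate vector fields. -/
def midCurv (Γ : GaugeForm M) (x : M) (a b : Fin 6) : Matrix (Fin 6) (Fin 6) ℝ :=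
  of fun p q => curvM Γ x (dualVec (coordForm x) a x) (dualVec (coordForm x) b x) (mid p) (mid q)

/-- The components of the first row of a gauge along coordinate vector fields. -/
def schoutenMatrix (Γ : GaugeForm M) (x : M) : Matrix (Fin 6) (Fin 6) ℝ :=
  of fun p a => Γ 0 (mid p) x (dualVec (coordForm x) a x)

lemma mul_vecMulVec_mul {A B : Matrix (Fin 6) (Fin 6) ℝ} (u v : Fin 6 → ℝ) (d c : Fin 6) :
    (A * vecMulVec u v * B) d c = (∑ p, A d p * u p) * ∑ q, v q * B q c := by
  rw [Matrix.mul_vecMulVec, Matrix.vecMulVec_mul]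
  rfl

namespace IsNormalConformalGauge

variable (h : IsNormalConformalGauge D U Γ) (hx : x ∈ U)

lemma curvM_midBlock (h : IsNormalConformalGauge D U Γ) (hx : x ∈ U) (a b : Fin 6) :
    curvM (midBlock Γ) x (dualVec (coordForm x) a x) (dualVec (coordForm x) b x) =
      midCurv Γ x a b -
      vecMulVec (fun p => solderMatrix Γ x x p a) (fun q => schoutenMatrix Γ x q b) +
      vecMulVec (fun p => solderMatrix Γ x x p b) (fun q => schoutenMatrix Γ x q a) -
      vecMulVec (fun p => (neutral6 * schoutenMatrix Γ x) p a)
        (fun q => (neutral6 * solderMatrix Γ x x) q b) +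
      vecMulVec (fun p => (neutral6 * schoutenMatrix Γ x) p b)
        (fun q => (neutral6 * solderMatrix Γ x x) q a) := by
  ext p q
  simp only [Matrix.add_apply, Matrix.sub_apply, vecMulVec_apply, neutral6_mul_apply]
  have e1 := fun v => (h.isSkewMatrix hx v).em7 p
  have e2 := fun v => (h.isSkewMatrix hx v).e7m q
  simp only [evM, of_apply] at e1 e2
  have e3 : midCurv Γ x a b p q = curvM Γ x (dualVec (coordForm x) a x) (dualVec (coordForm x) b x)
    (mid p) (mid q) := rfl
  rw [e3, curvM, curvM, Matrix.add_apply, Matrix.sub_apply, Matrix.mul_apply, Matrix.mul_apply,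
    Matrix.add_apply, Matrix.sub_apply, Matrix.mul_apply, Matrix.mul_apply, sum_fin8, sum_fin8]
  simp only [evM, of_apply, extDM, e1, e2, solderMatrix, schoutenMatrix, midBlock]
  ring

lemma sum_midCurv (h : IsNormalConformalGauge D U Γ) (hx : x ∈ U)
    (hc : ∀ v w, curvM Γ x v w 0 0 = 0) (c b : Fin 6) :
    ∑ a, ((solderMatrix Γ x x)⁻¹ * midCurv Γ x a b * solderMatrix Γ x x) a c = 0 := by
  have hsrc := mem_extChartAt_source (I := 𝓡 6) x
  have hE := (h.det_solderMatrix hx hsrc).isUnit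
  have n := fun q => h.normal x hx
    (fun p => ∑ a, (solderMatrix Γ x x)⁻¹ a p • dualVec (coordForm x) a x) (fun p q => by
      have := congrFun (congrFun (Matrix.mul_nonsing_inv _ hE) p) q
      rw [Matrix.mul_apply, Matrix.one_apply] at this
      rw [← this, map_sum]
      exact Finset.sum_congr rfl fun i _ => by rw [map_smul, smul_eq_mul, mul_comm]; rfl)
    q (dualVec (coordForm x) b x)
  simp only [GaugeForm.curv_eq, hc, ite_self, sub_zero] at n
  have e : ∀ p q, curvM Γ x (∑ a, (solderMatrix Γ x x)⁻¹ a p • dualVec (coordForm x) a x)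
      (dualVec (coordForm x) b x) (mid p) (mid q) =
      ∑ a, (solderMatrix Γ x x)⁻¹ a p * midCurv Γ x a b p q := by
    intro p q
    obtain ⟨B, -, hB⟩ := isAlt_curvM (x := x) Γ (mid p) (mid q)
    simp only [midCurv, of_apply]
    simp only [hB, map_sum, map_smul, LinearMap.sum_apply, LinearMap.smul_apply, smul_eq_mul]
  simp only [e] at n
  simp only [Matrix.mul_apply]
  rw [Finset.sum_comm]
  refine Finset.sum_eq_zero fun q _ => ?_
  rw [← Finset.sum_mul, Finset.sum_comm, n, zero_mul]

lemma weylCoord_gramInChart (h : IsNormalConformalGauge D U Γ)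
    (h0 : ∀ y ∈ U, ∀ v, Γ 0 0 y v = 0) (hc : ∀ v w, curvM Γ x v w 0 0 = 0) (hx : x ∈ U)
    (hs : s * s = 1) (hg : ∀ᶠ y in nhds x, ∀ v w, g y v w = s * Γ.metric y v w)
    (d c a b : Fin 6) :
    weylCoord (gramInChart g x) (𝒞 x x) d c a b =
      ((solderMatrix Γ x x)⁻¹ * midCurv Γ x a b * solderMatrix Γ x x) d c := by
  have hsrc := mem_extChartAt_source (I := 𝓡 6) x
  have hs0 : s ≠ 0 := fun h => by simp [h] at hs
  have hE := (h.det_solderMatrix hx hsrc).isUnit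
  have hG : gramInChart g x (𝒞 x x) =
      s • ((solderMatrix Γ x x)ᵀ * neutral6 * solderMatrix Γ x x) := by
    have := (gramInChart_eventuallyEq hg).self_of_nhds
    beta_reduce at this
    rwa [(𝒞 x).left_inv hsrc] at this
  have hR := h.riemann_gramInChart h0 hx hs0 hg
  have hu := h.isUnit_det_gram hs0 hx hsrc
  have hgauge := fun a b => curvM_gauge (k := solderMatrix Γ x)
    (fun a b => h.smoothAt hx (mid a) (mid b))
    (fun a b => h.smoothAt_coordConnection hx hsrc a b) (h.smoothAt_solderMatrix hx hsrc)
    (Filter.mem_of_superset (Filter.inter_mem (h.isOpen.mem_nhds hx)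
      (extChartAt_source_mem_nhds (I := 𝓡 6) x)) fun y hy => h.mul_coordConnection hy.1 hy.2)
    (dualVec (coordForm x) a x) (dualVec (coordForm x) b x)
  change ∀ a b, _ = curvM (midBlock Γ) x _ _ * _ at hgauge
  simp only [h.curvM_midBlock hx] at hgauge
  have hgauge' := fun a b => congrArg ((solderMatrix Γ x x)⁻¹ * ·) (hgauge a b)
  simp only [← mul_assoc, Matrix.nonsing_inv_mul _ hE, one_mul, mul_add, mul_sub, add_mul,
    sub_mul] at hgauge'
  have hW := h.sum_midCurv hx hc
  have i1 : ∀ d i, ∑ p, (solderMatrix Γ x x)⁻¹ d p * solderMatrix Γ x x p i =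
      if d = i then 1 else 0 := fun d i => by
    rw [← Matrix.mul_apply, Matrix.nonsing_inv_mul _ hE, Matrix.one_apply]
  refine weylCoord_eq (W := fun d c a b => ((solderMatrix Γ x x)⁻¹ * midCurv Γ x a b *
    solderMatrix Γ x x) d c) (P := ((solderMatrix Γ x x)ᵀ * schoutenMatrix Γ x))
    (Q := s • ((solderMatrix Γ x x)⁻¹ * (neutral6 * schoutenMatrix Γ x)))
    (by rwa [hG]) (fun a b => by rw [hG, Matrix.smul_apply, Matrix.smul_apply, gram_symm]) hW ?_ ?_
    d c a b
  · intro a b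
    rw [hG]
    refine (Matrix.mul_apply (M := s • ((solderMatrix Γ x x)ᵀ * neutral6 * solderMatrix Γ x x))
      (N := s • ((solderMatrix Γ x x)⁻¹ * (neutral6 * schoutenMatrix Γ x)))).symm.trans ?_
    rw [Matrix.smul_mul, Matrix.mul_smul, smul_smul, hs, one_smul, mul_assoc (_ * neutral6),
      ← mul_assoc (solderMatrix Γ x x) (solderMatrix Γ x x)⁻¹, Matrix.mul_nonsing_inv _ hE, one_mul,
      mul_assoc, ← mul_assoc neutral6, neutral6_mul_self, one_mul]
  · intro d c a b
    have t1 : ∀ c b, (∑ q, schoutenMatrix Γ x q b * solderMatrix Γ x x q c) =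
        ((solderMatrix Γ x x)ᵀ * schoutenMatrix Γ x) c b := fun c b => by
      rw [Matrix.mul_apply]
      exact Finset.sum_congr rfl fun q _ => mul_comm _ _
    have t2 : ∀ c b, (∑ q, (neutral6 * solderMatrix Γ x x) q b * solderMatrix Γ x x q c) =
        ((solderMatrix Γ x x)ᵀ * neutral6 * solderMatrix Γ x x) c b := fun c b => by
      rw [mul_assoc, Matrix.mul_apply]
      exact Finset.sum_congr rfl fun q _ => mul_comm _ _
    have t3 : ∀ d a, (∑ p, (solderMatrix Γ x x)⁻¹ d p * (neutral6 * schoutenMatrix Γ x) p a) =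
        ((solderMatrix Γ x x)⁻¹ * (neutral6 * schoutenMatrix Γ x)) d a := fun d a =>
      (Matrix.mul_apply).symm
    rw [hR, hgauge', hG]
    simp only [Matrix.add_apply, Matrix.sub_apply, mul_vecMulVec_mul, i1, t1, t2, t3,
      Matrix.smul_apply, Pi.smul_apply, smul_eq_mul, ite_mul, one_mul, zero_mul]
    linear_combination (((solderMatrix Γ x x)⁻¹ * (neutral6 * schoutenMatrix Γ x)) d a *
      ((solderMatrix Γ x x)ᵀ * neutral6 * solderMatrix Γ x x) c b -
      ((solderMatrix Γ x x)⁻¹ * (neutral6 * schoutenMatrix Γ x)) d b *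
      ((solderMatrix Γ x x)ᵀ * neutral6 * solderMatrix Γ x x) c a) * hs

end IsNormalConformalGauge

end WeylTensor

section WeylMain

open Matrix

variable {Γ : GaugeForm M} {g : BilinField M} {s : ℝ}

lemma apply_inverse_of_bijective {f : E6 →L[ℝ] E6} (hf : Function.Bijective f) (a : E6) :
    f (f.inverse a) = a := by
  let e : E6 ≃L[ℝ] E6 :=
    (LinearEquiv.ofBijective (f : E6 →ₗ[ℝ] E6) hf).toContinuousLinearEquiv
  have he : (e : E6 →L[ℝ] E6) = f := by ext v; rfl
  have h2 : f.inverse = (e.symm : E6 →L[ℝ] E6) := by rw [← he, ContinuousLinearMap.inverse_equiv]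
  rw [h2]
  exact e.apply_symm_apply a

lemma chartDeriv_inverse (x : M) (a : E6) : chartDeriv x ((chartDeriv x).inverse a) = a :=
  apply_inverse_of_bijective (f := (chartDeriv x : E6 →L[ℝ] E6))
    (chartDerivAt_bijective (mem_extChartAt_source (I := 𝓡 6) x)) a

lemma coordForm_weyl (v w z : 𝕋 x) (d : Fin 6) :
    coordForm x d x (weyl g x v w z) = ∑ c, ∑ a, ∑ b,
      weylCoord (gramInChart g x) (𝒞 x x) d c a b *
        coordForm x c x z * coordForm x a x v * coordForm x b x w := by
  have hsrc := mem_extChartAt_source (I := 𝓡 6) x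
  simp only [coordForm_apply hsrc, ← chartDeriv_eq]
  rw [weyl, chartDeriv_inverse]

theorem IsNormalConformalGauge.solder_weyl (h : IsNormalConformalGauge D U Γ)
    (h0 : ∀ y ∈ U, ∀ v, Γ 0 0 y v = 0) (hc : ∀ v w, curvM Γ x v w 0 0 = 0) (hx : x ∈ U)
    (hs : s * s = 1) (hg : ∀ᶠ y in nhds x, ∀ v w, g y v w = s * Γ.metric y v w)
    (v w z : 𝕋 x) (p : Fin 6) :
    Γ (mid p) 0 x (weyl g x v w z) =
      ∑ q, curvM Γ x v w (mid p) (mid q) * Γ (mid q) 0 x z := by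
  have hsrc := mem_extChartAt_source (I := 𝓡 6) x
  have hE := (h.det_solderMatrix hx hsrc).isUnit
  have e1 : ∀ a b, solderMatrix Γ x x * ((solderMatrix Γ x x)⁻¹ * midCurv Γ x a b *
      solderMatrix Γ x x) = midCurv Γ x a b * solderMatrix Γ x x := fun a b => by
    rw [← mul_assoc, ← mul_assoc, Matrix.mul_nonsing_inv _ hE, one_mul]
  have e2 : ∀ q, curvM Γ x v w (mid p) (mid q) = ∑ a, ∑ b, midCurv Γ x a b p q *
      (coordForm x a x v * coordForm x b x w) := by
    intro q
    obtain ⟨B, -, hB⟩ := isAlt_curvM (x := x) Γ (mid p) (mid q)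
    simp only [midCurv, of_apply, hB]
    exact ((isCoframe_coordForm x).coframeAt x hsrc).bilin_apply B v w
  rw [solder_eq_sum hsrc]
  simp only [coordForm_weyl, h.weylCoord_gramInChart h0 hc hx hs hg]
  have e3 : ∀ c a b, ∑ d, solderMatrix Γ x x p d * ((solderMatrix Γ x x)⁻¹ * midCurv Γ x a b *
      solderMatrix Γ x x) d c = ∑ q, midCurv Γ x a b p q * solderMatrix Γ x x q c := by
    intro c a b
    rw [← Matrix.mul_apply, e1, Matrix.mul_apply]
  have e4 : ∑ d, solderMatrix Γ x x p d * ∑ c, ∑ a, ∑ b, ((solderMatrix Γ x x)⁻¹ *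
      midCurv Γ x a b * solderMatrix Γ x x) d c * coordForm x c x z * coordForm x a x v *
        coordForm x b x w = ∑ c, ∑ a, ∑ b, (∑ d, solderMatrix Γ x x p d *
        ((solderMatrix Γ x x)⁻¹ * midCurv Γ x a b * solderMatrix Γ x x) d c) *
        coordForm x c x z * coordForm x a x v * coordForm x b x w := by
    simp only [Finset.mul_sum, Finset.sum_mul]
    rw [Finset.sum_comm]
    refine Finset.sum_congr rfl fun c _ => ?_
    rw [Finset.sum_comm]
    refine Finset.sum_congr rfl fun a _ => ?_
    rw [Finset.sum_comm]
    simp only [mul_assoc]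
  rw [e4]
  simp only [e3, e2, solder_eq_sum hsrc, Finset.mul_sum, Finset.sum_mul]
  generalize coordForm x = η
  have e5 : ∀ F : Fin 6 → Fin 6 → Fin 6 → Fin 6 → ℝ,
      ∑ c, ∑ a, ∑ b, ∑ q, F c a b q = ∑ q, ∑ c, ∑ a, ∑ b, F c a b q := fun F =>
    (Finset.sum_congr rfl fun c _ => (Finset.sum_congr rfl fun a _ => Finset.sum_comm).trans
      Finset.sum_comm).trans Finset.sum_comm
  rw [e5]
  refine Finset.sum_congr rfl fun q _ => Finset.sum_congr rfl fun c _ =>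
    Finset.sum_congr rfl fun a _ => Finset.sum_congr rfl fun b _ => by ring

/-- The Weyl tensor of a representing metric is the extended curvature tensor. -/
theorem IsCartanFrame.coord_weyl {f : CartanFrame M} (hD : IsNondegenerate D)
    (hf : IsCartanFrame D U f) (hg : RepresentsConformal D U g) (hx : x ∈ U)
    (v w z : 𝕋 x) : f.coord x (weyl g x v w z) =
      extTensor (f.S x) (f.coord x v) (f.coord x w) *ᵥ f.coord x z := by
  have h := hf.isNormalConformalGauge hD
  obtain ⟨r, sr, hr0, hr⟩ := h.exists_conformalFactor hg fun y hy => by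
    rw [gammaHat_metric]
    exact hg.multiple U subset_rfl _ hf.isThirdOrderFrame.isTwoAdapted y hy
  have ha : ∀ y ∈ U, 0 < |r y| := fun y hy => abs_pos.2 (hr0 y hy)
  have sa : ∀ y ∈ U, FunSmoothAt (fun z => |r z|) y := fun y hy => (sr y hy).abs (hr0 y hy)
  obtain ⟨Γ, k, hΓ, G, h00, hk, hkm⟩ := h.exists_gaugeMap (ε := fun _ => 1)
    (c := fun y => √|r y|) (H := fun _ a b => if a = b then 1 else 0) (σ := 0)
    (fun _ _ => .const _) (fun y hy => (sa y hy).sqrt (ha y hy).ne') (fun _ _ _ _ => .const _)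
    (fun _ _ => .zero) (fun _ _ => one_mul 1) (fun y hy => Real.sqrt_pos.2 (ha y hy))
    (fun y hy a b => by
      rw [Finset.sum_eq_single a (fun d _ hd => by simp [hd]) (by simp)]
      simp only [if_true, one_mul]
      exact if_congr ⟨Eq.symm, Eq.symm⟩ rfl rfl)
  have hsol : ∀ a v, Γ (mid a) 0 x v = √|r x| * f.gammaHat (mid a) 0 x v := by
    intro a v
    have := G.solder_eq (fun x hx v => h.isSkewMatrix hx v) hx (hk x hx) a v
    simpa [hkm x] using this
  have hcurv : ∀ a b v w, curvM Γ x v w (mid a) (mid b) =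
      curvM f.gammaHat x v w (mid a) (mid b) := by
    intro a b v w
    have := G.curv_mid h (fun a b => hΓ.smoothAt hx a b) hx a b v w
    simpa [hkm x] using this
  have hc : ∀ v w, curvM Γ x v w 0 0 = 0 := fun v w => by
    rw [(G.curv_col0 h (fun a b => hΓ.smoothAt hx a b) hx v w).2, ← GaugeForm.curv_eq, hf.curv_00 hx]
  have hsq : ∀ y ∈ U, (r y * |r y|⁻¹) * (r y * |r y|⁻¹) = 1 := fun y hy => by
    have := (ha y hy).ne'
    field_simp
    rw [sq_abs]
  have hs : ∀ᶠ y in nhds x, r y * |r y|⁻¹ = r x * |r x|⁻¹ :=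
    eventually_eq_of_sq_eq_one ((sr x hx).mul ((sa x hx).inv (ha x hx).ne')).continuousAt
      (Filter.mem_of_superset (h.isOpen.mem_nhds hx) hsq)
  have hmet : ∀ᶠ y in nhds x, ∀ v w, g y v w = r x * |r x|⁻¹ * Γ.metric y v w := by
    filter_upwards [hs, h.isOpen.mem_nhds hx] with y hy hyU v w
    have := G.metric_eq (fun x hx v => h.isSkewMatrix hx v) hyU (hk y hyU) v w
    rw [one_mul, Real.mul_self_sqrt (abs_nonneg _)] at this
    rw [← hy, this, hr y hyU, mul_assoc, ← mul_assoc |r y|⁻¹, inv_mul_cancel₀ (ha y hyU).ne',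
      one_mul]
  have key := hΓ.solder_weyl h00 hc hx (hsq x hx) hmet v w z
  funext p
  have e := key (idx6 p)
  simp only [hsol, hcurv, mul_left_comm _ √|r x|, ← Finset.mul_sum] at e
  have e' := mul_left_cancel₀ (Real.sqrt_pos.2 (ha x hx)).ne' e
  rw [gammaHat_solder] at e'
  rw [e', ← Equiv.sum_comp idx6, Matrix.mulVec, dotProduct]
  refine Finset.sum_congr rfl fun q _ => ?_
  rw [gammaHat_solder, ← GaugeForm.curv_eq, ← hf.curv_mid hx]
  rfl

end WeylMain

section FlatModel

lemma FunSmoothAt.clm_comp {V W : Type*} [NormedAddCommGroup V] [NormedSpace ℝ V]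
    [NormedAddCommGroup W] [NormedSpace ℝ W] {f : M → V} (hf : FunSmoothAt f x) (L : V →L[ℝ] W) :
    FunSmoothAt (fun y => L (f y)) x :=
  L.contDiff.contDiffAt.comp (𝒞 x x) hf

lemma FunSmoothAt.diff_clm_comp {V W : Type*} [NormedAddCommGroup V] [NormedSpace ℝ V]
    [NormedAddCommGroup W] [NormedSpace ℝ W] {f : M → V} (hf : FunSmoothAt f x) (L : V →L[ℝ] W)
    (v : 𝕋 x) : diff (fun y => L (f y)) x v = L (diff f x v) := by
  rw [(hf.clm_comp L).diff_apply, hf.diff_apply]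
  exact DFunLike.congr_fun (L.hasFDerivAt.comp _ (ContDiffAt.differentiableAt hf (by simp)).hasFDerivAt).fderiv _

lemma bijective_of_forms {e : Fin 3 ⊕ Fin 3 → E6 →L[ℝ] ℝ} (h : ∀ v, (∀ i, e i v = 0) → v = 0) :
    Function.Bijective fun v i => e i v := by
  let L : E6 →ₗ[ℝ] (Fin 3 ⊕ Fin 3 → ℝ) := LinearMap.pi fun i => (e i : E6 →ₗ[ℝ] ℝ)
  have hL : Function.Injective L := (injective_iff_map_eq_zero L).2 fun v hv =>
    h v fun i => congrFun hv i
  have : Module.finrank ℝ E6 = Module.finrank ℝ (Fin 3 ⊕ Fin 3 → ℝ) := by simp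
  exact ⟨hL, (LinearMap.injective_iff_surjective_of_finrank_eq_finrank this).1 hL⟩

lemma coframeAt_of_injective {e : Fin 3 ⊕ Fin 3 → OneForm M}
    (h : ∀ v : 𝕋 x, (∀ i, e i x v = 0) → v = 0) : CoframeAt e x :=
  bijective_of_forms (e := fun i => e i x) h

/-- The coframing `dy_i + ε_{ijk} x^j dx^k`, `dx^i`. -/
def flatCoframing (X Y : Fin 3 → M → ℝ) : Coframing M where
  θ i := (fun y => diff (Y i) y) + ∑ j, ∑ k, eps i j k • fsmul (X j) fun y => diff (X k) y
  om i := fun y => diff (X i) y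

lemma flatCoframing_θ (X Y : Fin 3 → M → ℝ) (i : Fin 3) (v : 𝕋 x) :
    (flatCoframing X Y).θ i x v =
      diff (Y i) x v + ∑ j, ∑ k, eps i j k * X j x * diff (X k) x v := by
  change diff (Y i) x v + (∑ j, ∑ k, eps i j k • fsmul (X j) fun y => diff (X k) y) x v = _
  simp only [OneForm.sum_apply, mul_assoc]
  rfl

lemma flatCoframing_metric (X Y : Fin 3 → M → ℝ) : (flatCoframing X Y).metric =
    ∑ i, symProd (fun y => diff (Y i) y) fun y => diff (X i) y := by
  funext x
  ext v w
  simp only [Coframing.metric, Fin.sum_univ_three, Pi.add_apply, symProd,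
    ContinuousLinearMap.add_apply, ContinuousLinearMap.smulRight_apply,
    ContinuousLinearMap.smul_apply, smul_eq_mul, flatCoframing_θ]
  simp only [flatCoframing, Fin.sum_univ_three, eps]
  norm_num
  ring

lemma isTwoAdapted_flatCoframing {U : Set M} {X Y : Fin 3 → M → ℝ} (hU : IsOpen U)
    (hX : ∀ i, SmoothFunOn U (X i)) (hY : ∀ i, SmoothFunOn U (Y i))
    (hi : ∀ y ∈ U, ∀ v, (∀ i, diff (X i) y v = 0) → (∀ i, diff (Y i) y v = 0) → v = 0)
    (hDU : ∀ y ∈ U, ∀ v, v ∈ D y ↔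
      ∀ i, diff (Y i) y v + ∑ j, ∑ k, eps i j k * X j y * diff (X k) y v = 0) :
    IsTwoAdapted D U (flatCoframing X Y) := by
  have sX : ∀ x ∈ U, ∀ i, FunSmoothAt (X i) x := fun x hx i =>
    (smoothFunOn_iff_smoothAt hU _).1 (hX i) x hx
  have sY : ∀ x ∈ U, ∀ i, FunSmoothAt (Y i) x := fun x hx i =>
    (smoothFunOn_iff_smoothAt hU _).1 (hY i) x hx
  have s1 : ∀ x ∈ U, ∀ i j k, OneForm.SmoothAt (eps i j k • fsmul (X j) fun y => diff (X k) y) x :=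
    fun x hx i j k => ((sX x hx k).smoothAt_diff.fsmul (sX x hx j)).const_smul _
  have dθ : ∀ x ∈ U, ∀ v w : 𝕋 x, ∀ i, extD ((flatCoframing X Y).θ i) x v w =
      ∑ j, ∑ k, eps i j k * wedge ((flatCoframing X Y).om j) ((flatCoframing X Y).om k) x v w := by
    intro x hx v w i
    have e1 : ∀ j k, extD (eps i j k • fsmul (X j) fun y => diff (X k) y) x v w =
        eps i j k * wedge ((flatCoframing X Y).om j) ((flatCoframing X Y).om k) x v w := by
      intro j k
      rw [extD_const_smul _ ((sX x hx k).smoothAt_diff.fsmul (sX x hx j)),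
        extD_fsmul (sX x hx j) (sX x hx k).smoothAt_diff, (sX x hx k).extD_diff, mul_zero, add_zero]
      rfl
    rw [flatCoframing, extD_add (sY x hx i).smoothAt_diff (.sum fun j _ => .sum fun k _ => s1 x hx i j k),
      (sY x hx i).extD_diff, zero_add, extD_sum _ fun j _ => .sum fun k _ => s1 x hx i j k]
    exact Finset.sum_congr rfl fun j _ => by
      rw [extD_sum _ fun k _ => s1 x hx i j k]
      exact Finset.sum_congr rfl fun k _ => e1 j k
  refine ⟨⟨hU, fun i => ?_, fun i => ?_, fun x hx => ?_, fun x hx i v hv => ?_,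
    fun x hx v w _ _ i => dθ x hx v w i⟩, 0, 0, fun i j => ?_, fun i j => ?_, fun x hx v w i => ⟨?_, ?_⟩⟩
  · exact (smoothOneFormOn_iff_smoothAt hU).2 fun x hx =>
      (sY x hx i).smoothAt_diff.add (.sum fun j _ => .sum fun k _ => s1 x hx i j k)
  · exact (smoothOneFormOn_iff_smoothAt hU).2 fun x hx => (sX x hx i).smoothAt_diff
  · refine Coframing.coframeAt_form.1 (coframeAt_of_injective fun v hv => ?_)
    · have h1 : ∀ i, diff (X i) x v = 0 := fun i => hv (.inr i)
      refine hi x hx v h1 fun i => ?_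
      have := hv (.inl i)
      change (flatCoframing X Y).θ i x v = 0 at this
      rw [flatCoframing_θ] at this
      simpa [h1] using this
  · rw [flatCoframing_θ]
    exact (hDU x hx v).1 hv i
  · exact (smoothOneFormOn_iff_smoothAt hU).2 fun x hx => .zero
  · exact (smoothOneFormOn_iff_smoothAt hU).2 fun x hx => .zero
  · rw [dθ x hx]
    simp [wedge]
  · change extD (fun y => diff (X i) y) x v w = _
    rw [(sX x hx i).extD_diff]
    simp [wedge]

theorem IsLocallyFlatModel.isConformallyFlat (hD : IsNondegenerate D) (h : IsLocallyFlatModel D) :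
    IsConformallyFlat D := by
  intro x
  obtain ⟨U, hU, hx, X, Y, hX, hY, hXY⟩ := h x
  refine ⟨U, hx, Y, X, hY, hX, ?_⟩
  rw [← flatCoframing_metric]
  exact (isTwoAdapted_flatCoframing hU hX hY (fun y hy => (hXY y hy).1)
    fun y hy => (hXY y hy).2).representsConformal hD

end FlatModel

section HomogeneousModel

/-- The vector space `ℝ^{4,3}`. -/
abbrev V43 : Type := (Fin 3 → ℝ) × ℝ × (Fin 3 → ℝ)

/-- The quadratic form of type `(4,3)` as a bilinear map. -/
def bilin43 : V43 →ₗ[ℝ] V43 →ₗ[ℝ] ℝ :=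
  LinearMap.mk₂ ℝ form43 (fun a b c => by simp [form43, Fin.sum_univ_three]; ring)
    (fun r a b => by simp [form43, Fin.sum_univ_three]; ring)
    (fun a b c => by simp [form43, Fin.sum_univ_three]; ring)
    (fun r a b => by simp [form43, Fin.sum_univ_three]; ring)

lemma form43_comm (a b : V43) : form43 a b = form43 b a := by
  simp [form43, Fin.sum_univ_three]; ring

/-- Pairing with a vector of `ℝ^{4,3}`. -/
def pair43 (b : V43) : V43 →L[ℝ] ℝ := (bilin43 b).toContinuousLinearMap

lemma pair43_apply (a b : V43) : pair43 b a = form43 a b := form43_comm b a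

lemma FunSmoothAt.pair43 {e : M → V43} (he : FunSmoothAt e x) (b : V43) :
    FunSmoothAt (fun y => form43 (e y) b) x := by
  simpa only [pair43_apply] using he.clm_comp (ThreePlane.pair43 b)

lemma FunSmoothAt.form43_diff {e : M → V43} (he : FunSmoothAt e x) (b : V43)
    (v : 𝕋 x) : form43 (diff e x v) b = diff (fun y => form43 (e y) b) x v := by
  simpa only [pair43_apply] using (he.diff_clm_comp (ThreePlane.pair43 b) v).symm

/-- The null frame with coordinates `X`, `Y`. -/
def nullFrame (X Y : Fin 3 → ℝ) (i : Fin 3) : V43 :=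
  (Pi.single i 1, X i, fun j => -(X i * X j) - ∑ k, eps i j k * Y k)

lemma eps_mul_eq_zero {a : Fin 3 → ℝ} (h : ∀ i j, ∑ k, eps i j k * a k = 0) (k : Fin 3) :
    a k = 0 := by
  have h0 := h 1 2
  have h1 := h 2 0
  have h2 := h 0 1
  simp [Fin.sum_univ_three, eps] at h0 h1 h2
  norm_num at h0 h1 h2
  fin_cases k
  exacts [h0, h1, h2]

theorem IsLocallyFlatModel.isLocallyHomogeneousModel (h : IsLocallyFlatModel D) :
    IsLocallyHomogeneousModel D := by
  intro x
  obtain ⟨U, hU, hx, X, Y, hX, hY, hXY⟩ := h x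
  have sX : ∀ x ∈ U, ∀ i, FunSmoothAt (X i) x := fun x hx i =>
    (smoothFunOn_iff_smoothAt hU _).1 (hX i) x hx
  have sY : ∀ x ∈ U, ∀ i, FunSmoothAt (Y i) x := fun x hx i =>
    (smoothFunOn_iff_smoothAt hU _).1 (hY i) x hx
  have sZ : ∀ x ∈ U, ∀ i j, FunSmoothAt (fun y => -(X i y * X j y) - ∑ k, eps i j k * Y k y) x :=
    fun x hx i j => ((sX x hx i).mul (sX x hx j)).neg.sub
      (.sum fun k _ => (FunSmoothAt.const _).mul (sY x hx k))
  have dZ : ∀ x ∈ U, ∀ i j v, diff (fun y => -(X i y * X j y) - ∑ k, eps i j k * Y k y) x v =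
      -(diff (X i) x v * X j x + X i x * diff (X j) x v) - ∑ k, eps i j k * diff (Y k) x v := by
    intro x hx i j v
    have e : (fun y => -(X i y * X j y) - ∑ k, eps i j k * Y k y) =
        fun y => (-1) * (X i y * X j y) + ∑ k, -eps i j k * Y k y := by
      funext y
      simp only [neg_mul, Finset.sum_neg_distrib, one_mul]
      ring
    rw [e, ((FunSmoothAt.const _).mul ((sX x hx i).mul (sX x hx j))).diff_add
      (.sum fun k _ => (FunSmoothAt.const _).mul (sY x hx k)),
      ((sX x hx i).mul (sX x hx j)).diff_const_mul, (sX x hx i).diff_mul (sX x hx j),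
      FunSmoothAt.diff_sum fun k => (FunSmoothAt.const _).mul (sY x hx k)]
    simp only [(sY x hx _).diff_const_mul]
    simp only [neg_mul, Finset.sum_neg_distrib]
    ring
  let e : Fin 3 → M → V43 := fun i y => nullFrame (fun j => X j y) (fun j => Y j y) i
  have se : ∀ i, SmoothFunOn U (e i) := fun i =>
    contMDiffOn_const.prodMk_space ((hX i).prodMk_space (contMDiffOn_pi_space.2 fun j =>
      (smoothFunOn_iff_smoothAt hU _).2 fun x hx => sZ x hx i j))
  have se' : ∀ y ∈ U, ∀ i, FunSmoothAt (e i) y := fun y hy i =>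
    (smoothFunOn_iff_smoothAt hU _).1 (se i) y hy
  have d1 : ∀ y ∈ U, ∀ i j v, (diff (e i) y v).1 j = 0 := fun y hy i j v => by
    have := (se' y hy i).diff_clm_comp ((ContinuousLinearMap.proj (R := ℝ) (φ := fun _ : Fin 3 => ℝ) j).comp
      (ContinuousLinearMap.fst ℝ (Fin 3 → ℝ) (ℝ × (Fin 3 → ℝ)))) v
    exact this.symm.trans (diff_const _ v)
  have d2 : ∀ y ∈ U, ∀ i v, (diff (e i) y v).2.1 = diff (X i) y v := fun y hy i v =>
    ((se' y hy i).diff_clm_comp ((ContinuousLinearMap.fst ℝ ℝ (Fin 3 → ℝ)).comp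
      (ContinuousLinearMap.snd ℝ (Fin 3 → ℝ) (ℝ × (Fin 3 → ℝ)))) v).symm
  have d3 : ∀ y ∈ U, ∀ i j v, (diff (e i) y v).2.2 j =
      -(diff (X i) y v * X j y + X i y * diff (X j) y v) - ∑ k, eps i j k * diff (Y k) y v :=
    fun y hy i j v => by
      rw [← dZ y hy]
      exact ((se' y hy i).diff_clm_comp ((ContinuousLinearMap.proj (R := ℝ) (φ := fun _ : Fin 3 => ℝ) j).comp
        ((ContinuousLinearMap.snd ℝ ℝ (Fin 3 → ℝ)).comp
          (ContinuousLinearMap.snd ℝ (Fin 3 → ℝ) (ℝ × (Fin 3 → ℝ))))) v).symm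
  refine ⟨U, hU, hx, e, se, fun y hy => ⟨?_, fun i j => ?_, fun v hv => ?_, fun v => ?_⟩⟩
  · refine Fintype.linearIndependent_iff.2 fun a ha i => ?_
    have := congrFun (congrArg Prod.fst ha) i
    simpa [Prod.fst_sum, Finset.sum_apply, e, nullFrame, Pi.single_apply] using this
  · simp only [form43, e, nullFrame, Fin.sum_univ_three, eps]
    fin_cases i <;> fin_cases j <;> simp <;> ring
  · have h0 : ∀ i, diff (e i) y v = 0 := by
      intro i
      obtain ⟨a, ha⟩ := (Submodule.mem_span_range_iff_exists_fun ℝ).1 (hv i)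
      have : ∀ j, a j = 0 := fun j => by
        have := congrFun (congrArg Prod.fst ha) j
        rw [d1 y hy] at this
        simpa [Prod.fst_sum, Finset.sum_apply, e, nullFrame, Pi.single_apply] using this
      simpa [this] using ha.symm
    have hX0 : ∀ i, diff (X i) y v = 0 := fun i => by rw [← d2 y hy, h0]; rfl
    refine (hXY y hy).1 v hX0 (eps_mul_eq_zero fun i j => ?_)
    have := d3 y hy i j v
    rw [h0] at this
    simpa [hX0] using this.symm
  · rw [(hXY y hy).2 v]
    have key : ∀ i j, form43 (diff (e i) y v) (e j y) = -∑ k, eps i j k *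
        (diff (Y k) y v + ∑ l, ∑ m, eps k l m * X l y * diff (X m) y v) := by
      intro i j
      simp only [form43, d1 y hy, d2 y hy, d3 y hy]
      generalize (fun m => diff (X m) y v) = dX
      simp only [e, nullFrame, Fin.sum_univ_three, eps]
      fin_cases i <;> fin_cases j <;> simp <;> ring
    simp only [key, neg_eq_zero]
    exact ⟨fun h i j => by simp [h], fun h => eps_mul_eq_zero h⟩

end HomogeneousModel

section SpinForms

/-- The exterior product of two coordinate functions of `ℝ⁸`. -/
def wedge8 (p q : Fin 8) (v w : Fin 8 → ℝ) : ℝ := v p * w q - v q * w p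

/-- The first three of the seven skew forms spanning the `7`-dimensional summand of `Λ²(ℝ⁸)` under
`spin(4,3)`. -/
def spinA : Fin 3 → (Fin 8 → ℝ) → (Fin 8 → ℝ) → ℝ :=
  ![fun v w => wedge8 0 4 v w + wedge8 2 3 v w, fun v w => wedge8 0 5 v w + wedge8 3 1 v w,
    fun v w => wedge8 0 6 v w + wedge8 1 2 v w]

/-- The last three of the seven skew forms. -/
def spinB : Fin 3 → (Fin 8 → ℝ) → (Fin 8 → ℝ) → ℝ :=
  ![fun v w => wedge8 1 7 v w + wedge8 5 6 v w, fun v w => wedge8 2 7 v w + wedge8 6 4 v w,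
    fun v w => wedge8 3 7 v w + wedge8 4 5 v w]

/-- The middle one of the seven skew forms. -/
def spinC (v w : Fin 8 → ℝ) : ℝ :=
  wedge8 0 7 v w + wedge8 1 4 v w + wedge8 2 5 v w + wedge8 3 6 v w

/-- The invariant quadratic tensor of the seven skew forms. -/
def spinQ (v w p q : Fin 8 → ℝ) : ℝ :=
  ∑ i, (spinA i v w * spinB i p q + spinB i v w * spinA i p q) - (1 / 2) * (spinC v w * spinC p q)

/-- The action on `ℝ⁸` of the element of `spin(4,3)` with components `a`, `b`, `t`, `o`, `h`. -/
def spinAct (a : Fin 3 → Fin 3 → ℝ) (b t o h : Fin 3 → ℝ) (v : Fin 8 → ℝ) : Fin 8 → ℝ :=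
  ![-((1 / 2) * ∑ i, a i i) * v 0 + b 0 * v 1 + b 1 * v 2 + b 2 * v 3 + t 0 * v 4 + t 1 * v 5 +
      t 2 * v 6,
    o 0 * v 0 + (a 0 0 - (1 / 2) * ∑ i, a i i) * v 1 + a 0 1 * v 2 + a 0 2 * v 3 - b 2 * v 5 +
      b 1 * v 6 + t 0 * v 7,
    o 1 * v 0 + a 1 0 * v 1 + (a 1 1 - (1 / 2) * ∑ i, a i i) * v 2 + a 1 2 * v 3 + b 2 * v 4 -
      b 0 * v 6 + t 1 * v 7,
    o 2 * v 0 + a 2 0 * v 1 + a 2 1 * v 2 + (a 2 2 - (1 / 2) * ∑ i, a i i) * v 3 - b 1 * v 4 +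
      b 0 * v 5 + t 2 * v 7,
    h 0 * v 0 + o 2 * v 2 - o 1 * v 3 + ((1 / 2) * ∑ i, a i i - a 0 0) * v 4 - a 1 0 * v 5 -
      a 2 0 * v 6 + b 0 * v 7,
    h 1 * v 0 - o 2 * v 1 + o 0 * v 3 - a 0 1 * v 4 + ((1 / 2) * ∑ i, a i i - a 1 1) * v 5 -
      a 2 1 * v 6 + b 1 * v 7,
    h 2 * v 0 + o 1 * v 1 - o 0 * v 2 - a 0 2 * v 4 - a 1 2 * v 5 +
      ((1 / 2) * ∑ i, a i i - a 2 2) * v 6 + b 2 * v 7,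
    h 0 * v 1 + h 1 * v 2 + h 2 * v 3 + o 0 * v 4 + o 1 * v 5 + o 2 * v 6 +
      ((1 / 2) * ∑ i, a i i) * v 7]

variable (a : Fin 3 → Fin 3 → ℝ) (b t o h : Fin 3 → ℝ) (v w p q : Fin 8 → ℝ)

lemma spinA_spinAct (i : Fin 3) :
    spinA i (spinAct a b t o h v) w + spinA i v (spinAct a b t o h w) =
      -∑ j, a j i * spinA j v w + b i * spinC v w - ∑ j, ∑ k, eps i j k * t j * spinB k v w := by
  fin_cases i <;> simp [spinA, spinB, spinC, wedge8, spinAct, Fin.sum_univ_three, eps] <;> ring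

lemma spinB_spinAct (i : Fin 3) :
    spinB i (spinAct a b t o h v) w + spinB i v (spinAct a b t o h w) =
      ∑ j, a i j * spinB j v w + o i * spinC v w + ∑ j, ∑ k, eps i j k * h j * spinA k v w := by
  fin_cases i <;> simp [spinA, spinB, spinC, wedge8, spinAct, Fin.sum_univ_three, eps] <;> ring

lemma spinC_spinAct :
    spinC (spinAct a b t o h v) w + spinC v (spinAct a b t o h w) =
      2 * ∑ i, b i * spinB i v w + 2 * ∑ i, o i * spinA i v w := by
  simp [spinA, spinB, spinC, wedge8, spinAct, Fin.sum_univ_three]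
  ring

lemma spinQ_spinAct : spinQ (spinAct a b t o h v) w p q + spinQ v (spinAct a b t o h w) p q +
    spinQ v w (spinAct a b t o h p) q + spinQ v w p (spinAct a b t o h q) = 0 := by
  have e : ∀ v' w' p' q', spinQ v' w p q + spinQ v w' p q + spinQ v w p' q + spinQ v w p q' =
      ∑ i, ((spinA i v' w + spinA i v w') * spinB i p q + (spinB i v' w + spinB i v w') * spinA i p q +
        spinA i v w * (spinB i p' q + spinB i p q') + spinB i v w * (spinA i p' q + spinA i p q')) -
      (1 / 2) * ((spinC v' w + spinC v w') * spinC p q + spinC v w * (spinC p' q + spinC p q')) := by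
    intro v' w' p' q'
    simp only [spinQ, Fin.sum_univ_three]
    ring
  rw [e]
  simp only [spinA_spinAct, spinB_spinAct, spinC_spinAct]
  generalize (fun i => spinA i v w) = A1
  simp only [Fin.sum_univ_three, eps]
  norm_num
  ring

end SpinForms

section SpinTransport

open Matrix

lemma FunSmoothAt.eventually_const {f : M → ℝ} (hf : FunSmoothAt f x)
    (h : ∀ᶠ y in nhds x, ∀ v, diff f y v = 0) : ∀ᶠ y in nhds x, f y = f x := by
  have h1 : ∀ᶠ p in nhds (𝒞 x x), fderiv ℝ (f ∘ (𝒞 x).symm) p = 0 ∧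
      DifferentiableAt ℝ (f ∘ (𝒞 x).symm) p := by
    filter_upwards [hf.inChart_diff, extChartAt_symm_eventually_mem h,
      hf.eventually_differentiableAt] with p hp hp' hd
    refine ⟨?_, hd⟩
    rw [← hp]
    ext w
    exact hp'.2 _
  obtain ⟨r, hr, hb⟩ := Metric.eventually_nhds_iff_ball.1 h1
  have h2 : ∀ᶠ p in nhds (𝒞 x x), p ∈ Metric.ball (𝒞 x x) r :=
    Metric.ball_mem_nhds _ hr
  filter_upwards [extChartAt_eventually h2] with y hy
  have := (convex_ball (𝒞 x x) r).is_const_of_fderivWithin_eq_zero (𝕜 := ℝ)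
    (f := f ∘ (𝒞 x).symm) (fun p hp => (hb p hp).2.differentiableWithinAt)
    (fun p hp => by rw [fderivWithin_of_isOpen Metric.isOpen_ball hp, (hb p hp).1])
    hy.2 (Metric.mem_ball_self hr)
  rwa [Function.comp_apply, Function.comp_apply, (𝒞 x).left_inv hy.1,
    extChartAt_to_inv] at this

/-- The product rule for a pairing of vectors of functions. -/
def HasProductRule (b : (Fin 8 → ℝ) → (Fin 8 → ℝ) → ℝ) (x : M) : Prop :=
  ∀ V W : M → Fin 8 → ℝ, (∀ c, FunSmoothAt (fun y => V y c) x) →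
    (∀ c, FunSmoothAt (fun y => W y c) x) → FunSmoothAt (fun y => b (V y) (W y)) x ∧
    ∀ u, diff (fun y => b (V y) (W y)) x u = b (fun c => diff (fun y => V y c) x u) (W x) +
      b (V x) (fun c => diff (fun y => W y c) x u)

lemma FunSmoothAt.diff_sub {f g : M → ℝ} (hf : FunSmoothAt f x) (hg : FunSmoothAt g x)
    (v : 𝕋 x) : diff (fun y => f y - g y) x v = diff f x v - diff g x v := by
  have e : (fun y => f y - g y) = fun y => f y + (-1) * g y := by funext y; ring
  rw [e, hf.diff_add ((FunSmoothAt.const _).mul hg), hg.diff_const_mul]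
  ring

lemma HasProductRule.wedge8 (p q : Fin 8) : HasProductRule (wedge8 p q) x := fun V W hV hW =>
  ⟨((hV p).mul (hW q)).sub ((hV q).mul (hW p)), fun u => by
    refine (((hV p).mul (hW q)).diff_sub ((hV q).mul (hW p)) u).trans ?_
    rw [(hV p).diff_mul (hW q), (hV q).diff_mul (hW p), ThreePlane.wedge8, ThreePlane.wedge8]
    ring⟩

lemma HasProductRule.add {b b' : (Fin 8 → ℝ) → (Fin 8 → ℝ) → ℝ} (h : HasProductRule b x)
    (h' : HasProductRule b' x) : HasProductRule (fun v w => b v w + b' v w) x := fun V W hV hW =>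
  ⟨(h V W hV hW).1.add (h' V W hV hW).1, fun u => by
    rw [(h V W hV hW).1.diff_add (h' V W hV hW).1, (h V W hV hW).2, (h' V W hV hW).2]
    ring⟩

lemma HasProductRule.spinA (i : Fin 3) : HasProductRule (spinA i) x := by
  fin_cases i <;> exact (wedge8 _ _).add (wedge8 _ _)

lemma HasProductRule.spinB (i : Fin 3) : HasProductRule (spinB i) x := by
  fin_cases i <;> exact (wedge8 _ _).add (wedge8 _ _)

lemma HasProductRule.spinC : HasProductRule spinC x :=
  (((wedge8 _ _).add (wedge8 _ _)).add (wedge8 _ _)).add (wedge8 _ _)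

lemma spinQ_productRule {V W P Q : M → Fin 8 → ℝ} (hV : ∀ c, FunSmoothAt (fun y => V y c) x)
    (hW : ∀ c, FunSmoothAt (fun y => W y c) x) (hP : ∀ c, FunSmoothAt (fun y => P y c) x)
    (hQ : ∀ c, FunSmoothAt (fun y => Q y c) x) :
    FunSmoothAt (fun y => spinQ (V y) (W y) (P y) (Q y)) x ∧ ∀ u,
    diff (fun y => spinQ (V y) (W y) (P y) (Q y)) x u =
      spinQ (fun c => diff (fun y => V y c) x u) (W x) (P x) (Q x) +
      spinQ (V x) (fun c => diff (fun y => W y c) x u) (P x) (Q x) +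
      spinQ (V x) (W x) (fun c => diff (fun y => P y c) x u) (Q x) +
      spinQ (V x) (W x) (P x) (fun c => diff (fun y => Q y c) x u) := by
  have a1 := fun i => HasProductRule.spinA i V W hV hW
  have a2 := fun i => HasProductRule.spinA i P Q hP hQ
  have b1 := fun i => HasProductRule.spinB i V W hV hW
  have b2 := fun i => HasProductRule.spinB i P Q hP hQ
  have c1 := HasProductRule.spinC V W hV hW
  have c2 := HasProductRule.spinC P Q hP hQ
  have s1 := fun i => ((a1 i).1.mul (b2 i).1).add ((b1 i).1.mul (a2 i).1)
  have s2 := FunSmoothAt.sum (s := Finset.univ) fun i _ => s1 i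
  have s3 := c1.1.mul c2.1
  refine ⟨s2.sub ((FunSmoothAt.const _).mul s3), fun u => ?_⟩
  refine (s2.diff_sub ((FunSmoothAt.const (1 / 2)).mul s3) u).trans ?_
  rw [FunSmoothAt.diff_sum s1, s3.diff_const_mul, c1.1.diff_mul c2.1, c1.2, c2.2]
  have e : ∀ i, _ := fun i => ((a1 i).1.mul (b2 i).1).diff_add ((b1 i).1.mul (a2 i).1) u
  simp only [e, (a1 _).1.diff_mul (b2 _).1, (b1 _).1.diff_mul (a2 _).1, (a1 _).2, (a2 _).2,
    (b1 _).2, (b2 _).2, spinQ, Fin.sum_univ_three]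
  ring

/-- The tensor `spinQ` as a bilinear map of its first two arguments. -/
def spinQBilin (p q : Fin 8 → ℝ) : (Fin 8 → ℝ) →ₗ[ℝ] (Fin 8 → ℝ) →ₗ[ℝ] ℝ :=
  LinearMap.mk₂ ℝ (fun v w => spinQ v w p q)
    (fun _ _ _ => by simp [spinQ, spinA, spinB, spinC, wedge8, Fin.sum_univ_three]; ring)
    (fun _ _ _ => by simp [spinQ, spinA, spinB, spinC, wedge8, Fin.sum_univ_three]; ring)
    (fun _ _ _ => by simp [spinQ, spinA, spinB, spinC, wedge8, Fin.sum_univ_three]; ring)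
    (fun _ _ _ => by simp [spinQ, spinA, spinB, spinC, wedge8, Fin.sum_univ_three]; ring)

/-- If the tensor `spinQ` is invariant on the columns of an invertible matrix, it is invariant. -/
lemma spinQ_mulVec {h H : Matrix (Fin 8) (Fin 8) ℝ} (hH : H * h = 1) {p q : Fin 8 → ℝ}
    {p' q' : Fin 8 → ℝ} (hQ : ∀ a b, spinQ (fun c => H c a) (fun c => H c b) p q =
      spinQ (Pi.single a 1) (Pi.single b 1) p' q') (v w : Fin 8 → ℝ) :
    spinQ (h *ᵥ v) (h *ᵥ w) p' q' = spinQ v w p q := by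
  have e1 : ∀ v : Fin 8 → ℝ, v = ∑ a, (h *ᵥ v) a • fun c => H c a := fun v => by
    have : H *ᵥ (h *ᵥ v) = v := by rw [mulVec_mulVec, hH, one_mulVec]
    conv_lhs => rw [← this]
    ext c
    simp [mulVec, dotProduct, Finset.sum_apply, mul_comm]
  have e2 : ∀ v : Fin 8 → ℝ, v = ∑ a, v a • (Pi.single a 1 : Fin 8 → ℝ) := fun v => by
    ext c
    simp [Finset.sum_apply, Pi.single_apply]
  change spinQBilin p' q' (h *ᵥ v) (h *ᵥ w) = spinQBilin p q v w
  conv_rhs => rw [e1 v, e1 w]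
  conv_lhs => rw [e2 (h *ᵥ v), e2 (h *ᵥ w)]
  simp only [map_sum, map_smul, LinearMap.sum_apply, LinearMap.smul_apply]
  exact Finset.sum_congr rfl fun a _ => congrArg _ (Finset.sum_congr rfl fun b _ =>
    congrArg _ (hQ b a).symm)

lemma idx8_values : idx8 (.inr 0) = 1 ∧ idx8 (.inr 1) = 2 ∧ idx8 (.inr 2) = 3 ∧
    idx8 (.inl 0) = 4 ∧ idx8 (.inl 1) = 5 ∧ idx8 (.inl 2) = 6 := ⟨rfl, rfl, rfl, rfl, rfl, rfl⟩

lemma spinQ_single (v w : Fin 8 → ℝ) (i : Fin 3) :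
    spinQ v w (Pi.single (idx8 (.inr i)) 1) (Pi.single 7 1) = spinA i v w := by
  fin_cases i <;> simp [spinQ, spinA, spinB, spinC, wedge8, Fin.sum_univ_three, idx8_values]

lemma spinA_eq (i : Fin 3) (v w : Fin 8 → ℝ) : spinA i v w =
    v 0 * w (idx8 (.inl i)) - v (idx8 (.inl i)) * w 0 +
      ∑ j, ∑ k, eps i j k * v (idx8 (.inr j)) * w (idx8 (.inr k)) := by
  fin_cases i <;> simp [spinA, wedge8, Fin.sum_univ_three, eps, idx8_values] <;> norm_num <;> ring

end SpinTransport

section FlatGauge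

open Matrix

variable {P : Fin 6 → M → ℝ}

/-- The flat gauge with soldering form `dP`. -/
def flatGauge (P : Fin 6 → M → ℝ) : GaugeForm M :=
  let e : Fin 6 → OneForm M := fun a y => diff (P a) y
  !![0,   0,   0,   0,   0,   0,   0,   0;
     e 0, 0,   0,   0,   0,   0,   0,   0;
     e 1, 0,   0,   0,   0,   0,   0,   0;
     e 2, 0,   0,   0,   0,   0,   0,   0;
     e 3, 0,   0,   0,   0,   0,   0,   0;
     e 4, 0,   0,   0,   0,   0,   0,   0;
     e 5, 0,   0,   0,   0,   0,   0,   0;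
     0,   e 3, e 4, e 5, e 0, e 1, e 2, 0]

lemma flatGauge_m0 (a : Fin 6) : flatGauge P (mid a) 0 = fun y => diff (P a) y := by
  fin_cases a <;> rfl
lemma flatGauge_7m (a : Fin 6) : flatGauge P 7 (mid a) = fun y => diff (P (a + 3)) y := by
  fin_cases a <;> rfl
lemma flatGauge_0 (b : Fin 8) : flatGauge P 0 b = 0 := by fin_cases b <;> rfl
lemma flatGauge_mm (a b : Fin 6) : flatGauge P (mid a) (mid b) = 0 := by
  fin_cases a <;> fin_cases b <;> rfl
lemma flatGauge_m7 (a : Fin 6) : flatGauge P (mid a) 7 = 0 := by fin_cases a <;> rfl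
lemma flatGauge_70 : flatGauge P 7 0 = 0 := rfl
lemma flatGauge_77 : flatGauge P 7 7 = 0 := rfl

lemma isNormalConformalGauge_flatGauge (hU : IsOpen U) (hP : ∀ x ∈ U, ∀ a, FunSmoothAt (P a) x)
    (hm : RepresentsConformal D U (flatGauge P).metric) :
    IsNormalConformalGauge D U (flatGauge P) where
  smooth a b := (smoothOneFormOn_iff_smoothAt hU).2 fun x hx => by
    revert a b
    simp only [forall_fin8, flatGauge_m0, flatGauge_7m, flatGauge_0, flatGauge_mm, flatGauge_m7,
      flatGauge_70, flatGauge_77]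
    exact ⟨⟨.zero, fun _ => .zero, .zero⟩, fun a => ⟨(hP x hx a).smoothAt_diff, fun _ => .zero,
      .zero⟩, .zero, fun a => (hP x hx _).smoothAt_diff, .zero⟩
  skew x hx v := by
    rw [GaugeForm.ev_eq]
    refine isSkewMatrix_iff.2 ⟨?_, ?_, ?_, fun a => ?_, fun a => ?_, fun a b => ?_⟩ <;>
      simp only [evM, of_apply, flatGauge_m0, flatGauge_7m, flatGauge_0, flatGauge_mm, flatGauge_m7,
        flatGauge_70, flatGauge_77] <;> simp
  solder x hx := by
    have hc : CoframeAt (fun p => flatGauge P (idx8 p) 0) x := coframeAt_of_injective fun v hv =>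
      hm.nondegenerate x hx v fun w => by
        rw [GaugeForm.metric_apply]
        refine Finset.sum_eq_zero fun a _ => ?_
        obtain ⟨p, rfl⟩ := idx6.surjective a
        rw [show flatGauge P (mid (idx6 p)) 0 x v = 0 from hv p, zero_mul]
    have h2 : (fun (v : 𝕋 x) a => flatGauge P (mid a) 0 x v) =
        idx6.arrowCongr (Equiv.refl ℝ) ∘ fun v p => flatGauge P (idx8 p) 0 x v := by
      funext v a
      obtain ⟨p, rfl⟩ := idx6.surjective a
      simp [idx8]
    rw [h2]
    exact (Equiv.bijective _).comp hc
  conformal := hm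
  torsion_free x hx a v w := by
    rw [GaugeForm.curv, sum_fin8]
    simp only [flatGauge_m0, flatGauge_0, flatGauge_mm, flatGauge_m7, (hP x hx a).extD_diff]
    simp [wedge]
  normal x hx X hX b w := by
    refine Finset.sum_eq_zero fun a _ => ?_
    rw [GaugeForm.curv, GaugeForm.curv, sum_fin8, sum_fin8]
    simp only [flatGauge_0, flatGauge_mm, flatGauge_m7, flatGauge_70, extD_zero]
    simp [wedge]

/-- A matrix function with logarithmic derivative `flatGauge P`. -/
def flatFrame (P : Fin 6 → M → ℝ) (y : M) : Matrix (Fin 8) (Fin 8) ℝ :=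
  !![1,     0,     0,     0,     0,     0,     0,     0;
     P 0 y, 1,     0,     0,     0,     0,     0,     0;
     P 1 y, 0,     1,     0,     0,     0,     0,     0;
     P 2 y, 0,     0,     1,     0,     0,     0,     0;
     P 3 y, 0,     0,     0,     1,     0,     0,     0;
     P 4 y, 0,     0,     0,     0,     1,     0,     0;
     P 5 y, 0,     0,     0,     0,     0,     1,     0;
     P 0 y * P 3 y + P 1 y * P 4 y + P 2 y * P 5 y, P 3 y, P 4 y, P 5 y, P 0 y, P 1 y, P 2 y, 1]

lemma flatFrame_m0 (y : M) (a : Fin 6) : flatFrame P y (mid a) 0 = P a y := by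
  fin_cases a <;> rfl
lemma flatFrame_7m (y : M) (a : Fin 6) : flatFrame P y 7 (mid a) = P (a + 3) y := by
  fin_cases a <;> rfl
lemma flatFrame_0m (y : M) (a : Fin 6) : flatFrame P y 0 (mid a) = 0 := by fin_cases a <;> rfl
lemma flatFrame_mm (y : M) (a b : Fin 6) :
    flatFrame P y (mid a) (mid b) = if a = b then 1 else 0 := by
  fin_cases a <;> fin_cases b <;> rfl
lemma flatFrame_m7 (y : M) (a : Fin 6) : flatFrame P y (mid a) 7 = 0 := by fin_cases a <;> rfl
lemma flatFrame_00 (y : M) : flatFrame P y 0 0 = 1 := rfl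
lemma flatFrame_07 (y : M) : flatFrame P y 0 7 = 0 := rfl
lemma flatFrame_77 (y : M) : flatFrame P y 7 7 = 1 := rfl
lemma flatFrame_70 (y : M) :
    flatFrame P y 7 0 = P 0 y * P 3 y + P 1 y * P 4 y + P 2 y * P 5 y := rfl

lemma flatFrame_eq_one {y : M} (h : ∀ a, P a y = 0) : flatFrame P y = 1 := by
  ext a b
  simp only [flatFrame, h]
  fin_cases a <;> fin_cases b <;> simp

lemma matSmoothAt_flatFrame (hP : ∀ a, FunSmoothAt (P a) x) : MatSmoothAt (flatFrame P) x := by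
  intro a b
  revert a b
  simp only [forall_fin8, flatFrame_m0, flatFrame_7m, flatFrame_0m, flatFrame_mm, flatFrame_m7,
    flatFrame_00, flatFrame_07, flatFrame_77, flatFrame_70]
  exact ⟨⟨.const _, fun _ => .const _, .const _⟩, fun a => ⟨hP a, fun _ => .const _, .const _⟩,
    (((hP 0).mul (hP 3)).add ((hP 1).mul (hP 4))).add ((hP 2).mul (hP 5)), fun a => hP _, .const _⟩

lemma diffM_flatFrame (hP : ∀ a, FunSmoothAt (P a) x) (v : 𝕋 x) :
    diffM (flatFrame P) x v = flatFrame P x * evM (flatGauge P) x v := by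
  ext a b
  rw [Matrix.mul_apply, sum_fin8]
  simp only [diffM, evM, of_apply]
  revert a b
  simp only [forall_fin8, flatFrame_m0, flatFrame_7m, flatFrame_0m, flatFrame_mm, flatFrame_m7,
    flatFrame_00, flatFrame_07, flatFrame_77, flatFrame_70, diff_const, flatGauge_m0, flatGauge_7m,
    flatGauge_0, flatGauge_mm, flatGauge_m7, flatGauge_70, flatGauge_77]
  have e0 : (0 : OneForm M) x v = 0 := rfl
  refine ⟨⟨?_, fun _ => ?_, ?_⟩, fun a => ⟨?_, fun _ => ?_, ?_⟩, ?_, fun a => ?_, ?_⟩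
  all_goals simp only [e0, mul_zero, Finset.sum_const_zero, add_zero, zero_add, zero_mul, one_mul]
  · simp
  · rw [(((hP 0).mul (hP 3)).add ((hP 1).mul (hP 4))).diff_add ((hP 2).mul (hP 5)),
      ((hP 0).mul (hP 3)).diff_add ((hP 1).mul (hP 4)), (hP 0).diff_mul (hP 3),
      (hP 1).diff_mul (hP 4), (hP 2).diff_mul (hP 5), Fin.sum_univ_six]
    simp only [Fin.reduceAdd, zero_add]
    ring

end FlatGauge

section Transport

open Matrix

variable {P : Fin 6 → M → ℝ} {f : CartanFrame M} {h k : M → Matrix (Fin 8) (Fin 8) ℝ}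

/-- A matrix function with logarithmic derivative `γ̂`. -/
structure IsParallelFrame (U : Set M) (f : CartanFrame M) (h : M → Matrix (Fin 8) (Fin 8) ℝ) :
    Prop where
  isOpen : IsOpen U
  smooth : ∀ x ∈ U, MatSmoothAt h x
  eq : ∀ x ∈ U, ∀ v, diffM h x v = h x * evM f.gammaHat x v

lemma GaugeMap.exists_isParallelFrame (g : GaugeMap U (flatGauge P) f.gammaHat k)
    (hP : ∀ x ∈ U, ∀ a, FunSmoothAt (P a) x) (hx : x ∈ U) (h0 : ∀ a, P a x = 0) :
    ∃ h, IsParallelFrame U f h ∧ h x = 1 := by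
  obtain ⟨ε, c, hk⟩ := g.parabolic x hx
  have s1 := fun y (hy : y ∈ U) => matSmoothAt_flatFrame (hP y hy)
  refine ⟨fun y => (k x)⁻¹ * (flatFrame P y * k y), ⟨g.isOpen, fun y hy =>
    (MatSmoothAt.const _).mul ((s1 y hy).mul (g.smooth y hy)), fun y hy v => ?_⟩, ?_⟩
  · rw [diffM_mul (.const _) ((s1 y hy).mul (g.smooth y hy)), diffM_const,
      diffM_mul (s1 y hy) (g.smooth y hy), diffM_flatFrame (hP y hy), zero_mul, zero_add,
      mul_assoc (k x)⁻¹, mul_assoc (flatFrame P y) (k y) (evM _ _ _),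
      g.eq y hy]
    simp only [mul_add, mul_assoc]
  · beta_reduce
    rw [flatFrame_eq_one h0, one_mul, Matrix.nonsing_inv_mul _ hk.det_ne_zero.isUnit]

lemma form44_mul_gammaHat (v : 𝕋 x) :
    form44 * evM f.gammaHat x v = -((evM f.gammaHat x v)ᵀ * form44) :=
  eq_neg_of_add_eq_zero_left (isSkewMatrix_iff.2 (isSkewMatrix_gammaHat f v))

lemma gammaHat_mul_form44 (v : 𝕋 x) :
    evM f.gammaHat x v * form44 = -(form44 * (evM f.gammaHat x v)ᵀ) := by
  have := congrArg (form44 * · * form44) (form44_mul_gammaHat (f := f) v)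
  simp only [mul_neg, neg_mul] at this
  rw [← mul_assoc, form44_mul_self, one_mul, ← mul_assoc, mul_assoc _ form44 form44,
    form44_mul_self, mul_one] at this
  exact this

lemma evM_gammaHat_mulVec (u : 𝕋 x) (v : Fin 8 → ℝ) :
    evM f.gammaHat x u *ᵥ v = spinAct (fun i j => f.α i j x u) (fun i => f.β i x u)
      (fun i => f.τ i x u) (fun i => f.om i x u) (fun i => f.θ i x u) v := by
  have hφ : f.φ x u = (1 / 2) * ∑ i, f.α i i x u := by
    simp [CartanFrame.φ, ContinuousLinearMap.sum_apply]
  have e1 : ∀ α : OneForm M, (-α) x u = -α x u := fun _ => rfl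
  have e2 : ∀ α β : OneForm M, (α - β) x u = α x u - β x u := fun _ _ => rfl
  have e3 : ∀ (r : ℝ) (α : OneForm M), (r • α) x u = r * α x u := fun _ _ => rfl
  have e4 : ∀ (p : Prop) [Decidable p], (if p then f.φ else 0 : OneForm M) x u =
      if p then f.φ x u else 0 := fun p _ => by split_ifs <;> rfl
  have e0 : (0 : OneForm M) x u = 0 := rfl
  have key : ∀ c, (evM f.gammaHat x u *ᵥ v) c = f.gammaHat c 0 x u * v 0 +
      (∑ i, f.gammaHat c (idx8 (.inl i)) x u * v (idx8 (.inl i)) +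
        ∑ i, f.gammaHat c (idx8 (.inr i)) x u * v (idx8 (.inr i))) +
      f.gammaHat c 7 x u * v 7 := fun c => by
    rw [mulVec, dotProduct, sum_idx8]
    rfl
  ext c
  rw [key]
  revert c
  rw [forall_idx8]
  simp only [gammaHat_00, gammaHat_07, gammaHat_70, gammaHat_77, gammaHat_0r, gammaHat_0l,
    gammaHat_r0, gammaHat_l0, gammaHat_7r, gammaHat_7l, gammaHat_r7, gammaHat_l7, gammaHat_rr,
    gammaHat_ll, gammaHat_rl, gammaHat_lr, e0, e1, e2, e3, e4, OneForm.sum_apply, hφ]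
  generalize f.α = α
  generalize f.β = β
  generalize f.τ = τ
  generalize f.om = om
  generalize f.θ = θ
  simp only [Fin.sum_univ_three, eps, spinAct]
  refine ⟨?_, ⟨fun i => ?_, fun i => ?_⟩, ?_⟩
  · simp [idx8_values]; ring
  · fin_cases i <;> simp [idx8_values] <;> norm_num <;> ring
  · fin_cases i <;> simp [idx8_values] <;> norm_num <;> ring
  · simp [idx8_values]; ring

namespace IsParallelFrame

lemma orthogonal (hp : IsParallelFrame U f h) (hx : x ∈ U) (h1 : h x = 1) :
    ∀ᶠ y in nhds x, h y * form44 * (h y)ᵀ = form44 := by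
  have s : ∀ y ∈ U, MatSmoothAt (fun y => h y * form44 * (h y)ᵀ) y := fun y hy =>
    ((hp.smooth y hy).mul (.const _)).mul (hp.smooth y hy).transpose
  have d : ∀ y ∈ U, ∀ v, diffM (fun y => h y * form44 * (h y)ᵀ) y v = 0 := by
    intro y hy v
    rw [diffM_mul ((hp.smooth y hy).mul (.const _)) (hp.smooth y hy).transpose,
      diffM_mul (hp.smooth y hy) (.const _), diffM_const, diffM_transpose, hp.eq y hy,
      Matrix.transpose_mul, mul_assoc (h y) _ form44, gammaHat_mul_form44]
    simp only [mul_zero, add_zero, mul_neg, neg_mul, mul_assoc]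
    exact neg_add_cancel _
  have : ∀ᶠ y in nhds x, ∀ a b, (h y * form44 * (h y)ᵀ) a b = (h x * form44 * (h x)ᵀ) a b :=
    Filter.eventually_all.2 fun a => Filter.eventually_all.2 fun b =>
      FunSmoothAt.eventually_const (s x hx a b) (Filter.mem_of_superset (hp.isOpen.mem_nhds hx)
        fun y hy v => congrFun (congrFun (d y hy v) a) b)
  filter_upwards [this] with y hy
  ext a b
  rw [hy, h1, one_mul, Matrix.transpose_one, mul_one]

lemma spinQ_const (hp : IsParallelFrame U f h) (hx : x ∈ U) (h1 : h x = 1) :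
    ∀ᶠ y in nhds x, ∀ a b c d, spinQ (fun e => (form44 * (h y)ᵀ * form44) e a)
      (fun e => (form44 * (h y)ᵀ * form44) e b) (fun e => (form44 * (h y)ᵀ * form44) e c)
      (fun e => (form44 * (h y)ᵀ * form44) e d) = spinQ (Pi.single a 1) (Pi.single b 1)
        (Pi.single c 1) (Pi.single d 1) := by
  have s : ∀ y ∈ U, MatSmoothAt (fun y => form44 * (h y)ᵀ * form44) y := fun y hy =>
    ((MatSmoothAt.const _).mul (hp.smooth y hy).transpose).mul (.const _)
  have d : ∀ y ∈ U, ∀ v, diffM (fun y => form44 * (h y)ᵀ * form44) y v =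
      -(evM f.gammaHat y v * (form44 * (h y)ᵀ * form44)) := by
    intro y hy v
    rw [diffM_mul ((MatSmoothAt.const _).mul (hp.smooth y hy).transpose) (.const _),
      diffM_mul (.const _) (hp.smooth y hy).transpose, diffM_const, diffM_transpose,
      hp.eq y hy, Matrix.transpose_mul, ← mul_assoc (evM _ _ _), ← mul_assoc (evM _ _ _),
      gammaHat_mul_form44]
    simp only [zero_mul, zero_add, mul_zero, add_zero, mul_assoc, neg_mul, neg_neg]
  have d' : ∀ y ∈ U, ∀ v a, (fun c => diff (fun y => (form44 * (h y)ᵀ * form44) c a) y v) =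
      spinAct (fun i j => -f.α i j y v) (fun i => -f.β i y v) (fun i => -f.τ i y v)
        (fun i => -f.om i y v) (fun i => -f.θ i y v) fun c => (form44 * (h y)ᵀ * form44) c a := by
    intro y hy v a
    have e := evM_gammaHat_mulVec (f := f) (x := y) (-v) fun c => (form44 * (h y)ᵀ * form44) c a
    simp only [map_neg] at e
    rw [← e]
    funext c
    refine (congrFun (congrFun (d y hy v) c) a).trans ?_
    rw [Matrix.neg_apply, Matrix.mul_apply, mulVec, dotProduct, ← Finset.sum_neg_distrib]
    exact Finset.sum_congr rfl fun b _ => by simp [evM]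
  refine Filter.eventually_all.2 fun a => Filter.eventually_all.2 fun b =>
    Filter.eventually_all.2 fun c => Filter.eventually_all.2 fun e => ?_
  have key := FunSmoothAt.eventually_const
    (spinQ_productRule (x := x) (fun j => s x hx j a) (fun j => s x hx j b) (fun j => s x hx j c)
      fun j => s x hx j e).1 (Filter.mem_of_superset (hp.isOpen.mem_nhds hx) fun y hy v => by
        rw [(spinQ_productRule (x := y) (fun j => s y hy j a) (fun j => s y hy j b)
          (fun j => s y hy j c) fun j => s y hy j e).2, d' y hy, d' y hy, d' y hy, d' y hy]
        exact spinQ_spinAct _ _ _ _ _ _ _ _ _)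
  filter_upwards [key] with y hy
  rw [hy, h1, Matrix.transpose_one, mul_one, form44_mul_self]
  congr 1 <;> · ext j; rw [Matrix.one_apply, Pi.single_apply]

end IsParallelFrame

end Transport

section FlatCoordinates

open Matrix

lemma mem_iff_of_finrank {W : Submodule ℝ E6} (hW : Module.finrank ℝ W = 3)
    {a b : Fin 3 → E6 →L[ℝ] ℝ} {X : Fin 3 → ℝ}
    (h0 : ∀ v, (∀ i, a i v = 0) → (∀ i, b i v = 0) → v = 0)
    (hWb : ∀ v ∈ W, ∀ i, b i v + ∑ j, ∑ k, eps i j k * X j * a k v = 0) (v : E6) :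
    v ∈ W ↔ ∀ i, b i v + ∑ j, ∑ k, eps i j k * X j * a k v = 0 := by
  let K : Submodule ℝ E6 := ⨅ i, LinearMap.ker
    ((b i : E6 →ₗ[ℝ] ℝ) + ∑ j, ∑ k, (eps i j k * X j) • (a k : E6 →ₗ[ℝ] ℝ))
  have hK : ∀ v, v ∈ K ↔ ∀ i, b i v + ∑ j, ∑ k, eps i j k * X j * a k v = 0 := fun v => by
    simp [K, Submodule.mem_iInf, LinearMap.sum_apply]
  have hle : W ≤ K := fun v hv => (hK v).2 (hWb v hv)
  let L : K →ₗ[ℝ] (Fin 3 → ℝ) := (LinearMap.pi fun i => (a i : E6 →ₗ[ℝ] ℝ)).comp K.subtype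
  have hL : Function.Injective L := (injective_iff_map_eq_zero L).2 fun v hv => by
    have h1 : ∀ i, a i v = 0 := fun i => congrFun hv i
    refine Subtype.ext (h0 v h1 fun i => ?_)
    have := (hK v).1 v.2 i
    simpa [h1] using this
  have hfin : Module.finrank ℝ K ≤ Module.finrank ℝ W := by
    rw [hW]
    exact (LinearMap.finrank_le_finrank_of_injective hL).trans (by simp)
  rw [Submodule.eq_of_le_of_finrank_le hle hfin, hK]

lemma spinA_projective {u w : Fin 8 → ℝ} {X Y a b : Fin 3 → ℝ}
    (hX : ∀ i, u (idx8 (.inr i)) = X i * u 0) (hY : ∀ i, u (idx8 (.inl i)) = Y i * u 0)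
    (ha : ∀ i, w (idx8 (.inr i)) = a i * u 0 + X i * w 0)
    (hb : ∀ i, w (idx8 (.inl i)) = b i * u 0 + Y i * w 0) (i : Fin 3) :
    spinA i u w = u 0 ^ 2 * (b i + ∑ j, ∑ k, eps i j k * X j * a k) := by
  rw [spinA_eq]
  simp only [hX, hY, ha, hb, Fin.sum_univ_three]
  fin_cases i <;> simp [eps] <;> ring

lemma form44_dotProduct (u w : Fin 8 → ℝ) : u ⬝ᵥ (form44 *ᵥ w) = -(u 0 * w 7) - u 7 * w 0 +
    ∑ i, (u (idx8 (.inr i)) * w (idx8 (.inl i)) + u (idx8 (.inl i)) * w (idx8 (.inr i))) := by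
  simp [form44, mulVec, dotProduct, Fin.sum_univ_eight, Fin.sum_univ_three, idx8_values]
  ring

lemma eq_smul_of_projective {u w : Fin 8 → ℝ} {X Y : Fin 3 → ℝ} (h0 : u 0 ≠ 0)
    (hX : ∀ i, u (idx8 (.inr i)) = X i * u 0) (hY : ∀ i, u (idx8 (.inl i)) = Y i * u 0)
    (ha : ∀ i, w (idx8 (.inr i)) = X i * w 0) (hb : ∀ i, w (idx8 (.inl i)) = Y i * w 0)
    (huu : u ⬝ᵥ (form44 *ᵥ u) = 0) (huw : u ⬝ᵥ (form44 *ᵥ w) = 0) : w = (w 0 / u 0) • u := by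
  ext c
  rw [Pi.smul_apply, smul_eq_mul]
  revert c
  rw [forall_idx8]
  refine ⟨by field_simp, ⟨fun i => ?_, fun i => ?_⟩, ?_⟩
  · rw [hY, hb]; field_simp
  · rw [hX, ha]; field_simp
  · rw [form44_dotProduct] at huu huw
    simp only [hX, hY, ha, hb, Fin.sum_univ_three] at huu huw
    rw [div_mul_eq_mul_div, eq_div_iff h0]
    have : u 0 * (w 7 * u 0 - w 0 * u 7) = 0 := by linear_combination w 0 * huu - u 0 * huw
    linarith [(mul_eq_zero.1 this).resolve_left h0]

variable {f : CartanFrame M} {h : M → Matrix (Fin 8) (Fin 8) ℝ}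

lemma RepresentsConformal.congr_mono {g g' : BilinField M} {V : Set M}
    (h : RepresentsConformal D U g) (hV : IsOpen V) (hVU : V ⊆ U) (hg : ∀ y ∈ V, g' y = g y) :
    RepresentsConformal D V g' where
  isOpen := hV
  smooth := (h.smooth.mono hVU).congr fun y hy => by rw [hg y hy]
  symm y hy v w := by rw [hg y hy]; exact h.symm y (hVU hy) v w
  nondegenerate y hy v hv := h.nondegenerate y (hVU hy) v fun w => by rw [← hg y hy]; exact hv w
  multiple W hW c hc y hy := by
    rw [hg y (hW hy)]
    exact h.multiple W (hW.trans hVU) c hc y hy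

theorem IsParallelFrame.exists_flat_coordinates (hD : IsNondegenerate D)
    (hf : IsCartanFrame D U f) (hp : IsParallelFrame U f h) (hx : x ∈ U) (h1 : h x = 1) :
    ∃ V : Set M, IsOpen V ∧ x ∈ V ∧ ∃ X Y : Fin 3 → M → ℝ,
      (∀ i, SmoothFunOn V (X i)) ∧ (∀ i, SmoothFunOn V (Y i)) ∧
      ∀ y ∈ V, (∀ v, (∀ i, diff (X i) y v = 0) → (∀ i, diff (Y i) y v = 0) → v = 0) ∧
        ∀ v, v ∈ D y ↔ ∀ i, diff (Y i) y v + ∑ j, ∑ k, eps i j k * X j y * diff (X k) y v = 0 := by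
  have e00 : ∀ᶠ y in nhds x, h y 0 0 ≠ 0 :=
    (hp.smooth x hx 0 0).continuousAt.eventually_ne (by simp [h1])
  obtain ⟨V, hV, hVo, hxV⟩ := eventually_nhds_iff.1
    (((hp.orthogonal hx h1).and (hp.spinQ_const hx h1)).and (e00.and (hp.isOpen.mem_nhds hx)))
  let X : Fin 3 → M → ℝ := fun i y => h y (idx8 (.inr i)) 0 * (h y 0 0)⁻¹
  let Y : Fin 3 → M → ℝ := fun i y => h y (idx8 (.inl i)) 0 * (h y 0 0)⁻¹
  have ss : ∀ y ∈ V, ∀ c, FunSmoothAt (fun y => h y c 0 * (h y 0 0)⁻¹) y := fun y hy c =>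
    (hp.smooth y (hV y hy).2.2 c 0).mul ((hp.smooth y (hV y hy).2.2 0 0).inv (hV y hy).2.1)
  have hu : ∀ y ∈ V, ∀ c, h y c 0 = h y c 0 * (h y 0 0)⁻¹ * h y 0 0 := fun y hy c => by
    rw [inv_mul_cancel_right₀ (hV y hy).2.1]
  have hd : ∀ y ∈ V, ∀ c v, diff (fun y => h y c 0) y v =
      diff (fun y => h y c 0 * (h y 0 0)⁻¹) y v * h y 0 0 +
        h y c 0 * (h y 0 0)⁻¹ * diff (fun y => h y 0 0) y v := fun y hy c v => by
    rw [← (ss y hy c).diff_mul (hp.smooth y (hV y hy).2.2 0 0),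
      diff_congr (Filter.mem_of_superset (hVo.mem_nhds hy) fun z hz => hu z hz c)]
  refine ⟨V, hVo, hxV, X, Y, fun i => (smoothFunOn_iff_smoothAt hVo _).2 fun y hy => ss y hy _,
    fun i => (smoothFunOn_iff_smoothAt hVo _).2 fun y hy => ss y hy _, fun y hy => ?_⟩
  obtain ⟨⟨ho, hq⟩, h0, hyU⟩ := hV y hy
  set H := form44 * (h y)ᵀ * form44 with hH
  have hhH : h y * H = 1 := by
    rw [hH, ← mul_assoc, ← mul_assoc, ho, form44_mul_self]
  have hHh : H * h y = 1 := mul_eq_one_comm.1 hhH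
  have ho' : (h y)ᵀ * form44 * h y = form44 := by
    have := congrArg (form44 * ·) hHh
    simpa only [hH, ← mul_assoc, form44_mul_self, one_mul, mul_one] using this
  let e0 : Fin 8 → ℝ := Pi.single 0 1
  have eu : ∀ c, (h y *ᵥ e0) c = h y c 0 := fun c => by simp [e0]
  have ew : ∀ v c, (h y *ᵥ (evM f.gammaHat y v *ᵥ e0)) c = diff (fun y => h y c 0) y v := by
    intro v c
    rw [mulVec_mulVec, ← hp.eq y hyU]
    simp [e0, diffM]
  have hdot : ∀ w, (h y *ᵥ e0) ⬝ᵥ (form44 *ᵥ (h y *ᵥ w)) = -w 7 := by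
    intro w
    rw [dotProduct_mulVec, dotProduct_mulVec, ← vecMul_transpose (h y), vecMul_vecMul,
      vecMul_vecMul, ← mul_assoc, ho']
    rw [← dotProduct_mulVec, form44_dotProduct]
    simp [e0, idx8, mid]
  have hX : ∀ i, (h y *ᵥ e0) (idx8 (.inr i)) = X i y * (h y *ᵥ e0) 0 := fun i => by
    rw [eu, eu]; exact hu y hy _
  have hY : ∀ i, (h y *ᵥ e0) (idx8 (.inl i)) = Y i y * (h y *ᵥ e0) 0 := fun i => by
    rw [eu, eu]; exact hu y hy _
  have ha : ∀ v i, (h y *ᵥ (evM f.gammaHat y v *ᵥ e0)) (idx8 (.inr i)) =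
      diff (X i) y v * (h y *ᵥ e0) 0 + X i y * (h y *ᵥ (evM f.gammaHat y v *ᵥ e0)) 0 := by
    intro v i
    rw [eu, ew, ew]; exact hd y hy _ v
  have hb : ∀ v i, (h y *ᵥ (evM f.gammaHat y v *ᵥ e0)) (idx8 (.inl i)) =
      diff (Y i) y v * (h y *ᵥ e0) 0 + Y i y * (h y *ᵥ (evM f.gammaHat y v *ᵥ e0)) 0 := by
    intro v i
    rw [eu, ew, ew]; exact hd y hy _ v
  have hg : ∀ v, evM f.gammaHat y v *ᵥ e0 = spinAct (fun i j => f.α i j y v) (fun i => f.β i y v)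
      (fun i => f.τ i y v) (fun i => f.om i y v) (fun i => f.θ i y v) e0 :=
    fun v => evM_gammaHat_mulVec v e0
  have hA := hf.isThirdOrderFrame.isTwoAdapted.toIsOneAdapted
  have inj : ∀ v, (∀ i, diff (X i) y v = 0) → (∀ i, diff (Y i) y v = 0) → v = 0 := by
    intro v hXv hYv
    have key := eq_smul_of_projective (w := h y *ᵥ (evM f.gammaHat y v *ᵥ e0)) (by rwa [eu]) hX hY
      (fun i => by rw [ha, hXv, zero_mul, zero_add]) (fun i => by rw [hb, hYv, zero_mul, zero_add])
      (by rw [hdot]; simp [e0]) (by rw [hdot, hg]; simp [e0, spinAct])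
    rw [← mulVec_smul] at key
    have key2 := congrArg (H *ᵥ ·) key
    simp only [mulVec_mulVec _ H, hHh, one_mulVec] at key2
    refine hA.isCoframe.coframeAt y hyU |>.ext fun p => ?_
    have := congrFun key2 (idx8 p)
    rw [hg] at this
    rcases p with i | i <;> fin_cases i <;>
      simpa [spinAct, idx8_values, e0, Coframing.form] using this
  refine ⟨inj, mem_iff_of_finrank (hD.finrank_eq y) inj
    fun (v : 𝕋 y) hv i => ?_⟩
  have hθ : ∀ i, f.θ i y v = 0 := fun i => hA.annihilates y hyU i v hv
  have key := spinA_projective hX hY (ha v) (hb v) i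
  rw [← spinQ_single, spinQ_mulVec hHh (fun a b => hq a b _ _), hg] at key
  have k0 : ∀ j, spinA j e0 (spinAct (fun i j => f.α i j y v) (fun i => f.β i y v)
      (fun i => f.τ i y v) (fun i => f.om i y v) (fun i => f.θ i y v) e0) = 0 := fun j => by
    fin_cases j <;> simp [spinA, wedge8, spinAct, e0, hθ]
  have k1 : ∀ j, spinB j e0 (spinAct (fun i j => f.α i j y v) (fun i => f.β i y v)
      (fun i => f.τ i y v) (fun i => f.om i y v) (fun i => f.θ i y v) e0) = 0 := fun j => by
    fin_cases j <;> simp [spinB, wedge8, e0]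
  have k2 : spinC e0 (spinAct (fun i j => f.α i j y v) (fun i => f.β i y v)
      (fun i => f.τ i y v) (fun i => f.om i y v) (fun i => f.θ i y v) e0) = 0 := by
    simp [spinC, wedge8, spinAct, e0]
  rw [spinQ] at key
  simp only [k0, k1, k2, zero_mul, add_zero, Finset.sum_const_zero, mul_zero, sub_zero, eu] at key
  exact (mul_eq_zero.1 key.symm).resolve_left (pow_ne_zero 2 h0)

theorem IsConformallyFlat.isLocallyFlatModel (hD : IsNondegenerate D) (h : IsConformallyFlat D) :
    IsLocallyFlatModel D := by
  intro x
  obtain ⟨U₀, hx₀, p, q, hp, hq, hm₀⟩ := h x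
  obtain ⟨V, hxV, c, hc₀⟩ := hD.exists_isTwoAdapted x
  set U := U₀ ∩ V with hUV
  have hU : IsOpen U := hm₀.isOpen.inter hc₀.isOpen
  have hc := hc₀.mono hU inter_subset_right
  have hx : x ∈ U := ⟨hx₀, hxV⟩
  obtain ⟨t, ht, htf⟩ := hc.exists_isThirdOrderFrame
  have hf := htf.isCartanFrame
  let P : Fin 6 → M → ℝ := fun a y => Sum.elim p q (finSumFinEquiv.symm a) y -
    Sum.elim p q (finSumFinEquiv.symm a) x
  have sp : ∀ y ∈ U, ∀ s, FunSmoothAt (Sum.elim p q s) y := by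
    rintro y hy (i | i)
    exacts [(smoothFunOn_iff_smoothAt hm₀.isOpen _).1 (hp i) y hy.1,
      (smoothFunOn_iff_smoothAt hm₀.isOpen _).1 (hq i) y hy.1]
  have sP : ∀ y ∈ U, ∀ a, FunSmoothAt (P a) y := fun y hy a => (sp y hy _).sub (.const _)
  have dP : ∀ y ∈ U, ∀ a, diff (P a) y = diff (Sum.elim p q (finSumFinEquiv.symm a)) y := by
    intro y hy a
    ext v
    refine ((sp y hy _).diff_sub (.const _) v).trans ?_
    rw [diff_const, sub_zero]
  have hmP : ∀ y ∈ U, (flatGauge P).metric y =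
      (∑ i, symProd (fun y => diff (p i) y) fun y => diff (q i) y : BilinField M) y := by
    intro y hy
    ext v w
    have e : ∀ i, symProd (fun y => diff (p i) y) (fun y => diff (q i) y) y v w =
        diff (p i) y v * diff (q i) y w + diff (q i) y v * diff (p i) y w := fun _ => rfl
    rw [GaugeForm.metric_apply, Fin.sum_univ_six, Fin.sum_univ_three]
    simp only [flatGauge_m0, dP y hy, Pi.add_apply, ContinuousLinearMap.add_apply, e]
    change diff (p 0) y v * diff (q 0) y w + diff (p 1) y v * diff (q 1) y w +
      diff (p 2) y v * diff (q 2) y w + diff (q 0) y v * diff (p 0) y w +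
      diff (q 1) y v * diff (p 1) y w + diff (q 2) y v * diff (p 2) y w = _
    ring
  have hN := isNormalConformalGauge_flatGauge hU sP 
    (hm₀.congr_mono hU inter_subset_left hmP)
  obtain ⟨k, g⟩ := hN.exists_gaugeMap_of_metric (hf.isNormalConformalGauge hD) fun y hy => by
    rw [gammaHat_metric]
    exact hN.conformal.multiple U subset_rfl _ htf.isTwoAdapted y hy
  obtain ⟨h, hpf, h1⟩ := g.exists_isParallelFrame sP hx fun a => sub_self _
  exact hpf.exists_flat_coordinates hD hf hx h1

end FlatCoordinates

section HomogeneousCoordinates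

open Matrix

lemma form43_nondegenerate {w : V43} (h : ∀ u, form43 w u = 0) : w = 0 := by
  refine Prod.ext (funext fun i => ?_) (Prod.ext ?_ (funext fun i => ?_))
  · simpa [form43, Pi.single_apply] using h (0, 0, Pi.single i 1)
  · simpa [form43] using h (0, 1, 0)
  · simpa [form43, Pi.single_apply] using h (Pi.single i 1, 0, 0)

lemma exists_dual_form43 {E : Fin 3 → V43} (hE : LinearIndependent ℝ E) :
    ∃ F : Fin 3 → V43, ∀ i j, form43 (E i) (F j) = if i = j then 1 else 0 := by
  let L : V43 →ₗ[ℝ] (Fin 3 → ℝ) := LinearMap.pi fun i => bilin43 (E i)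
  have hL : LinearMap.range L = ⊤ := by
    by_contra hne
    obtain ⟨f, hf, hle⟩ := Submodule.exists_le_ker_of_lt_top _ (lt_top_iff_ne_top.2 hne)
    have hv : ∀ v, ∑ i, f (Pi.single i 1) * form43 (E i) v = 0 := fun v => by
      have h1 : f (L v) = 0 := hle ⟨v, rfl⟩
      rw [f.pi_apply_eq_sum_univ] at h1
      refine (Finset.sum_congr rfl fun i _ => ?_).trans h1
      rw [smul_eq_mul, mul_comm]
      congr 2
      ext j
      simp [Pi.single_apply, eq_comm]
    have h2 : ∑ i, f (Pi.single i 1) • E i = 0 := form43_nondegenerate fun u => by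
      change bilin43 (∑ i, f (Pi.single i 1) • E i) u = 0
      rw [map_sum, LinearMap.sum_apply]
      simp only [map_smul, LinearMap.smul_apply]
      exact hv u
    have h3 := Fintype.linearIndependent_iff.1 hE _ h2
    exact hf (LinearMap.pi_ext' fun i => LinearMap.ext_ring (h3 i))
  choose F hF using fun j => LinearMap.range_eq_top.1 hL (Pi.single j 1)
  exact ⟨F, fun i j => (congrFun (hF j) i).trans (Pi.single_apply _ _ _)⟩

/-- A basis of `ℝ^{4,3}` adapted to a null `3`-plane. -/
lemma exists_nullBasis {E : Fin 3 → V43} (hE : LinearIndependent ℝ E)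
    (h0 : ∀ i j, form43 (E i) (E j) = 0) : ∃ (F : Fin 3 → V43) (n : V43) (σ : ℝ), σ * σ = 1 ∧
    (∀ i j, form43 (E i) (F j) = if i = j then 1 else 0) ∧
    ∀ u v, form43 u v = ∑ k, (form43 u (F k) * form43 v (E k) + form43 u (E k) * form43 v (F k)) +
      2 * σ * (form43 u n * form43 v n) := by
  obtain ⟨F', hF'⟩ := exists_dual_form43 hE
  have add' : ∀ u v w, form43 u (v + w) = form43 u v + form43 u w := fun u => map_add (bilin43 u)
  have sub' : ∀ u v w, form43 u (v - w) = form43 u v - form43 u w := fun u => map_sub (bilin43 u)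
  have smul' : ∀ u (r : ℝ) v, form43 u (r • v) = r * form43 u v := fun u => map_smul (bilin43 u)
  have sum' : ∀ u (w : Fin 3 → V43), form43 u (∑ i, w i) = ∑ i, form43 u (w i) := fun u w =>
    map_sum (bilin43 u) w _
  let F : Fin 3 → V43 := fun j => F' j - ∑ k, ((1 / 2) * form43 (F' j) (F' k)) • E k
  have hF : ∀ i j, form43 (E i) (F j) = if i = j then 1 else 0 := fun i j => by
    simp only [F, sub', sum', smul', h0, mul_zero, Finset.sum_const_zero, sub_zero, hF']
  have hFE : ∀ i j, form43 (F i) (E j) = if i = j then 1 else 0 := fun i j => by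
    rw [form43_comm, hF]
    simp only [eq_comm]
  have hFF : ∀ i j, form43 (F i) (F j) = 0 := fun i j => by
    have e : form43 (F i) (F' j) = (1 / 2) * form43 (F' i) (F' j) := by
      rw [form43_comm]
      simp only [F, sub', sum', smul', form43_comm (F' j) (E _), hF']
      simp only [mul_ite, mul_one, mul_zero, Finset.sum_ite_eq', Finset.mem_univ, if_true,
        form43_comm (F' j)]
      ring
    change form43 (F i) (F' j - ∑ k, ((1 / 2) * form43 (F' j) (F' k)) • E k) = 0
    simp only [sub', sum', smul', hFE, e]
    simp only [mul_ite, mul_one, mul_zero, Finset.sum_ite_eq, Finset.mem_univ, if_true,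
        form43_comm (F' j)]
    ring
  let K : V43 →ₗ[ℝ] (Fin 3 → ℝ) × (Fin 3 → ℝ) :=
    (LinearMap.pi fun i => bilin43 (E i)).prod (LinearMap.pi fun i => bilin43 (F i))
  have hK : LinearMap.range K = ⊤ := LinearMap.range_eq_top.2 fun s => by
    refine ⟨∑ k, s.1 k • F k + ∑ k, s.2 k • E k, Prod.ext (funext fun i => ?_) (funext fun i => ?_)⟩
    · change form43 (E i) _ = _
      simp [add', sum', smul', hF, h0]
    · change form43 (F i) _ = _
      simp [add', sum', smul', hFE, hFF]
  have hker : Module.finrank ℝ (LinearMap.ker K) = 1 := by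
    have := K.finrank_range_add_finrank_ker
    rw [hK, finrank_top] at this
    simp at this
    omega
  obtain ⟨n, hn, hgen⟩ := finrank_eq_one_iff'.1 hker
  have hEn : ∀ i, form43 (E i) n = 0 := fun i => congrFun (congrArg Prod.fst n.2) i
  have hFn : ∀ i, form43 (F i) n = 0 := fun i => congrFun (congrArg Prod.snd n.2) i
  have expand : ∀ v, ∃ c : ℝ, v = ∑ k, form43 v (F k) • E k + ∑ k, form43 v (E k) • F k +
      c • (n : V43) := fun v => by
    have hw : v - (∑ k, form43 v (F k) • E k + ∑ k, form43 v (E k) • F k) ∈ LinearMap.ker K := by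
      refine Prod.ext (funext fun i => ?_) (funext fun i => ?_)
      · change form43 (E i) _ = 0
        simp [add', sub', sum', smul', hF, h0, form43_comm v]
      · change form43 (F i) _ = 0
        simp [add', sub', sum', smul', hFE, hFF, form43_comm v]
    obtain ⟨c, hc⟩ := hgen ⟨_, hw⟩
    refine ⟨c, ?_⟩
    have := congrArg Subtype.val hc
    change c • (n : V43) = _ at this
    rw [this]
    exact (add_sub_cancel _ _).symm
  have hN : form43 (n : V43) n ≠ 0 := fun hN => hn (Subtype.ext (form43_nondegenerate fun u => by
    obtain ⟨c, hc⟩ := expand u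
    rw [hc]
    simp [add', sum', smul', hN, form43_comm (n : V43), hEn, hFn]))
  set r : ℝ := (form43 (n : V43) n)⁻¹ with hr
  have hr0 : r ≠ 0 := inv_ne_zero hN
  have ha := abs_pos.2 hr0
  refine ⟨F, √(|r| / 2) • (n : V43), r / |r|, ?_, hF, fun u v => ?_⟩
  · rw [div_mul_div_comm, abs_mul_abs_self, div_self (mul_ne_zero hr0 hr0)]
  · obtain ⟨c, hc⟩ := expand v
    have hvn : form43 v n = c * form43 (n : V43) n := by
      rw [form43_comm]
      conv_lhs => rw [hc]
      simp [add', sum', smul', form43_comm (n : V43) (E _), form43_comm (n : V43) (F _), hEn, hFn]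
    have h2 : 2 * (r / |r|) * (√(|r| / 2) * √(|r| / 2)) = r := by
      rw [Real.mul_self_sqrt (by positivity)]
      field_simp
    have h3 : 2 * (r / |r|) * (form43 u (√(|r| / 2) • (n : V43)) *
        form43 v (√(|r| / 2) • (n : V43))) = c * form43 u n := by
      rw [smul', smul', hvn]
      calc _ = (2 * (r / |r|) * (√(|r| / 2) * √(|r| / 2))) * form43 (n : V43) n *
            (c * form43 u n) := by ring
        _ = _ := by rw [h2, hr, inv_mul_cancel₀ hN, one_mul]
    rw [h3]
    conv_lhs => rw [hc]
    simp only [add', sum', smul', Finset.sum_add_distrib]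
    congr 1
    rw [add_comm]
    congr 1 <;> exact Finset.sum_congr rfl fun k _ => mul_comm _ _

lemma sandwich_eq_zero {a S : Matrix (Fin 3) (Fin 3) ℝ} (ha : IsUnit a.det) :
    a * S * aᵀ = 0 ↔ S = 0 := by
  refine ⟨fun h => ?_, fun h => by simp [h]⟩
  have := congrArg (fun m => a⁻¹ * m * aᵀ⁻¹) h
  simp only [mul_zero, zero_mul] at this
  rwa [← mul_assoc, ← mul_assoc, Matrix.nonsing_inv_mul _ ha, one_mul, mul_assoc,
    Matrix.mul_nonsing_inv _ (by rwa [det_transpose]), mul_one] at this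

variable {V : Set M}

/-- The solution of a linear system with smooth coefficients. -/
lemma exists_smooth_solution {a : M → Matrix (Fin 3) (Fin 3) ℝ} {g : Fin 3 → M → ℝ}
    (ha : ∀ y ∈ V, ∀ i j, FunSmoothAt (fun z => a z i j) y) (hdet : ∀ y ∈ V, (a y).det ≠ 0)
    (hV : IsOpen V) (hg : ∀ y ∈ V, ∀ i, FunSmoothAt (g i) y) : ∃ G : Fin 3 → M → ℝ,
    (∀ y ∈ V, ∀ i, FunSmoothAt (G i) y) ∧ (∀ y ∈ V, ∀ i, g i y = ∑ k, a y i k * G k y) ∧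
    ∀ y ∈ V, ∀ i v, diff (g i) y v =
      ∑ k, (diff (fun z => a z i k) y v * G k y + a y i k * diff (G k) y v) := by
  have sG : ∀ y ∈ V, ∀ i, FunSmoothAt (fun y => ∑ k, (a y)⁻¹ i k * g k y) y := fun y hy i =>
    .sum fun k _ => (FunSmoothAt.matrix_inv (ha y hy) (hdet y hy) i k).mul (hg y hy k)
  have eG : ∀ y ∈ V, ∀ i, g i y = ∑ k, a y i k * ∑ l, (a y)⁻¹ k l * g l y := fun y hy i => by
    have := congrFun (congrArg (· *ᵥ fun i => g i y)
      (Matrix.mul_nonsing_inv (a y) (hdet y hy).isUnit)) i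
    rw [← mulVec_mulVec, one_mulVec] at this
    exact this.symm
  refine ⟨fun i y => ∑ k, (a y)⁻¹ i k * g k y, sG, eG, fun y hy i v => ?_⟩
  have e : g i =ᶠ[nhds y] fun y => ∑ k, a y i k * ∑ l, (a y)⁻¹ k l * g l y :=
    Filter.mem_of_superset (hV.mem_nhds hy) fun z hz => eG z hz i
  rw [diff_congr e, FunSmoothAt.diff_sum fun k => (ha y hy i k).mul (sG y hy k)]
  exact Finset.sum_congr rfl fun k _ => by rw [(ha y hy i k).diff_mul (sG y hy k)]


/-- The algebraic relation between the differentials of a null frame and of its coordinates. -/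
lemma nullFrame_torsion {σ : ℝ} (hσ : σ * σ = 1) {Z W : Fin 3 → Fin 3 → ℝ} {X p q : Fin 3 → ℝ}
    (hq : ∀ k, q k = -σ / 2 * (W (k + 1) (k + 2) - W (k + 2) (k + 1)))
    (hS : ∀ i j, W i j + W j i + 2 * σ * (p i * X j + X i * p j) = 0) (i j : Fin 3) :
    W i j + 2 * σ * (p i * X j) =
      -σ * ∑ k, eps i j k * (q k + ∑ l, ∑ m, eps k l m * X l * p m) := by
  have h0 := hq 0
  have h1 := hq 1
  have h2 := hq 2
  simp only [Fin.reduceAdd, zero_add] at h0 h1 h2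
  fin_cases i <;> fin_cases j <;> simp [eps, Fin.sum_univ_three] <;> norm_num
  · linear_combination (1 / 2) * hS 0 0
  · rw [h2]; linear_combination (1 / 2) * hS 0 1 - (1 / 2) * (W 0 1 - W 1 0) * hσ
  · rw [h1]; linear_combination (1 / 2) * hS 0 2 - (1 / 2) * (W 0 2 - W 2 0) * hσ
  · rw [h2]; linear_combination (1 / 2) * hS 1 0 - (1 / 2) * (W 1 0 - W 0 1) * hσ
  · linear_combination (1 / 2) * hS 1 1
  · rw [h0]; linear_combination (1 / 2) * hS 1 2 - (1 / 2) * (W 1 2 - W 2 1) * hσ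
  · rw [h1]; linear_combination (1 / 2) * hS 2 0 - (1 / 2) * (W 2 0 - W 0 2) * hσ
  · rw [h0]; linear_combination (1 / 2) * hS 2 1 - (1 / 2) * (W 2 1 - W 1 2) * hσ
  · linear_combination (1 / 2) * hS 2 2

theorem IsLocallyHomogeneousModel.isLocallyFlatModel (h : IsLocallyHomogeneousModel D) :
    IsLocallyFlatModel D := by
  intro x
  obtain ⟨U, hU, hx, e, se', he⟩ := h x
  have se : ∀ y ∈ U, ∀ i, FunSmoothAt (e i) y := fun y hy i =>
    (smoothFunOn_iff_smoothAt hU _).1 (se' i) y hy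
  obtain ⟨F, n, σ, hσ, hEF, hexp⟩ := exists_nullBasis (he x hx).1 (he x hx).2.1
  let a : M → Matrix (Fin 3) (Fin 3) ℝ := fun y => Matrix.of fun i k => form43 (e i y) (F k)
  have sa : ∀ y ∈ U, ∀ i j, FunSmoothAt (fun z => a z i j) y := fun y hy i j => (se y hy i).pair43 _
  have ax : a x = 1 := by
    ext i j
    rw [Matrix.one_apply]
    exact hEF i j
  have ev : ∀ᶠ y in nhds x, (a y).det ≠ 0 :=
    (FunSmoothAt.det (sa x hx)).continuousAt.eventually_ne (by simp [ax])
  obtain ⟨V, hV, hVo, hxV⟩ := eventually_nhds_iff.1 (ev.and (hU.mem_nhds hx))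
  have sa' : ∀ y ∈ V, ∀ i j, FunSmoothAt (fun z => a z i j) y := fun y hy => sa y (hV y hy).2
  obtain ⟨X, sX, eX, dX⟩ := exists_smooth_solution sa' (fun y hy => (hV y hy).1) hVo
    (g := fun i y => form43 (e i y) n) fun y hy i => (se y (hV y hy).2 i).pair43 _
  choose Z' sZ eZ dZ using fun j => exists_smooth_solution sa' (fun y hy => (hV y hy).1) hVo
    (g := fun i y => form43 (e i y) (e j x)) fun y hy i => (se y (hV y hy).2 i).pair43 _
  have hS : ∀ y ∈ V, ∀ i j, Z' j i y + Z' i j y + 2 * σ * (X i y * X j y) = 0 := by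
    intro y hy i j
    have key : a y * (Matrix.of fun i j => Z' j i y + Z' i j y + 2 * σ * (X i y * X j y)) * (a y)ᵀ
        = 0 := by
      ext i j
      rw [Matrix.zero_apply, ← (he y (hV y hy).2).2.1 i j, hexp]
      simp only [eX y hy, eZ _ y hy, Matrix.mul_apply, Fin.sum_univ_three, Matrix.transpose_apply,
        Matrix.of_apply, a]
      ring
    exact congrFun (congrFun ((sandwich_eq_zero (hV y hy).1.isUnit).1 key) i) j
  have hdS : ∀ y ∈ V, ∀ i j v, diff (Z' j i) y v + diff (Z' i j) y v +
      2 * σ * (diff (X i) y v * X j y + X i y * diff (X j) y v) = 0 := by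
    intro y hy i j v
    rw [← (sX y hy i).diff_mul (sX y hy j), ← ((sX y hy i).mul (sX y hy j)).diff_const_mul,
      ← (sZ j y hy i).diff_add (sZ i y hy j), ← ((sZ j y hy i).add (sZ i y hy j)).diff_add
      ((FunSmoothAt.const _).mul ((sX y hy i).mul (sX y hy j))), ← diff_const (x := y) (0 : ℝ) v]
    exact diff_congr (Filter.mem_of_superset (hVo.mem_nhds hy) fun z hz => hS z hz i j) v
  let Y : Fin 3 → M → ℝ := fun k y => -σ / 2 * (Z' (k + 2) (k + 1) y - Z' (k + 1) (k + 2) y)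
  have sY : ∀ y ∈ V, ∀ k, FunSmoothAt (Y k) y := fun y hy k =>
    (FunSmoothAt.const _).mul ((sZ _ y hy _).sub (sZ _ y hy _))
  have dY : ∀ y ∈ V, ∀ k v, diff (Y k) y v =
      -σ / 2 * (diff (Z' (k + 2) (k + 1)) y v - diff (Z' (k + 1) (k + 2)) y v) := by
    intro y hy k v
    rw [← (sZ _ y hy _).diff_sub (sZ _ y hy _)]
    exact ((sZ _ y hy _).sub (sZ _ y hy _)).diff_const_mul _ v
  refine ⟨V, hVo, hxV, X, Y, fun i => (smoothFunOn_iff_smoothAt hVo _).2 fun y hy => sX y hy i,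
    fun i => (smoothFunOn_iff_smoothAt hVo _).2 fun y hy => sY y hy i, fun y hy => ?_⟩
  have hyU := (hV y hy).2
  have hT : ∀ v i j, _ := fun v i j => nullFrame_torsion hσ
    (Z := fun i j => Z' j i y) (W := fun i j => diff (Z' j i) y v) (X := fun i => X i y)
    (p := fun i => diff (X i) y v) (q := fun i => diff (Y i) y v) (fun k => dY y hy k v)
    (fun i j => hdS y hy i j v) i j
  have da : ∀ v i k, form43 (diff (e i) y v) (F k) = diff (fun z => a z i k) y v := fun v i k =>
    (se y hyU i).form43_diff _ v
  have db : ∀ v i, form43 (diff (e i) y v) n = _ := fun v i =>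
    ((se y hyU i).form43_diff _ v).trans (dX y hy i v)
  have dz : ∀ v i j, form43 (diff (e i) y v) (e j x) = _ := fun v i j =>
    ((se y hyU i).form43_diff _ v).trans (dZ j y hy i v)
  refine ⟨fun v hXv hYv => (he y hyU).2.2.1 v fun i => ?_, fun v => ?_⟩
  · have hZ : ∀ i j, diff (Z' j i) y v = 0 := fun i j => by simpa [hXv, hYv] using hT v i j
    let A : Matrix (Fin 3) (Fin 3) ℝ := Matrix.of fun i k => diff (fun z => a z i k) y v
    have hA : ∀ i k, ∑ l, (A * (a y)⁻¹) i l * a y l k = A i k := fun i k => by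
      rw [← Matrix.mul_apply, Matrix.mul_assoc, Matrix.nonsing_inv_mul _ (hV y hy).1.isUnit, mul_one]
    generalize A * (a y)⁻¹ = C at hA
    have hw : diff (e i) y v - ∑ l, C i l • e l y = 0 := form43_nondegenerate fun u => by
      have sub' : ∀ u, form43 (diff (e i) y v - ∑ l, C i l • e l y) u =
          form43 (diff (e i) y v) u - ∑ l, C i l * form43 (e l y) u := fun u => by
        rw [form43_comm, form43_comm _ u]
        simp only [form43_comm _ u]
        change bilin43 u _ = _
        rw [map_sub, map_sum]
        simp only [map_smul]
        rfl
      have w1 : ∀ k, form43 (diff (e i) y v - ∑ l, C i l • e l y) (F k) = 0 := fun k => by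
        rw [sub', da, sub_eq_zero]
        exact (hA i k).symm
      have w2 : form43 (diff (e i) y v - ∑ l, C i l • e l y) n = 0 := by
        rw [sub', db]
        simp only [hXv, mul_zero, add_zero, eX y hy]
        have : ∀ k, diff (fun z => a z i k) y v = ∑ l, C i l * a y l k := fun k => (hA i k).symm
        simp only [this, Fin.sum_univ_three]
        ring
      have w3 : ∀ j, form43 (diff (e i) y v - ∑ l, C i l • e l y) (e j x) = 0 := fun j => by
        rw [sub', dz]
        simp only [hZ, mul_zero, add_zero, eZ _ y hy]
        have : ∀ k, diff (fun z => a z i k) y v = ∑ l, C i l * a y l k := fun k => (hA i k).symm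
        simp only [this, Fin.sum_univ_three]
        ring
      rw [hexp]
      simp [w1, w2, w3]
    rw [sub_eq_zero.1 hw]
    exact Submodule.sum_mem _ fun l _ => Submodule.smul_mem _ _ (Submodule.subset_span ⟨l, rfl⟩)
  · have key : (Matrix.of fun i j => form43 (diff (e i) y v) (e j y)) = a y * (Matrix.of fun i j =>
        -σ * ∑ k, eps i j k * (diff (Y k) y v + ∑ l, ∑ m, eps k l m * X l y * diff (X m) y v)) *
        (a y)ᵀ := by
      have e1 : (Matrix.of fun i j =>
          -σ * ∑ k, eps i j k * (diff (Y k) y v + ∑ l, ∑ m, eps k l m * X l y * diff (X m) y v)) =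
          Matrix.of fun i j => diff (Z' j i) y v + 2 * σ * (diff (X i) y v * X j y) := by
        ext i j
        exact (hT v i j).symm
      rw [e1]
      ext i j
      have ea : ∀ j k, form43 (e j y) (F k) = a y j k := fun _ _ => rfl
      rw [Matrix.of_apply, hexp]
      simp only [da, db, dz, ea, eX y hy, eZ _ y hy, Matrix.mul_apply, Fin.sum_univ_three,
        Matrix.transpose_apply, Matrix.of_apply]
      linear_combination diff (fun z => a z i 0) y v * a y j 0 * hS y hy 0 0 +
        diff (fun z => a z i 0) y v * a y j 1 * hS y hy 1 0 +
        diff (fun z => a z i 0) y v * a y j 2 * hS y hy 2 0 +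
        diff (fun z => a z i 1) y v * a y j 0 * hS y hy 0 1 +
        diff (fun z => a z i 1) y v * a y j 1 * hS y hy 1 1 +
        diff (fun z => a z i 1) y v * a y j 2 * hS y hy 2 1 +
        diff (fun z => a z i 2) y v * a y j 0 * hS y hy 0 2 +
        diff (fun z => a z i 2) y v * a y j 1 * hS y hy 1 2 +
        diff (fun z => a z i 2) y v * a y j 2 * hS y hy 2 2
    rw [(he y hyU).2.2.2]
    have hσ0 : σ ≠ 0 := left_ne_zero_of_mul (hσ.trans_ne one_ne_zero)
    refine ⟨fun hv => eps_mul_eq_zero fun i j => ?_, fun hv i j => ?_⟩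
    · have h0 : (Matrix.of fun i j => form43 (diff (e i) y v) (e j y)) = 0 := by
        ext i j
        exact hv i j
      rw [key, sandwich_eq_zero (hV y hy).1.isUnit] at h0
      exact (mul_eq_zero.1 (congrFun (congrFun h0 i) j)).resolve_left (neg_ne_zero.2 hσ0)
    · refine (congrFun (congrFun key i) j).trans ?_
      simp only [hv, mul_zero, Finset.sum_const_zero]
      rw [show (Matrix.of fun _ _ => 0 : Matrix (Fin 3) (Fin 3) ℝ) = 0 from rfl, mul_zero, zero_mul]
      rfl

end HomogeneousCoordinates

end Manifolds

end ThreePlane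

end

theorem mainTheorem5 {M : Type*} [TopologicalSpace M] [ChartedSpace (EuclideanSpace ℝ (Fin 6)) M]
    [IsManifold (𝓡 6) ∞ M] (D : (x : M) → Submodule ℝ (TangentSpace (𝓡 6) x))
    (hD : IsNondegenerate D) :
    -- local existence of adapted coframings, of sections of `B₃`, and of the curvature functions
    (∀ x : M, ∃ U : Set M, x ∈ U ∧ ∃ c : Coframing M, IsTwoAdapted D U c) ∧
    (∀ (U : Set M) (c : Coframing M), IsTwoAdapted D U c →
      ∃ f : ThirdOrderFrame M, f.toCoframing = c ∧ IsThirdOrderFrame D U f) ∧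
    (∀ (U : Set M) (t : ThirdOrderFrame M), IsThirdOrderFrame D U t →
      ∃ f : CartanFrame M, f.toThirdOrderFrame = t ∧ IsCartanFrame D U f) ∧
    -- the canonical conformal structure
    (∀ (U : Set M) (c : Coframing M), IsTwoAdapted D U c → RepresentsConformal D U c.metric) ∧
    -- the extended curvature tensor takes values in a bundle of rank 48
    (Module.finrank ℝ extTensorSpace = 48 ∧
      ∀ h ∈ groupG2, ∀ F ∈ extTensorSpace,
        (fun a b => h⁻¹ * F (h *ᵥ a) (h *ᵥ b) * h) ∈ extTensorSpace) ∧
    -- the embedding of `B₃` in the normal conformal Cartan bundle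
    (∀ (U : Set M) (f : CartanFrame M), IsCartanFrame D U f →
      IsNormalConformalGauge D U f.gammaHat ∧
      ∀ Γ : GaugeForm M, IsNormalConformalGauge D U Γ →
        ∃ k : M → Matrix (Fin 8) (Fin 8) ℝ, IsGaugeTransformation U Γ f.gammaHat k ∧
          ∀ k' : M → Matrix (Fin 8) (Fin 8) ℝ, IsGaugeTransformation U Γ f.gammaHat k' →
            ∀ x ∈ U, k' x = k x) ∧
    -- the Weyl tensor is the extended curvature tensor
    (∀ (U : Set M) (f : CartanFrame M) (g : BilinField M), IsCartanFrame D U f →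
      RepresentsConformal D U g → ∀ x ∈ U, ∀ v w z : TangentSpace (𝓡 6) x,
        f.coord x (weyl g x v w z) =
          extTensor (f.S x) (f.coord x v) (f.coord x w) *ᵥ f.coord x z) ∧
    -- conformal flatness
    (IsConformallyFlat D ↔ IsLocallyHomogeneousModel D) ∧
    (IsLocallyHomogeneousModel D ↔ IsLocallyFlatModel D) := by
  refine ⟨hD.exists_isTwoAdapted, fun U c h => h.exists_isThirdOrderFrame,
    fun U t h => ⟨t.toCartanFrame, rfl, h.isCartanFrame⟩,
    fun U c h => h.representsConformal hD,
    ⟨finrank_extTensorSpace, fun h hh F hF => extTensorSpace_invariant hh hF⟩,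
    fun U f hf => ⟨hf.isNormalConformalGauge hD, fun Γ hΓ => hf.exists_gaugeTransformation hD hΓ⟩,
    fun U f g hf hg x hx v w z => hf.coord_weyl hD hg hx v w z,
    ⟨fun h => (h.isLocallyFlatModel hD).isLocallyHomogeneousModel,
      fun h => h.isLocallyFlatModel.isConformallyFlat hD⟩,
    ⟨fun h => h.isLocallyFlatModel, fun h => h.isLocallyHomogeneousModel⟩⟩
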